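/- Fix integers $k\ge 1$ and $d\ge 0$. A \emph{curve} in $\mathbb{R}^d$ is a continuous map $[0,1]\to\mathbb{R}^d$. The \emph{weak Fréchet distance} of two curves $\pi,\sigma$ is $$d_W(\pi,\sigma)=\inf_{f,g}\ \max_{s\in[0,1]}\ \|\pi(f(s))-\sigma(g(s))\|,$$ where $f,g$ range over all continuous (not necessarily injective) maps $[0,1]\to[0,1]$ that fix $0$ and $1$. A \emph{polygonal curve} is given by its sequence of vertices (at least one), and its complexity is the number of its vertices. The model of computation is the real RAM: a random access machine with one memory for natural numbers (addition, truncated subtraction, comparison, use as addresses) and one memory for real numbers (exact arithmetic and comparison, no rounding), each operation taking one unit of time. As is customary for exact geometric algorithms, algebraic problems of constant size are solved in constant time; precisely, computing the minimum value (when it exists) of a polynomial under finitely many constraints $g_j\ge 0$ with polynomials $g_j$ is an elementary operation, where the polynomials have rational coefficients, depend on finitely many variables and on finitely many parameters read from memory, and are fixed in the program. (Its cost is the number of parameters plus a constant.) There are a program and a constant $C$, depending only on $k$ and $d$, such that for any $k$ polygonal curves $\pi_1,\dots,\pi_k$ in $\mathbb{R}^d$ of total complexity $n$, the program, given the vertices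 of the curves as input, halts after at most $C n^k$ steps (that is, in $O(n^k)$ time) and outputs the vertices of a polygonal curve $\sigma$, of complexity at most $C n^k$, that minimizes the maximum weak Fréchet distance to the given curves among all curves: $$\max_{1\le i\le k} d_W(\pi_i,\sigma)\ \le\ \max_{1\le i\le k} d_W(\pi_i,\tau)\qquad\text{for every curve }\tau\text{ in }\mathbb{R}^d.$$ Moreover, the radius of the minimum enclosing ball of $k$ points is convex under linear motion: for all $a_1,\dots,a_k,b_1,\dots,b_k\in\mathbb{R}^d$, the function that maps $t\in\mathbb{R}$ to the radius of the minimum enclosing ball of $\{a_1+tb_1,\dots,a_k+tb_k\}$ is convex. -/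

import Mathlib

noncomputable section

/-! ### Curves, polygonal curves, weak Fréchet distance -/

/-- The Euclidean space `ℝ^d`. -/
abbrev Pt (d : ℕ) : Type := EuclideanSpace ℝ (Fin d)

/-- A curve in `ℝ^d`: a continuous map from `[0,1]`. -/
abbrev Curve (d : ℕ) : Type := C(unitInterval, Pt d)

/-- A (possibly non-monotone) reparameterization: a continuous map `f : [0,1] → [0,1]` with
`f 0 = 0` and `f 1 = 1`, not necessarily injective. -/
def IsWeakReparam (f : C(unitInterval, unitInterval)) : Prop :=
  f 0 = 0 ∧ f 1 = 1

/-- The width of a pair of reparameterizations of two curves (a supremum of a continuous function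
over `[0,1]`, hence a maximum). -/
def curveWidth {d : ℕ} (π σ : Curve d) (f g : C(unitInterval, unitInterval)) : ℝ :=
  ⨆ s : unitInterval, dist (π (f s)) (σ (g s))

/-- The weak Fréchet distance. -/
def weakFrechet {d : ℕ} (π σ : Curve d) : ℝ :=
  sInf {w : ℝ | ∃ f g : C(unitInterval, unitInterval),
    IsWeakReparam f ∧ IsWeakReparam g ∧ w = curveWidth π σ f g}

/-- A polygonal curve in `ℝ^d`, given by its sequence of vertices (at least one vertex;
vertices may repeat and edges may cross). -/
structure PolygonalCurve (d : ℕ) where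
  numEdges : ℕ
  vertex : Fin (numEdges + 1) → Pt d

/-- The complexity of a polygonal curve: its number of vertices. -/
def PolygonalCurve.complexity {d : ℕ} (π : PolygonalCurve d) : ℕ := π.numEdges + 1

/-- The curve traced by a polygonal curve with `m` edges: on `[j/m, (j+1)/m]` it moves linearly from
vertex `j` to vertex `j+1`. (The `j`-th summand below stays `0` up to time `j/m`, and stays equal to
the `j`-th edge vector from time `(j+1)/m` on.) -/
def PolygonalCurve.toCurve {d : ℕ} (π : PolygonalCurve d) : Curve d where
  toFun t := π.vertex 0 + ∑ j : Fin π.numEdges,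
    (max 0 (min 1 ((π.numEdges : ℝ) * (t : ℝ) - (j : ℕ))) : ℝ) •
      (π.vertex j.succ - π.vertex j.castSucc)
  continuous_toFun := by fun_prop

/-- The radius of the minimum enclosing ball of the points `p i`. -/
def minRad {ι : Type*} {d : ℕ} (p : ι → Pt d) : ℝ :=
  sInf {r : ℝ | 0 ≤ r ∧ ∃ c : Pt d, ∀ i, dist (p i) c ≤ r}

/-! ### The real RAM

A random access machine with two memories indexed by natural numbers, one holding natural numbers
and one holding real numbers. Programs are finite while-programs. Natural numbers support only
addition, (truncated) subtraction, comparison, and use as addresses in both memories; real numbers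
support exact field operations and comparison. There is no conversion between the two sorts, so in
particular no rounding. As usual for exact geometric computation, an algebraic problem
of constant size can be solved in constant time: see `PolyProblem`. -/

namespace RealRAM

/-- The contents of the two memories. -/
structure State where
  nat : ℕ → ℕ
  real : ℕ → ℝ

/-- Expressions of sort natural number; `load a` is the content of the cell with address `a`. -/
inductive NatExpr : Type
  | lit (n : ℕ)
  | load (a : NatExpr)
  | add (a b : NatExpr)
  | sub (a b : NatExpr)

/-- Expressions of sort real number; `load a` is the content of the real cell with address `a`. -/
inductive RealExpr : Type
  | lit (q : ℚ)
  | load (a : NatExpr)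
  | add (a b : RealExpr)
  | sub (a b : RealExpr)
  | mul (a b : RealExpr)
  | div (a b : RealExpr)

/-- Tests. -/
inductive BoolExpr : Type
  | natLt (a b : NatExpr)
  | natEq (a b : NatExpr)
  | realLt (a b : RealExpr)
  | realEq (a b : RealExpr)
  | neg (a : BoolExpr)
  | conj (a b : BoolExpr)

def NatExpr.eval (s : State) : NatExpr → ℕ
  | lit n => n
  | load a => s.nat (a.eval s)
  | add a b => a.eval s + b.eval s
  | sub a b => a.eval s - b.eval s

/-- Division by zero returns zero. -/
def RealExpr.eval (s : State) : RealExpr → ℝ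
  | lit q => (q : ℝ)
  | load a => s.real (a.eval s)
  | add a b => a.eval s + b.eval s
  | sub a b => a.eval s - b.eval s
  | mul a b => a.eval s * b.eval s
  | div a b => a.eval s / b.eval s

def BoolExpr.Holds (s : State) : BoolExpr → Prop
  | natLt a b => a.eval s < b.eval s
  | natEq a b => a.eval s = b.eval s
  | realLt a b => a.eval s < b.eval s
  | realEq a b => a.eval s = b.eval s
  | neg a => ¬ a.Holds s
  | conj a b => a.Holds s ∧ b.Holds s

/-- The number of elementary operations in the evaluation of an expression. -/
def NatExpr.cost : NatExpr → ℕ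
  | lit _ => 1
  | load a => a.cost + 1
  | add a b => a.cost + b.cost + 1
  | sub a b => a.cost + b.cost + 1

def RealExpr.cost : RealExpr → ℕ
  | lit _ => 1
  | load a => a.cost + 1
  | add a b => a.cost + b.cost + 1
  | sub a b => a.cost + b.cost + 1
  | mul a b => a.cost + b.cost + 1
  | div a b => a.cost + b.cost + 1

def BoolExpr.cost : BoolExpr → ℕ
  | natLt a b => a.cost + b.cost + 1
  | natEq a b => a.cost + b.cost + 1
  | realLt a b => a.cost + b.cost + 1
  | realEq a b => a.cost + b.cost + 1
  | neg a => a.cost + 1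
  | conj a b => a.cost + b.cost + 1

/-- A polynomial minimization problem of fixed format: minimize `objective` over all values of the
variables for which all `constraints` are nonnegative. The polynomials have rational coefficients
and depend on the variables and on parameters. A program contains such problems as part of its text,
so their numbers of parameters, variables and constraints, and their degrees, are constants; only
the values of the parameters are data. -/
structure PolyProblem : Type where
  numParams : ℕ
  numVars : ℕ
  objective : MvPolynomial (Fin numParams ⊕ Fin numVars) ℚ
  constraints : List (MvPolynomial (Fin numParams ⊕ Fin numVars) ℚ)

/-- The set of values of the objective on the feasible set, for parameters `a`. -/
def PolyProblem.values (Q : PolyProblem) (a : Fin Q.numParams → ℝ) : Set ℝ :=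
  {y | ∃ x : Fin Q.numVars → ℝ,
    (∀ g ∈ Q.constraints, 0 ≤ MvPolynomial.aeval (Sum.elim a x) g) ∧
      y = MvPolynomial.aeval (Sum.elim a x) Q.objective}

/-- Programs. `storeNat a e` and `storeReal a e` store the value of `e` at address `a`;
`minimize Q src dst` takes the parameters of `Q` from the real cells `src, src + 1, …` and stores
the minimum value (a single real number, not a minimizer) at the real address `dst`. -/
inductive Program : Type
  | skip
  | storeNat (a e : NatExpr)
  | storeReal (a : NatExpr) (e : RealExpr)
  | minimize (Q : PolyProblem) (src dst : NatExpr)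
  | seq (p q : Program)
  | cond (b : BoolExpr) (p q : Program)
  | loop (b : BoolExpr) (p : Program)

/-- `Exec p s s' t`: started in state `s`, the program `p` halts in state `s'` after `t` elementary
steps. The machine is deterministic; a program that runs forever, or that reaches a minimization
problem whose minimum does not exist, does not halt. -/
inductive Exec : Program → State → State → ℕ → Prop
  | skip (s : State) : Exec Program.skip s s 1
  | storeNat (s : State) (a e : NatExpr) :
      Exec (Program.storeNat a e) s
        ⟨Function.update s.nat (a.eval s) (e.eval s), s.real⟩ (a.cost + e.cost + 1)
  | storeReal (s : State) (a : NatExpr) (e : RealExpr) :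
      Exec (Program.storeReal a e) s
        ⟨s.nat, Function.update s.real (a.eval s) (e.eval s)⟩ (a.cost + e.cost + 1)
  | minimize (s : State) (Q : PolyProblem) (src dst : NatExpr) (y : ℝ)
      (h : IsLeast (Q.values fun i => s.real (src.eval s + (i : ℕ))) y) :
      Exec (Program.minimize Q src dst) s
        ⟨s.nat, Function.update s.real (dst.eval s) y⟩ (src.cost + dst.cost + Q.numParams + 1)
  | seq {p q : Program} {s s' s'' : State} {t t' : ℕ}
      (h : Exec p s s' t) (h' : Exec q s' s'' t') :
      Exec (Program.seq p q) s s'' (t + t')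
  | cond_true {b : BoolExpr} {p q : Program} {s s' : State} {t : ℕ}
      (hb : b.Holds s) (h : Exec p s s' t) :
      Exec (Program.cond b p q) s s' (b.cost + t + 1)
  | cond_false {b : BoolExpr} {p q : Program} {s s' : State} {t : ℕ}
      (hb : ¬ b.Holds s) (h : Exec q s s' t) :
      Exec (Program.cond b p q) s s' (b.cost + t + 1)
  | loop_false {b : BoolExpr} {p : Program} {s : State} (hb : ¬ b.Holds s) :
      Exec (Program.loop b p) s s (b.cost + 1)
  | loop_true {b : BoolExpr} {p : Program} {s s' s'' : State} {t t' : ℕ}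
      (hb : b.Holds s) (h : Exec p s s' t) (h' : Exec (Program.loop b p) s' s'' t') :
      Exec (Program.loop b p) s s'' (b.cost + t + t' + 1)

/-! ### Input and output -/

/-- The list of all coordinates of the vertices of `k` polygonal curves: curve by curve, and vertex
by vertex within a curve. -/
def inputCoords {k d : ℕ} (π : Fin k → PolygonalCurve d) : List ℝ :=
  (List.finRange k).flatMap fun i =>
    (List.finRange ((π i).numEdges + 1)).flatMap fun j =>
      List.ofFn fun c : Fin d => (π i).vertex j c

/-- The initial state: the natural cell `i < k` holds the number of vertices of the `i`-th curve,
the real cells `0, 1, …` hold the coordinates, and all other cells are zero. -/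
def inputState {k d : ℕ} (π : Fin k → PolygonalCurve d) : State where
  nat a := if h : a < k then (π ⟨a, h⟩).complexity else 0
  real a := (inputCoords π).getD a 0

/-- In state `s` the polygonal curve `σ` is written as the output: the natural cell `0` holds the
number of its vertices, and the real cells, from the address given by the natural cell `1` on, hold
the coordinates of its vertices, vertex by vertex. -/
def State.Outputs {d : ℕ} (s : State) (σ : PolygonalCurve d) : Prop :=
  s.nat 0 = σ.complexity ∧
    ∀ (j : Fin (σ.numEdges + 1)) (c : Fin d),
      s.real (s.nat 1 + (j : ℕ) * d + (c : ℕ)) = σ.vertex j c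

end RealRAM

end

/-!
The weak Fréchet distance allows a point on a curve to move back and forth, so only connectivity
matters. Each of the `k` input curves splits into vertices and edges, and a cell of their free space
is a choice of one vertex or edge per curve. A cell has as its weight the least squared radius of a
ball that meets all the chosen segments; there are `∏ (2 * mᵢ + 1)` cells for curves with `mᵢ` edges,
that is `O(n ^ k)`, and they form a grid in which an edge has the larger weight of its two ends. The
optimal squared radius is the bottleneck weight of the paths from the cell of all first vertices to
the cell of all last vertices (`Feasible`).

*Upper bound* (`GoodPath.weakFrechet_le`). For each cell of a path of weight at most `r`, take the
center of a ball of radius `√r` that meets the chosen segments. Two neighboring cells choose, for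
every curve, points on a common edge. The polygonal curve through the centers thus stays, by
convexity, within distance `√r` of a walk on every input curve.

*Lower bound* (`sqrt_le_of_weakFrechet_le`). Let a curve `τ` have weak Fréchet distance less than `ρ`
to all input curves, with reparameterizations `fᵢ` of the input curves and `gᵢ` of `τ`. The `gᵢ` may
all be different, so it is not clear that the input curves can be walked simultaneously. This is the
problem of climbing `k` mountains at equal heights. Replace the `gᵢ` by discrete profiles with unit
steps (`exists_profile`). The positions on the `k` profiles that have a common height form a graph, in
which a vertex has `∏ upᵢ + ∏ downᵢ` neighbors, where `upᵢ` and `downᵢ` count the neighbors on the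
`i`-th profile that are higher and lower. This number is odd only for the common start and the common
end, so by the handshaking lemma the two lie in one component (`exists_climb`). The climb yields a
sequence of positions on the input curves that are always near one point of `τ`; between two of them
all cells that are passed have weight at most `(ρ + δ) ^ 2`.

*Running time.* The weights and the centers are values of polynomial minimization problems of constant
size. The bottleneck weight of a graph with `V` vertices and `M` edges is found in time `O(V + M)`
without sorting (`runs_bottleneck`): take a pivot weight such that a fixed fraction of the weights is
on either side (`runs_findPivot`, by repeated sampling of blocks), and label the components of the
graph of the lighter edges (`runs_components`). If they connect the two marked vertices, drop the
other edges; otherwise contract the components. Either way a fixed fraction of the edges disappears.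
A path is then read off a spanning forest of the edges that are not too heavy.

Programs are written in a small structured language over named columns of memory cells, which is
compiled to the machine; `Runs` is a total correctness statement with a time bound for it.

*Enclosing balls* (`convexOn_minRad`). A convex combination of enclosing balls at two times encloses
the points at the time between.
-/

noncomputable section

namespace RealRAM

/-! ### A structured layer over the machine -/

/-- Names of the families of natural-number variables that have one member for each input curve:
the number of vertices, the position of the first coordinate in the input, the stride and the radix
of the digit of the curve, the remainder modulo the stride and the digit of the current node, and
the positions of the two endpoints of the current segment. -/
inductive NF : Type
  | cnt | off | str | rad | low | dig | pa | pb

/-- Names of the natural-number columns: scalars (only row `0` is used) and arrays. The arrays hold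
the edges of a graph (`eu`, `ev`) and their marks (`act`), adjacency lists (`tgt`, `nxt`, `head`), a
spanning forest (`lab`, `par`), the queue of a graph search (`qu`), new numbers of vertices (`nid`),
and a path (`pth`). -/
inductive NA : Type
  | v | nV | nM | acc | z | src | tgtv | done | kp
  | cur | cv | cl | qh | qt | root
  | m | rl | bl | hl | pos | out | ia | ib | rank
  | e | mm | len | fin
  | eu | ev | act | tgt | nxt | head | lab | par | qu | nid | pth

/-- The columns of the memory for natural numbers. -/
inductive NC (k : ℕ) : Type
  | fam (f : NF) (i : Fin k)
  | sc (a : NA)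

/-- The columns of the memory for real numbers. The cells `par 0, par 1, …` of one row are
consecutive in memory; they hold the parameters of a minimization problem. The other columns hold
the input (`inp`), the weights of the edges (`ew`), the values from which a pivot is selected (`pv`)
and a sorted block of them (`tmp`), the pivot (`piv`), and the bottleneck weight (`ans`). -/
inductive RC (np : ℕ) : Type
  | inp | ew | pv | tmp | piv | ans
  | par (j : Fin np)

/-- The index of a family. -/
def NF.num : NF → ℕ
  | cnt => 0 | off => 1 | str => 2 | rad => 3 | low => 4 | dig => 5 | pa => 6 | pb => 7

/-- The index of a column. -/
def NA.num : NA → ℕ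
  | v => 0 | nV => 1 | nM => 2 | acc => 3 | z => 4 | src => 5 | tgtv => 6 | done => 7 | kp => 8
  | cur => 9 | cv => 10 | cl => 11 | qh => 12 | qt => 13 | root => 14
  | m => 15 | rl => 16 | bl => 17 | hl => 18 | pos => 19 | out => 20 | ia => 21 | ib => 22
  | rank => 23 | e => 24 | mm => 25 | len => 26 | fin => 27
  | eu => 28 | ev => 29 | act => 30 | tgt => 31 | nxt => 32 | head => 33 | lab => 34
  | par => 35 | qu => 36 | nid => 37 | pth => 38

theorem NF.num_injective : Function.Injective NF.num := by
  intro a b h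
  cases a <;> cases b <;> first | rfl | simp [NF.num] at h

theorem NA.num_injective : Function.Injective NA.num := by
  intro a b h
  cases a <;> cases b <;> first | rfl | exact absurd h (by decide)

theorem NF.num_lt (f : NF) : f.num < 8 := by cases f <;> decide

theorem NA.num_lt (a : NA) : a.num < 39 := by cases a <;> decide

/-- The number of columns. -/
def width (k np : ℕ) : ℕ := 8 * k + 39 + np + 6

/-- The position of a column inside a row; the input cell of curve `i` is at position `i`. -/
def NC.code {k : ℕ} : NC k → ℕ
  | fam f i => f.num * k + i
  | sc a => 8 * k + a.num

/-- The position of a real column inside a row. -/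
def RC.code {np : ℕ} : RC np → ℕ
  | inp => 0 | ew => 1 | pv => 2 | tmp => 3 | piv => 4 | ans => 5
  | par j => 6 + j

variable {k np : ℕ}

theorem NC.code_lt (np : ℕ) (c : NC k) : c.code < width k np := by
  cases c with
  | fam f i =>
    have := f.num_lt
    have := i.isLt
    have : (f.num + 1) * k ≤ 8 * k := Nat.mul_le_mul_right _ (by omega)
    simp only [NC.code, width]
    rw [add_mul] at this
    omega
  | sc a => have := a.num_lt; simp only [NC.code, width]; omega

theorem RC.code_lt (k : ℕ) (c : RC np) : c.code < width k np := by
  cases c <;> simp only [RC.code, width] <;> omega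

theorem NC.code_injective : Function.Injective (NC.code (k := k)) := by
  rintro (⟨f, i⟩ | a) (⟨g, j⟩ | b) h <;> simp only [NC.code] at h
  · have hi := i.isLt
    have hj := j.isLt
    have h1 : (f.num * k + i) / k = (g.num * k + j) / k := by rw [h]
    have hk : 0 < k := by omega
    rw [mul_comm, Nat.mul_add_div hk, mul_comm, Nat.mul_add_div hk, Nat.div_eq_of_lt hi,
      Nat.div_eq_of_lt hj] at h1
    have h2 : f = g := NF.num_injective (by omega)
    subst h2
    congr 1
    ext
    omega
  · have := f.num_lt
    have := i.isLt
    have : (f.num + 1) * k ≤ 8 * k := Nat.mul_le_mul_right _ (by omega)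
    rw [add_mul] at this
    omega
  · have := g.num_lt
    have := j.isLt
    have : (g.num + 1) * k ≤ 8 * k := Nat.mul_le_mul_right _ (by omega)
    rw [add_mul] at this
    omega
  · congr 1
    exact NA.num_injective (by omega)

theorem RC.code_injective : Function.Injective (RC.code (np := np)) := by
  rintro (_ | _ | _ | _ | _ | _ | i) (_ | _ | _ | _ | _ | _ | j) h <;>
    simp only [RC.code] at h <;> first | rfl | omega | skip
  congr 1
  ext
  omega

theorem row_col_inj {W r c r' c' : ℕ} (hc : c < W) (hc' : c' < W) (h : W * r + c = W * r' + c') :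
    r = r' ∧ c = c' := by
  have hW : 0 < W := by omega
  have h1 : (W * r + c) / W = (W * r' + c') / W := by rw [h]
  rw [Nat.mul_add_div hW, Nat.mul_add_div hW, Nat.div_eq_of_lt hc, Nat.div_eq_of_lt hc'] at h1
  have : r = r' := by omega
  subst this
  omega

/-- The memory seen as an array of rows of named columns. -/
structure HS (k np : ℕ) where
  n : NC k → ℕ → ℕ
  x : RC np → ℕ → ℝ

open Classical in
/-- Assignment to a cell of the memory for natural numbers. -/
def HS.setN (h : HS k np) (c : NC k) (r v : ℕ) : HS k np :=
  ⟨fun c' r' => if c' = c ∧ r' = r then v else h.n c' r', h.x⟩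

open Classical in
/-- Assignment to a cell of the memory for real numbers. -/
def HS.setX (h : HS k np) (c : RC np) (r : ℕ) (y : ℝ) : HS k np :=
  ⟨h.n, fun c' r' => if c' = c ∧ r' = r then y else h.x c' r'⟩

open Classical in
@[simp] theorem HS.setN_n (h : HS k np) (c : NC k) (r v : ℕ) (c' : NC k) (r' : ℕ) :
    (h.setN c r v).n c' r' = if c' = c ∧ r' = r then v else h.n c' r' := rfl

open Classical in
/-- A whole column after an assignment. -/
theorem HS.setN_col (h : HS k np) (c : NC k) (r v : ℕ) (c' : NC k) :
    (h.setN c r v).n c' = if c' = c then Function.update (h.n c) r v else h.n c' := by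
  funext r'
  by_cases hc : c' = c
  · subst hc
    by_cases hr : r' = r <;> simp [HS.setN, hr]
  · simp [HS.setN, hc]

@[simp] theorem HS.setN_x (h : HS k np) (c : NC k) (r v : ℕ) : (h.setN c r v).x = h.x := rfl

open Classical in
@[simp] theorem HS.setX_x (h : HS k np) (c : RC np) (r : ℕ) (y : ℝ) (c' : RC np) (r' : ℕ) :
    (h.setX c r y).x c' r' = if c' = c ∧ r' = r then y else h.x c' r' := rfl

open Classical in
theorem HS.setX_col (h : HS k np) (c : RC np) (r : ℕ) (y : ℝ) (c' : RC np) :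
    (h.setX c r y).x c' = if c' = c then Function.update (h.x c) r y else h.x c' := by
  funext r'
  by_cases hc : c' = c
  · subst hc
    by_cases hr : r' = r <;> simp [HS.setX, hr]
  · simp [HS.setX, hc]

@[simp] theorem HS.setX_n (h : HS k np) (c : RC np) (r : ℕ) (y : ℝ) : (h.setX c r y).n = h.n := rfl

/-- The cell in column `c` and row `r` has the address `width * r + code c`. -/
def view (k np : ℕ) (s : State) : HS k np :=
  ⟨fun c r => s.nat (width k np * r + c.code), fun c r => s.real (width k np * r + c.code)⟩

/-- Expressions for natural numbers in terms of columns. -/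
inductive NE (k : ℕ) : Type
  | lit (n : ℕ)
  | rd (c : NC k) (r : NE k)
  | add (a b : NE k)
  | sub (a b : NE k)

/-- The content of a scalar variable. -/
abbrev vr (a : NA) : NE k := .rd (.sc a) (.lit 0)

/-- The content of a scalar variable that belongs to an input curve. -/
abbrev fv (f : NF) (i : Fin k) : NE k := .rd (.fam f i) (.lit 0)

/-- An entry of an array. -/
abbrev ar (a : NA) (r : NE k) : NE k := .rd (.sc a) r

/-- The value of an expression. -/
@[simp] def NE.eval (h : HS k np) : NE k → ℕ
  | lit n => n
  | rd c r => h.n c (r.eval h)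
  | add a b => a.eval h + b.eval h
  | sub a b => a.eval h - b.eval h

/-- Multiplication by a constant. -/
def NE.smul : ℕ → NE k → NE k
  | 0, _ => lit 0
  | n + 1, e => add (smul n e) e

@[simp] theorem NE.eval_smul (h : HS k np) (n : ℕ) (e : NE k) :
    (NE.smul n e).eval h = n * e.eval h := by
  induction n with
  | zero => simp [NE.smul]
  | succ n ih => simp [NE.smul, ih, add_mul]

/-- Multiplication by a constant, as repeated addition: the machine does not multiply natural
numbers. -/
def mulConst : ℕ → NatExpr → NatExpr
  | 0, _ => .lit 0
  | n + 1, e => .add (mulConst n e) e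

@[simp] theorem eval_mulConst (s : State) (n : ℕ) (e : NatExpr) :
    (mulConst n e).eval s = n * e.eval s := by
  induction n with
  | zero => simp [mulConst, NatExpr.eval]
  | succ n ih => simp [mulConst, NatExpr.eval, ih, add_mul]

/-- The address of the cell in a given row and at a given position of the row. -/
def cell (W : ℕ) (r : NatExpr) (c : ℕ) : NatExpr := .add (mulConst W r) (.lit c)

@[simp] theorem eval_cell (s : State) (W : ℕ) (r : NatExpr) (c : ℕ) :
    (cell W r c).eval s = W * r.eval s + c := by
  simp [cell, NatExpr.eval]

/-- Translation to an expression of the machine, for rows of width `W`. -/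
def NE.compile (W : ℕ) : NE k → NatExpr
  | lit n => .lit n
  | rd c r => .load (cell W (r.compile W) c.code)
  | add a b => .add (a.compile W) (b.compile W)
  | sub a b => .sub (a.compile W) (b.compile W)

@[simp] theorem NE.eval_compile (s : State) (e : NE k) :
    (e.compile (width k np)).eval s = e.eval (view k np s) := by
  induction e with
  | lit n => rfl
  | rd c r ih => simp [NE.compile, NatExpr.eval, ih, view]
  | add a b iha ihb => simp [NE.compile, NatExpr.eval, iha, ihb]
  | sub a b iha ihb => simp [NE.compile, NatExpr.eval, iha, ihb]

/-- Tests in terms of columns. -/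
inductive BE (k np : ℕ) : Type
  | lt (a b : NE k)
  | eq (a b : NE k)
  | rlt (c : RC np) (r : NE k) (c' : RC np) (r' : NE k)
  | neg (a : BE k np)
  | conj (a b : BE k np)

/-- The truth value of a test. -/
@[simp] def BE.holds (h : HS k np) : BE k np → Prop
  | lt a b => a.eval h < b.eval h
  | eq a b => a.eval h = b.eval h
  | rlt c r c' r' => h.x c (r.eval h) < h.x c' (r'.eval h)
  | neg a => ¬ a.holds h
  | conj a b => a.holds h ∧ b.holds h

/-- Translation to a test of the machine. -/
def BE.compile : BE k np → BoolExpr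
  | lt a b => .natLt (a.compile (width k np)) (b.compile (width k np))
  | eq a b => .natEq (a.compile (width k np)) (b.compile (width k np))
  | rlt c r c' r' => .realLt (.load (cell (width k np) (r.compile (width k np)) c.code))
      (.load (cell (width k np) (r'.compile (width k np)) c'.code))
  | neg a => .neg a.compile
  | conj a b => .conj a.compile b.compile

@[simp] theorem BE.holds_compile (s : State) (b : BE k np) :
    b.compile.Holds s ↔ b.holds (view k np s) := by
  induction b with
  | lt a b => simp [BE.compile, BoolExpr.Holds]
  | eq a b => simp [BE.compile, BoolExpr.Holds]
  | rlt c r c' r' => simp [BE.compile, BoolExpr.Holds, RealExpr.eval, view]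
  | neg a ih => simp [BE.compile, BoolExpr.Holds, ih]
  | conj a b iha ihb => simp [BE.compile, BoolExpr.Holds, iha, ihb]

/-- Programs in terms of columns. `cpR` copies one real number; `minim Q r c` solves `Q` for the
parameters in row `r` and stores the minimum in column `c` of that row. -/
inductive HP (k np : ℕ) : Type
  | skip
  | setN (c : NC k) (r e : NE k)
  | cpR (c : RC np) (r : NE k) (c' : RC np) (r' : NE k)
  | minim (Q : PolyProblem) (r : NE k) (c : RC np)
  | seq (p q : HP k np)
  | cond (b : BE k np) (p q : HP k np)
  | loop (b : BE k np) (p : HP k np)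

infixr:60 " ;; " => HP.seq

/-- Assignment to a scalar variable. -/
abbrev put (a : NA) (e : NE k) : HP k np := .setN (.sc a) (.lit 0) e

/-- Assignment to an array entry. -/
abbrev putA (a : NA) (r e : NE k) : HP k np := .setN (.sc a) r e

/-- Assignment to a scalar variable that belongs to an input curve. -/
abbrev putF (f : NF) (i : Fin k) (e : NE k) : HP k np := .setN (.fam f i) (.lit 0) e

/-- Translation to a program of the machine. -/
def HP.compile : HP k np → Program
  | skip => .skip
  | setN c r e => .storeNat (cell (width k np) (r.compile (width k np)) c.code)
      (e.compile (width k np))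
  | cpR c r c' r' => .storeReal (cell (width k np) (r.compile (width k np)) c.code)
      (.load (cell (width k np) (r'.compile (width k np)) c'.code))
  | minim Q r c => .minimize Q (cell (width k np) (r.compile (width k np)) 6)
      (cell (width k np) (r.compile (width k np)) c.code)
  | seq p q => .seq p.compile q.compile
  | cond b p q => .cond b.compile p.compile q.compile
  | loop b p => .loop b.compile p.compile

/-- A bound for the number of machine steps in one step of the structured program. -/
def HP.K : HP k np → ℕ
  | skip => 1
  | setN c r e => (cell (width k np) (r.compile (width k np)) c.code).cost +
      (e.compile (width k np)).cost + 1
  | cpR c r c' r' => (cell (width k np) (r.compile (width k np)) c.code).cost +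
      (RealExpr.load (cell (width k np) (r'.compile (width k np)) c'.code)).cost + 1
  | minim Q r c => (cell (width k np) (r.compile (width k np)) 6).cost +
      (cell (width k np) (r.compile (width k np)) c.code).cost + Q.numParams + 1
  | seq p q => p.K + q.K
  | cond b p q => b.compile.cost + 1 + p.K + q.K
  | loop b p => b.compile.cost + 1 + p.K

theorem view_setN (s : State) (c : NC k) (r v : ℕ) :
    view k np ⟨Function.update s.nat (width k np * r + c.code) v, s.real⟩ =
      (view k np s).setN c r v := by
  simp only [view, HS.setN, HS.mk.injEq, and_true]
  funext c' r'
  by_cases h : c' = c ∧ r' = r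
  · obtain ⟨rfl, rfl⟩ := h
    simp
  · rw [if_neg h, Function.update_of_ne]
    intro he
    have := row_col_inj (c'.code_lt np) (c.code_lt np) he
    exact h ⟨NC.code_injective this.2, this.1⟩

theorem view_setX (s : State) (c : RC np) (r : ℕ) (y : ℝ) :
    view k np ⟨s.nat, Function.update s.real (width k np * r + c.code) y⟩ =
      (view k np s).setX c r y := by
  simp only [view, HS.setX, HS.mk.injEq, true_and]
  funext c' r'
  by_cases h : c' = c ∧ r' = r
  · obtain ⟨rfl, rfl⟩ := h
    simp
  · rw [if_neg h, Function.update_of_ne]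
    intro he
    have := row_col_inj (c'.code_lt k) (c.code_lt k) he
    exact h ⟨RC.code_injective this.2, this.1⟩

/-- Total correctness with a time bound: from memory contents `h`, the program `p` halts after at
most `T` steps (of `p.K` machine steps each) with contents that satisfy `Q`. -/
def Runs (p : HP k np) (h : HS k np) (T : ℕ) (Q : HS k np → Prop) : Prop :=
  ∀ s, view k np s = h → ∃ s' t, Exec p.compile s s' t ∧ t ≤ p.K * T ∧ Q (view k np s')

theorem Runs.mono {p : HP k np} {h : HS k np} {T T' : ℕ} {Q Q' : HS k np → Prop}
    (hr : Runs p h T Q) (hT : T ≤ T') (hQ : ∀ h', Q h' → Q' h') : Runs p h T' Q' := by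
  intro s hs
  obtain ⟨s', t, he, ht, hq⟩ := hr s hs
  exact ⟨s', t, he, ht.trans (Nat.mul_le_mul_left _ hT), hQ _ hq⟩

theorem Runs.skip {h : HS k np} {Q : HS k np → Prop} (hQ : Q h) : Runs .skip h 1 Q := by
  rintro s rfl
  exact ⟨s, 1, Exec.skip s, by simp [HP.K], hQ⟩

theorem Runs.setN {h : HS k np} {c : NC k} {r e : NE k} {Q : HS k np → Prop}
    (hQ : Q (h.setN c (r.eval h) (e.eval h))) : Runs (.setN c r e) h 1 Q := by
  rintro s rfl
  refine ⟨_, _, Exec.storeNat s _ _, by simp [HP.K], ?_⟩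
  simpa [view_setN] using hQ

theorem Runs.cpR {h : HS k np} {c c' : RC np} {r r' : NE k} {Q : HS k np → Prop}
    (hQ : Q (h.setX c (r.eval h) (h.x c' (r'.eval h)))) : Runs (.cpR c r c' r') h 1 Q := by
  rintro s rfl
  refine ⟨_, _, Exec.storeReal s _ _, by simp [HP.K], ?_⟩
  have : (view k np s).x c' (r'.eval (view k np s)) =
      s.real (width k np * r'.eval (view k np s) + c'.code) := rfl
  rw [this] at hQ
  simpa [view_setX, RealExpr.eval] using hQ

theorem Runs.minim {h : HS k np} {c : RC np} {r : NE k} {P : PolyProblem} {Q : HS k np → Prop}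
    (hP : P.numParams ≤ np) {y : ℝ}
    (hy : IsLeast (P.values fun i => h.x (.par (Fin.castLE hP i)) (r.eval h)) y)
    (hQ : Q (h.setX c (r.eval h) y)) : Runs (.minim P r c) h 1 Q := by
  rintro s rfl
  refine ⟨_, _, Exec.minimize s P _ _ y ?_, by simp [HP.K], ?_⟩
  · convert hy using 3 with i
    simp [view, RC.code, add_assoc]
  · simpa [view_setX] using hQ

/-- Sequential composition; the time bound for the second program may depend on the intermediate
state. -/
theorem Runs.seq {p q : HP k np} {h : HS k np} {T₁ T : ℕ} {Q : HS k np → Prop}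
    (hp : Runs p h T₁ fun h' => ∃ T₂, T₁ + T₂ ≤ T ∧ Runs q h' T₂ Q) : Runs (p ;; q) h T Q := by
  intro s hs
  obtain ⟨s', t, he, ht, T₂, hT, hq⟩ := hp s hs
  obtain ⟨s'', t', he', ht', hQ⟩ := hq s' rfl
  refine ⟨s'', t + t', Exec.seq he he', ?_, hQ⟩
  calc t + t' ≤ p.K * T₁ + q.K * T₂ := by omega
    _ ≤ p.K * T + q.K * T :=
      add_le_add (Nat.mul_le_mul_left _ (by omega)) (Nat.mul_le_mul_left _ (by omega))
    _ = _ := by simp [HP.K, add_mul]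

/-- Sequential composition with time bounds fixed beforehand. -/
theorem Runs.seq' {p q : HP k np} {h : HS k np} (T₁ T₂ : ℕ) {T : ℕ} {Q : HS k np → Prop}
    (hp : Runs p h T₁ fun h' => Runs q h' T₂ Q) (hT : T₁ + T₂ ≤ T) : Runs (p ;; q) h T Q :=
  Runs.seq (hp.mono le_rfl fun _ hr => ⟨T₂, hT, hr⟩)

theorem Runs.cond {b : BE k np} {p q : HP k np} {h : HS k np} {T : ℕ} {Q : HS k np → Prop}
    (hp : b.holds h → Runs p h T Q) (hq : ¬ b.holds h → Runs q h T Q) :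
    Runs (.cond b p q) h (T + 1) Q := by
  rintro s rfl
  by_cases hb : b.holds (view k np s)
  · obtain ⟨s', t, he, ht, hQ⟩ := hp hb s rfl
    refine ⟨s', _, Exec.cond_true ((BE.holds_compile s b).2 hb) he, ?_, hQ⟩
    simp only [HP.K]
    nlinarith [Nat.zero_le T, Nat.zero_le (b.compile.cost * T), Nat.zero_le (q.K * T)]
  · obtain ⟨s', t, he, ht, hQ⟩ := hq hb s rfl
    refine ⟨s', _, Exec.cond_false (mt (BE.holds_compile s b).1 hb) he, ?_, hQ⟩
    simp only [HP.K]
    nlinarith [Nat.zero_le T, Nat.zero_le (b.compile.cost * T), Nat.zero_le (p.K * T)]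

/-- The natural-number columns to which a program may write. -/
@[simp] def HP.wN : HP k np → NC k → Prop
  | setN c _ _, c' => c' = c
  | seq p q, c' => p.wN c' ∨ q.wN c'
  | cond _ p q, c' => p.wN c' ∨ q.wN c'
  | loop _ p, c' => p.wN c'
  | skip, _ => False
  | cpR _ _ _ _, _ => False
  | minim _ _ _, _ => False

/-- The real-number columns to which a program may write. -/
@[simp] def HP.wX : HP k np → RC np → Prop
  | cpR c _ _ _, c' => c' = c
  | minim _ _ c, c' => c' = c
  | seq p q, c' => p.wX c' ∨ q.wX c'
  | cond _ p q, c' => p.wX c' ∨ q.wX c'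
  | loop _ p, c' => p.wX c'
  | skip, _ => False
  | setN _ _ _, _ => False

/-- Only columns to which `p` may write have changed. -/
structure Frame (p : HP k np) (h h' : HS k np) : Prop where
  n : ∀ c, ¬ p.wN c → h'.n c = h.n c
  x : ∀ c, ¬ p.wX c → h'.x c = h.x c

theorem Frame.refl (p : HP k np) (h : HS k np) : Frame p h h := ⟨fun _ _ => rfl, fun _ _ => rfl⟩

theorem Frame.trans {p : HP k np} {h h' h'' : HS k np} (a : Frame p h h') (b : Frame p h' h'') :
    Frame p h h'' :=
  ⟨fun c hc => (b.n c hc).trans (a.n c hc), fun c hc => (b.x c hc).trans (a.x c hc)⟩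

theorem Frame.weaken {p q : HP k np} {h h' : HS k np} (a : Frame p h h')
    (hn : ∀ c, p.wN c → q.wN c) (hx : ∀ c, p.wX c → q.wX c) : Frame q h h' :=
  ⟨fun c hc => a.n c (mt (hn c) hc), fun c hc => a.x c (mt (hx c) hc)⟩

theorem frame_loop {b : BE k np} {p : HP k np}
    (ih : ∀ s s' t, Exec p.compile s s' t → Frame p (view k np s) (view k np s')) :
    ∀ P s s' t, Exec P s s' t → P = .loop b.compile p.compile →
      Frame (.loop b p) (view k np s) (view k np s') := by
  intro P s s' t he
  induction he with
  | loop_false hb => intro _; exact Frame.refl _ _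
  | loop_true hb h h' _ ih' =>
    intro heq
    have h1 := heq
    injection h1 with h1 h2
    subst h2
    exact ((ih _ _ _ h).weaken (q := .loop b p) (fun _ => id) (fun _ => id)).trans (ih' heq)
  | _ => intro heq; cases heq

theorem frame_of_exec (p : HP k np) : ∀ s s' t, Exec p.compile s s' t →
    Frame p (view k np s) (view k np s') := by
  induction p with
  | skip => intro s s' t he; cases he; exact Frame.refl _ _
  | setN c r e =>
    intro s s' t he
    cases he
    rw [eval_cell, view_setN]
    refine ⟨fun c' hc => ?_, fun c' hc => rfl⟩
    funext r'
    simp only [HP.wN] at hc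
    simp [hc]
  | cpR c r c' r' =>
    intro s s' t he
    cases he
    rw [eval_cell, view_setX]
    refine ⟨fun c' hc => rfl, fun c' hc => ?_⟩
    funext r'
    simp only [HP.wX] at hc
    simp [hc]
  | minim Q r c =>
    intro s s' t he
    cases he
    rw [eval_cell, view_setX]
    refine ⟨fun c' hc => rfl, fun c' hc => ?_⟩
    funext r'
    simp only [HP.wX] at hc
    simp [hc]
  | seq p q ihp ihq =>
    intro s s' t he
    cases he with
    | seq h h' =>
      exact ((ihp _ _ _ h).weaken (fun _ => Or.inl) (fun _ => Or.inl)).trans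
        ((ihq _ _ _ h').weaken (fun _ => Or.inr) (fun _ => Or.inr))
  | cond b p q ihp ihq =>
    intro s s' t he
    cases he with
    | cond_true hb h => exact (ihp _ _ _ h).weaken (fun _ => Or.inl) (fun _ => Or.inl)
    | cond_false hb h => exact (ihq _ _ _ h).weaken (fun _ => Or.inr) (fun _ => Or.inr)
  | loop b p ih => intro s s' t he; exact frame_loop ih _ _ _ _ he rfl

/-- Every specification can be extended by the fact that columns to which the program does not write
are unchanged. -/
theorem Runs.frame {p : HP k np} {h : HS k np} {T : ℕ} {Q : HS k np → Prop}
    (hr : Runs p h T Q) : Runs p h T fun h' => Q h' ∧ Frame p h h' := by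
  rintro s rfl
  obtain ⟨s', t, he, ht, hq⟩ := hr s rfl
  exact ⟨s', t, he, ht, hq, frame_of_exec p _ _ _ he⟩

/-- The rule for loops, with an invariant `I` and a potential `Φ` that pays for each round. -/
theorem Runs.loop {b : BE k np} {p : HP k np} {h₀ : HS k np} (I : HS k np → Prop)
    (Φ : HS k np → ℕ) (h0 : I h₀)
    (step : ∀ h, Frame p h₀ h → I h → b.holds h →
      ∃ T, Runs p h T fun h' => I h' ∧ T + 1 + Φ h' ≤ Φ h) :
    Runs (.loop b p) h₀ (Φ h₀ + 1) fun h' => I h' ∧ ¬ b.holds h' := by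
  have key : ∀ N h, Frame p h₀ h → I h → Φ h ≤ N → Runs (.loop b p) h (Φ h + 1)
      fun h' => I h' ∧ ¬ b.holds h' := by
    intro N
    induction N using Nat.strong_induction_on with
    | _ N ih =>
      rintro h hF hI hN s rfl
      by_cases hb : b.holds (view k np s)
      · obtain ⟨T, hr⟩ := step _ hF hI hb
        obtain ⟨s', t, he, ht, ⟨hI', hΦ⟩, hF'⟩ := hr.frame s rfl
        obtain ⟨s'', t', he', ht', hQ⟩ := ih (Φ (view k np s')) (by omega) _ (hF.trans hF') hI'
          le_rfl s' rfl
        refine ⟨s'', _, Exec.loop_true ((BE.holds_compile s b).2 hb) he he', ?_, hQ⟩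
        have h1 : (HP.loop b p).K * (T + 1 + Φ (view k np s') + 1) ≤
            (HP.loop b p).K * (Φ (view k np s) + 1) := Nat.mul_le_mul_left _ (by omega)
        refine le_trans ?_ h1
        simp only [HP.K] at ht' ⊢
        nlinarith [Nat.zero_le T, Nat.zero_le (b.compile.cost * T)]
      · refine ⟨s, _, Exec.loop_false (mt (BE.holds_compile s b).1 hb), ?_, hI, hb⟩
        simp only [HP.K]
        nlinarith [Nat.zero_le (Φ (view k np s)), Nat.zero_le p.K,
          Nat.zero_le (b.compile.cost * Φ (view k np s)), Nat.zero_le (p.K * Φ (view k np s))]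
  exact key _ h₀ (Frame.refl _ _) h0 le_rfl

/-- Programs without loops and minimization problems. -/
@[simp] def HP.Simple : HP k np → Prop
  | skip => True
  | setN _ _ _ => True
  | cpR _ _ _ _ => True
  | minim _ _ _ => False
  | seq p q => p.Simple ∧ q.Simple
  | cond _ p q => p.Simple ∧ q.Simple
  | loop _ _ => False

/-- A bound for the number of steps of a program without loops. -/
@[simp] def HP.size : HP k np → ℕ
  | seq p q => p.size + q.size
  | cond _ p q => max p.size q.size + 1
  | _ => 1

open Classical in
/-- The effect of a program without loops and minimization problems. -/
@[simp] def HP.sl : HP k np → HS k np → HS k np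
  | skip, h => h
  | setN c r e, h => h.setN c (r.eval h) (e.eval h)
  | cpR c r c' r', h => h.setX c (r.eval h) (h.x c' (r'.eval h))
  | minim _ _ _, h => h
  | seq p q, h => q.sl (p.sl h)
  | cond b p q, h => if b.holds h then p.sl h else q.sl h
  | loop _ _, h => h

/-- Programs without loops and minimization problems are executed symbolically. -/
theorem Runs.sl {p : HP k np} (hp : p.Simple) : ∀ {h : HS k np} {Q : HS k np → Prop},
    Q (p.sl h) → Runs p h p.size Q := by
  induction p with
  | skip => intro h Q hQ; exact Runs.skip hQ
  | setN c r e => intro h Q hQ; exact Runs.setN hQ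
  | cpR c r c' r' => intro h Q hQ; exact Runs.cpR hQ
  | minim Q r c => exact hp.elim
  | seq p q ihp ihq =>
    intro h Q hQ
    exact Runs.seq' _ _ (ihp hp.1 (ihq hp.2 hQ)) le_rfl
  | cond b p q ihp ihq =>
    intro h Q hQ
    refine Runs.cond (fun hb => ?_) (fun hb => ?_)
    · refine (ihp hp.1 (Q := Q) ?_).mono (le_max_left _ _) fun _ => id
      simpa [HP.sl, hb] using hQ
    · refine (ihq hp.2 (Q := Q) ?_).mono (le_max_right _ _) fun _ => id
      simpa [HP.sl, hb] using hQ
  | loop b p => exact hp.elim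

/-- `for ζ < ℓ do body`. -/
def forLoop (ζ ℓ : NA) (body : HP k np) : HP k np :=
  put ζ (.lit 0) ;; .loop (.lt (vr ζ) (vr ℓ)) (body ;; put ζ (.add (vr ζ) (.lit 1)))

/-- The rule for counting loops, with an invariant for each value of the counter. -/
theorem Runs.forLoop {ζ ℓ : NA} {body : HP k np} (hz : ¬ body.wN (.sc ζ)) (hl : ¬ body.wN (.sc ℓ))
    (hne : ℓ ≠ ζ) {h : HS k np} (I : ℕ → HS k np → Prop) (n T : ℕ) (hn : h.n (.sc ℓ) 0 = n)
    (h0 : I 0 (h.setN (.sc ζ) 0 0))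
    (step : ∀ i < n, ∀ h', Frame (forLoop ζ ℓ body) h h' → h'.n (.sc ζ) 0 = i →
      h'.n (.sc ℓ) 0 = n → I i h' → Runs body h' T fun h'' => I (i + 1) (h''.setN (.sc ζ) 0 (i + 1))) :
    Runs (forLoop ζ ℓ body) h (n * (T + 2) + 2) fun h' => I n h' ∧ h'.n (.sc ζ) 0 = n := by
  refine Runs.seq' 1 (n * (T + 2) + 1) (Runs.setN ?_) (by omega)
  simp only [NE.eval]
  set h₀ := h.setN (.sc ζ) 0 0
  have key := Runs.loop (b := .lt (vr ζ) (vr ℓ)) (p := body ;; put ζ (.add (vr ζ) (.lit 1)))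
    (h₀ := h₀)
    (fun h' => h'.n (.sc ζ) 0 ≤ n ∧ h'.n (.sc ℓ) 0 = n ∧ I (h'.n (.sc ζ) 0) h')
    (fun h' => (n - h'.n (.sc ζ) 0) * (T + 2)) ?_ ?_
  · have hzero : h₀.n (.sc ζ) 0 = 0 := by simp [h₀]
    rw [hzero, Nat.sub_zero] at key
    refine key.mono le_rfl ?_
    rintro h' ⟨⟨h1, h2, h3⟩, h4⟩
    simp only [BE.holds, NE.eval, h2, not_lt] at h4
    have : h'.n (.sc ζ) 0 = n := le_antisymm h1 h4
    rw [this] at h3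
    exact ⟨h3, this⟩
  · simp [h₀, hn, h0, hne]
  · rintro h' hF ⟨h1, h2, h3⟩ hb
    simp only [BE.holds, NE.eval, h2] at hb
    refine ⟨T + 1, ?_⟩
    have hF' : Frame (RealRAM.forLoop ζ ℓ body) h h' := by
      refine Frame.trans (h' := h₀) ⟨fun c hc => ?_, fun c hc => rfl⟩ (hF.weaken ?_ ?_)
      · funext r
        have : c ≠ .sc ζ := by
          rintro rfl
          exact hc (by simp [RealRAM.forLoop])
        simp [h₀, this]
      · intro c hc
        simp only [HP.wN] at hc
        simp only [RealRAM.forLoop, HP.wN]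
        tauto
      · intro c hc
        simp only [HP.wX] at hc
        simp only [RealRAM.forLoop, HP.wX]
        tauto
    refine Runs.seq' T 1 ((step _ hb h' hF' rfl h2 h3).frame.mono le_rfl ?_) le_rfl
    rintro h'' ⟨hI, hF2⟩
    have e1 := congrFun (hF2.n _ hz) 0
    have e2 := congrFun (hF2.n _ hl) 0
    refine Runs.setN ?_
    simp only [NE.eval, HS.setN_n, and_self, if_true, e1, NC.sc.injEq, hne, and_true, if_false, e2,
      h2]
    refine ⟨⟨by omega, by trivial, hI⟩, ?_⟩
    obtain ⟨j, hj⟩ : ∃ j, n = h'.n (.sc ζ) 0 + 1 + j := ⟨n - h'.n (.sc ζ) 0 - 1, by omega⟩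
    have a1 : n - h'.n (.sc ζ) 0 = j + 1 := by omega
    have a2 : n - (h'.n (.sc ζ) 0 + 1) = j := by omega
    rw [a1, a2]
    ring_nf
    omega

/-- Sequential composition over a list. -/
def seqL {ι : Type*} : List ι → (ι → HP k np) → HP k np
  | [], _ => .skip
  | a :: l, f => f a ;; seqL l f

@[simp] theorem wN_seqL {ι : Type*} (l : List ι) (f : ι → HP k np) (c : NC k) :
    (seqL l f).wN c ↔ ∃ a ∈ l, (f a).wN c := by
  induction l with
  | nil => simp [seqL]
  | cons a l ih => simp [seqL, ih]

@[simp] theorem wX_seqL {ι : Type*} (l : List ι) (f : ι → HP k np) (c : RC np) :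
    (seqL l f).wX c ↔ ∃ a ∈ l, (f a).wX c := by
  induction l with
  | nil => simp [seqL]
  | cons a l ih => simp [seqL, ih]

/-- The rule for composition over a list, with an invariant for each initial part of the list. -/
theorem Runs.seqL {ι : Type*} {l : List ι} {f : ι → HP k np} {h : HS k np} (T : ℕ)
    (I : List ι → HS k np → Prop) (h0 : I [] h)
    (step : ∀ pre a post, l = pre ++ a :: post → ∀ h', Frame (seqL l f) h h' → I pre h' →
      Runs (f a) h' T (I (pre ++ [a]))) :
    Runs (seqL l f) h (l.length * T + 1) (I l) := by
  have key : ∀ (l' pre : List ι) (h' : HS k np), l = pre ++ l' → Frame (RealRAM.seqL l f) h h' →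
      I pre h' → Runs (RealRAM.seqL l' f) h' (l'.length * T + 1) (I l) := by
    intro l'
    induction l' with
    | nil =>
      intro pre h' hl hF hI
      rw [List.append_nil] at hl
      subst hl
      exact (Runs.skip hI).mono (by simp) fun _ => id
    | cons a l' ih =>
      intro pre h' hl hF hI
      refine Runs.seq' T (l'.length * T + 1) ((step pre a l' hl h' hF hI).frame.mono le_rfl ?_) ?_
      · rintro h'' ⟨hI', hF'⟩
        refine ih (pre ++ [a]) h'' (by simp [hl]) (hF.trans (hF'.weaken ?_ ?_)) hI'
        · intro c hc
          rw [wN_seqL]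
          exact ⟨a, by simp [hl], hc⟩
        · intro c hc
          rw [wX_seqL]
          exact ⟨a, by simp [hl], hc⟩
      · simp only [List.length_cons, add_mul]
        omega
  exact key l [] h rfl (Frame.refl _ _) h0

end RealRAM

namespace RealRAM
variable {k np : ℕ}

/-! ### Approximate medians in linear time -/

/-- The number of the first `n` values that are at most `x`. -/
def countLE (f : ℕ → ℝ) (n : ℕ) (x : ℝ) : ℕ := ∑ i ∈ Finset.range n, if f i ≤ x then 1 else 0

/-- The number of the first `n` values that are at least `x`. -/
def countGE (f : ℕ → ℝ) (n : ℕ) (x : ℝ) : ℕ := ∑ i ∈ Finset.range n, if x ≤ f i then 1 else 0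

theorem countLE_add (f : ℕ → ℝ) (a b : ℕ) (x : ℝ) :
    countLE f (a + b) x = countLE f a x + countLE (fun i => f (a + i)) b x := by
  rw [countLE, Finset.sum_range_add]; rfl

theorem countGE_add (f : ℕ → ℝ) (a b : ℕ) (x : ℝ) :
    countGE f (a + b) x = countGE f a x + countGE (fun i => f (a + i)) b x := by
  rw [countGE, Finset.sum_range_add]; rfl

theorem countLE_congr {f g : ℕ → ℝ} {n : ℕ} (h : ∀ i < n, f i = g i) (x : ℝ) :
    countLE f n x = countLE g n x :=
  Finset.sum_congr rfl fun i hi => by rw [h i (Finset.mem_range.1 hi)]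

theorem countGE_congr {f g : ℕ → ℝ} {n : ℕ} (h : ∀ i < n, f i = g i) (x : ℝ) :
    countGE f n x = countGE g n x :=
  Finset.sum_congr rfl fun i hi => by rw [h i (Finset.mem_range.1 hi)]

theorem countLE_eq_card (f : ℕ → ℝ) (n : ℕ) (x : ℝ) :
    countLE f n x = ((Finset.range n).filter fun i => f i ≤ x).card := by
  rw [Finset.card_filter, countLE]

theorem countGE_eq_card (f : ℕ → ℝ) (n : ℕ) (x : ℝ) :
    countGE f n x = ((Finset.range n).filter fun i => x ≤ f i).card := by
  rw [Finset.card_filter, countGE]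

/-- `b` precedes `a` in the order by value, ties being broken by position. -/
def Precedes (f : ℕ → ℝ) (b a : ℕ) : Prop := f b < f a ∨ (¬ f a < f b ∧ b < a)

open Classical in
/-- The number of those among the first `j` positions that precede `a`. -/
def rankOf (f : ℕ → ℝ) (j a : ℕ) : ℕ := ∑ b ∈ Finset.range j, if Precedes f b a then 1 else 0

open Classical in
theorem rankOf_succ (f : ℕ → ℝ) (j a : ℕ) :
    rankOf f (j + 1) a = rankOf f j a + if Precedes f j a then 1 else 0 :=
  Finset.sum_range_succ _ _

theorem Precedes.trans {f : ℕ → ℝ} {a b c : ℕ} (h : Precedes f a b) (h' : Precedes f b c) :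
    Precedes f a c := by
  unfold Precedes at *
  rcases h with h | ⟨h, h1⟩ <;> rcases h' with h' | ⟨h', h1'⟩
  · exact Or.inl (h.trans h')
  · exact Or.inl (h.trans_le (not_lt.1 h'))
  · exact Or.inl ((not_lt.1 h).trans_lt h')
  · exact Or.inr ⟨not_lt.2 ((not_lt.1 h).trans (not_lt.1 h')), h1.trans h1'⟩

theorem precedes_irrefl (f : ℕ → ℝ) (a : ℕ) : ¬ Precedes f a a := by
  simp [Precedes]

theorem precedes_total (f : ℕ → ℝ) {a b : ℕ} (h : a ≠ b) : Precedes f a b ∨ Precedes f b a := by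
  unfold Precedes
  rcases lt_trichotomy (f a) (f b) with h' | h' | h'
  · exact Or.inl (Or.inl h')
  · rcases lt_or_gt_of_ne h with h1 | h1
    · exact Or.inl (Or.inr ⟨by simp [h'], h1⟩)
    · exact Or.inr (Or.inr ⟨by simp [h'], h1⟩)
  · exact Or.inr (Or.inl h')

theorem rankOf_lt {f : ℕ → ℝ} {n a b : ℕ} (ha : a < n) (h : Precedes f a b) :
    rankOf f n a < rankOf f n b := by
  classical
  simp only [rankOf, ← Finset.card_filter]
  apply Finset.card_lt_card
  refine ⟨fun c hc => ?_, fun hs => ?_⟩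
  · simp only [Finset.mem_filter] at hc ⊢
    exact ⟨hc.1, hc.2.trans h⟩
  · have : a ∈ (Finset.range n).filter fun c => Precedes f c b := by simp [ha, h]
    have := hs this
    simp [precedes_irrefl] at this

theorem rankOf_lt_self {f : ℕ → ℝ} {n a : ℕ} (ha : a < n) : rankOf f n a < n := by
  classical
  simp only [rankOf, ← Finset.card_filter]
  calc _ < (Finset.range n).card := by
        apply Finset.card_lt_card
        refine ⟨Finset.filter_subset _ _, fun hs => ?_⟩
        have := hs (Finset.mem_range.2 ha)
        simp [precedes_irrefl] at this
    _ = n := Finset.card_range n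

theorem rankOf_injOn (f : ℕ → ℝ) (n : ℕ) : Set.InjOn (rankOf f n) (Finset.range n : Set ℕ) := by
  intro a ha b hb h
  by_contra hne
  simp only [Finset.coe_range, Set.mem_Iio] at ha hb
  rcases precedes_total f hne with h' | h'
  · exact (rankOf_lt ha h').ne h
  · exact (rankOf_lt hb h').ne' h

theorem image_rankOf (f : ℕ → ℝ) (n : ℕ) :
    (Finset.range n).image (rankOf f n) = Finset.range n := by
  apply Finset.eq_of_subset_of_card_le
  · intro j hj
    obtain ⟨a, ha, rfl⟩ := Finset.mem_image.1 hj
    exact Finset.mem_range.2 (rankOf_lt_self (Finset.mem_range.1 ha))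
  · rw [Finset.card_image_of_injOn (rankOf_injOn f n)]

/-- `g` lists the first `n` values of `f` by rank. -/
def RankSorted (f g : ℕ → ℝ) (n : ℕ) : Prop := ∀ a < n, g (rankOf f n a) = f a

theorem RankSorted.mono {f g : ℕ → ℝ} {n : ℕ} (h : RankSorted f g n) {i j : ℕ} (hij : i ≤ j)
    (hj : j < n) : g i ≤ g j := by
  have hi : i < n := by omega
  rw [← Finset.mem_range, ← image_rankOf f n] at hi hj
  obtain ⟨a, ha, rfl⟩ := Finset.mem_image.1 hi
  obtain ⟨b, hb, rfl⟩ := Finset.mem_image.1 hj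
  rw [h a (Finset.mem_range.1 ha), h b (Finset.mem_range.1 hb)]
  by_contra hlt
  have : Precedes f b a := Or.inl (not_le.1 hlt)
  have := rankOf_lt (Finset.mem_range.1 hb) this
  omega

theorem RankSorted.sum_eq {f g : ℕ → ℝ} {n : ℕ} (h : RankSorted f g n) (p : ℝ → ℕ) :
    ∑ i ∈ Finset.range n, p (g i) = ∑ i ∈ Finset.range n, p (f i) := by
  conv_lhs => rw [← image_rankOf f n]
  rw [Finset.sum_image (rankOf_injOn f n)]
  exact Finset.sum_congr rfl fun a ha => by rw [h a (Finset.mem_range.1 ha)]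

/-- Every fourth element of a sorted list represents three others that are not larger. -/
theorem RankSorted.countLE_sample {f g : ℕ → ℝ} {n : ℕ} (h : RankSorted f g (4 * n)) (x : ℝ) :
    4 * countLE (fun i => g (4 * i + 3)) n x ≤ countLE f (4 * n) x := by
  have e : countLE f (4 * n) x = countLE g (4 * n) x :=
    (h.sum_eq fun y => if y ≤ x then 1 else 0).symm
  rw [e, countLE_eq_card, countLE_eq_card]
  have h4 : ∀ y : ℕ, 4 * y = y * (Finset.range 4).card := by simp [mul_comm]
  rw [h4 (Finset.card _), ← Finset.card_product]
  apply Finset.card_le_card_of_injOn fun p => 4 * p.1 + p.2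
  · rintro ⟨i, r⟩ hp
    simp only [Finset.coe_product, Finset.coe_filter, Finset.mem_range, Finset.coe_range,
      Set.mem_prod, Set.mem_ofPred_eq, Set.mem_Iio] at hp ⊢
    exact ⟨by omega, (h.mono (by omega) (by omega)).trans hp.1.2⟩
  · rintro ⟨i, r⟩ hp ⟨i', r'⟩ hp' heq
    simp only [Finset.coe_product, Finset.coe_filter, Finset.mem_range, Finset.coe_range,
      Set.mem_prod, Set.mem_ofPred_eq, Set.mem_Iio] at hp hp' heq
    simp only [Prod.mk.injEq]
    omega

/-- Every sampled element is followed by three others that are not smaller, except for the last one,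
which ends the list. -/
theorem RankSorted.countGE_sample {f g : ℕ → ℝ} {n : ℕ} (h : RankSorted f g (4 * n)) (x : ℝ) :
    4 * countGE (fun i => g (4 * i + 3)) n x ≤ countGE f (4 * n) x + 3 := by
  have e : countGE f (4 * n) x = countGE g (4 * n) x :=
    (h.sum_eq fun y => if x ≤ y then 1 else 0).symm
  rw [e, countGE_eq_card, countGE_eq_card]
  have h4 : ∀ y : ℕ, 4 * y = y * (Finset.range 4).card := by simp [mul_comm]
  rw [h4 (Finset.card _), ← Finset.card_product]
  have h3 : 3 = (Finset.Ico (4 * n) (4 * n + 3)).card := by simp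
  conv_rhs => rw [h3]
  refine le_trans ?_ (Finset.card_union_le _ _)
  apply Finset.card_le_card_of_injOn fun p => 4 * p.1 + 3 + p.2
  · rintro ⟨i, r⟩ hp
    simp only [Finset.coe_product, Finset.coe_filter, Finset.mem_range, Finset.coe_range,
      Set.mem_prod, Set.mem_ofPred_eq, Set.mem_Iio, Finset.coe_union, Set.mem_union,
      Finset.coe_Ico, Set.mem_Ico] at hp ⊢
    by_cases hlt : 4 * i + 3 + r < 4 * n
    · exact Or.inl ⟨hlt, hp.1.2.trans (h.mono (by omega) hlt)⟩
    · exact Or.inr (by omega)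
  · rintro ⟨i, r⟩ hp ⟨i', r'⟩ hp' heq
    simp only [Finset.coe_product, Finset.coe_filter, Finset.mem_range, Finset.coe_range,
      Set.mem_prod, Set.mem_ofPred_eq, Set.mem_Iio] at hp hp' heq
    simp only [Prod.mk.injEq]
    omega

/-- Write the rank of the `ia`-th element of the current block to `rank`. -/
def rankBody : HP k np :=
  .cond (.rlt .pv (.add (vr .pos) (vr .ib)) .pv (.add (vr .pos) (vr .ia)))
    (put .rank (.add (vr .rank) (.lit 1)))
    (.cond (.conj (.neg (.rlt .pv (.add (vr .pos) (vr .ia)) .pv (.add (vr .pos) (vr .ib))))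
        (.lt (vr .ib) (vr .ia)))
      (put .rank (.add (vr .rank) (.lit 1))) .skip)

/-- Sort the block of length `bl` that starts at `pos` into `tmp`, by computing all ranks. -/
def rankSort : HP k np :=
  forLoop .ia .bl (put .rank (.lit 0) ;; forLoop .ib .bl rankBody ;;
    .cpR .tmp (vr .rank) .pv (.add (vr .pos) (vr .ia)))

/-- Keep every fourth element of the sorted block. -/
def sampleBlock : HP k np :=
  forLoop .ia .hl (.cpR .pv (.add (vr .out) (vr .ia)) .tmp (.add (.smul 4 (vr .ia)) (.lit 3)))

theorem runs_rankSort (h : HS k np) :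
    Runs rankSort h (h.n (.sc .bl) 0 * (h.n (.sc .bl) 0 * 5 + 6) + 2) fun h' =>
      RankSorted (fun i => h.x .pv (h.n (.sc .pos) 0 + i)) (h'.x .tmp) (h.n (.sc .bl) 0) := by
  set n := h.n (.sc .bl) 0 with hn
  set p := h.n (.sc .pos) 0 with hp
  set f : ℕ → ℝ := fun i => h.x .pv (p + i) with hf
  refine (Runs.forLoop (by simp [forLoop, rankBody]) (by simp [forLoop, rankBody]) (by simp)
    (fun i h' => ∀ a < i, h'.x .tmp (rankOf f n a) = f a) n (n * 5 + 4) hn.symm (by simp) ?_).mono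
    (by ring_nf; omega) ?_
  · intro a ha h1 hF h1a h1n hI
    have hpv : h1.x .pv = h.x .pv := hF.x _ (by simp [forLoop, rankBody])
    have hpos : h1.n (.sc .pos) = h.n (.sc .pos) := hF.n _ (by simp [forLoop, rankBody])
    refine Runs.seq' 1 (n * 5 + 3) (Runs.setN ?_) (by omega)
    refine Runs.seq' (n * 5 + 2) 1 (((Runs.forLoop (by simp [rankBody])
      (by simp [rankBody]) (by simp) (fun j h' => h'.n (.sc .rank) 0 = rankOf f j a) n 3
      (by simpa using h1n) (by simp [rankOf]) ?_).frame).mono (by omega) ?_) (by omega)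
    · intro j hj h2 hF2 h2j h2n hI2
      have e1 : h2.x .pv = h.x .pv := by
        rw [hF2.x _ (by simp [forLoop, rankBody])]; simpa using hpv
      have e2 : h2.n (.sc .pos) 0 = p := by
        rw [hF2.n _ (by simp [forLoop, rankBody])]; simp [hpos, hp]
      have e3 : h2.n (.sc .ia) 0 = a := by
        rw [hF2.n _ (by simp [forLoop, rankBody])]; simpa using h1a
      refine (Runs.sl (by simp [rankBody]) ?_).mono (by simp [rankBody]) fun _ => id
      simp only [rankOf_succ, Precedes, hf]
      simp only [rankBody, HP.sl, BE.holds, NE.eval, e1, e2, e3, h2j]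
      split_ifs <;> first | (simp_all; done) | (simp_all; grind)
    · rintro h2 ⟨⟨hr, -⟩, hF2⟩
      have e1 : h2.x .pv = h.x .pv := by
        rw [hF2.x _ (by simp [forLoop, rankBody])]; simpa using hpv
      have e2 : h2.n (.sc .pos) 0 = p := by
        rw [hF2.n _ (by simp [forLoop, rankBody])]; simp [hpos, hp]
      have e3 : h2.n (.sc .ia) 0 = a := by
        rw [hF2.n _ (by simp [forLoop, rankBody])]; simpa using h1a
      have e4 : h2.x .tmp = h1.x .tmp := by
        rw [hF2.x _ (by simp [forLoop, rankBody])]; simp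
      refine Runs.cpR ?_
      intro b hb
      simp only [HS.setN_x, HS.setX_x, NE.eval, hr, e1, e2, e3, true_and, e4]
      split_ifs with hc
      · have := rankOf_injOn f n (by simpa using (by omega : b < n)) (by simpa using ha) hc
        rw [this]
      · have : b ≠ a := by rintro rfl; exact hc rfl
        exact hI b (by omega)
  · rintro h' ⟨hI, -⟩
    exact hI

theorem runs_sampleBlock (h : HS k np) :
    Runs sampleBlock h (h.n (.sc .hl) 0 * 3 + 2) fun h' => ∀ i, h'.x .pv i =
      if h.n (.sc .out) 0 ≤ i ∧ i < h.n (.sc .out) 0 + h.n (.sc .hl) 0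
      then h.x .tmp (4 * (i - h.n (.sc .out) 0) + 3) else h.x .pv i := by
  refine (Runs.forLoop (by simp) (by simp) (by simp)
    (fun j h' => ∀ i, h'.x .pv i = if h.n (.sc .out) 0 ≤ i ∧ i < h.n (.sc .out) 0 + j
      then h.x .tmp (4 * (i - h.n (.sc .out) 0) + 3) else h.x .pv i) _ 1 rfl ?_ ?_).mono
    le_rfl fun _ hh => hh.1
  · intro i
    rw [if_neg (by omega)]
    rfl
  · intro j hj h1 hF h1j h1n hI
    have e1 : h1.n (.sc .out) = h.n (.sc .out) := hF.n _ (by simp [forLoop])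
    have e2 : h1.x .tmp = h.x .tmp := hF.x _ (by simp [forLoop])
    refine Runs.cpR ?_
    intro i
    simp only [HS.setN_x, HS.setX_x, NE.eval, NE.eval_smul, e1, e2, h1j, true_and, hI i]
    split_ifs with c1 c2 c3
    · subst c1
      congr 1
      omega
    · omega
    · rfl
    · omega
    · omega
    · rfl

/-- Replace a block by a sample of a quarter of its elements. -/
def reduceBlock : HP k np :=
  rankSort ;; sampleBlock ;; put .pos (.add (vr .pos) (vr .bl)) ;;
    put .out (.add (vr .out) (vr .hl))

/-- Combine groups of eight runs of length `rl` to runs of length `2 * rl`. -/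
def reduceLevel : HP k np :=
  put .bl (.smul 8 (vr .rl)) ;; put .hl (.smul 2 (vr .rl)) ;; put .pos (.lit 0) ;;
    put .out (.lit 0) ;; .loop (.lt (vr .pos) (vr .m)) reduceBlock ;; put .m (vr .out) ;;
    put .rl (vr .hl)

theorem runs_reduceBlock (h : HS k np) (r : ℕ) (hb : h.n (.sc .bl) 0 = 8 * r)
    (hh : h.n (.sc .hl) 0 = 2 * r) :
    Runs reduceBlock h (320 * r ^ 2 + 54 * r + 6) fun h' =>
      h'.n (.sc .pos) 0 = h.n (.sc .pos) 0 + 8 * r ∧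
      h'.n (.sc .out) 0 = h.n (.sc .out) 0 + 2 * r ∧
      ∃ g, RankSorted (fun i => h.x .pv (h.n (.sc .pos) 0 + i)) g (8 * r) ∧
      ∀ i, h'.x .pv i = if h.n (.sc .out) 0 ≤ i ∧ i < h.n (.sc .out) 0 + 2 * r
      then g (4 * (i - h.n (.sc .out) 0) + 3) else h.x .pv i := by
  refine Runs.seq' (320 * r ^ 2 + 48 * r + 2) (6 * r + 4)
    (((runs_rankSort h).frame).mono (by rw [hb]; ring_nf; omega) ?_) (by omega)
  rintro h1 ⟨hs, hF⟩
  have e1 : h1.n (.sc .hl) = h.n (.sc .hl) := hF.n _ (by simp [rankSort, forLoop, rankBody])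
  have e2 : h1.n (.sc .out) = h.n (.sc .out) := hF.n _ (by simp [rankSort, forLoop, rankBody])
  have e3 : h1.n (.sc .pos) = h.n (.sc .pos) := hF.n _ (by simp [rankSort, forLoop, rankBody])
  have e4 : h1.n (.sc .bl) = h.n (.sc .bl) := hF.n _ (by simp [rankSort, forLoop, rankBody])
  have e5 : h1.x .pv = h.x .pv := hF.x _ (by simp [rankSort, forLoop, rankBody])
  refine Runs.seq' (6 * r + 2) 2
    (((runs_sampleBlock h1).frame).mono (by rw [e1, hh]; ring_nf; omega) ?_) (by omega)
  rintro h2 ⟨hs2, hF2⟩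
  have d1 : h2.n (.sc .hl) = h.n (.sc .hl) := by
    rw [hF2.n _ (by simp [sampleBlock, forLoop]), e1]
  have d2 : h2.n (.sc .out) = h.n (.sc .out) := by
    rw [hF2.n _ (by simp [sampleBlock, forLoop]), e2]
  have d3 : h2.n (.sc .pos) = h.n (.sc .pos) := by
    rw [hF2.n _ (by simp [sampleBlock, forLoop]), e3]
  have d4 : h2.n (.sc .bl) = h.n (.sc .bl) := by
    rw [hF2.n _ (by simp [sampleBlock, forLoop]), e4]
  refine (Runs.sl (by simp) ?_).mono (by simp) fun _ => id
  rw [hb] at hs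
  rw [e1, e2, e5, hh] at hs2
  refine ⟨?_, ?_, h1.x .tmp, hs, ?_⟩
  · simp [d3, d4, hb]
  · simp [d2, d1, hh]
  · intro i
    simpa using hs2 i

/-- One level of sampling quarters the counts, up to an error of `3` in each of the `B` blocks. -/
theorem runs_reduceLevel (h : HS k np) (r B : ℕ) (hr : h.n (.sc .rl) 0 = r)
    (hm : h.n (.sc .m) 0 = 8 * r * B) (hr0 : 0 < r) :
    Runs reduceLevel h (B * (320 * r ^ 2 + 54 * r + 7) + 7) fun h' =>
      h'.n (.sc .rl) 0 = 2 * r ∧ h'.n (.sc .m) 0 = 2 * r * B ∧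
      (∀ x, 4 * countLE (h'.x .pv) (2 * r * B) x ≤ countLE (h.x .pv) (8 * r * B) x) ∧
      (∀ x, 4 * countGE (h'.x .pv) (2 * r * B) x ≤ countGE (h.x .pv) (8 * r * B) x + 3 * B) ∧
      (0 < B → ∀ i j, i ≤ j → j < 2 * r → h'.x .pv i ≤ h'.x .pv j) := by
  refine Runs.seq' 1 _ (Runs.setN ?_) (add_comm _ _).le
  refine Runs.seq' 1 _ (Runs.setN ?_) (add_comm _ _).le
  refine Runs.seq' 1 _ (Runs.setN ?_) (add_comm _ _).le
  refine Runs.seq' 1 (B * (320 * r ^ 2 + 54 * r + 7) + 3) (Runs.setN ?_) (by omega)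
  refine Runs.seq' (B * (320 * r ^ 2 + 54 * r + 7) + 1) 2 ?_ (by omega)
  simp only [NE.eval, NE.eval_smul]
  set h₁ := (((h.setN (.sc .bl) 0 (8 * h.n (.sc .rl) 0)).setN (.sc .hl) 0
    (2 * (h.setN (.sc .bl) 0 (8 * h.n (.sc .rl) 0)).n (.sc .rl) 0)).setN (.sc .pos) 0 0).setN
    (.sc .out) 0 0 with hh1
  have key := Runs.loop (b := .lt (vr .pos) (vr .m)) (p := reduceBlock) (h₀ := h₁)
    (fun h' => ∃ b, h'.n (.sc .pos) 0 = 8 * r * b ∧ h'.n (.sc .out) 0 = 2 * r * b ∧ b ≤ B ∧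
      (∀ i, 2 * r * b ≤ i → h'.x .pv i = h.x .pv i) ∧
      (∀ x, 4 * countLE (h'.x .pv) (2 * r * b) x ≤ countLE (h.x .pv) (8 * r * b) x) ∧
      (∀ x, 4 * countGE (h'.x .pv) (2 * r * b) x ≤ countGE (h.x .pv) (8 * r * b) x + 3 * b) ∧
      (0 < b → ∀ i j, i ≤ j → j < 2 * r → h'.x .pv i ≤ h'.x .pv j))
    (fun h' => (8 * r * B - h'.n (.sc .pos) 0) / (8 * r) * (320 * r ^ 2 + 54 * r + 7)) ?_ ?_
  · refine key.frame.mono ?_ ?_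
    · simp only [hh1, HS.setN_n]
      simp [Nat.mul_div_cancel_left B (by omega : 0 < 8 * r)]
    · rintro h2 ⟨⟨⟨b, hb1, hb2, hb3, -, hb5, hb6, hb7⟩, hb⟩, hF⟩
      have e1 : h2.n (.sc .m) 0 = 8 * r * B := by
        rw [hF.n _ (by simp [reduceBlock, rankSort, sampleBlock, forLoop, rankBody])]
        simp [hh1, hm]
      have e2 : h2.n (.sc .hl) 0 = 2 * r := by
        rw [hF.n _ (by simp [reduceBlock, rankSort, sampleBlock, forLoop, rankBody])]
        simp [hh1, hr]
      have : b = B := by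
        simp only [BE.holds, NE.eval, e1, hb1, not_lt] at hb
        exact le_antisymm hb3 (Nat.le_of_mul_le_mul_left hb (by omega))
      subst this
      refine (Runs.sl (by simp) ?_).mono (by simp) fun _ => id
      refine ⟨?_, ?_, ?_⟩
      · simp [e2]
      · simp [hb2]
      · simpa using ⟨hb5, hb6, hb7⟩
  · refine ⟨0, by simp [hh1], by simp [hh1], by simp, by simp [hh1], by simp [countLE],
      by simp [countGE], by simp⟩
  · rintro h2 hF ⟨b, hb1, hb2, hb3, hb4, hb5, hb6, hb7⟩ hb
    have e1 : h2.n (.sc .m) 0 = 8 * r * B := by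
      rw [hF.n _ (by simp [reduceBlock, rankSort, sampleBlock, forLoop, rankBody])]
      simp [hh1, hm]
    have e2 : h2.n (.sc .hl) 0 = 2 * r := by
      rw [hF.n _ (by simp [reduceBlock, rankSort, sampleBlock, forLoop, rankBody])]
      simp [hh1, hr]
    have e3 : h2.n (.sc .bl) 0 = 8 * r := by
      rw [hF.n _ (by simp [reduceBlock, rankSort, sampleBlock, forLoop, rankBody])]
      simp [hh1, hr]
    have hbB : b < B := by
      simp only [BE.holds, NE.eval, e1, hb1] at hb
      exact lt_of_mul_lt_mul_left hb (Nat.zero_le _)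
    refine ⟨_, (runs_reduceBlock h2 r e3 e2).mono le_rfl ?_⟩
    rintro h3 ⟨c1, c2, g, c3, c4⟩
    rw [hb1] at c1 c3
    rw [hb2] at c2 c4
    have hle : 2 * r * b ≤ 8 * r * b := Nat.mul_le_mul_right _ (by omega)
    have c3' : RankSorted (fun i => h.x .pv (8 * r * b + i)) g (8 * r) := by
      have : (fun i => h2.x .pv (8 * r * b + i)) = fun i => h.x .pv (8 * r * b + i) := by
        funext i
        exact hb4 _ (by omega)
      rwa [this] at c3
    have hlow : ∀ i < 2 * r * b, h3.x .pv i = h2.x .pv i := by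
      intro i hi
      rw [c4, if_neg (by omega)]
    have hnew : ∀ i < 2 * r, h3.x .pv (2 * r * b + i) = g (4 * i + 3) := by
      intro i hi
      rw [c4, if_pos (by omega)]
      congr 2
      omega
    have h42 : 8 * r = 4 * (2 * r) := by ring
    have c3'' := c3'
    rw [h42] at c3''
    refine ⟨⟨b + 1, by rw [c1]; ring, by rw [c2]; ring, hbB, ?_, ?_, ?_, ?_⟩, ?_⟩
    · intro i hi
      rw [mul_add] at hi
      rw [c4, if_neg (by omega), hb4 _ (by omega)]
    · intro x
      rw [mul_add, mul_add, mul_one, mul_one, countLE_add, countLE_add, countLE_congr hlow,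
        countLE_congr hnew]
      have := c3''.countLE_sample x
      have := hb5 x
      simp only [← h42] at *
      omega
    · intro x
      rw [mul_add, mul_add, mul_one, mul_one, countGE_add, countGE_add, countGE_congr hlow,
        countGE_congr hnew]
      have := c3''.countGE_sample x
      have := hb6 x
      simp only [← h42] at *
      omega
    · intro _ i j hij hj
      rcases Nat.eq_zero_or_pos b with rfl | hb0
      · have a1 := hnew i (by omega)
        have a2 := hnew j hj
        simp only [mul_zero, zero_add] at a1 a2
        rw [a1, a2]
        exact c3'.mono (by omega) (by omega)
      · have : 2 * r * 1 ≤ 2 * r * b := Nat.mul_le_mul_left _ hb0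
        rw [hlow i (by omega), hlow j (by omega)]
        exact hb7 hb0 i j hij hj
    · rw [c1, hb1]
      have a1 : (8 * r * B - 8 * r * b) / (8 * r) = B - b := by
        rw [← Nat.mul_sub, Nat.mul_div_cancel_left _ (by omega)]
      have a2 : (8 * r * B - (8 * r * b + 8 * r)) / (8 * r) = B - (b + 1) := by
        rw [← Nat.mul_succ, ← Nat.mul_sub, Nat.mul_div_cancel_left _ (by omega)]
      rw [a1, a2]
      obtain ⟨j, hj⟩ : ∃ j, B = b + 1 + j := ⟨B - b - 1, by omega⟩
      have a3 : B - b = j + 1 := by omega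
      have a4 : B - (b + 1) = j := by omega
      rw [a3, a4, Nat.add_mul, one_mul]
      omega

/-- Find a value `piv` among the weights `ew` of the first `nM` items so that a constant fraction of
them is at most `piv`, and a constant fraction is at least `piv`. -/
def findPivot : HP k np :=
  put .m (.lit 1) ;; .loop (.neg (.lt (vr .nM) (.smul 8 (vr .m)))) (put .m (.smul 8 (vr .m))) ;;
    forLoop .e .m (.cpR .pv (vr .e) .ew (vr .e)) ;; put .rl (.lit 1) ;;
    .loop (.lt (vr .rl) (vr .m)) reduceLevel ;; put .z (.lit 0) ;;
    .loop (.neg (.lt (vr .rl) (.add (.smul 8 (vr .z)) (.lit 8)))) (put .z (.add (vr .z) (.lit 1))) ;;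
    .cpR .piv (.lit 0) .pv (vr .z)

/-- The largest power of `8` that does not exceed the number of items. -/
theorem runs_largestPower (h : HS k np) (hM : 0 < h.n (.sc .nM) 0) :
    Runs (put .m (.lit 1) ;; .loop (.neg (.lt (vr .nM) (.smul 8 (vr .m))))
      (put .m (.smul 8 (vr .m)))) h (2 * h.n (.sc .nM) 0 + 2) fun h' =>
      ∃ q, h'.n (.sc .m) 0 = 8 ^ q ∧ 8 ^ q ≤ h.n (.sc .nM) 0 ∧ h.n (.sc .nM) 0 < 8 * 8 ^ q := by
  set M := h.n (.sc .nM) 0 with hMd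
  refine Runs.seq' 1 (2 * M + 1) (Runs.setN ?_) (by omega)
  refine ((Runs.loop (fun h' => ∃ q, h'.n (.sc .m) 0 = 8 ^ q ∧ 8 ^ q ≤ M)
    (fun h' => 2 * (M - h'.n (.sc .m) 0)) ⟨0, by simp, by rw [pow_zero]; omega⟩ ?_).frame).mono ?_ ?_
  · rintro h1 hF ⟨q, h1q, hq⟩ hb
    have e : h1.n (.sc .nM) 0 = M := by rw [hF.n _ (by simp)]; simp [hMd]
    simp only [BE.holds, NE.eval, NE.eval_smul, e, h1q, not_lt] at hb
    refine ⟨1, Runs.setN ⟨⟨q + 1, ?_, ?_⟩, ?_⟩⟩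
    · simp [h1q, pow_succ, mul_comm]
    · rwa [pow_succ, mul_comm]
    · simp only [NE.eval, NE.eval_smul, HS.setN_n, and_self, if_true, h1q]
      have := Nat.one_le_pow q 8 (by norm_num)
      omega
  · simp
  · rintro h1 ⟨⟨⟨q, h1q, hq⟩, hb⟩, hF⟩
    have e : h1.n (.sc .nM) 0 = M := by rw [hF.n _ (by simp)]; simp [hMd]
    simp only [BE.holds, NE.eval, NE.eval_smul, e, h1q, not_lt, not_le] at hb
    exact ⟨q, h1q, hq, hb⟩

/-- The bounds are those of the error analysis of sampling: after `j` levels, each of the `8 ^ q / 4 ^ j`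
remaining elements stands for `4 ^ j` elements; no error arises on the side of the smaller elements,
and on the side of the larger elements the errors add up to at most `3 / 4` of all elements. -/
theorem runs_reduceLevels (h : HS k np) (q : ℕ) (hm : h.n (.sc .m) 0 = 8 ^ q)
    (hrl : h.n (.sc .rl) 0 = 1) :
    Runs (.loop (.lt (vr .rl) (vr .m)) reduceLevel) h (112 * 8 ^ q + 1) fun h' =>
      ∃ r, h'.n (.sc .rl) 0 = r ∧ 0 < r ∧ r ^ 3 = 8 ^ q ∧
        (∀ x, r ^ 2 * countLE (h'.x .pv) r x ≤ countLE (h.x .pv) (8 ^ q) x) ∧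
        (∀ x, 4 * r ^ 2 * countGE (h'.x .pv) r x + 3 * r ^ 2 ≤
          4 * countGE (h.x .pv) (8 ^ q) x + 3 * 8 ^ q) ∧
        (∀ i j, i ≤ j → j < r → h'.x .pv i ≤ h'.x .pv j) := by
  -- A level halves `m * rl`, and its running time is proportional to this product.
  refine (Runs.loop (fun h' => ∃ r b, h'.n (.sc .rl) 0 = r ∧ h'.n (.sc .m) 0 = 8 ^ b * r ∧
    0 < r ∧ 8 ^ b * r ^ 3 = 8 ^ q ∧
    (∀ x, r ^ 2 * countLE (h'.x .pv) (8 ^ b * r) x ≤ countLE (h.x .pv) (8 ^ q) x) ∧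
    (∀ x, 4 * r ^ 2 * countGE (h'.x .pv) (8 ^ b * r) x + 3 * 8 ^ b * r ^ 2 ≤
      4 * countGE (h.x .pv) (8 ^ q) x + 3 * 8 ^ q) ∧
    (∀ i j, i ≤ j → j < r → h'.x .pv i ≤ h'.x .pv j))
    (fun h' => 112 * (h'.n (.sc .m) 0 * h'.n (.sc .rl) 0)) ?_ ?_).mono ?_ ?_
  · refine ⟨1, q, hrl, by simpa using hm, by simp, by simp, by simp, by simp, ?_⟩
    intro i j hij hj
    obtain rfl : i = j := by omega
    exact le_rfl
  · rintro h1 hF ⟨r, b, h1r, h1m, hr, hrq, hle, hge, hs⟩ hb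
    simp only [BE.holds, NE.eval, h1r, h1m] at hb
    obtain ⟨c, rfl⟩ : ∃ c, b = c + 1 := by
      cases b with
      | zero => simp at hb
      | succ c => exact ⟨c, rfl⟩
    have hB : 0 < 8 ^ c := by positivity
    set B := 8 ^ c with hBd
    have e8 : 8 ^ (c + 1) = 8 * B := by rw [pow_succ, mul_comm]
    rw [e8] at h1m hrq hle hge
    refine ⟨_, (runs_reduceLevel h1 r B h1r (by rw [h1m]; ring) hr).mono le_rfl ?_⟩
    rintro h2 ⟨f1, f2, f3, f4, f5⟩
    refine ⟨⟨2 * r, c, f1, by rw [f2]; ring, by omega, by rw [← hrq]; ring, ?_, ?_, f5 hB⟩, ?_⟩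
    · intro x
      have a1 := hle x
      have a2 := f3 x
      have b1 : 8 * B * r = 8 * r * B := by ring
      have b2 : B * (2 * r) = 2 * r * B := by ring
      rw [b1] at a1
      rw [← hBd, b2]
      refine le_trans ?_ a1
      calc (2 * r) ^ 2 * countLE (h2.x .pv) (2 * r * B) x
          = r ^ 2 * (4 * countLE (h2.x .pv) (2 * r * B) x) := by ring
        _ ≤ _ := Nat.mul_le_mul_left _ a2
    · intro x
      have a1 := hge x
      have a2 := f4 x
      have b1 : 8 * B * r = 8 * r * B := by ring
      have b2 : B * (2 * r) = 2 * r * B := by ring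
      rw [b1] at a1
      rw [← hBd, b2]
      have a3 := Nat.mul_le_mul_left (4 * r ^ 2) a2
      refine le_trans ?_ a1
      calc 4 * (2 * r) ^ 2 * countGE (h2.x .pv) (2 * r * B) x + 3 * B * (2 * r) ^ 2
          = 4 * r ^ 2 * (4 * countGE (h2.x .pv) (2 * r * B) x) + 12 * (B * r ^ 2) := by ring
        _ ≤ 4 * r ^ 2 * (countGE (h1.x .pv) (8 * r * B) x + 3 * B) + 12 * (B * r ^ 2) := by omega
        _ = _ := by ring
    · rw [f1, f2, h1r, h1m]
      have : 1 ≤ r * r * B := Nat.mul_pos (Nat.mul_pos hr hr) hB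
      have : r * B ≤ r * r * B := by nlinarith
      have : B ≤ r * r * B := by nlinarith [Nat.mul_pos hr hr]
      nlinarith
  · rw [hm, hrl, mul_one]
  · rintro h1 ⟨⟨r, b, h1r, h1m, hr, hrq, hle, hge, hs⟩, hb⟩
    simp only [BE.holds, NE.eval, h1r, h1m, not_lt] at hb
    have hb0 : b = 0 := by
      by_contra hne
      have : 1 < 8 ^ b := Nat.one_lt_pow hne (by norm_num)
      nlinarith
    subst hb0
    simp only [pow_zero, one_mul, mul_one] at hrq hle hge
    exact ⟨r, h1r, hr, hrq, hle, hge, hs⟩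

/-- In a sorted list at least `z + 1` elements are at most the `z`-th one. -/
theorem le_countLE_of_sorted {f : ℕ → ℝ} {r z : ℕ} (hs : ∀ i j, i ≤ j → j < r → f i ≤ f j)
    (hz : z < r) : z + 1 ≤ countLE f r (f z) := by
  rw [countLE_eq_card]
  calc z + 1 = (Finset.range (z + 1)).card := by simp
    _ ≤ _ := Finset.card_le_card fun i hi => by
      have := Finset.mem_range.1 hi
      exact Finset.mem_filter.2 ⟨Finset.mem_range.2 (by omega), hs i z (by omega) hz⟩

theorem le_countGE_of_sorted {f : ℕ → ℝ} {r z : ℕ} (hs : ∀ i j, i ≤ j → j < r → f i ≤ f j) :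
    r - z ≤ countGE f r (f z) := by
  rw [countGE_eq_card]
  calc r - z = (Finset.Ico z r).card := by simp
    _ ≤ _ := Finset.card_le_card fun i hi => by
      have := Finset.mem_Ico.1 hi
      exact Finset.mem_filter.2 ⟨Finset.mem_range.2 (by omega), hs z i (by omega) (by omega)⟩

theorem countLE_mono (f : ℕ → ℝ) {a b : ℕ} (hab : a ≤ b) (x : ℝ) :
    countLE f a x ≤ countLE f b x := by
  obtain ⟨c, rfl⟩ := Nat.exists_eq_add_of_le hab
  rw [countLE_add]
  omega

theorem countGE_mono (f : ℕ → ℝ) {a b : ℕ} (hab : a ≤ b) (x : ℝ) :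
    countGE f a x ≤ countGE f b x := by
  obtain ⟨c, rfl⟩ := Nat.exists_eq_add_of_le hab
  rw [countGE_add]
  omega

/-- The pivot is the element at position `⌊r / 8⌋` of the final sorted sample of size `r`, where `r ^ 3`
is the largest power of `8` up to the number of items. At least `r / 8` elements of the sample are
not larger, and each represents `r ^ 2` items; at least `7 r / 8` are not smaller, of which the
equivalent of at most `3 r / 4` is lost to the errors of sampling. -/
theorem runs_findPivot (h : HS k np) (hM : 0 < h.n (.sc .nM) 0) :
    Runs findPivot h (200 * h.n (.sc .nM) 0) fun h' =>
      h.n (.sc .nM) 0 ≤ 64 * countLE (h.x .ew) (h.n (.sc .nM) 0) (h'.x .piv 0) ∧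
      h.n (.sc .nM) 0 ≤ 64 * countGE (h.x .ew) (h.n (.sc .nM) 0) (h'.x .piv 0) := by
  set M := h.n (.sc .nM) 0 with hMd
  have assoc : ∀ {p q r : HP k np} {h : HS k np} {T : ℕ} {Q : HS k np → Prop} (T₁ T₂ : ℕ),
      Runs (p ;; q) h T₁ (fun h' => Runs r h' T₂ Q) → T₁ + T₂ ≤ T → Runs (p ;; q ;; r) h T Q := by
    intro p q r h T Q T₁ T₂ hr hT s hs
    obtain ⟨s', t, he, ht, hq⟩ := hr s hs
    obtain ⟨s'', t', he', ht', hQ⟩ := hq s' rfl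
    cases he with
    | seq h1 h2 =>
      refine ⟨s'', _, Exec.seq h1 (Exec.seq h2 he'), ?_, hQ⟩
      calc _ ≤ (p ;; q).K * T₁ + r.K * T₂ := by omega
        _ ≤ (p ;; q).K * T + r.K * T :=
          add_le_add (Nat.mul_le_mul_left _ (by omega)) (Nat.mul_le_mul_left _ (by omega))
        _ = _ := by simp only [HP.K]; ring
  refine assoc (2 * M + 2) (198 * M - 2) ((runs_largestPower h hM).frame.mono le_rfl ?_) (by omega)
  rintro h1 ⟨⟨q, h1q, hq1, hq2⟩, hF1⟩
  rw [← hMd] at hq1 hq2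
  have e1 : h1.x .ew = h.x .ew := hF1.x _ (by simp)
  refine Runs.seq' (8 ^ q * 3 + 2) (195 * M - 4) ((Runs.forLoop (by simp) (by simp) (by simp)
    (fun i h' => ∀ j < i, h'.x .pv j = h.x .ew j) (8 ^ q) 1 h1q (by simp) ?_).frame.mono le_rfl
    ?_) (by omega)
  · intro i hi h2 hF2 h2e _ hI
    have e2 : h2.x .ew = h.x .ew := by rw [hF2.x _ (by simp [forLoop]), e1]
    refine Runs.cpR ?_
    intro j hj
    simp only [NE.eval, h2e, HS.setN_x, HS.setX_x, true_and, e2]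
    split_ifs with hc
    · rw [hc]
    · exact hI j (by omega)
  rintro h2 ⟨⟨hcp, -⟩, hF2⟩
  have h2m : h2.n (.sc .m) 0 = 8 ^ q := by rw [hF2.n _ (by simp [forLoop]), h1q]
  refine Runs.seq' 1 (195 * M - 5) (Runs.setN ?_) (by omega)
  refine Runs.seq' (112 * 8 ^ q + 1) (83 * M - 6) ((runs_reduceLevels _ q ?_ ?_).frame.mono le_rfl
    ?_) (by omega)
  · simpa using h2m
  · simp
  rintro h3 ⟨⟨r, h3r, hr0, hrq, hle, hge, hs⟩, hF3⟩
  have hrM : r ≤ M := by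
    refine le_trans ?_ hq1
    rw [← hrq]
    exact Nat.le_self_pow (by norm_num) r
  refine Runs.seq' 1 (83 * M - 7) (Runs.setN ?_) (by omega)
  refine Runs.seq' (2 * M + 1) 1 ?_ (by omega)
  set h4 := h3.setN (.sc .z) ((NE.lit 0 : NE k).eval h3) ((NE.lit 0 : NE k).eval h3) with h4d
  refine ((Runs.loop (fun h' => 8 * h'.n (.sc .z) 0 ≤ r) (fun h' => 2 * (M - h'.n (.sc .z) 0))
    ?_ ?_).frame).mono ?_ ?_
  · simp [h4d]
  · intro h5 hF5 hI hb
    have e5 : h5.n (.sc .rl) 0 = r := by rw [hF5.n _ (by simp)]; simp [h4d, h3r]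
    simp only [BE.holds, NE.eval, NE.eval_smul, e5, not_lt] at hb
    refine ⟨1, Runs.setN ⟨?_, ?_⟩⟩
    · simp only [NE.eval, HS.setN_n, and_self, if_true]
      omega
    · simp only [NE.eval, HS.setN_n, and_self, if_true]
      omega
  · simp [h4d]
  · rintro h5 ⟨⟨hI, hb⟩, hF5⟩
    have e5 : h5.n (.sc .rl) 0 = r := by rw [hF5.n _ (by simp)]; simp [h4d, h3r]
    have e6 : h5.x .pv = h3.x .pv := by rw [hF5.x _ (by simp)]; simp [h4d]
    simp only [BE.holds, NE.eval, NE.eval_smul, e5, not_not] at hb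
    refine Runs.cpR ?_
    simp only [NE.eval, HS.setX_x, and_self, if_true, e6]
    set z := h5.n (.sc .z) 0
    set y := h3.x .pv z with hy
    have hle' := hle y
    have hge' := hge y
    simp only [HS.setN_x] at hle' hge'
    rw [countLE_congr hcp] at hle'
    rw [countGE_congr hcp] at hge'
    have a1 := le_countLE_of_sorted hs (by omega : z < r)
    have a2 := le_countGE_of_sorted (z := z) hs
    have a3 := countLE_mono (h.x .ew) hq1 y
    have a4 := countGE_mono (h.x .ew) hq1 y
    rw [← hrq] at hq2 hle' hge' a3 a4
    refine ⟨?_, ?_⟩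
    · have b1 := Nat.mul_le_mul_left (r ^ 2) a1
      have b2 : r ^ 2 * r ≤ r ^ 2 * (8 * (z + 1)) := Nat.mul_le_mul_left _ (by omega)
      have b3 : r ^ 3 = r ^ 2 * r := by ring
      rw [← hy] at b1
      linarith
    · have b1 := Nat.mul_le_mul_left (r ^ 2) a2
      have b2 : r ^ 2 * (7 * r) ≤ r ^ 2 * (8 * (r - z)) := Nat.mul_le_mul_left _ (by omega)
      have b3 : r ^ 3 = r ^ 2 * r := by ring
      rw [← hy] at b1
      generalize r - z = w at b1 b2
      linarith [Nat.zero_le (r ^ 2)]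

end RealRAM

namespace RealRAM
variable {k np : ℕ}

/-! ### Connected components in linear time -/

/-- The source of half-edge `h`; the edge `e` consists of the half-edges `2 * e` and `2 * e + 1`. -/
def hsrc (a b : ℕ → ℕ) (h : ℕ) : ℕ := if h % 2 = 0 then a (h / 2) else b (h / 2)

/-- The pointer `q` (where `0` is the null pointer and `h + 1` points to `h`) points to the last
active half-edge with source `v` among the half-edges below `B`. -/
def PrevPtr (A : ℕ → Prop) (s : ℕ → ℕ) (q v B : ℕ) : Prop :=
  (q = 0 ∧ ∀ h < B, A h → s h ≠ v) ∨
    (0 < q ∧ q ≤ B ∧ A (q - 1) ∧ s (q - 1) = v ∧ ∀ h, q ≤ h → h < B → A h → s h ≠ v)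

theorem PrevPtr.skip {A : ℕ → Prop} {s : ℕ → ℕ} {q v B : ℕ} (h : PrevPtr A s q v B)
    (hB : A B → s B ≠ v) : PrevPtr A s q v (B + 1) := by
  rcases h with ⟨h1, h2⟩ | ⟨h1, h2, h3, h4, h5⟩
  · refine Or.inl ⟨h1, fun h hh ha => ?_⟩
    rcases Nat.lt_succ_iff_lt_or_eq.1 hh with h' | rfl
    · exact h2 h h' ha
    · exact hB ha
  · refine Or.inr ⟨h1, by omega, h3, h4, fun h hq hh ha => ?_⟩
    rcases Nat.lt_succ_iff_lt_or_eq.1 hh with h' | rfl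
    · exact h5 h hq h' ha
    · exact hB ha

theorem prevPtr_self {A : ℕ → Prop} {s : ℕ → ℕ} {B : ℕ} (hB : A B) :
    PrevPtr A s (B + 1) (s B) (B + 1) :=
  Or.inr ⟨by omega, le_rfl, hB, rfl, fun h h1 h2 => by omega⟩

/-- The arrays `head` and `nxt` hold the adjacency lists for the active half-edges below `B`. -/
structure AdjLists (V B : ℕ) (A : ℕ → Prop) (s t head nxt tgt : ℕ → ℕ) : Prop where
  head : ∀ v < V, PrevPtr A s (head v) v B
  nxt : ∀ h < B, A h → PrevPtr A s (nxt h) (s h) h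
  tgt : ∀ h < B, A h → tgt h = t h

theorem AdjLists.skip {V B : ℕ} {A : ℕ → Prop} {s t head nxt tgt : ℕ → ℕ}
    (h : AdjLists V B A s t head nxt tgt) (hB : ¬ A B) : AdjLists V (B + 1) A s t head nxt tgt where
  head v hv := (h.head v hv).skip fun ha => (hB ha).elim
  nxt e he ha := h.nxt e (lt_of_le_of_ne (by omega) (by rintro rfl; exact hB ha)) ha
  tgt e he ha := h.tgt e (lt_of_le_of_ne (by omega) (by rintro rfl; exact hB ha)) ha

theorem AdjLists.push {V B : ℕ} {A : ℕ → Prop} {s t head nxt tgt : ℕ → ℕ}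
    (h : AdjLists V B A s t head nxt tgt) (hB : A B) (hs : s B < V) :
    AdjLists V (B + 1) A s t (Function.update head (s B) (B + 1))
      (Function.update nxt B (head (s B))) (Function.update tgt B (t B)) where
  head v hv := by
    by_cases hc : v = s B
    · subst hc
      rw [Function.update_self]
      exact prevPtr_self hB
    · rw [Function.update_of_ne hc]
      exact (h.head v hv).skip fun _ he => hc he.symm
  nxt e he ha := by
    by_cases hc : e = B
    · subst hc
      rw [Function.update_self]
      exact h.head _ hs
    · rw [Function.update_of_ne hc]
      exact h.nxt e (by omega) ha
  tgt e he ha := by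
    by_cases hc : e = B
    · subst hc
      rw [Function.update_self]
    · rw [Function.update_of_ne hc]
      exact h.tgt e (by omega) ha

/-- Insert a half-edge with index `i` from `u` to `w` into the adjacency lists. -/
def pushHalf (i u w : NE k) : HP k np :=
  putA .tgt i w ;; putA .nxt i (ar .head u) ;; putA .head u (.add i (.lit 1))

/-- Build the adjacency lists of the graph of the active edges. -/
def buildLists : HP k np :=
  forLoop .z .nV (putA .head (vr .z) (.lit 0)) ;;
    forLoop .e .nM (.cond (.eq (ar .act (vr .e)) (.lit 1))
      (pushHalf (.smul 2 (vr .e)) (ar .eu (vr .e)) (ar .ev (vr .e)) ;;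
        pushHalf (.add (.smul 2 (vr .e)) (.lit 1)) (ar .ev (vr .e)) (ar .eu (vr .e))) .skip)

/-- The half-edge `i` belongs to an active edge. -/
def ActiveHalf (act : ℕ → ℕ) (i : ℕ) : Prop := act (i / 2) = 1

theorem hsrc_even (a b : ℕ → ℕ) (e : ℕ) : hsrc a b (2 * e) = a e := by
  simp [hsrc]

theorem hsrc_odd (a b : ℕ → ℕ) (e : ℕ) : hsrc a b (2 * e + 1) = b e := by
  have h1 : (2 * e + 1) % 2 = 1 := by omega
  have h2 : (2 * e + 1) / 2 = e := by omega
  simp [hsrc, h1, h2]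

theorem activeHalf_even (act : ℕ → ℕ) (e : ℕ) : ActiveHalf act (2 * e) ↔ act e = 1 := by
  simp [ActiveHalf]

theorem activeHalf_odd (act : ℕ → ℕ) (e : ℕ) : ActiveHalf act (2 * e + 1) ↔ act e = 1 := by
  have h2 : (2 * e + 1) / 2 = e := by omega
  simp [ActiveHalf, h2]

theorem runs_buildLists (h : HS k np) (V M : ℕ) (hV : h.n (.sc .nV) 0 = V)
    (hM : h.n (.sc .nM) 0 = M)
    (hE : ∀ e < M, h.n (.sc .act) e = 1 → h.n (.sc .eu) e < V ∧ h.n (.sc .ev) e < V) :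
    Runs buildLists h (3 * V + 9 * M + 4) fun h' =>
      AdjLists V (2 * M) (ActiveHalf (h.n (.sc .act))) (hsrc (h.n (.sc .eu)) (h.n (.sc .ev)))
        (hsrc (h.n (.sc .ev)) (h.n (.sc .eu))) (h'.n (.sc .head)) (h'.n (.sc .nxt))
        (h'.n (.sc .tgt)) := by
  refine Runs.seq' (V * 3 + 2) (M * 9 + 2) ((Runs.forLoop (by simp) (by simp) (by simp)
    (fun i h' => ∀ v < i, h'.n (.sc .head) v = 0) V 1 hV (by simp) ?_).frame.mono le_rfl ?_)
    (by omega)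
  · intro i hi h1 hF h1z _ hI
    refine Runs.setN ?_
    intro v hv
    simp only [NE.eval, h1z, HS.setN_n, NC.sc.injEq, reduceCtorEq, false_and, if_false, true_and]
    split_ifs with hc
    · rfl
    · exact hI v (by omega)
  rintro h1 ⟨⟨hz, -⟩, hF1⟩
  have a1 : h1.n (.sc .act) = h.n (.sc .act) := hF1.n _ (by simp [forLoop])
  have a2 : h1.n (.sc .eu) = h.n (.sc .eu) := hF1.n _ (by simp [forLoop])
  have a3 : h1.n (.sc .ev) = h.n (.sc .ev) := hF1.n _ (by simp [forLoop])
  have a4 : h1.n (.sc .nM) 0 = M := by rw [hF1.n _ (by simp [forLoop]), hM]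
  refine (Runs.forLoop (by simp [pushHalf]) (by simp [pushHalf]) (by simp)
    (fun e h' => AdjLists V (2 * e) (ActiveHalf (h.n (.sc .act)))
      (hsrc (h.n (.sc .eu)) (h.n (.sc .ev))) (hsrc (h.n (.sc .ev)) (h.n (.sc .eu)))
      (h'.n (.sc .head)) (h'.n (.sc .nxt)) (h'.n (.sc .tgt))) M 7 a4 ?_ ?_).mono le_rfl
      fun _ hh => hh.1
  · refine ⟨fun v hv => Or.inl ⟨?_, by simp⟩, by simp, by simp⟩
    simp [hz v hv]
  · intro e he h2 hF2 h2e _ hI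
    have b1 : h2.n (.sc .act) = h.n (.sc .act) := by
      rw [hF2.n _ (by simp [forLoop, pushHalf]), a1]
    have b2 : h2.n (.sc .eu) = h.n (.sc .eu) := by
      rw [hF2.n _ (by simp [forLoop, pushHalf]), a2]
    have b3 : h2.n (.sc .ev) = h.n (.sc .ev) := by
      rw [hF2.n _ (by simp [forLoop, pushHalf]), a3]
    refine Runs.cond (T := 6) (fun hc => ?_) (fun hc => ?_)
    · simp only [BE.holds, NE.eval, h2e, b1] at hc
      obtain ⟨hu, hv⟩ := hE e he hc
      have p1 := hI.push ((activeHalf_even _ _).2 hc) (by rwa [hsrc_even])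
      have p2 := p1.push ((activeHalf_odd _ _).2 hc) (by rwa [hsrc_odd])
      rw [hsrc_even, hsrc_even, hsrc_odd, hsrc_odd] at p2
      refine (Runs.sl (by simp [pushHalf]) ?_).mono (by simp [pushHalf]) fun _ => id
      convert p2 using 1
      · rfl
      · funext v
        simp only [pushHalf, HP.sl, NE.eval, NE.eval_smul, HS.setN_n, NC.sc.injEq, reduceCtorEq,
          false_and, if_false, true_and, h2e, b2, b3, Function.update_apply]
      · funext v
        simp only [pushHalf, HP.sl, NE.eval, NE.eval_smul, HS.setN_n, NC.sc.injEq, reduceCtorEq,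
          false_and, if_false, true_and, h2e, b2, b3, Function.update_apply]
      · funext v
        simp only [pushHalf, HP.sl, NE.eval, NE.eval_smul, HS.setN_n, NC.sc.injEq, reduceCtorEq,
          false_and, if_false, true_and, h2e, b2, b3, Function.update_apply]
    · simp only [BE.holds, NE.eval, h2e, b1] at hc
      have p1 := hI.skip (mt (activeHalf_even _ _).1 hc)
      have p2 := p1.skip (mt (activeHalf_odd _ _).1 hc)
      refine (Runs.skip ?_).mono (by omega) fun _ => id
      convert p2 using 1 <;> first | rfl | (funext v; simp)

/-- One graph search that labels all components: `cur` is the next half-edge of the vertex `cv` under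
examination, `qu` is the queue with the vertices from `qh` on still to be examined, and `root` is the
next vertex at which a new component may start. The label of a component is its root plus one,
and `0` means that a vertex has not been reached. -/
def search : HP k np :=
  put .cur (.lit 0) ;; put .qh (.lit 0) ;; put .qt (.lit 0) ;; put .root (.lit 0) ;;
  .loop (.neg (.conj (.eq (vr .cur) (.lit 0))
      (.conj (.neg (.lt (vr .qh) (vr .qt))) (.neg (.lt (vr .root) (vr .nV))))))
    (.cond (.neg (.eq (vr .cur) (.lit 0)))
      (.cond (.eq (ar .lab (ar .tgt (.sub (vr .cur) (.lit 1)))) (.lit 0))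
        (putA .lab (ar .tgt (.sub (vr .cur) (.lit 1))) (vr .cl) ;;
          putA .par (ar .tgt (.sub (vr .cur) (.lit 1))) (vr .cv) ;;
          putA .qu (vr .qt) (ar .tgt (.sub (vr .cur) (.lit 1))) ;;
          put .qt (.add (vr .qt) (.lit 1))) .skip ;;
        put .cur (ar .nxt (.sub (vr .cur) (.lit 1))))
      (.cond (.lt (vr .qh) (vr .qt))
        (put .cv (ar .qu (vr .qh)) ;; put .cl (ar .lab (vr .cv)) ;; put .cur (ar .head (vr .cv)) ;;
          put .qh (.add (vr .qh) (.lit 1)))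
        (.cond (.eq (ar .lab (vr .root)) (.lit 0))
          (putA .lab (vr .root) (.add (vr .root) (.lit 1)) ;; putA .par (vr .root) (vr .root) ;;
            putA .qu (vr .qt) (vr .root) ;; put .qt (.add (vr .qt) (.lit 1))) .skip ;;
          put .root (.add (vr .root) (.lit 1)))))

/-- The adjacency relation of the active half-edges. -/
def HalfAdj (H : ℕ) (A : ℕ → Prop) (s t : ℕ → ℕ) (u v : ℕ) : Prop := ∃ h < H, A h ∧ s h = u ∧ t h = v

/-- The invariant of the graph search: half-edges at examined vertices stay inside one component
(`closed`), and all vertices in the queue belong to the component that is being searched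
(`pending`). -/
structure SearchInv (V H : ℕ) (A : ℕ → Prop) (s t lab par qu : ℕ → ℕ)
    (qh qt cur cv cl root : ℕ) : Prop where
  qh_le : qh ≤ qt
  root_le : root ≤ V
  qu_lt : ∀ i < qt, qu i < V ∧ lab (qu i) ≠ 0
  qu_inj : ∀ i < qt, ∀ j < qt, qu i = qu j → i = j
  qu_surj : ∀ v < V, lab v ≠ 0 → ∃ i < qt, qu i = v
  lab_spec : ∀ v < V, lab v ≠ 0 → lab v ≤ V ∧ Relation.EqvGen (HalfAdj H A s t) v (lab v - 1)
  closed : ∀ h < H, A h → (∃ i < qh, qu i = s h) → (s h = cv ∧ h < cur) ∨ lab (t h) = lab (s h)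
  cur_spec : cur ≠ 0 → 0 < qh ∧ cv = qu (qh - 1) ∧ cl = lab cv ∧ cur ≤ H ∧ A (cur - 1) ∧
    s (cur - 1) = cv
  roots : ∀ v < root, lab v ≠ 0
  parents : ∀ i < qt, lab (qu i) = qu i + 1 ∨ ∃ j < i, HalfAdj H A s t (qu j) (qu i) ∧
    par (qu i) = qu j ∧ lab (qu i) = lab (qu j)
  zero : (root = 0 → qt = 0) ∧ (0 < root → lab 0 = 1)
  pending : (∀ i j, qh ≤ i → i < qt → qh ≤ j → j < qt → lab (qu i) = lab (qu j)) ∧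
    (cur ≠ 0 → ∀ i, qh ≤ i → i < qt → lab (qu i) = cl)

open Classical in
/-- The half-edges that the search has not examined yet. -/
def unscanned (H : ℕ) (s qu : ℕ → ℕ) (qh cur cv : ℕ) : Finset ℕ :=
  (Finset.range H).filter fun h => ¬ ((∃ i < qh, qu i = s h) ∧ ¬ (s h = cv ∧ h < cur))

theorem SearchInv.qt_le {V H : ℕ} {A : ℕ → Prop} {s t lab par qu : ℕ → ℕ}
    {qh qt cur cv cl root : ℕ} (I : SearchInv V H A s t lab par qu qh qt cur cv cl root) :
    qt ≤ V := by
  have := Finset.card_le_card_of_injOn (s := Finset.range qt) (t := Finset.range V) qu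
    (fun i hi => by simpa using (I.qu_lt i (by simpa using hi)).1)
    (fun i hi j hj => I.qu_inj i (by simpa using hi) j (by simpa using hj))
  simpa using this

/-- Reaching a new vertex `w` with label `c`. -/
theorem SearchInv.visit {V H : ℕ} {A : ℕ → Prop} {s t lab par qu : ℕ → ℕ}
    {qh qt cur cv cl root : ℕ} (I : SearchInv V H A s t lab par qu qh qt cur cv cl root)
    {w c p : ℕ} (hw : w < V) (hlw : lab w = 0) (hc : c ≠ 0) (hcV : c ≤ V)
    (hcw : Relation.EqvGen (HalfAdj H A s t) w (c - 1))
    (hp : c = w + 1 ∨ ∃ j < qt, HalfAdj H A s t (qu j) w ∧ p = qu j ∧ c = lab (qu j))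
    (hz : root = 0 → w = 0 ∧ c = 1 ∧ qt = 0) (hpe : (cur ≠ 0 ∧ c = cl) ∨ (cur = 0 ∧ qh = qt))
    (root' : ℕ) (hr' : root' ≤ V) (hr2 : ∀ v, root ≤ v → v < root' → v = w) (hr3 : 0 < root') :
    SearchInv V H A s t (Function.update lab w c) (Function.update par w p)
      (Function.update qu qt w) qh (qt + 1) cur cv cl root' := by
  have hne : ∀ i < qt, qu i ≠ w := fun i hi he => (I.qu_lt i hi).2 (by rw [he, hlw])
  have hqu : ∀ i < qt, Function.update qu qt w i = qu i := fun i hi =>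
    Function.update_of_ne (by omega) _ _
  have hqt : Function.update qu qt w qt = w := Function.update_self _ _ _
  have hlab : ∀ v, lab v ≠ 0 → Function.update lab w c v = lab v := fun v hv =>
    Function.update_of_ne (by rintro rfl; exact hv hlw) _ _
  have hlabw : Function.update lab w c w = c := Function.update_self _ _ _
  have hqh := I.qh_le
  refine ⟨by omega, hr', ?_, ?_, ?_, ?_, ?_, ?_, ?_, ?_, ⟨?_, ?_⟩, ?_, ?_⟩
  · intro i hi
    rcases Nat.lt_succ_iff_lt_or_eq.1 hi with h | rfl
    · rw [hqu i h, hlab _ (I.qu_lt i h).2]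
      exact I.qu_lt i h
    · rw [hqt, hlabw]
      exact ⟨hw, hc⟩
  · intro i hi j hj hij
    rcases Nat.lt_succ_iff_lt_or_eq.1 hi with h | rfl <;>
      rcases Nat.lt_succ_iff_lt_or_eq.1 hj with h' | rfl
    · rw [hqu i h, hqu j h'] at hij
      exact I.qu_inj i h j h' hij
    · rw [hqu i h, hqt] at hij
      exact (hne i h hij).elim
    · rw [hqu j h', hqt] at hij
      exact (hne j h' hij.symm).elim
    · rfl
  · intro v hv hl
    by_cases hvw : v = w
    · exact ⟨qt, by omega, by rw [hqt, hvw]⟩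
    · rw [Function.update_of_ne hvw] at hl
      obtain ⟨i, hi, rfl⟩ := I.qu_surj v hv hl
      exact ⟨i, by omega, hqu i hi⟩
  · intro v hv hl
    by_cases hvw : v = w
    · rw [hvw, hlabw]
      exact ⟨hcV, hcw⟩
    · rw [Function.update_of_ne hvw] at hl ⊢
      exact I.lab_spec v hv hl
  · rintro h hh ha ⟨i, hi, hs⟩
    rw [hqu i (by omega)] at hs
    rcases I.closed h hh ha ⟨i, hi, hs⟩ with h1 | h1
    · exact Or.inl h1
    · right
      have hls : lab (s h) ≠ 0 := by rw [← hs]; exact (I.qu_lt i (by omega)).2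
      rw [hlab _ hls, hlab _ (by rwa [h1]), h1]
  · intro hcur
    obtain ⟨h1, h2, h3, h4⟩ := I.cur_spec hcur
    refine ⟨h1, ?_, ?_, h4⟩
    · rw [hqu _ (by omega), h2]
    · rw [hlab _ (by rw [h2]; exact (I.qu_lt _ (by omega)).2), h3]
  · intro v hv
    by_cases hvr : v < root
    · rw [hlab v (I.roots v hvr)]
      exact I.roots v hvr
    · rw [hr2 v (by omega) hv, hlabw]
      exact hc
  · intro i hi
    rcases Nat.lt_succ_iff_lt_or_eq.1 hi with h | rfl
    · rw [hqu i h, hlab _ (I.qu_lt i h).2]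
      rcases I.parents i h with h1 | ⟨j, hj, h1, h2, h3⟩
      · exact Or.inl h1
      · refine Or.inr ⟨j, hj, ?_⟩
        rw [hqu j (by omega), hlab _ (I.qu_lt j (by omega)).2, Function.update_of_ne (hne i h)]
        exact ⟨h1, h2, h3⟩
    · rw [hqt, hlabw]
      rcases hp with h1 | ⟨j, hj, h1, h2, h3⟩
      · exact Or.inl h1
      · refine Or.inr ⟨j, hj, ?_⟩
        rw [hqu j (by omega), hlab _ (I.qu_lt j (by omega)).2, Function.update_self]
        exact ⟨h1, h2, h3⟩
  · intro h
    omega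
  · intro _
    rcases Nat.eq_zero_or_pos root with h0 | h0
    · obtain ⟨rfl, rfl, -⟩ := hz h0
      exact hlabw
    · have := I.zero.2 h0
      rw [hlab 0 (by omega), this]
  · intro i j hi hi' hj hj'
    have key : ∀ i, qh ≤ i → i < qt + 1 → Function.update lab w c (Function.update qu qt w i) = c := by
      intro i hi hi'
      rcases Nat.lt_succ_iff_lt_or_eq.1 hi' with h | rfl
      · rcases hpe with ⟨h1, h2⟩ | ⟨h1, h2⟩
        · rw [hqu i h, hlab _ (I.qu_lt i h).2, h2]
          exact I.pending.2 h1 i hi h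
        · omega
      · rw [hqt, hlabw]
    rw [key i hi hi', key j hj hj']
  · intro hcur i hi hi'
    rcases Nat.lt_succ_iff_lt_or_eq.1 hi' with h | rfl
    · rw [hqu i h, hlab _ (I.qu_lt i h).2]
      exact I.pending.2 hcur i hi h
    · rw [hqt, hlabw]
      rcases hpe with ⟨h1, h2⟩ | ⟨h1, h2⟩
      · exact h2
      · exact (hcur h1).elim

/-- Moving on to the next half-edge of the vertex under examination. -/
theorem SearchInv.advance {V H : ℕ} {A : ℕ → Prop} {s t lab par qu : ℕ → ℕ}
    {qh qt cur cv cl root : ℕ} (I : SearchInv V H A s t lab par qu qh qt cur cv cl root)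
    (hcur : cur ≠ 0) {q : ℕ} (hq : PrevPtr A s q cv (cur - 1))
    (hl : lab (t (cur - 1)) = cl) :
    SearchInv V H A s t lab par qu qh qt q cv cl root := by
  obtain ⟨h1, h2, h3, h4, h5, h6⟩ := I.cur_spec hcur
  refine ⟨I.qh_le, I.root_le, I.qu_lt, I.qu_inj, I.qu_surj, I.lab_spec, ?_, ?_, I.roots,
    I.parents, I.zero, I.pending.1, fun _ => I.pending.2 hcur⟩
  · intro h hh ha hi
    rcases I.closed h hh ha hi with ⟨h7, h8⟩ | h7
    · rcases Nat.lt_or_ge h q with hhq | hhq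
      · exact Or.inl ⟨h7, hhq⟩
      · right
        have : h = cur - 1 := by
          by_contra hne
          rcases hq with ⟨hq0, hq1⟩ | ⟨hq0, hq1, hq2, hq3, hq4⟩
          · exact hq1 h (by omega) ha h7
          · exact hq4 h hhq (by omega) ha h7
        rw [this, hl, h6, h3]
    · exact Or.inr h7
  · intro hq0
    rcases hq with ⟨hq1, -⟩ | ⟨hq1, hq2, hq3, hq4, -⟩
    · exact (hq0 hq1).elim
    · exact ⟨h1, h2, h3, by omega, hq3, hq4⟩

/-- Taking the next vertex from the queue. -/
theorem SearchInv.pop {V H : ℕ} {A : ℕ → Prop} {s t lab par qu : ℕ → ℕ}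
    {qh qt cv cl root : ℕ} (I : SearchInv V H A s t lab par qu qh qt 0 cv cl root)
    (hlt : qh < qt) {q : ℕ} (hq : PrevPtr A s q (qu qh) H) :
    SearchInv V H A s t lab par qu (qh + 1) qt q (qu qh) (lab (qu qh)) root := by
  refine ⟨hlt, I.root_le, I.qu_lt, I.qu_inj, I.qu_surj, I.lab_spec, ?_, ?_, I.roots,
    I.parents, I.zero, fun i j hi hi' hj => I.pending.1 i j (by omega) hi' (by omega),
    fun _ i hi hi' => I.pending.1 i qh (by omega) hi' le_rfl hlt⟩
  · rintro h hh ha ⟨i, hi, hs⟩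
    rcases Nat.lt_succ_iff_lt_or_eq.1 hi with h' | rfl
    · rcases I.closed h hh ha ⟨i, h', hs⟩ with ⟨_, h7⟩ | h7
      · omega
      · exact Or.inr h7
    · rcases Nat.lt_or_ge h q with hhq | hhq
      · exact Or.inl ⟨hs.symm, hhq⟩
      · rcases hq with ⟨_, hq1⟩ | ⟨_, _, _, _, hq4⟩
        · exact (hq1 h hh ha hs.symm).elim
        · exact (hq4 h hhq hh ha hs.symm).elim
  · intro hq0
    rcases hq with ⟨hq1, -⟩ | ⟨hq1, hq2, hq3, hq4, -⟩
    · exact (hq0 hq1).elim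
    · exact ⟨by omega, by simp, rfl, hq2, hq3, hq4⟩

/-- Passing a vertex that has been reached already. -/
theorem SearchInv.nextRoot {V H : ℕ} {A : ℕ → Prop} {s t lab par qu : ℕ → ℕ}
    {qh qt cur cv cl root : ℕ} (I : SearchInv V H A s t lab par qu qh qt cur cv cl root)
    (hr : root < V) (hl : lab root ≠ 0) :
    SearchInv V H A s t lab par qu qh qt cur cv cl (root + 1) := by
  refine ⟨I.qh_le, hr, I.qu_lt, I.qu_inj, I.qu_surj, I.lab_spec, I.closed, I.cur_spec, ?_,
    I.parents, ⟨by omega, fun _ => ?_⟩, I.pending⟩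
  · intro v hv
    rcases Nat.lt_succ_iff_lt_or_eq.1 hv with h | rfl
    · exact I.roots v h
    · exact hl
  · rcases Nat.eq_zero_or_pos root with rfl | h0
    · obtain ⟨i, hi, _⟩ := I.qu_surj 0 hr hl
      have := I.zero.1 rfl
      omega
    · exact I.zero.2 h0

/-- A vertex that is adjacent to the one under examination and has been reached already belongs to
the same component. -/
theorem SearchInv.lab_eq {V H : ℕ} {A : ℕ → Prop} {s t lab par qu : ℕ → ℕ}
    {qh qt cur cv cl root : ℕ} (I : SearchInv V H A s t lab par qu qh qt cur cv cl root)
    (hsym : ∀ h < H, A h → HalfAdj H A s t (t h) (s h)) (hcur : cur ≠ 0)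
    (hw : t (cur - 1) < V) (hl : lab (t (cur - 1)) ≠ 0) : lab (t (cur - 1)) = cl := by
  obtain ⟨h1, h2, h3, h4, h5, h6⟩ := I.cur_spec hcur
  obtain ⟨i, hi, hiw⟩ := I.qu_surj _ hw hl
  rcases Nat.lt_or_ge i qh with hq | hq
  · obtain ⟨h', hh', ha', hs', ht'⟩ := hsym (cur - 1) (by omega) h5
    rcases I.closed h' hh' ha' ⟨i, hq, by rw [hs', hiw]⟩ with ⟨h7, -⟩ | h7
    · rw [← hs', h7, h3]
    · rw [← hs', ← h7, ht', h6, h3]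
  · rw [← hiw]
    exact I.pending.2 hcur i hq hi

theorem card_unscanned_advance {H : ℕ} {s qu : ℕ → ℕ} {qh cur cv q : ℕ}
    (hcH : cur ≤ H) (hs : s (cur - 1) = cv) (hqh : 0 < qh) (hcv : cv = qu (qh - 1))
    (hq : q < cur) :
    (unscanned H s qu qh q cv).card + 1 ≤ (unscanned H s qu qh cur cv).card := by
  classical
  apply Nat.succ_le_of_lt
  apply Finset.card_lt_card
  refine ⟨fun h hh => ?_, fun hsub => ?_⟩
  · simp only [unscanned, Finset.mem_filter, Finset.mem_range] at hh ⊢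
    refine ⟨hh.1, fun hx => hh.2 ⟨hx.1, fun hy => hx.2 ⟨hy.1, by omega⟩⟩⟩
  · have hm : cur - 1 ∈ unscanned H s qu qh cur cv := by
      simp only [unscanned, Finset.mem_filter, Finset.mem_range]
      exact ⟨by omega, fun hx => hx.2 ⟨hs, by omega⟩⟩
    have := hsub hm
    simp only [unscanned, Finset.mem_filter, Finset.mem_range] at this
    exact this.2 ⟨⟨qh - 1, by omega, by rw [hs, hcv]⟩, fun hx => by omega⟩

theorem unscanned_congr {H : ℕ} {s qu qu' : ℕ → ℕ} {qh cur cv : ℕ}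
    (h : ∀ i < qh, qu' i = qu i) :
    unscanned H s qu' qh cur cv = unscanned H s qu qh cur cv := by
  classical
  apply Finset.filter_congr
  intro e _
  have : (∃ i < qh, qu' i = s e) ↔ ∃ i < qh, qu i = s e :=
    ⟨fun ⟨i, hi, he⟩ => ⟨i, hi, by rw [← h i hi, he]⟩, fun ⟨i, hi, he⟩ => ⟨i, hi, by rw [h i hi, he]⟩⟩
  rw [this]

theorem card_unscanned_pop {H : ℕ} {s qu : ℕ → ℕ} {qh cv q qt : ℕ} (hlt : qh < qt)
    (hinj : ∀ i < qt, ∀ j < qt, qu i = qu j → i = j) :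
    (unscanned H s qu (qh + 1) q (qu qh)).card ≤ (unscanned H s qu qh 0 cv).card := by
  classical
  apply Finset.card_le_card
  intro h hh
  simp only [unscanned, Finset.mem_filter, Finset.mem_range] at hh ⊢
  refine ⟨hh.1, ?_⟩
  rintro ⟨⟨i, hi, he⟩, -⟩
  refine hh.2 ⟨⟨i, by omega, he⟩, fun hx => ?_⟩
  have := hinj i (by omega) qh hlt (by rw [he, hx.1])
  omega

/-- Every round reaches a new root, takes a vertex from the queue, or examines a half-edge, so the
numbers of roots, vertices and half-edges that are left form a potential. -/
theorem runs_search (h : HS k np) (V H : ℕ) (A : ℕ → Prop) (s t : ℕ → ℕ)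
    (hV : h.n (.sc .nV) 0 = V)
    (hadj : AdjLists V H A s t (h.n (.sc .head)) (h.n (.sc .nxt)) (h.n (.sc .tgt)))
    (ht : ∀ i < H, A i → t i < V) (hsym : ∀ i < H, A i → HalfAdj H A s t (t i) (s i))
    (hlab : ∀ v < V, h.n (.sc .lab) v = 0) :
    Runs search h (9 * (2 * V + H) + 5) fun h' => ∃ cv cl, SearchInv V H A s t (h'.n (.sc .lab))
      (h'.n (.sc .par)) (h'.n (.sc .qu)) V V 0 cv cl V := by
  refine Runs.seq' 1 (9 * (2 * V + H) + 4) (Runs.setN ?_) (by omega)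
  refine Runs.seq' 1 (9 * (2 * V + H) + 3) (Runs.setN ?_) (by omega)
  refine Runs.seq' 1 (9 * (2 * V + H) + 2) (Runs.setN ?_) (by omega)
  refine Runs.seq' 1 (9 * (2 * V + H) + 1) (Runs.setN ?_) (by omega)
  simp only [NE.eval]
  set h₁ := (((h.setN (.sc .cur) 0 0).setN (.sc .qh) 0 0).setN (.sc .qt) 0 0).setN (.sc .root) 0 0
    with hh1
  have b0 : h₁.n (.sc .nV) 0 = V := by simp [hh1, hV]
  have b1 : h₁.n (.sc .head) = h.n (.sc .head) := by funext v; simp [hh1]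
  have b2 : h₁.n (.sc .nxt) = h.n (.sc .nxt) := by funext v; simp [hh1]
  have b3 : h₁.n (.sc .tgt) = h.n (.sc .tgt) := by funext v; simp [hh1]
  refine (Runs.loop
    (fun h' => SearchInv V H A s t (h'.n (.sc .lab)) (h'.n (.sc .par)) (h'.n (.sc .qu))
      (h'.n (.sc .qh) 0) (h'.n (.sc .qt) 0) (h'.n (.sc .cur) 0) (h'.n (.sc .cv) 0)
      (h'.n (.sc .cl) 0) (h'.n (.sc .root) 0))
    (fun h' => 9 * ((V - h'.n (.sc .root) 0) + (V - h'.n (.sc .qh) 0) +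
      (unscanned H s (h'.n (.sc .qu)) (h'.n (.sc .qh) 0) (h'.n (.sc .cur) 0)
        (h'.n (.sc .cv) 0)).card)) ?_ ?_).frame.mono ?_ ?_
  · simp only [hh1]
    refine ⟨by simp, by simp, by simp, by simp, ?_, ?_, by simp, by simp, by simp, by simp,
      by simp, by simp⟩
    · intro v hv hl
      exact (hl (by simpa using hlab v hv)).elim
    · intro v hv hl
      exact (hl (by simpa using hlab v hv)).elim
  · intro h2 hF I hb
    have e0 : h2.n (.sc .nV) 0 = V := by rw [hF.n _ (by simp), b0]
    have e1 : h2.n (.sc .head) = h.n (.sc .head) := by rw [hF.n _ (by simp), b1]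
    have e2 : h2.n (.sc .nxt) = h.n (.sc .nxt) := by rw [hF.n _ (by simp), b2]
    have e3 : h2.n (.sc .tgt) = h.n (.sc .tgt) := by rw [hF.n _ (by simp), b3]
    have hqtV := I.qt_le
    have hqh := I.qh_le
    simp only [BE.holds, NE.eval, e0] at hb
    set lab := h2.n (.sc .lab) with hlabd
    set par := h2.n (.sc .par) with hpard
    set qu := h2.n (.sc .qu) with hqud
    set qh := h2.n (.sc .qh) 0 with hqhd
    set qt := h2.n (.sc .qt) 0 with hqtd
    set cur := h2.n (.sc .cur) 0 with hcurd
    set cv := h2.n (.sc .cv) 0 with hcvd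
    set cl := h2.n (.sc .cl) 0 with hcld
    set root := h2.n (.sc .root) 0 with hrootd
    refine ⟨8, (Runs.sl (by simp) ?_).mono (by simp) fun _ => id⟩
    by_cases hcur : cur = 0
    · by_cases hq : qh < qt
      · have I' := I
        rw [hcur] at I'
        have hnew := I'.pop hq (hadj.head _ (I.qu_lt qh hq).1)
        have hcard := card_unscanned_pop (H := H) (s := s) (cv := cv)
          (q := h.n (.sc .head) (qu qh)) hq I.qu_inj
        rw [hcur]
        simp only [HP.sl, BE.holds, NE.eval, ← hcurd, hcur, not_true_eq_false, if_false,
          ← hqhd, ← hqtd, hq, if_true]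
        simp only [HS.setN_col, Function.update_self, e1, ← hpard, ← hqud, ← hlabd, ← hqhd, ← hqtd, ← hrootd, NC.sc.injEq,
          reduceCtorEq, if_false, if_true]
        refine ⟨hnew, ?_⟩
        omega
      · have hroot : root < V := by
          by_contra hr
          exact hb ⟨hcur, hq, hr⟩
        have hqq : qh = qt := by omega
        simp only [HP.sl, BE.holds, NE.eval, ← hcurd, hcur, not_true_eq_false, if_false,
          ← hqhd, ← hqtd, hq, ← hlabd, ← hrootd]
        by_cases hl : lab root = 0
        · have hnew := I.visit hroot hl (c := root + 1) (p := root) (by omega) (by omega)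
            (by simpa using Relation.EqvGen.refl _) (Or.inl rfl)
            (fun h0 => ⟨h0, by omega, I.zero.1 h0⟩) (Or.inr ⟨hcur, hqq⟩) (root + 1) hroot
            (fun v h1 h2 => by omega) (by omega)
          simp only [hl, if_true, HS.setN_col, Function.update_self, ← hqud, ← hlabd, ← hqhd, ← hqtd, ← hrootd,
            ← hpard, ← hcurd, ← hcvd, ← hcld, NC.sc.injEq,
            reduceCtorEq, if_false]
          refine ⟨?_, ?_⟩
          · exact hnew
          · rw [unscanned_congr (qu := qu) fun i hi => Function.update_of_ne (by omega) _ _, hcur]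
            omega
        · have hnew := I.nextRoot hroot hl
          simp only [hl, if_false, HS.setN_col, Function.update_self, ← hqud, ← hlabd, ← hqhd, ← hqtd, ← hrootd,
            ← hpard, ← hcurd, ← hcvd, ← hcld, NC.sc.injEq,
            reduceCtorEq, if_true]
          exact ⟨hnew, by rw [hcur]; omega⟩
    · obtain ⟨h1, h2', h3, h4, h5, h6⟩ := I.cur_spec hcur
      have hroot : 0 < root := by
        by_contra hr
        have := I.zero.1 (by omega)
        omega
      have htg : h.n (.sc .tgt) (cur - 1) = t (cur - 1) := hadj.tgt _ (by omega) h5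
      have hnx := hadj.nxt (cur - 1) (by omega) h5
      rw [h6] at hnx
      have hlt : h.n (.sc .nxt) (cur - 1) < cur := by
        rcases hnx with ⟨hx, -⟩ | ⟨_, hx, -⟩ <;> omega
      have hcard := card_unscanned_advance (H := H) (s := s) (qu := qu) h4 h6 h1 h2' hlt
      have htV := ht (cur - 1) (by omega) h5
      simp only [HP.sl, BE.holds, NE.eval, ← hcurd, hcur, not_false_eq_true, if_true, e3, htg,
          ← hqhd, ← hqtd, ← hlabd, ← hrootd, ← hcld]
      by_cases hl : lab (t (cur - 1)) = 0
      · have hadj1 : HalfAdj H A s t cv (t (cur - 1)) := ⟨cur - 1, by omega, h5, h6, rfl⟩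
        have hcv := I.qu_lt (qh - 1) (by omega)
        rw [← h2'] at hcv
        have hls := I.lab_spec cv hcv.1 hcv.2
        rw [← h3] at hls
        have hnew := I.visit htV hl (c := cl) (p := cv) (by rw [h3]; exact hcv.2) hls.1
          (Relation.EqvGen.trans _ _ _ (Relation.EqvGen.symm _ _ (Relation.EqvGen.rel _ _ hadj1))
            hls.2)
          (Or.inr ⟨qh - 1, by omega, by rw [← h2']; exact hadj1, h2', by rw [← h2', h3]⟩)
          (fun h0 => by omega) (Or.inl ⟨hcur, rfl⟩) root I.root_le (fun v h1 h2 => by omega) hroot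
        have hnew2 := hnew.advance hcur hnx (Function.update_self _ _ _)
        simp only [hl, if_true, HS.setN_col, Function.update_self, ← hqud, ← hlabd, ← hqhd, ← hqtd, ← hrootd,
            ← hpard, ← hcurd, ← hcvd, ← hcld, NC.sc.injEq, e2, e3, htg,
            reduceCtorEq, if_false]
        refine ⟨?_, ?_⟩
        · exact hnew2
        · rw [unscanned_congr (qu := qu) fun i hi => Function.update_of_ne (by omega) _ _]
          omega
      · have hnew := I.advance hcur hnx (I.lab_eq hsym hcur htV hl)
        simp only [hl, if_false, HS.setN_col, Function.update_self, ← hqud, ← hlabd, ← hqhd, ← hqtd, ← hrootd,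
            ← hpard, ← hcurd, ← hcvd, ← hcld, NC.sc.injEq, e2,
            reduceCtorEq, if_true]
        exact ⟨hnew, by omega⟩
  · have hc : ∀ a b c d, (unscanned H s a b c d).card ≤ H := fun a b c d =>
      (Finset.card_filter_le _ _).trans (by simp)
    have := hc (h₁.n (.sc .qu)) (h₁.n (.sc .qh) 0) (h₁.n (.sc .cur) 0) (h₁.n (.sc .cv) 0)
    omega
  · rintro h2 ⟨⟨I, hb⟩, hF⟩
    have e0 : h2.n (.sc .nV) 0 = V := by rw [hF.n _ (by simp), b0]
    simp only [BE.holds, NE.eval, e0, not_not, not_lt] at hb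
    obtain ⟨c1, c2, c3⟩ := hb
    have r1 : h2.n (.sc .root) 0 = V := le_antisymm I.root_le c3
    have r2 : V ≤ h2.n (.sc .qt) 0 := by
      have := Finset.card_le_card_of_injOn (s := Finset.range V)
        (t := (Finset.range (h2.n (.sc .qt) 0)).image (h2.n (.sc .qu))) id
        (fun v hv => by
          have hv' : v < V := by simpa using hv
          obtain ⟨i, hi, he⟩ := I.qu_surj v hv' (I.roots v (by omega))
          simp only [id, Finset.coe_image, Set.mem_image, Finset.coe_range, Set.mem_Iio]
          exact ⟨i, hi, he⟩) (fun a _ b _ h => h)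
      have := this.trans Finset.card_image_le
      simpa using this
    have r3 := I.qt_le
    have r4 := I.qh_le
    have r5 : h2.n (.sc .qt) 0 = V := by omega
    have r6 : h2.n (.sc .qh) 0 = V := by omega
    rw [r1, r5, r6, c1] at I
    exact ⟨_, _, I⟩

/-- Label the components of the graph that is formed by the active edges. -/
def components : HP k np :=
  forLoop .z .nV (putA .lab (vr .z) (.lit 0)) ;; buildLists ;; search

/-- The adjacency relation of the first `M` edges `a e`, `b e` with property `p`. -/
def EdgeRel (M : ℕ) (p : ℕ → Prop) (a b : ℕ → ℕ) (u v : ℕ) : Prop :=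
  ∃ e < M, p e ∧ a e = u ∧ b e = v

/-- The labels `lab` and parents `par` of a spanning forest of the graph with adjacency relation `R` on
`V` vertices. The parents are acyclic because they come earlier in some order. -/
structure SpanningForest (V : ℕ) (R : ℕ → ℕ → Prop) (lab par : ℕ → ℕ) : Prop where
  lab_iff : ∀ u < V, ∀ v < V, lab u = lab v ↔ Relation.EqvGen R u v
  lab_le : ∀ v < V, 0 < lab v ∧ lab v ≤ V
  lab_zero : 0 < V → lab 0 = 1
  par : ∃ ord : ℕ → ℕ, ∀ v < V, lab v = v + 1 ∨ (par v < V ∧ ord (par v) < ord v ∧ ord v < V ∧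
    lab (par v) = lab v ∧ (R (par v) v ∨ R v (par v)))

/-- The half-edges form the symmetric closure of the edge relation. -/
theorem halfAdj_iff {M : ℕ} {act a b : ℕ → ℕ} {u v : ℕ} :
    HalfAdj (2 * M) (ActiveHalf act) (hsrc a b) (hsrc b a) u v ↔
      EdgeRel M (fun e => act e = 1) a b u v ∨ EdgeRel M (fun e => act e = 1) a b v u := by
  constructor
  · rintro ⟨i, hi, ha, hs, ht⟩
    rcases Nat.mod_two_eq_zero_or_one i with h | h
    · simp only [hsrc, h, if_true] at hs ht
      exact Or.inl ⟨i / 2, by omega, ha, hs, ht⟩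
    · simp only [hsrc, h, one_ne_zero, if_false] at hs ht
      exact Or.inr ⟨i / 2, by omega, ha, ht, hs⟩
  · rintro (⟨e, he, ha, h1, h2⟩ | ⟨e, he, ha, h1, h2⟩)
    · exact ⟨2 * e, by omega, (activeHalf_even _ _).2 ha, by rw [hsrc_even, h1],
        by rw [hsrc_even, h2]⟩
    · exact ⟨2 * e + 1, by omega, (activeHalf_odd _ _).2 ha, by rw [hsrc_odd, h2],
        by rw [hsrc_odd, h1]⟩

/-- Functions on a relation extend to the equivalence relation that it generates. -/
theorem eqvGen_map {α β : Type*} {R : α → α → Prop} {S : β → β → Prop} (f : α → β)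
    (h : ∀ a b, R a b → Relation.EqvGen S (f a) (f b)) {a b : α} (hab : Relation.EqvGen R a b) :
    Relation.EqvGen S (f a) (f b) := by
  induction hab with
  | rel _ _ h' => exact h _ _ h'
  | refl _ => exact Relation.EqvGen.refl _
  | symm _ _ _ ih => exact Relation.EqvGen.symm _ _ ih
  | trans _ _ _ _ _ ih ih' => exact Relation.EqvGen.trans _ _ _ ih ih'

theorem eqvGen_eq_of_forall {α β : Type*} {R : α → α → Prop} (f : α → β)
    (h : ∀ a b, R a b → f a = f b) {a b : α} (hab : Relation.EqvGen R a b) : f a = f b := by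
  induction hab with
  | rel _ _ h' => exact h _ _ h'
  | refl _ => rfl
  | symm _ _ _ ih => exact ih.symm
  | trans _ _ _ _ _ ih ih' => exact ih.trans ih'

theorem runs_components (h : HS k np) (V M : ℕ) (hV : h.n (.sc .nV) 0 = V)
    (hM : h.n (.sc .nM) 0 = M)
    (hE : ∀ e < M, h.n (.sc .act) e = 1 → h.n (.sc .eu) e < V ∧ h.n (.sc .ev) e < V) :
    Runs components h (27 * (V + M) + 11) fun h' =>
      SpanningForest V (EdgeRel M (fun e => h.n (.sc .act) e = 1) (h.n (.sc .eu)) (h.n (.sc .ev)))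
        (h'.n (.sc .lab)) (h'.n (.sc .par)) := by
  refine Runs.seq' (V * 3 + 2) (24 * V + 27 * M + 9) ((Runs.forLoop (by simp) (by simp) (by simp)
    (fun i h' => ∀ v < i, h'.n (.sc .lab) v = 0) V 1 hV (by simp) ?_).frame.mono le_rfl ?_)
    (by omega)
  · intro i hi h1 hF h1z _ hI
    refine Runs.setN ?_
    intro v hv
    simp only [NE.eval, h1z, HS.setN_n, NC.sc.injEq, reduceCtorEq, false_and, if_false, true_and]
    split_ifs with hc
    · rfl
    · exact hI v (by omega)
  rintro h1 ⟨⟨hz, -⟩, hF1⟩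
  have a1 : h1.n (.sc .act) = h.n (.sc .act) := hF1.n _ (by simp [forLoop])
  have a2 : h1.n (.sc .eu) = h.n (.sc .eu) := hF1.n _ (by simp [forLoop])
  have a3 : h1.n (.sc .ev) = h.n (.sc .ev) := hF1.n _ (by simp [forLoop])
  have a4 : h1.n (.sc .nM) 0 = M := by rw [hF1.n _ (by simp [forLoop]), hM]
  have a5 : h1.n (.sc .nV) 0 = V := by rw [hF1.n _ (by simp [forLoop]), hV]
  refine Runs.seq' (3 * V + 9 * M + 4) (9 * (2 * V + 2 * M) + 5)
    ((runs_buildLists h1 V M a5 a4 (by rwa [a1, a2, a3])).frame.mono le_rfl ?_) (by omega)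
  rintro h2 ⟨hadj, hF2⟩
  have b1 : h2.n (.sc .lab) = h1.n (.sc .lab) := hF2.n _ (by simp [forLoop, buildLists, pushHalf])
  have b2 : h2.n (.sc .nV) 0 = V := by
    rw [hF2.n _ (by simp [forLoop, buildLists, pushHalf]), a5]
  rw [a1, a2, a3] at hadj
  set act := h.n (.sc .act) with hact
  set eu := h.n (.sc .eu) with heu
  set ev := h.n (.sc .ev) with hev
  refine (runs_search h2 V (2 * M) _ _ _ b2 hadj ?_ ?_ (by rw [b1]; exact hz)).mono le_rfl ?_
  · intro i hi ha
    have := hE (i / 2) (by omega) ha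
    simp only [hsrc]
    split_ifs
    · exact this.2
    · exact this.1
  · intro i hi ha
    have h1 : HalfAdj (2 * M) (ActiveHalf act) (hsrc eu ev) (hsrc ev eu) (hsrc eu ev i)
      (hsrc ev eu i) := ⟨i, hi, ha, rfl, rfl⟩
    rw [halfAdj_iff] at h1 ⊢
    exact h1.symm
  · rintro h3 ⟨cv, cl, I⟩
    have hrel : ∀ u v, HalfAdj (2 * M) (ActiveHalf act) (hsrc eu ev) (hsrc ev eu) u v →
        Relation.EqvGen (EdgeRel M (fun e => act e = 1) eu ev) u v := by
      intro u v huv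
      rcases halfAdj_iff.1 huv with h | h
      · exact Relation.EqvGen.rel _ _ h
      · exact Relation.EqvGen.symm _ _ (Relation.EqvGen.rel _ _ h)
    have hpop : ∀ v < V, ∃ i < V, h3.n (.sc .qu) i = v := fun v hv =>
      I.qu_surj v hv (I.roots v hv)
    have hlab : ∀ v < V, Relation.EqvGen (EdgeRel M (fun e => act e = 1) eu ev) v
        (h3.n (.sc .lab) v - 1) := fun v hv =>
      eqvGen_map id (fun a b hab => hrel a b hab) (I.lab_spec v hv (I.roots v hv)).2
    have hedge : ∀ u v, EdgeRel M (fun e => act e = 1) eu ev u v →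
        h3.n (.sc .lab) u = h3.n (.sc .lab) v := by
      intro u v huv
      obtain ⟨i, hi, ha, hs, ht⟩ := halfAdj_iff.2 (Or.inl huv)
      have huV : u < V := by
        obtain ⟨e, he, hae, h1, h2⟩ := huv
        rw [← h1]
        exact (hE e he hae).1
      rcases I.closed i hi ha (by rw [hs]; exact hpop u huV) with ⟨-, h1⟩ | h1
      · omega
      · rw [← hs, ← ht, h1]
    refine ⟨?_, ?_, ?_, ?_⟩
    · intro u hu v hv
      constructor
      · intro he
        have h1 := hlab u hu
        rw [he] at h1
        exact Relation.EqvGen.trans _ _ _ h1 (Relation.EqvGen.symm _ _ (hlab v hv))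
      · exact eqvGen_eq_of_forall _ hedge
    · intro v hv
      exact ⟨Nat.pos_of_ne_zero (I.roots v hv), (I.lab_spec v hv (I.roots v hv)).1⟩
    · exact I.zero.2
    · choose! ord hord hqu using hpop
      refine ⟨ord, fun v hv => ?_⟩
      have hv' := hqu v hv
      rcases I.parents (ord v) (hord v hv) with h1 | ⟨j, hj, h1, h2, h3'⟩
      · rw [hv'] at h1
        exact Or.inl h1
      · right
        rw [hv'] at h1 h2 h3'
        have hjV : j < V := hj.trans (hord v hv)
        have hp := (I.qu_lt j hjV).1
        rw [← h2] at hp h1 h3'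
        have hoj : ord (h3.n (.sc .par) v) = j :=
          I.qu_inj _ (hord _ hp) j hjV (by rw [hqu _ hp, h2])
        exact ⟨hp, by omega, hord v hv, h3'.symm, halfAdj_iff.1 h1⟩

end RealRAM

namespace RealRAM
variable {k np : ℕ}

/-! ### Bottleneck connectivity in linear time -/

/-- The vertices `s` and `t` are connected by edges whose weights satisfy `q`. -/
def Conn (M : ℕ) (q : ℝ → Prop) (a b : ℕ → ℕ) (w : ℕ → ℝ) (s t : ℕ) : Prop :=
  Relation.EqvGen (EdgeRel M (fun e => q (w e)) a b) s t

theorem Conn.mono {M : ℕ} {q q' : ℝ → Prop} {a b : ℕ → ℕ} {w : ℕ → ℝ} {s t : ℕ}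
    (hq : ∀ x, q x → q' x) (h : Conn M q a b w s t) : Conn M q' a b w s t :=
  eqvGen_map id (fun _ _ ⟨e, he, h1, h2⟩ => Relation.EqvGen.rel _ _ ⟨e, he, hq _ h1, h2⟩) h

/-- Mark the edges that satisfy a test. -/
def mark (b : BE k np) : HP k np :=
  forLoop .e .nM (.cond b (putA .act (vr .e) (.lit 1)) (putA .act (vr .e) (.lit 0)))

/-- The current edge is lighter than the pivot. -/
def ltPivot : BE k np := .rlt .ew (vr .e) .piv (.lit 0)

/-- The current edge is not heavier than the pivot. -/
def lePivot : BE k np := .neg (.rlt .piv (.lit 0) .ew (vr .e))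

open Classical in
theorem runs_mark (h : HS k np) (b : BE k np) (p : ℕ → Prop) (M : ℕ) (hM : h.n (.sc .nM) 0 = M)
    (hb : ∀ e < M, ∀ h', Frame (mark b) h h' → h'.n (.sc .e) 0 = e → (b.holds h' ↔ p e)) :
    Runs (mark b) h (4 * M + 2) fun h' =>
      ∀ e < M, h'.n (.sc .act) e = if p e then 1 else 0 := by
  refine (Runs.forLoop (by simp) (by simp) (by simp) (fun i h' => ∀ e < i, h'.n (.sc .act) e =
    if p e then 1 else 0) M 2 hM (by simp) ?_).mono (by omega) fun _ hh => hh.1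
  intro i hi h1 hF h1e _ hI
  have hb1 := hb i hi h1 hF h1e
  refine (Runs.sl (by simp) ?_).mono (by simp) fun _ => id
  simp only [HP.sl, hb1, NE.eval, h1e]
  intro e he
  by_cases hp : p i
  · simp only [hp, if_true, HS.setN_n, NC.sc.injEq, reduceCtorEq, false_and, if_false, true_and]
    by_cases hc : e = i
    · simp [hc, hp]
    · simp only [hc, if_false]
      exact hI e (by omega)
  · simp only [hp, if_false, HS.setN_n, NC.sc.injEq, reduceCtorEq, false_and, true_and]
    by_cases hc : e = i
    · simp [hc, hp]
    · simp only [hc, if_false]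
      exact hI e (by omega)

/-- Assign the next free number to the label `c` unless it has a number. -/
def newId (c : NE k) : HP k np :=
  .cond (.eq (ar .nid c) (.lit 0))
    (put .acc (.add (vr .acc) (.lit 1)) ;; putA .nid c (vr .acc)) .skip

/-- The numbers of the labels `1, …, V` that have one are different, and at most `acc`. -/
structure Numbering (V : ℕ) (nid : ℕ → ℕ) (acc : ℕ) : Prop where
  le : ∀ c, 1 ≤ c → c ≤ V → nid c ≤ acc
  inj : ∀ c, 1 ≤ c → c ≤ V → ∀ c', 1 ≤ c' → c' ≤ V → nid c ≠ 0 → nid c = nid c' → c = c'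

theorem runs_newId (h : HS k np) {c : NE k} {c₀ V : ℕ} (hc : c.eval h = c₀)
    (hc' : c.eval (h.setN (.sc .acc) 0 (h.n (.sc .acc) 0 + 1)) = c₀) (h1 : 1 ≤ c₀) (hV : c₀ ≤ V)
    (hN : Numbering V (h.n (.sc .nid)) (h.n (.sc .acc) 0)) :
    Runs (newId c) h 3 fun h' => Numbering V (h'.n (.sc .nid)) (h'.n (.sc .acc) 0) ∧
      (∀ c, h.n (.sc .nid) c ≠ 0 → h'.n (.sc .nid) c = h.n (.sc .nid) c) ∧
      h'.n (.sc .nid) c₀ ≠ 0 ∧ h'.n (.sc .acc) 0 ≤ h.n (.sc .acc) 0 + 1 := by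
  refine (Runs.sl (by simp [newId]) ?_).mono (by simp [newId]) fun _ => id
  by_cases hz : h.n (.sc .nid) c₀ = 0
  · simp only [newId, HP.sl, BE.holds, NE.eval, hc, hc', hz, if_true, HS.setN_col, NC.sc.injEq,
      reduceCtorEq, if_false, Function.update_self]
    refine ⟨⟨?_, ?_⟩, ?_, by simp, by simp⟩
    · intro c a1 a2
      by_cases he : c = c₀
      · simp [he]
      · rw [Function.update_of_ne he]
        exact (hN.le c a1 a2).trans (Nat.le_succ _)
    · intro c a1 a2 c' a3 a4 hne heq
      have b1 := hN.le c a1 a2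
      have b2 := hN.le c' a3 a4
      by_cases he : c = c₀ <;> by_cases he' : c' = c₀
      · rw [he, he']
      · rw [he, Function.update_self, Function.update_of_ne he'] at heq
        omega
      · rw [he', Function.update_self, Function.update_of_ne he] at heq
        omega
      · rw [Function.update_of_ne he] at heq hne
        rw [Function.update_of_ne he'] at heq
        exact hN.inj c a1 a2 c' a3 a4 hne heq
    · intro c hc0
      rw [Function.update_of_ne (by rintro rfl; exact hc0 hz)]
  · simp only [newId, HP.sl, BE.holds, NE.eval, hc, hz, if_false]
    exact ⟨hN, by simp, hz, Nat.le_succ _⟩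

/-- Keep only the edges with mark `kp`, replace all vertices by the numbers of their labels, and
number only the labels that occur. -/
def contract : HP k np :=
  forLoop .z .nV (putA .nid (.add (vr .z) (.lit 1)) (.lit 0)) ;;
  put .acc (.lit 0) ;; put .mm (.lit 0) ;;
  newId (ar .lab (vr .src)) ;; newId (ar .lab (vr .tgtv)) ;;
  put .src (.sub (ar .nid (ar .lab (vr .src))) (.lit 1)) ;;
  put .tgtv (.sub (ar .nid (ar .lab (vr .tgtv))) (.lit 1)) ;;
  forLoop .e .nM (.cond (.eq (ar .act (vr .e)) (vr .kp))
    (newId (ar .lab (ar .eu (vr .e))) ;; newId (ar .lab (ar .ev (vr .e))) ;;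
      putA .eu (vr .mm) (.sub (ar .nid (ar .lab (ar .eu (vr .e)))) (.lit 1)) ;;
      putA .ev (vr .mm) (.sub (ar .nid (ar .lab (ar .ev (vr .e)))) (.lit 1)) ;;
      .cpR .ew (vr .mm) .ew (vr .e) ;; put .mm (.add (vr .mm) (.lit 1))) .skip) ;;
  put .nM (vr .mm) ;; put .nV (vr .acc)

/-- The state of the contraction after `i` edges of the graph `a`, `b`, `w` with labels `lab`. -/
structure ContractInv (V i mm acc : ℕ) (keep : ℕ → Prop) (lab nid a b a' b' : ℕ → ℕ)
    (w w' : ℕ → ℝ) : Prop where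
  mm_le : mm ≤ i
  acc_le : acc ≤ 2 * mm + 2
  num : Numbering V nid acc
  rest : ∀ j, mm ≤ j → a' j = a j ∧ b' j = b j ∧ w' j = w j
  ofKept : ∀ e < i, keep e → ∃ e' < mm, nid (lab (a e)) ≠ 0 ∧ nid (lab (b e)) ≠ 0 ∧
    a' e' + 1 = nid (lab (a e)) ∧ b' e' + 1 = nid (lab (b e)) ∧ w' e' = w e
  toKept : ∀ e' < mm, ∃ e < i, keep e ∧ nid (lab (a e)) ≠ 0 ∧ nid (lab (b e)) ≠ 0 ∧
    a' e' + 1 = nid (lab (a e)) ∧ b' e' + 1 = nid (lab (b e)) ∧ w' e' = w e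
  card : ∃ S : Finset ℕ, S.card = mm ∧ ∀ e, e ∈ S ↔ e < i ∧ keep e

theorem ContractInv.skip {V i mm acc : ℕ} {keep : ℕ → Prop} {lab nid a b a' b' : ℕ → ℕ}
    {w w' : ℕ → ℝ} (I : ContractInv V i mm acc keep lab nid a b a' b' w w') (hk : ¬ keep i) :
    ContractInv V (i + 1) mm acc keep lab nid a b a' b' w w' := by
  refine ⟨by have := I.mm_le; omega, I.acc_le, I.num, I.rest, ?_, ?_, ?_⟩
  · intro e he hke
    exact I.ofKept e (lt_of_le_of_ne (by omega) (by rintro rfl; exact hk hke)) hke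
  · intro e' he'
    obtain ⟨e, he, h⟩ := I.toKept e' he'
    exact ⟨e, by omega, h⟩
  · obtain ⟨S, hS, hm⟩ := I.card
    refine ⟨S, hS, fun e => (hm e).trans ⟨fun h => ⟨by omega, h.2⟩, fun h => ⟨?_, h.2⟩⟩⟩
    exact lt_of_le_of_ne (by omega) (by rintro rfl; exact hk h.2)

theorem ContractInv.push {V i mm acc acc' : ℕ} {keep : ℕ → Prop} {lab nid nid' a b a' b' : ℕ → ℕ}
    {w w' : ℕ → ℝ} (I : ContractInv V i mm acc keep lab nid a b a' b' w w') (hk : keep i)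
    (hN : Numbering V nid' acc') (hacc : acc' ≤ acc + 2)
    (hext : ∀ c, nid c ≠ 0 → nid' c = nid c) (h1 : nid' (lab (a i)) ≠ 0)
    (h2 : nid' (lab (b i)) ≠ 0) :
    ContractInv V (i + 1) (mm + 1) acc' keep lab nid' a b
      (Function.update a' mm (nid' (lab (a i)) - 1)) (Function.update b' mm (nid' (lab (b i)) - 1))
      w (Function.update w' mm (w i)) := by
  refine ⟨by have := I.mm_le; omega, by have := I.acc_le; omega, hN, ?_, ?_, ?_, ?_⟩
  · intro j hj
    rw [Function.update_of_ne (by omega), Function.update_of_ne (by omega),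
      Function.update_of_ne (by omega)]
    exact I.rest j (by omega)
  · intro e he hke
    rcases Nat.lt_succ_iff_lt_or_eq.1 he with hlt | rfl
    · obtain ⟨e', he', c1, c2, c3, c4, c5⟩ := I.ofKept e hlt hke
      refine ⟨e', by omega, ?_⟩
      rw [Function.update_of_ne (by omega), Function.update_of_ne (by omega),
        Function.update_of_ne (by omega), hext _ c1, hext _ c2]
      exact ⟨c1, c2, c3, c4, c5⟩
    · refine ⟨mm, by omega, h1, h2, ?_, ?_, ?_⟩
      · rw [Function.update_self]; omega
      · rw [Function.update_self]; omega
      · rw [Function.update_self]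
  · intro e' he'
    rcases Nat.lt_succ_iff_lt_or_eq.1 he' with hlt | rfl
    · obtain ⟨e, he, hke, c1, c2, c3, c4, c5⟩ := I.toKept e' hlt
      refine ⟨e, by omega, hke, ?_⟩
      rw [Function.update_of_ne (by omega), Function.update_of_ne (by omega),
        Function.update_of_ne (by omega), hext _ c1, hext _ c2]
      exact ⟨c1, c2, c3, c4, c5⟩
    · refine ⟨i, by omega, hk, h1, h2, ?_, ?_, ?_⟩
      · rw [Function.update_self]; omega
      · rw [Function.update_self]; omega
      · rw [Function.update_self]
  · obtain ⟨S, hS, hm⟩ := I.card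
    refine ⟨insert i S, ?_, fun e => ?_⟩
    · rw [Finset.card_insert_of_notMem fun h => by have := (hm i).1 h; omega, hS]
    · rw [Finset.mem_insert, hm]
      constructor
      · rintro (rfl | h)
        · exact ⟨by omega, hk⟩
        · exact ⟨by omega, h.2⟩
      · rintro ⟨h, h'⟩
        rcases Nat.lt_succ_iff_lt_or_eq.1 h with hlt | rfl
        · exact Or.inr ⟨hlt, h'⟩
        · exact Or.inl rfl

/-- The data of a weighted graph with two marked vertices, as stored in memory. -/
structure IsGraph (h : HS k np) (V M : ℕ) : Prop where
  nV : h.n (.sc .nV) 0 = V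
  nM : h.n (.sc .nM) 0 = M
  eu : ∀ e < M, h.n (.sc .eu) e < V
  ev : ∀ e < M, h.n (.sc .ev) e < V
  src : h.n (.sc .src) 0 < V
  tgtv : h.n (.sc .tgtv) 0 < V

/-- Connectivity of the two marked vertices of the stored graph. -/
def ConnIn (h : HS k np) (M : ℕ) (q : ℝ → Prop) : Prop :=
  Conn M q (h.n (.sc .eu)) (h.n (.sc .ev)) (h.x .ew) (h.n (.sc .src) 0) (h.n (.sc .tgtv) 0)

/-- The adjacency relation between labels that is given by the kept edges. -/
def LabelRel (M : ℕ) (keep : ℕ → Prop) (q : ℝ → Prop) (a b lab : ℕ → ℕ) (w : ℕ → ℝ) :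
    ℕ → ℕ → Prop :=
  EdgeRel M (fun e => keep e ∧ q (w e)) (fun e => lab (a e)) fun e => lab (b e)

/-- Renumbering the labels does not change connectivity, since the numbers of different labels are
different. -/
theorem ContractInv.conn_iff {V M mm acc : ℕ} {keep : ℕ → Prop} {lab nid a b a' b' : ℕ → ℕ}
    {w w' : ℕ → ℝ} (I : ContractInv V M mm acc keep lab nid a b a' b' w w') {q : ℝ → Prop}
    (hla : ∀ e < M, 1 ≤ lab (a e) ∧ lab (a e) ≤ V) (hlb : ∀ e < M, 1 ≤ lab (b e) ∧ lab (b e) ≤ V)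
    {c d : ℕ} (hc1 : 1 ≤ c) (hc2 : c ≤ V) (hc : nid c ≠ 0) (hd1 : 1 ≤ d) (hd2 : d ≤ V)
    (hd : nid d ≠ 0) :
    Conn mm q a' b' w' (nid c - 1) (nid d - 1) ↔
      Relation.EqvGen (LabelRel M keep q a b lab w) c d := by
  classical
  constructor
  · intro hconn
    let inv : ℕ → ℕ := fun x => if h : ∃ c, 1 ≤ c ∧ c ≤ V ∧ nid c = x + 1 then h.choose else 0
    have hinv : ∀ c, 1 ≤ c → c ≤ V → nid c ≠ 0 → ∀ x, x + 1 = nid c → inv x = c := by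
      intro c a1 a2 a3 x hx
      have hex : ∃ c, 1 ≤ c ∧ c ≤ V ∧ nid c = x + 1 := ⟨c, a1, a2, hx.symm⟩
      have hs := hex.choose_spec
      simp only [inv, dif_pos hex]
      exact (I.num.inj c a1 a2 _ hs.1 hs.2.1 a3 (by rw [hs.2.2, hx])).symm
    have := eqvGen_map (S := LabelRel M keep q a b lab w) inv ?_ hconn
    · rwa [hinv c hc1 hc2 hc _ (by omega), hinv d hd1 hd2 hd _ (by omega)] at this
    · rintro x y ⟨e', he', hq, rfl, rfl⟩
      obtain ⟨e, he, hk, c1, c2, c3, c4, c5⟩ := I.toKept e' he'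
      rw [hinv _ (hla e he).1 (hla e he).2 c1 _ c3, hinv _ (hlb e he).1 (hlb e he).2 c2 _ c4]
      exact Relation.EqvGen.rel _ _ ⟨e, he, ⟨hk, by rwa [← c5]⟩, rfl, rfl⟩
  · refine eqvGen_map (fun c => nid c - 1) ?_
    rintro x y ⟨e, he, ⟨hk, hq⟩, rfl, rfl⟩
    obtain ⟨e', he', c1, c2, c3, c4, c5⟩ := I.ofKept e he hk
    refine Relation.EqvGen.rel _ _ ⟨e', he', by simpa only [c5] using hq, ?_, ?_⟩
    · change a' e' = nid (lab (a e)) - 1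
      omega
    · change b' e' = nid (lab (b e)) - 1
      omega

/-- The new graph has the kept edges, with labels as vertices. Only labels that occur are numbered, so
the number of vertices is bounded by the number of edges. -/
theorem runs_contract (h : HS k np) {V M : ℕ} (hG : IsGraph h V M)
    (hlab : ∀ v < V, 0 < h.n (.sc .lab) v ∧ h.n (.sc .lab) v ≤ V)
    (hst : h.n (.sc .lab) (h.n (.sc .src) 0) ≠ h.n (.sc .lab) (h.n (.sc .tgtv) 0)) :
    Runs contract h (3 * V + 13 * M + 16) fun h' => ∃ V' M', IsGraph h' V' M' ∧ V' ≤ 2 * M' + 2 ∧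
      (∃ S : Finset ℕ, S.card = M' ∧
        ∀ e, e ∈ S ↔ e < M ∧ h.n (.sc .act) e = h.n (.sc .kp) 0) ∧
      h'.n (.sc .src) 0 ≠ h'.n (.sc .tgtv) 0 ∧
      ∀ q, ConnIn h' M' q ↔ Relation.EqvGen
        (LabelRel M (fun e => h.n (.sc .act) e = h.n (.sc .kp) 0) q (h.n (.sc .eu)) (h.n (.sc .ev))
          (h.n (.sc .lab)) (h.x .ew)) (h.n (.sc .lab) (h.n (.sc .src) 0))
          (h.n (.sc .lab) (h.n (.sc .tgtv) 0)) := by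
  obtain ⟨hV, hM, hu, hv, hs, ht⟩ := hG
  set lab := h.n (.sc .lab) with hlabd
  set a := h.n (.sc .eu) with had
  set b := h.n (.sc .ev) with hbd
  set w := h.x .ew with hwd
  set s := h.n (.sc .src) 0 with hsd
  set t := h.n (.sc .tgtv) 0 with htd
  set act := h.n (.sc .act) with hactd
  set kp := h.n (.sc .kp) 0 with hkpd
  refine Runs.seq' (V * 3 + 2) (13 * M + 14) ((Runs.forLoop (by simp) (by simp) (by simp)
    (fun i h' => ∀ c, 1 ≤ c → c ≤ i → h'.n (.sc .nid) c = 0) V 1 hV (by simp; omega)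
    ?_).frame.mono le_rfl ?_) (by omega)
  · intro i hi h1 hF h1z _ hI
    refine Runs.setN ?_
    intro c hc1 hc2
    simp only [NE.eval, h1z, HS.setN_n, NC.sc.injEq, reduceCtorEq, false_and, if_false, true_and]
    split_ifs with hc
    · rfl
    · exact hI c hc1 (by omega)
  rintro h1 ⟨⟨hz, -⟩, hF1⟩
  refine Runs.seq' 1 (13 * M + 13) (Runs.setN ?_) (by omega)
  refine Runs.seq' 1 (13 * M + 12) (Runs.setN ?_) (by omega)
  simp only [NE.eval]
  set h2 := (h1.setN (.sc .acc) 0 0).setN (.sc .mm) 0 0 with h2d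
  have a1 : h2.n (.sc .lab) = lab := by
    rw [hlabd, ← (hF1.n (.sc .lab) (by simp [forLoop]))]; simp [h2d, HS.setN_col]
  have a2 : h2.n (.sc .src) 0 = s := by
    rw [hsd, ← (hF1.n (.sc .src) (by simp [forLoop]))]; simp [h2d]
  have a3 : h2.n (.sc .tgtv) 0 = t := by
    rw [htd, ← (hF1.n (.sc .tgtv) (by simp [forLoop]))]; simp [h2d]
  have hN2 : Numbering V (h2.n (.sc .nid)) (h2.n (.sc .acc) 0) := by
    have : h2.n (.sc .nid) = h1.n (.sc .nid) := by simp [h2d, HS.setN_col]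
    rw [this]
    exact ⟨fun c c1 c2 => by rw [hz c c1 c2]; omega,
      fun c c1 c2 _ _ _ hne => (hne (hz c c1 c2)).elim⟩
  refine Runs.seq' 3 (13 * M + 9) ((runs_newId h2 (c₀ := lab s) (by simp [a1, a2])
    (by simp [a1, a2]) (hlab s hs).1 (hlab s hs).2 hN2).frame.mono le_rfl ?_) (by omega)
  rintro h3 ⟨⟨hN3, hx3, hs3, hacc3⟩, hF3⟩
  have b1 : h3.n (.sc .lab) = lab := by rw [hF3.n _ (by simp [newId]), a1]
  have b2 : h3.n (.sc .src) 0 = s := by rw [hF3.n _ (by simp [newId]), a2]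
  have b3 : h3.n (.sc .tgtv) 0 = t := by rw [hF3.n _ (by simp [newId]), a3]
  refine Runs.seq' 3 (13 * M + 6) ((runs_newId h3 (c₀ := lab t) (by simp [b1, b3])
    (by simp [b1, b3]) (hlab t ht).1 (hlab t ht).2 hN3).frame.mono le_rfl ?_) (by omega)
  rintro h4 ⟨⟨hN4, hx4, ht4, hacc4⟩, hF4⟩
  have c1 : h4.n (.sc .lab) = lab := by rw [hF4.n _ (by simp [newId]), b1]
  have c2 : h4.n (.sc .src) 0 = s := by rw [hF4.n _ (by simp [newId]), b2]
  have c3 : h4.n (.sc .tgtv) 0 = t := by rw [hF4.n _ (by simp [newId]), b3]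
  have hs4 : h4.n (.sc .nid) (lab s) ≠ 0 := by rw [hx4 _ hs3]; exact hs3
  refine Runs.seq' 1 (13 * M + 5) (Runs.setN ?_) (by omega)
  refine Runs.seq' 1 (13 * M + 4) (Runs.setN ?_) (by omega)
  simp only [NE.eval, c1, c2, c3, HS.setN_col, NC.sc.injEq, reduceCtorEq, if_false]
  set h5 := (h4.setN (.sc .src) 0 (h4.n (.sc .nid) (lab s) - 1)).setN (.sc .tgtv) 0
    (h4.n (.sc .nid) (lab t) - 1) with h5d
  have hF25 : ∀ c : NC k, c ≠ .sc .src → c ≠ .sc .tgtv → c ≠ .sc .acc → c ≠ .sc .nid →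
      c ≠ .sc .mm → c ≠ .sc .z → h5.n c = h.n c := by
    intro c e1 e2 e3 e4 e5 e6
    rw [h5d, HS.setN_col, if_neg e2, HS.setN_col, if_neg e1, hF4.n _ (by simp [newId, e3, e4]),
      hF3.n _ (by simp [newId, e3, e4]), h2d, HS.setN_col, if_neg e5, HS.setN_col, if_neg e3,
      hF1.n _ (by simp [forLoop, e4, e6])]
  have hX25 : h5.x .ew = w := by
    rw [h5d, HS.setN_x, HS.setN_x, hF4.x _ (by simp [newId]), hF3.x _ (by simp [newId]), h2d,
      HS.setN_x, HS.setN_x, hF1.x _ (by simp [forLoop])]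
  have d1 : h5.n (.sc .nM) 0 = M := by rw [hF25] <;> simp [hM]
  have d2 : h5.n (.sc .nid) = h4.n (.sc .nid) := by simp [h5d, HS.setN_col]
  have d3 : h5.n (.sc .acc) = h4.n (.sc .acc) := by simp [h5d, HS.setN_col]
  have d4 : h5.n (.sc .mm) 0 = 0 := by
    simp only [h5d, HS.setN_col, NC.sc.injEq, reduceCtorEq, if_false]
    rw [hF4.n _ (by simp [newId]), hF3.n _ (by simp [newId])]
    simp [h2d]
  have d5 : h4.n (.sc .acc) 0 ≤ 2 := by
    have : h2.n (.sc .acc) 0 = 0 := by simp [h2d]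
    omega
  refine Runs.seq' (M * 13 + 2) 2 ((Runs.forLoop (by simp [newId]) (by simp [newId]) (by simp)
    (fun i h' => ContractInv V i (h'.n (.sc .mm) 0) (h'.n (.sc .acc) 0) (fun e => act e = kp) lab
      (h'.n (.sc .nid)) a b (h'.n (.sc .eu)) (h'.n (.sc .ev)) w (h'.x .ew) ∧
      h'.n (.sc .nid) (lab s) = h4.n (.sc .nid) (lab s) ∧
      h'.n (.sc .nid) (lab t) = h4.n (.sc .nid) (lab t)) M 11 d1 ?_ ?_).frame.mono le_rfl ?_)
    (by omega)
  · simp only [HS.setN_col, NC.sc.injEq, reduceCtorEq, if_false, HS.setN_x, d2, d3, d4]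
    have e1 : h5.n (.sc .eu) = a := by rw [hF25] <;> simp
    have e2 : h5.n (.sc .ev) = b := by rw [hF25] <;> simp
    refine ⟨⟨le_rfl, by omega, hN4, fun j _ => by simp [e1, e2, hX25], by simp, by simp,
      ⟨∅, by simp, by simp⟩⟩, by simp⟩
  · rintro i hi h6 hF6 h6e - ⟨I, hIs, hIt⟩
    have e1 : h6.n (.sc .act) = act := by
      rw [hF6.n _ (by simp [forLoop, newId]), hF25] <;> simp
    have e2 : h6.n (.sc .kp) 0 = kp := by
      rw [hF6.n _ (by simp [forLoop, newId]), hF25] <;> simp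
    have e3 : h6.n (.sc .lab) = lab := by
      rw [hF6.n _ (by simp [forLoop, newId]), hF25] <;> simp
    refine Runs.cond (T := 10) (fun hc => ?_) (fun hc => ?_)
    · simp only [BE.holds, NE.eval, h6e, e1, e2] at hc
      obtain ⟨r1, r2, r3⟩ := I.rest i I.mm_le
      have l1 := hlab _ (hu i hi)
      have l2 := hlab _ (hv i hi)
      refine Runs.seq' 3 7 ((runs_newId h6 (c₀ := lab (a i)) (by simp [e3, h6e, r1])
        (by simp [e3, h6e, r1]) l1.1 l1.2 I.num).frame.mono le_rfl ?_) (by omega)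
      rintro h7 ⟨⟨hN7, hx7, hs7, hacc7⟩, hF7⟩
      have f3 : h7.n (.sc .lab) = lab := by rw [hF7.n _ (by simp [newId]), e3]
      have f4 : h7.n (.sc .e) 0 = i := by rw [hF7.n _ (by simp [newId]), h6e]
      have f5 : h7.n (.sc .eu) = h6.n (.sc .eu) := hF7.n _ (by simp [newId])
      have f6 : h7.n (.sc .ev) = h6.n (.sc .ev) := hF7.n _ (by simp [newId])
      have f7 : h7.n (.sc .mm) = h6.n (.sc .mm) := hF7.n _ (by simp [newId])
      have f8 : h7.x .ew = h6.x .ew := hF7.x _ (by simp [newId])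
      refine Runs.seq' 3 4 ((runs_newId h7 (c₀ := lab (b i)) (by simp [f3, f4, f6, r2])
        (by simp [f3, f4, f6, r2]) l2.1 l2.2 hN7).frame.mono le_rfl ?_) (by omega)
      rintro h8 ⟨⟨hN8, hx8, hs8, hacc8⟩, hF8⟩
      have g3 : h8.n (.sc .lab) = lab := by rw [hF8.n _ (by simp [newId]), f3]
      have g4 : h8.n (.sc .e) 0 = i := by rw [hF8.n _ (by simp [newId]), f4]
      have g5 : h8.n (.sc .eu) = h6.n (.sc .eu) := by rw [hF8.n _ (by simp [newId]), f5]
      have g6 : h8.n (.sc .ev) = h6.n (.sc .ev) := by rw [hF8.n _ (by simp [newId]), f6]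
      have g7 : h8.n (.sc .mm) = h6.n (.sc .mm) := by rw [hF8.n _ (by simp [newId]), f7]
      have g8 : h8.x .ew = h6.x .ew := by rw [hF8.x _ (by simp [newId]), f8]
      have hext : ∀ c, h6.n (.sc .nid) c ≠ 0 → h8.n (.sc .nid) c = h6.n (.sc .nid) c := by
        intro c hc0
        rw [hx8 c (by rw [hx7 c hc0]; exact hc0), hx7 c hc0]
      have hpush := I.push hc hN8 (by omega) hext (by rw [hx8 _ hs7]; exact hs7) hs8
      refine (Runs.sl (by simp) ?_).mono (by simp) fun _ => id
      simp only [HP.sl, NE.eval, HS.setN_col, HS.setX_col, HS.setX_n, HS.setN_x, NC.sc.injEq,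
        reduceCtorEq, if_false, if_true, Function.update_self, g3, g4, g5, g6, g7, g8, r1, r2, r3]
      refine ⟨hpush, ?_, ?_⟩
      · rw [hext _ (by rw [hIs]; exact hs4), hIs]
      · rw [hext _ (by rw [hIt]; exact ht4), hIt]
    · simp only [BE.holds, NE.eval, h6e, e1, e2] at hc
      refine (Runs.skip ?_).mono (by omega) fun _ => id
      simp only [HS.setN_col, NC.sc.injEq, reduceCtorEq, if_false, HS.setN_x]
      exact ⟨I.skip hc, hIs, hIt⟩
  · rintro h6 ⟨⟨⟨I, hIs, hIt⟩, -⟩, hF6⟩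
    have e1 : h6.n (.sc .src) 0 = h4.n (.sc .nid) (lab s) - 1 := by
      rw [hF6.n _ (by simp [forLoop, newId])]; simp [h5d]
    have e2 : h6.n (.sc .tgtv) 0 = h4.n (.sc .nid) (lab t) - 1 := by
      rw [hF6.n _ (by simp [forLoop, newId])]; simp [h5d]
    refine (Runs.sl (by simp) ?_).mono (by simp) fun _ => id
    refine ⟨h6.n (.sc .acc) 0, h6.n (.sc .mm) 0, ⟨?_, ?_, ?_, ?_, ?_, ?_⟩, I.acc_le, I.card, ?_, ?_⟩
    · simp
    · simp
    · intro e he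
      obtain ⟨e0, he0, -, i1, i2, i3, i4, -⟩ := I.toKept e he
      have := I.num.le _ (hlab _ (hu e0 he0)).1 (hlab _ (hu e0 he0)).2
      simp only [HP.sl, HS.setN_col, NC.sc.injEq, reduceCtorEq, if_false]
      omega
    · intro e he
      obtain ⟨e0, he0, -, i1, i2, i3, i4, -⟩ := I.toKept e he
      have := I.num.le _ (hlab _ (hv e0 he0)).1 (hlab _ (hv e0 he0)).2
      simp only [HP.sl, HS.setN_col, NC.sc.injEq, reduceCtorEq, if_false]
      omega
    · have := I.num.le _ (hlab _ hs).1 (hlab _ hs).2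
      simp only [HP.sl, HS.setN_col, NC.sc.injEq, reduceCtorEq, if_false, e1]
      omega
    · have := I.num.le _ (hlab _ ht).1 (hlab _ ht).2
      simp only [HP.sl, HS.setN_col, NC.sc.injEq, reduceCtorEq, if_false, e2]
      omega
    · simp only [HP.sl, HS.setN_col, NC.sc.injEq, reduceCtorEq, if_false, e1, e2]
      intro heq
      exact hst (hN4.inj _ (hlab _ hs).1 (hlab _ hs).2 _ (hlab _ ht).1 (hlab _ ht).2 hs4 (by omega))
    · intro q
      simp only [ConnIn, HP.sl, HS.setN_col, NC.sc.injEq, reduceCtorEq, if_false, HS.setN_x, e1, e2]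
      rw [← hIs, ← hIt]
      exact I.conn_iff (fun e he => hlab _ (hu e he)) (fun e he => hlab _ (hv e he))
        (hlab _ hs).1 (hlab _ hs).2 (by rw [hIs]; exact hs4) (hlab _ ht).1 (hlab _ ht).2
        (by rw [hIt]; exact ht4)

end RealRAM

namespace RealRAM
variable {k np : ℕ}

/-- If every vertex has its own label, contraction only deletes edges. -/
theorem labelRel_iff_of_succ {M V : ℕ} {keep : ℕ → Prop} {q : ℝ → Prop} {a b lab : ℕ → ℕ}
    {w : ℕ → ℝ} (ha : ∀ e < M, a e < V) (hb : ∀ e < M, b e < V) (hl : ∀ v < V, lab v = v + 1)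
    {s t : ℕ} (hs : s < V) (ht : t < V) :
    Relation.EqvGen (LabelRel M keep q a b lab w) (lab s) (lab t) ↔
      Relation.EqvGen (EdgeRel M (fun e => keep e ∧ q (w e)) a b) s t := by
  rw [hl s hs, hl t ht]
  constructor
  · intro h
    have := eqvGen_map (S := EdgeRel M (fun e => keep e ∧ q (w e)) a b) (fun c => c - 1) ?_ h
    · simpa using this
    · rintro x y ⟨e, he, hk, rfl, rfl⟩
      exact Relation.EqvGen.rel _ _ ⟨e, he, hk, by simp [hl _ (ha e he)], by simp [hl _ (hb e he)]⟩
  · refine eqvGen_map (fun c => c + 1) ?_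
    rintro x y ⟨e, he, hk, rfl, rfl⟩
    exact Relation.EqvGen.rel _ _ ⟨e, he, hk, hl _ (ha e he), hl _ (hb e he)⟩

/-- Contracting the components of the graph of light edges preserves connectivity by edges that
include all light ones. -/
theorem labelRel_iff_of_forest {M V : ℕ} {light : ℕ → Prop} {q : ℝ → Prop}
    {a b lab par : ℕ → ℕ} {w : ℕ → ℝ} (ha : ∀ e < M, a e < V) (hb : ∀ e < M, b e < V)
    (hF : SpanningForest V (EdgeRel M light a b) lab par) (hq : ∀ e < M, light e → q (w e))
    {s t : ℕ} (hs : s < V) (ht : t < V) :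
    Relation.EqvGen (LabelRel M (fun e => ¬ light e) q a b lab w) (lab s) (lab t) ↔
      Conn M q a b w s t := by
  classical
  constructor
  · intro h
    let rep : ℕ → ℕ := fun c => if h : ∃ v < V, lab v = c then h.choose else 0
    have hrep : ∀ v < V, Conn M q a b w (rep (lab v)) v := by
      intro v hv
      have hex : ∃ v' < V, lab v' = lab v := ⟨v, hv, rfl⟩
      have hs := hex.choose_spec
      simp only [rep, dif_pos hex]
      exact eqvGen_map id (fun _ _ ⟨e, he, h1, h2⟩ =>
        Relation.EqvGen.rel _ _ ⟨e, he, hq e he h1, h2⟩) ((hF.lab_iff _ hs.1 _ hv).1 hs.2)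
    have := eqvGen_map (S := EdgeRel M (fun e => q (w e)) a b) rep ?_ h
    · exact ((hrep s hs).symm.trans _ _ _ this).trans _ _ _ (hrep t ht)
    · rintro x y ⟨e, he, hk, rfl, rfl⟩
      exact ((hrep _ (ha e he)).trans _ _ _ (Relation.EqvGen.rel _ _ ⟨e, he, hk.2, rfl, rfl⟩)).trans
        _ _ _ (hrep _ (hb e he)).symm
  · refine eqvGen_map lab ?_
    rintro x y ⟨e, he, hk, rfl, rfl⟩
    by_cases hl : light e
    · rw [(hF.lab_iff _ (ha e he) _ (hb e he)).2 (Relation.EqvGen.rel _ _ ⟨e, he, hl, rfl, rfl⟩)]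
      exact Relation.EqvGen.refl _
    · exact Relation.EqvGen.rel _ _ ⟨e, he, ⟨hl, hk⟩, rfl, rfl⟩

theorem EdgeRel.congr {M : ℕ} {p p' : ℕ → Prop} (h : ∀ e < M, p e ↔ p' e) (a b : ℕ → ℕ) :
    EdgeRel M p a b = EdgeRel M p' a b := by
  funext u v
  exact propext ⟨fun ⟨e, he, h1, h2⟩ => ⟨e, he, (h e he).1 h1, h2⟩,
    fun ⟨e, he, h1, h2⟩ => ⟨e, he, (h e he).2 h1, h2⟩⟩

/-- Label the components of the graph of the edges that satisfy a test. -/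
def markComponents (b : BE k np) : HP k np := mark b ;; components

@[simp] theorem wN_markComponents (b : BE k np) (c : NC k) : (markComponents b).wN c ↔
    c ∈ [NC.sc .e, .sc .act, .sc .z, .sc .lab, .sc .head, .sc .nxt, .sc .tgt, .sc .root,
      .sc .cur, .sc .cv, .sc .cl, .sc .qh, .sc .qt, .sc .par, .sc .qu] := by
  simp only [markComponents, mark, components, forLoop, buildLists, pushHalf, search, HP.wN,
    List.mem_cons, List.not_mem_nil, or_false]
  tauto

@[simp] theorem wX_markComponents (b : BE k np) (c : RC np) : ¬ (markComponents b).wX c := by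
  simp [markComponents, mark, components, forLoop, buildLists, pushHalf, search]

open Classical in
theorem runs_markComponents (h : HS k np) {V M : ℕ} (hV : h.n (.sc .nV) 0 = V)
    (hM : h.n (.sc .nM) 0 = M) (hu : ∀ e < M, h.n (.sc .eu) e < V)
    (hv : ∀ e < M, h.n (.sc .ev) e < V) (b : BE k np) (p : ℕ → Prop)
    (hb : ∀ e < M, ∀ h', Frame (mark b) h h' → h'.n (.sc .e) 0 = e → (b.holds h' ↔ p e)) :
    Runs (markComponents b) h (31 * M + 27 * V + 13) fun h' =>
      (∀ e < M, h'.n (.sc .act) e = if p e then 1 else 0) ∧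
      SpanningForest V (EdgeRel M p (h.n (.sc .eu)) (h.n (.sc .ev)))
        (h'.n (.sc .lab)) (h'.n (.sc .par)) := by
  refine Runs.seq' (4 * M + 2) (27 * (V + M) + 11)
    ((runs_mark h b p M hM hb).frame.mono le_rfl ?_) (by omega)
  rintro h2 ⟨hact, hF2⟩
  have e1 : h2.n (.sc .eu) = h.n (.sc .eu) := hF2.n _ (by simp [mark, forLoop])
  have e2 : h2.n (.sc .ev) = h.n (.sc .ev) := hF2.n _ (by simp [mark, forLoop])
  refine ((runs_components h2 V M ?_ ?_ ?_).frame).mono le_rfl ?_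
  · rw [hF2.n _ (by simp [mark, forLoop]), hV]
  · rw [hF2.n _ (by simp [mark, forLoop]), hM]
  · intro e he _
    rw [e1, e2]
    exact ⟨hu e he, hv e he⟩
  · rintro h3 ⟨hsf, hF3⟩
    rw [hF3.n (.sc .act) (by simp [components, forLoop, buildLists, pushHalf, search])]
    refine ⟨hact, ?_⟩
    rw [e1, e2, EdgeRel.congr (p' := p)] at hsf
    · exact hsf
    · intro e he
      simp only [hact e he]
      split_ifs with hc <;> simp [hc]

/-- One round: find a pivot weight `p`. If the edges lighter than `p` connect the two vertices,
delete the others. Otherwise, if the edges up to `p` connect them, the answer is `p`. Otherwise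
contract the edges up to `p`. -/
def round : HP k np :=
  findPivot ;; markComponents ltPivot ;;
  .cond (.eq (ar .lab (vr .src)) (ar .lab (vr .tgtv)))
    (put .kp (.lit 1) ;; forLoop .z .nV (putA .lab (vr .z) (.add (vr .z) (.lit 1))) ;; contract)
    (markComponents lePivot ;;
      .cond (.eq (ar .lab (vr .src)) (ar .lab (vr .tgtv)))
        (.cpR .ans (.lit 0) .piv (.lit 0) ;; put .done (.lit 1))
        (put .kp (.lit 0) ;; contract))

/-- The stored graph has the bottleneck values described by `C`, and its marked vertices are
different and connected. -/
structure Reduced (C : ℝ → Prop) (h : HS k np) (V M : ℕ) : Prop where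
  graph : IsGraph h V M
  ne : h.n (.sc .src) 0 ≠ h.n (.sc .tgtv) 0
  conn : ConnIn h M fun _ => True
  iff : ∀ r, C r ↔ ConnIn h M (· ≤ r)

theorem Reduced.pos {C : ℝ → Prop} {h : HS k np} {V M : ℕ} (hR : Reduced C h V M) : 0 < M := by
  rcases Nat.eq_zero_or_pos M with rfl | h0
  · exact (hR.ne (eqvGen_eq_of_forall id (fun a b ⟨e, he, _⟩ => absurd he (by omega))
      hR.conn)).elim
  · exact h0

/-- Both memories hold the same graph. -/
structure SameGraph (h h' : HS k np) : Prop where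
  eu : h'.n (.sc .eu) = h.n (.sc .eu)
  ev : h'.n (.sc .ev) = h.n (.sc .ev)
  ew : h'.x .ew = h.x .ew
  src : h'.n (.sc .src) 0 = h.n (.sc .src) 0
  tgtv : h'.n (.sc .tgtv) 0 = h.n (.sc .tgtv) 0
  nV : h'.n (.sc .nV) 0 = h.n (.sc .nV) 0
  nM : h'.n (.sc .nM) 0 = h.n (.sc .nM) 0
  done : h'.n (.sc .done) 0 = h.n (.sc .done) 0

theorem SameGraph.trans {h h' h'' : HS k np} (a : SameGraph h h') (b : SameGraph h' h'') :
    SameGraph h h'' :=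
  ⟨b.eu.trans a.eu, b.ev.trans a.ev, b.ew.trans a.ew, b.src.trans a.src, b.tgtv.trans a.tgtv,
    b.nV.trans a.nV, b.nM.trans a.nM, b.done.trans a.done⟩

theorem Frame.sameGraph {p : HP k np} {h h' : HS k np} (hF : Frame p h h') (hx : ¬ p.wX .ew)
    (hn : ∀ c : NC k, c ∈ [NC.sc .eu, .sc .ev, .sc .src, .sc .tgtv, .sc .nV, .sc .nM, .sc .done] →
      ¬ p.wN c) : SameGraph h h' :=
  ⟨hF.n _ (hn _ (by simp)), hF.n _ (hn _ (by simp)), hF.x _ hx,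
    congrFun (hF.n _ (hn _ (by simp))) 0, congrFun (hF.n _ (hn _ (by simp))) 0,
    congrFun (hF.n _ (hn _ (by simp))) 0, congrFun (hF.n _ (hn _ (by simp))) 0,
    congrFun (hF.n _ (hn _ (by simp))) 0⟩

theorem IsGraph.congr {h h' : HS k np} {V M : ℕ} (hG : IsGraph h V M) (hS : SameGraph h h') :
    IsGraph h' V M :=
  ⟨hS.nV.trans hG.nV, hS.nM.trans hG.nM, by rw [hS.eu]; exact hG.eu, by rw [hS.ev]; exact hG.ev,
    by rw [hS.src]; exact hG.src, by rw [hS.tgtv]; exact hG.tgtv⟩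

theorem frame_findPivot {h h' : HS k np} (hF : Frame findPivot h h') : SameGraph h h' := by
  refine hF.sameGraph ?_ ?_
  · simp [findPivot, reduceLevel, reduceBlock, rankSort, rankBody, sampleBlock, forLoop]
  · simp [findPivot, reduceLevel, reduceBlock, rankSort, rankBody, sampleBlock, forLoop]

theorem frame_markComponents {b : BE k np} {h h' : HS k np} (hF : Frame (markComponents b) h h') :
    SameGraph h h' :=
  hF.sameGraph (by simp) (by simp)

/-- If connectivity through the kept edges between labels has the same bottleneck values, and at least
a `64`-th of the edges is removed, then contraction is one round of progress. -/
theorem runs_contract_reduced (C : ℝ → Prop) (h : HS k np) {V M : ℕ} (hG : IsGraph h V M)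
    {keep : ℕ → Prop} (hkeep : ∀ e < M, h.n (.sc .act) e = h.n (.sc .kp) 0 ↔ keep e)
    (hdone : h.n (.sc .done) 0 = 0)
    (hlab : ∀ v < V, 0 < h.n (.sc .lab) v ∧ h.n (.sc .lab) v ≤ V)
    (hst : h.n (.sc .lab) (h.n (.sc .src) 0) ≠ h.n (.sc .lab) (h.n (.sc .tgtv) 0))
    (hconn : Relation.EqvGen (LabelRel M keep (fun _ => True) (h.n (.sc .eu)) (h.n (.sc .ev))
      (h.n (.sc .lab)) (h.x .ew)) (h.n (.sc .lab) (h.n (.sc .src) 0))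
      (h.n (.sc .lab) (h.n (.sc .tgtv) 0)))
    (hiff : ∀ r, C r ↔ Relation.EqvGen (LabelRel M keep (· ≤ r) (h.n (.sc .eu)) (h.n (.sc .ev))
      (h.n (.sc .lab)) (h.x .ew)) (h.n (.sc .lab) (h.n (.sc .src) 0))
      (h.n (.sc .lab) (h.n (.sc .tgtv) 0)))
    {A : Finset ℕ} (hA : A ⊆ Finset.range M) (hA' : ∀ e ∈ A, ¬ keep e) (hAc : M ≤ 64 * A.card) :
    Runs contract h (3 * V + 13 * M + 16) fun h' =>
      h'.n (.sc .done) 0 = 0 ∧ ∃ V' M', Reduced C h' V' M' ∧ V' ≤ 2 * M' + 2 ∧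
        64 * M' ≤ 63 * M := by
  refine (runs_contract h hG hlab hst).frame.mono le_rfl ?_
  rintro h' ⟨⟨V', M', hG', hVM, ⟨S, hS, hSm⟩, hne, hcc⟩, hF⟩
  have hrel : ∀ q, LabelRel M (fun e => h.n (.sc .act) e = h.n (.sc .kp) 0) q (h.n (.sc .eu))
      (h.n (.sc .ev)) (h.n (.sc .lab)) (h.x .ew) = LabelRel M keep q (h.n (.sc .eu))
      (h.n (.sc .ev)) (h.n (.sc .lab)) (h.x .ew) := fun q =>
    EdgeRel.congr (fun e he => and_congr (hkeep e he) Iff.rfl) _ _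
  refine ⟨?_, V', M', ⟨hG', hne, ?_, ?_⟩, hVM, ?_⟩
  · rw [hF.n _ (by simp [contract, newId, forLoop]), hdone]
  · rw [hcc, hrel]; exact hconn
  · intro r
    rw [hcc, hrel]; exact hiff r
  · have hdisj : Disjoint S A := by
      rw [Finset.disjoint_left]
      intro e h1 h2
      have := (hSm e).1 h1
      exact hA' e h2 ((hkeep e this.1).1 this.2)
    have : (S ∪ A).card ≤ (Finset.range M).card := by
      apply Finset.card_le_card
      apply Finset.union_subset _ hA
      intro e he
      exact Finset.mem_range.2 ((hSm e).1 he).1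
    rw [Finset.card_union_of_disjoint hdisj, Finset.card_range] at this
    omega

/-- A round either finds the bottleneck weight or removes a `64`-th of the edges: the edges that are
not lighter than the pivot, or those that are not heavier. -/
theorem runs_round (C : ℝ → Prop) (h : HS k np) {V M : ℕ} (hR : Reduced C h V M)
    (hd : h.n (.sc .done) 0 = 0) :
    Runs round h (276 * M + 60 * V + 80) fun h' =>
      (h'.n (.sc .done) 0 ≠ 0 ∧ ∀ r, C r ↔ h'.x .ans 0 ≤ r) ∨
      (h'.n (.sc .done) 0 = 0 ∧ ∃ V' M', Reduced C h' V' M' ∧ V' ≤ 2 * M' + 2 ∧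
        64 * M' ≤ 63 * M) := by
  classical
  have hMp := hR.pos
  obtain ⟨hG, hne, hcn, hiff⟩ := hR
  have hfp := runs_findPivot h (by rw [hG.nM]; omega)
  rw [hG.nM] at hfp
  refine Runs.seq' (200 * M) (76 * M + 60 * V + 80) (hfp.frame.mono le_rfl ?_) (by omega)
  rintro h1 ⟨⟨hle, hge⟩, hF1⟩
  have S1 := frame_findPivot hF1
  rw [countLE_eq_card] at hle
  rw [countGE_eq_card] at hge
  set p := h1.x .piv 0 with hp
  set a := h.n (.sc .eu) with had
  set b := h.n (.sc .ev) with hbd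
  set w := h.x .ew with hwd
  set s := h.n (.sc .src) 0 with hsd
  set t := h.n (.sc .tgtv) 0 with htd
  refine Runs.seq' (31 * M + 27 * V + 13) (45 * M + 33 * V + 67)
    ((runs_markComponents h1 (hG.congr S1).nV (hG.congr S1).nM (hG.congr S1).eu
      (hG.congr S1).ev ltPivot (fun e => w e < p) ?_).frame.mono le_rfl ?_)
    (by omega)
  · intro e he h' hF he'
    rw [ltPivot, BE.holds, NE.eval, NE.eval, NE.eval, he', hF.x _ (by simp [mark, forLoop]),
      hF.x _ (by simp [mark, forLoop]), S1.ew]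
  rintro h2 ⟨⟨hact, hsf⟩, hF2⟩
  have S2 := S1.trans (frame_markComponents hF2)
  have hp2 : h2.x .piv 0 = p := by rw [hF2.x _ (by simp)]
  rw [S1.eu, S1.ev] at hsf
  -- The lighter edges connect the marked vertices if and only if the bottleneck is below the pivot.
  have hcond : h2.n (.sc .lab) s = h2.n (.sc .lab) t ↔ Conn M (· < p) a b w s t :=
    hsf.lab_iff s hG.src t hG.tgtv
  refine (Runs.cond (T := 45 * M + 33 * V + 66) (fun hc => ?_) (fun hc => ?_)).mono (by omega)
    fun _ => id
  · simp only [BE.holds, NE.eval, S2.src, S2.tgtv] at hc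
    have hc' := hcond.1 hc
    refine Runs.seq' 1 (45 * M + 33 * V + 65) (Runs.setN ?_) (by omega)
    simp only [NE.eval]
    refine Runs.seq' (V * 3 + 2) (3 * V + 13 * M + 16) ((Runs.forLoop (by simp) (by simp) (by simp)
      (fun i h' => ∀ v < i, h'.n (.sc .lab) v = v + 1) V 1 (by simp [S2.nV, hG.nV]) (by simp)
      ?_).frame.mono le_rfl ?_) (by omega)
    · intro i hi h' hF h1z _ hI
      refine Runs.setN ?_
      intro c hc1
      simp only [NE.eval, h1z, HS.setN_n, NC.sc.injEq, reduceCtorEq, false_and, if_false, true_and]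
      split_ifs with hc
      · rw [hc]
      · exact hI c (by omega)
    · rintro h3 ⟨⟨hl, -⟩, hF3⟩
      have S3 : SameGraph h h3 := by
        refine S2.trans (SameGraph.trans ?_ (hF3.sameGraph (by simp [forLoop]) (by simp [forLoop])))
        constructor <;> simp [HS.setN_col]
      have ha3 : h3.n (.sc .act) = h2.n (.sc .act) := by
        rw [hF3.n _ (by simp [forLoop])]; simp [HS.setN_col]
      have hk3 : h3.n (.sc .kp) 0 = 1 := by
        rw [hF3.n _ (by simp [forLoop])]; simp
      have hrel : ∀ q, Relation.EqvGen (LabelRel M (fun e => w e < p) q a b (h3.n (.sc .lab)) w)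
          (h3.n (.sc .lab) s) (h3.n (.sc .lab) t) ↔
          Relation.EqvGen (EdgeRel M (fun e => w e < p ∧ q (w e)) a b) s t := fun q =>
        labelRel_iff_of_succ hG.eu hG.ev hl hG.src hG.tgtv
      refine (runs_contract_reduced C h3 (hG.congr S3) (keep := fun e => w e < p)
        (A := (Finset.range M).filter fun e => p ≤ w e) ?_ ?_ ?_ ?_ ?_ ?_ (Finset.filter_subset _ _)
        ?_ hge).mono le_rfl fun _ => Or.inr
      · intro e he
        rw [ha3, hk3, hact e he]
        split_ifs with hc <;> simp [hc]
      · rw [S3.done, hd]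
      · intro v hv
        rw [hl v hv]; omega
      · rw [S3.src, S3.tgtv, hl _ hG.src, hl _ hG.tgtv]
        omega
      · rw [S3.eu, S3.ev, S3.src, S3.tgtv, S3.ew, hrel]
        simp only [and_true]
        exact hc'
      · intro r
        rw [S3.eu, S3.ev, S3.src, S3.tgtv, S3.ew, hrel, hiff]
        by_cases hpr : p ≤ r
        · refine ⟨fun _ => ?_, fun _ => Conn.mono (fun x hx => hx.le.trans hpr) hc'⟩
          exact Conn.mono (q' := fun x => x < p ∧ x ≤ r) (fun x hx => ⟨hx, hx.le.trans hpr⟩) hc'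
        · push Not at hpr
          exact ⟨fun hcr => Conn.mono (q' := fun x => x < p ∧ x ≤ r)
            (fun x hx => ⟨hx.trans_lt hpr, hx⟩) hcr,
            fun hcr => Conn.mono (q := fun x => x < p ∧ x ≤ r) (q' := (· ≤ r))
            (fun x hx => hx.2) hcr⟩
      · intro e he
        exact not_lt.2 (Finset.mem_filter.1 he).2
  · simp only [BE.holds, NE.eval, S2.src, S2.tgtv] at hc
    have hc' := mt hcond.2 hc
    refine Runs.seq' (31 * M + 27 * V + 13) (14 * M + 6 * V + 53)
      ((runs_markComponents h2 (hG.congr S2).nV (hG.congr S2).nM (hG.congr S2).eu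
        (hG.congr S2).ev lePivot (fun e => w e ≤ p) ?_).frame.mono le_rfl ?_)
      (by omega)
    · intro e he h' hF he'
      rw [lePivot, BE.holds, BE.holds, NE.eval, NE.eval, NE.eval, he',
        hF.x _ (by simp [mark, forLoop]), hF.x _ (by simp [mark, forLoop]), S2.ew, hp2, not_lt]
    rintro h3 ⟨⟨hact3, hsf3⟩, hF3⟩
    have S3 := S2.trans (frame_markComponents hF3)
    have hp3 : h3.x .piv 0 = p := by rw [hF3.x _ (by simp), hp2]
    rw [S2.eu, S2.ev] at hsf3
    have hcond3 : h3.n (.sc .lab) s = h3.n (.sc .lab) t ↔ Conn M (· ≤ p) a b w s t :=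
      hsf3.lab_iff s hG.src t hG.tgtv
    refine (Runs.cond (T := 14 * M + 6 * V + 52) (fun hd3 => ?_) (fun hd3 => ?_)).mono (by omega)
      fun _ => id
    · simp only [BE.holds, NE.eval, S3.src, S3.tgtv] at hd3
      refine (Runs.sl (by simp) ?_).mono (by simp) fun _ => Or.inl
      simp only [HP.sl, NE.eval, HS.setN_n, HS.setN_x, HS.setX_x, and_self, if_true, hp3]
      refine ⟨by simp, fun r => ?_⟩
      rw [hiff]
      refine ⟨fun hcr => ?_, fun hpr => Conn.mono (fun x hx => hx.trans hpr) (hcond3.1 hd3)⟩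
      by_contra! hlt
      exact hc' (Conn.mono (fun x hx => hx.trans_lt hlt) hcr)
    · simp only [BE.holds, NE.eval, S3.src, S3.tgtv] at hd3
      have hd3' := mt hcond3.2 hd3
      refine Runs.seq' 1 (14 * M + 6 * V + 51) (Runs.setN ?_) (by omega)
      simp only [NE.eval]
      set h4 := h3.setN (.sc .kp) 0 0 with h4d
      have S4 : SameGraph h h4 := by
        refine S3.trans ?_
        constructor <;> simp [h4d, HS.setN_col]
      have hl4 : h4.n (.sc .lab) = h3.n (.sc .lab) := by simp [h4d, HS.setN_col]
      refine (runs_contract_reduced C h4 (hG.congr S4) (keep := fun e => ¬ w e ≤ p)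
        (A := (Finset.range M).filter fun e => w e ≤ p) ?_ ?_ ?_ ?_ ?_ ?_ (Finset.filter_subset _ _)
        ?_ hle).mono (by omega) fun _ => Or.inr
      · intro e he
        simp only [h4d, HS.setN_n, NC.sc.injEq, reduceCtorEq, false_and, if_false, true_and,
          if_true, hact3 e he]
        split_ifs with hc <;> simp [hc]
      · rw [S4.done, hd]
      · rw [hl4]; exact hsf3.lab_le
      · rw [hl4, S4.src, S4.tgtv]; exact hd3
      · rw [S4.eu, S4.ev, S4.src, S4.tgtv, S4.ew, hl4]
        exact (labelRel_iff_of_forest hG.eu hG.ev hsf3 (fun _ _ _ => trivial) hG.src hG.tgtv).2 hcn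
      · intro r
        rw [S4.eu, S4.ev, S4.src, S4.tgtv, S4.ew, hl4, hiff]
        by_cases hpr : p ≤ r
        · exact (labelRel_iff_of_forest hG.eu hG.ev hsf3 (fun _ _ h => h.trans hpr) hG.src
            hG.tgtv).symm
        · push Not at hpr
          refine ⟨fun hcr => (hd3' (Conn.mono (fun x hx => hx.trans hpr.le) hcr)).elim,
            fun hcr => (hd3 ?_).elim⟩
          exact eqvGen_eq_of_forall id
            (fun u v ⟨e, _, h1, _⟩ => (h1.1 (h1.2.trans hpr.le)).elim) hcr
      · intro e he
        exact not_not.2 (Finset.mem_filter.1 he).2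

/-- Compute the least `r` such that the edges of weight at most `r` connect the marked vertices. -/
def bottleneck : HP k np := .loop (.eq (vr .done) (.lit 0)) round

open Classical in
/-- Since every round removes a fixed fraction of the edges, the rounds take linear time in total. -/
theorem runs_bottleneck (C : ℝ → Prop) (h : HS k np) {V M : ℕ} (hV : h.n (.sc .nV) 0 = V)
    (hM : h.n (.sc .nM) 0 = M) (h0 : h.n (.sc .done) 0 = 0 → Reduced C h V M)
    (h1 : h.n (.sc .done) 0 ≠ 0 → ∀ r, C r ↔ h.x .ans 0 ≤ r) :
    Runs bottleneck h (60 * V + 40000 * M + 1) fun h' => ∀ r, C r ↔ h'.x .ans 0 ≤ r := by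
  -- The potential pays for the vertices of the present round; the loss of a `64`-th of the `M` edges
  -- frees `625 * M`, which pays for its edges and for the at most `2 * M + 2` vertices that remain.
  have key := Runs.loop (b := .eq (vr .done) (.lit 0)) (p := round) (h₀ := h)
    (fun h' => (h'.n (.sc .done) 0 = 0 → ∃ V' M', Reduced C h' V' M') ∧
      (h'.n (.sc .done) 0 ≠ 0 → ∀ r, C r ↔ h'.x .ans 0 ≤ r))
    (fun h' => if h'.n (.sc .done) 0 = 0 then
      60 * h'.n (.sc .nV) 0 + 40000 * h'.n (.sc .nM) 0 else 0)
    ⟨fun hd => ⟨V, M, h0 hd⟩, h1⟩ ?_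
  · refine key.mono ?_ ?_
    · split_ifs <;> omega
    · rintro h' ⟨⟨-, hh⟩, hd⟩
      exact hh (by simpa using hd)
  · rintro h' - ⟨hI, -⟩ hd
    simp only [BE.holds, NE.eval] at hd
    obtain ⟨V', M', hR⟩ := hI hd
    refine ⟨_, (runs_round C h' hR hd).mono le_rfl ?_⟩
    have hp := hR.pos
    rw [if_pos hd, hR.graph.nV, hR.graph.nM]
    rintro h'' (⟨hd', hh⟩ | ⟨hd', V'', M'', hR', hv, hm⟩)
    · refine ⟨⟨fun h => (hd' h).elim, fun _ => hh⟩, ?_⟩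
      rw [if_neg hd']
      omega
    · refine ⟨⟨fun _ => ⟨_, _, hR'⟩, fun h => (h hd').elim⟩, ?_⟩
      rw [if_pos hd', hR'.graph.nV, hR'.graph.nM]
      omega

end RealRAM

namespace RealRAM

/-! ### The radius of a product of segments as a polynomial minimization problem -/

section Segments

variable {k d : ℕ}

/-- The squared distance of `x` from the point with parameter `t i` on the `i`-th segment. -/
def segSq (A B : Fin k → Fin d → ℝ) (t : Fin k → ℝ) (x : Fin d → ℝ) (i : Fin k) : ℝ :=
  ∑ c, (A i c + t i * (B i c - A i c) - x c) ^ 2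

/-- The ball with center `x` and squared radius `r` contains the chosen points of the segments. -/
structure SegFeas (A B : Fin k → Fin d → ℝ) (r : ℝ) (t : Fin k → ℝ) (x : Fin d → ℝ) : Prop where
  t_mem : ∀ i, 0 ≤ t i ∧ t i ≤ 1
  le : ∀ i, segSq A B t x i ≤ r

theorem segSq_nonneg (A B : Fin k → Fin d → ℝ) (t : Fin k → ℝ) (x : Fin d → ℝ) (i : Fin k) :
    0 ≤ segSq A B t x i := Finset.sum_nonneg fun _ _ => sq_nonneg _

theorem continuous_segSq (A B : Fin k → Fin d → ℝ) (i : Fin k) :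
    Continuous fun z : (Fin k → ℝ) × (Fin d → ℝ) => segSq A B z.1 z.2 i := by
  unfold segSq
  fun_prop

/-- The feasible set is bounded since all feasible centers are close to the first segment. -/
theorem isCompact_segFeas (hk : 0 < k) (A B : Fin k → Fin d → ℝ) (r : ℝ) :
    IsCompact {z : (Fin k → ℝ) × (Fin d → ℝ) | SegFeas A B r z.1 z.2} := by
  let b : Fin d → ℝ := fun c => |A ⟨0, hk⟩ c| + |B ⟨0, hk⟩ c - A ⟨0, hk⟩ c| + (|r| + 1)
  have hK : IsCompact ((Set.Icc (0 : Fin k → ℝ) 1) ×ˢ (Set.Icc (-b) b)) :=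
    isCompact_Icc.prod isCompact_Icc
  refine hK.of_isClosed_subset ?_ ?_
  · have : {z : (Fin k → ℝ) × (Fin d → ℝ) | SegFeas A B r z.1 z.2} =
        (⋂ i, {z | 0 ≤ z.1 i}) ∩ (⋂ i, {z | z.1 i ≤ 1}) ∩ ⋂ i, {z | segSq A B z.1 z.2 i ≤ r} := by
      ext z
      simp only [Set.mem_ofPred_eq, Set.mem_inter_iff, Set.mem_iInter]
      exact ⟨fun h => ⟨⟨fun i => (h.t_mem i).1, fun i => (h.t_mem i).2⟩, h.le⟩,
        fun h => ⟨fun i => ⟨h.1.1 i, h.1.2 i⟩, h.2⟩⟩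
    rw [this]
    refine ((isClosed_iInter fun i => ?_).inter (isClosed_iInter fun i => ?_)).inter
      (isClosed_iInter fun i => ?_)
    · exact isClosed_le continuous_const (by fun_prop)
    · exact isClosed_le (by fun_prop) continuous_const
    · exact isClosed_le (continuous_segSq A B i) continuous_const
  · rintro ⟨t, x⟩ h
    refine ⟨⟨fun i => (h.t_mem i).1, fun i => (h.t_mem i).2⟩, ?_⟩
    have key : ∀ c, |x c| ≤ b c := by
      intro c
      have h1 : (A ⟨0, hk⟩ c + t ⟨0, hk⟩ * (B ⟨0, hk⟩ c - A ⟨0, hk⟩ c) - x c) ^ 2 ≤ r :=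
        (Finset.single_le_sum (f := fun c => (A ⟨0, hk⟩ c + t ⟨0, hk⟩ *
          (B ⟨0, hk⟩ c - A ⟨0, hk⟩ c) - x c) ^ 2) (fun _ _ => sq_nonneg _)
          (Finset.mem_univ c)).trans (h.le ⟨0, hk⟩)
      have h2 := h.t_mem ⟨0, hk⟩
      set y := A ⟨0, hk⟩ c + t ⟨0, hk⟩ * (B ⟨0, hk⟩ c - A ⟨0, hk⟩ c) - x c with hy
      have h3 : |y| ≤ |r| + 1 := by
        rw [← sq_abs] at h1
        have := le_abs_self r
        nlinarith [abs_nonneg y, abs_nonneg r]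
      have h4 : |t ⟨0, hk⟩ * (B ⟨0, hk⟩ c - A ⟨0, hk⟩ c)| ≤ |B ⟨0, hk⟩ c - A ⟨0, hk⟩ c| := by
        rw [abs_mul, abs_of_nonneg h2.1]
        exact mul_le_of_le_one_left (abs_nonneg _) h2.2
      have h5 : x c = A ⟨0, hk⟩ c + t ⟨0, hk⟩ * (B ⟨0, hk⟩ c - A ⟨0, hk⟩ c) - y := by rw [hy]; ring
      rw [h5]
      exact (abs_sub _ _).trans (add_le_add ((abs_add_le _ _).trans (add_le_add le_rfl h4)) h3)
    exact ⟨fun c => (abs_le.1 (key c)).1, fun c => (abs_le.1 (key c)).2⟩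

/-- The squared radius of the smallest ball that contains a point of each segment. -/
def segRad (A B : Fin k → Fin d → ℝ) : ℝ := sInf {r | 0 ≤ r ∧ ∃ t x, SegFeas A B r t x}

/-- The minimum is attained, by compactness. -/
theorem isLeast_segRad (hk : 0 < k) (A B : Fin k → Fin d → ℝ) :
    IsLeast {r | 0 ≤ r ∧ ∃ t x, SegFeas A B r t x} (segRad A B) := by
  let r₀ := ∑ i, segSq A B 0 0 i
  have hr₀ : SegFeas A B r₀ 0 0 := ⟨fun i => ⟨le_rfl, zero_le_one⟩, fun i =>
    Finset.single_le_sum (fun j _ => segSq_nonneg A B 0 0 j) (Finset.mem_univ i)⟩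
  have hr₀' : 0 ≤ r₀ := Finset.sum_nonneg fun j _ => segSq_nonneg A B 0 0 j
  let K : Set (ℝ × (Fin k → ℝ) × (Fin d → ℝ)) :=
    (Set.Icc 0 r₀ ×ˢ {z : (Fin k → ℝ) × (Fin d → ℝ) | SegFeas A B r₀ z.1 z.2}) ∩
      ⋂ i, {z | segSq A B z.2.1 z.2.2 i ≤ z.1}
  have hK : IsCompact K := by
    refine (isCompact_Icc.prod (isCompact_segFeas hk A B r₀)).inter_right
      (isClosed_iInter fun i => ?_)
    exact isClosed_le ((continuous_segSq A B i).comp continuous_snd) continuous_fst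
  obtain ⟨y, ⟨⟨y', t, x⟩, ⟨⟨hy0, hf⟩, hle⟩, rfl⟩, hmin⟩ := (hK.image continuous_fst).exists_isLeast
    ⟨r₀, ⟨r₀, 0, 0⟩, ⟨⟨⟨hr₀', le_rfl⟩, hr₀⟩, Set.mem_iInter.2 hr₀.le⟩, rfl⟩
  have hl : IsLeast {r | 0 ≤ r ∧ ∃ t x, SegFeas A B r t x} y' := by
    refine ⟨⟨hy0.1, t, x, hf.t_mem, fun i => Set.mem_iInter.1 hle i⟩, ?_⟩
    rintro r ⟨h0, t', x', hf'⟩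
    rcases le_total r r₀ with hr | hr
    · exact hmin ⟨⟨r, t', x'⟩, ⟨⟨⟨h0, hr⟩, hf'.t_mem, fun i => (hf'.le i).trans hr⟩,
        Set.mem_iInter.2 hf'.le⟩, rfl⟩
    · exact hy0.2.trans hr
  rwa [segRad, hl.csInf_eq]

theorem segRad_le_iff (hk : 0 < k) (A B : Fin k → Fin d → ℝ) (r : ℝ) :
    segRad A B ≤ r ↔ ∃ t x, SegFeas A B r t x := by
  obtain ⟨⟨h0, t, x, hf⟩, hmin⟩ := isLeast_segRad hk A B
  refine ⟨fun h => ⟨t, x, hf.t_mem, fun i => (hf.le i).trans h⟩, fun ⟨t', x', hf'⟩ => hmin ⟨?_, t', x', hf'⟩⟩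
  exact (segSq_nonneg A B t' x' ⟨0, hk⟩).trans (hf'.le _)

/-- The number of parameters: the coordinates of the endpoints of `k` segments, a squared radius,
and the coordinates of a point. -/
def numPar (k d : ℕ) : ℕ := 2 * (k * d) + 1 + d

theorem idx_lt (i : Fin k) (c : Fin d) : (i : ℕ) * d + c < k * d := by
  have : ((i : ℕ) + 1) * d ≤ k * d := Nat.mul_le_mul_right _ i.isLt
  rw [add_mul] at this
  omega

/-- The position of a coordinate of the first endpoint of a segment. -/
def idxA (i : Fin k) (c : Fin d) : Fin (numPar k d) :=
  ⟨i * d + c, by have := idx_lt i c; simp only [numPar]; omega⟩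

/-- The position of a coordinate of the second endpoint of a segment. -/
def idxB (i : Fin k) (c : Fin d) : Fin (numPar k d) :=
  ⟨k * d + (i * d + c), by have := idx_lt i c; simp only [numPar]; omega⟩

/-- The position of the squared radius. -/
def idxR : Fin (numPar k d) := ⟨2 * (k * d), by simp only [numPar]; omega⟩

/-- The position of a coordinate of the point. -/
def idxG (c : Fin d) : Fin (numPar k d) :=
  ⟨2 * (k * d) + 1 + c, by have := c.isLt; simp only [numPar]; omega⟩

open MvPolynomial

/-- Polynomials in the parameters and `k + d + 1` variables: positions on the `k` segments, the
coordinates of the center, and the squared radius. -/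
abbrev SegPoly (k d : ℕ) : Type := MvPolynomial (Fin (numPar k d) ⊕ Fin (k + d + 1)) ℚ

/-- The position on the `i`-th segment. -/
def varT (i : Fin k) : SegPoly k d := X (Sum.inr ⟨i, by omega⟩)

/-- A coordinate of the center. -/
def varX (c : Fin d) : SegPoly k d := X (Sum.inr ⟨k + c, by omega⟩)

/-- The squared radius. -/
def varR : SegPoly k d := X (Sum.inr ⟨k + d, by omega⟩)

/-- The constraints that express `SegFeas` for the squared radius `ρ`. -/
def segConstraints (ρ : SegPoly k d) : List (SegPoly k d) :=
  (List.finRange k).flatMap fun i =>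
    [varT i, 1 - varT i, ρ - ∑ c : Fin d, (X (Sum.inl (idxA i c)) +
      varT i * (X (Sum.inl (idxB i c)) - X (Sum.inl (idxA i c))) - varX c) ^ 2]

/-- Minimize the squared radius. -/
def radProblem (k d : ℕ) : PolyProblem where
  numParams := numPar k d
  numVars := k + d + 1
  objective := varR
  constraints := varR :: segConstraints varR

/-- Minimize the coordinate `c` of the center, for a given squared radius and given coordinates
before `c`. -/
def centerProblem (k d : ℕ) (c : Fin d) : PolyProblem where
  numParams := numPar k d
  numVars := k + d + 1
  objective := varX c
  constraints := segConstraints (X (Sum.inl idxR)) ++ (List.finRange d).flatMap fun l =>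
    if l < c then [varX l - X (Sum.inl (idxG l)), X (Sum.inl (idxG l)) - varX l] else []

theorem segConstraints_iff (a : Fin (numPar k d) → ℝ) (z : Fin (k + d + 1) → ℝ)
    (ρ : SegPoly k d) :
    (∀ g ∈ segConstraints ρ, 0 ≤ aeval (Sum.elim a z) g) ↔
      SegFeas (fun i c => a (idxA i c)) (fun i c => a (idxB i c)) (aeval (Sum.elim a z) ρ)
        (fun i => z ⟨i, by omega⟩) fun c => z ⟨k + c, by omega⟩ := by
  simp only [segConstraints, List.mem_flatMap, List.mem_finRange, true_and, List.mem_cons,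
    List.not_mem_nil, or_false, forall_exists_index]
  constructor
  · intro h
    refine ⟨fun i => ⟨?_, ?_⟩, fun i => ?_⟩
    · simpa [varT] using h _ i (Or.inl rfl)
    · simpa [varT] using h _ i (Or.inr (Or.inl rfl))
    · simpa [varT, varX, segSq] using h _ i (Or.inr (Or.inr rfl))
  · rintro h g i (rfl | rfl | rfl)
    · simpa [varT] using (h.t_mem i).1
    · simpa [varT] using (h.t_mem i).2
    · simpa [varT, varX, segSq] using h.le i

/-- The vector of all variables. -/
def assemble (t : Fin k → ℝ) (x : Fin d → ℝ) (r : ℝ) (j : Fin (k + d + 1)) : ℝ :=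
  if h : (j : ℕ) < k then t ⟨j, h⟩ else if h : (j : ℕ) - k < d then x ⟨j - k, h⟩ else r

theorem assemble_t (t : Fin k → ℝ) (x : Fin d → ℝ) (r : ℝ) (i : Fin k) :
    assemble t x r ⟨i, by omega⟩ = t i := by
  simp [assemble]

theorem assemble_x (t : Fin k → ℝ) (x : Fin d → ℝ) (r : ℝ) (c : Fin d) :
    assemble t x r ⟨k + c, by omega⟩ = x c := by
  simp [assemble]

theorem assemble_r (t : Fin k → ℝ) (x : Fin d → ℝ) (r : ℝ) :
    assemble t x r ⟨k + d, by omega⟩ = r := by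
  simp [assemble]

theorem values_radProblem (a : Fin (numPar k d) → ℝ) : (radProblem k d).values a =
    {y | ∃ z : Fin (k + d + 1) → ℝ, (0 ≤ aeval (Sum.elim a z) (varR : SegPoly k d) ∧
      ∀ g ∈ segConstraints (varR : SegPoly k d), 0 ≤ aeval (Sum.elim a z) g) ∧
        y = aeval (Sum.elim a z) (varR : SegPoly k d)} := by
  ext y
  exact ⟨fun ⟨z, hz, hy⟩ => ⟨z, List.forall_mem_cons.1 hz, hy⟩,
    fun ⟨z, hz, hy⟩ => ⟨z, List.forall_mem_cons.2 hz, hy⟩⟩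

theorem values_centerProblem (c : Fin d) (a : Fin (numPar k d) → ℝ) :
    (centerProblem k d c).values a = {y | ∃ z : Fin (k + d + 1) → ℝ,
      (∀ g ∈ segConstraints (X (Sum.inl idxR) : SegPoly k d) ++ (List.finRange d).flatMap fun l =>
        if l < c then [varX l - X (Sum.inl (idxG l)), X (Sum.inl (idxG l)) - varX l] else [],
          0 ≤ aeval (Sum.elim a z) g) ∧ y = aeval (Sum.elim a z) (varX c : SegPoly k d)} := rfl

theorem isLeast_radProblem (hk : 0 < k) (a : Fin (numPar k d) → ℝ) :
    IsLeast ((radProblem k d).values a)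
      (segRad (fun i c => a (idxA i c)) fun i c => a (idxB i c)) := by
  convert isLeast_segRad hk (fun i c => a (idxA i c)) fun i c => a (idxB i c) using 1
  ext r
  rw [values_radProblem]
  constructor
  · rintro ⟨z, ⟨h0, hz⟩, rfl⟩
    exact ⟨h0, _, _, (segConstraints_iff a z _).1 hz⟩
  · rintro ⟨h0, t, x, hf⟩
    have hr : aeval (Sum.elim a (assemble t x r)) (varR : SegPoly k d) = r := by
      simp [varR, assemble_r]
    refine ⟨assemble t x r, ⟨by rwa [hr], ?_⟩, hr.symm⟩
    rw [segConstraints_iff, hr]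
    simpa only [assemble_t, assemble_x] using hf

/-- If the coordinates before `c` extend to a feasible center, then the least feasible coordinate `c`
exists, and together with them it extends to a feasible center. -/
theorem exists_isLeast_centerProblem (hk : 0 < k) (c : Fin d) (a : Fin (numPar k d) → ℝ)
    (hne : ∃ t x, SegFeas (fun i c => a (idxA i c)) (fun i c => a (idxB i c)) (a idxR) t x ∧
      ∀ l < c, x l = a (idxG l)) :
    ∃ y, IsLeast ((centerProblem k d c).values a) y ∧
      ∃ t x, SegFeas (fun i c => a (idxA i c)) (fun i c => a (idxB i c)) (a idxR) t x ∧
        (∀ l < c, x l = a (idxG l)) ∧ x c = y := by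
  set A := fun (i : Fin k) (c : Fin d) => a (idxA i c)
  set B := fun (i : Fin k) (c : Fin d) => a (idxB i c)
  let K : Set ((Fin k → ℝ) × (Fin d → ℝ)) :=
    {z | SegFeas A B (a idxR) z.1 z.2} ∩ ⋂ l, {z | l < c → z.2 l = a (idxG l)}
  have hK : IsCompact K := by
    refine (isCompact_segFeas hk A B _).inter_right (isClosed_iInter fun l => ?_)
    by_cases hl : l < c
    · simp only [hl, forall_true_left]
      exact isClosed_eq (by fun_prop) continuous_const
    · simp [hl]
  have hcont : Continuous fun z : (Fin k → ℝ) × (Fin d → ℝ) => z.2 c := by fun_prop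
  obtain ⟨t₀, x₀, hf₀, hg₀⟩ := hne
  obtain ⟨y, hy⟩ := (hK.image hcont).exists_isLeast
    ⟨_, (t₀, x₀), ⟨hf₀, Set.mem_iInter.2 hg₀⟩, rfl⟩
  have hv : (centerProblem k d c).values a = (fun z : (Fin k → ℝ) × (Fin d → ℝ) => z.2 c) '' K := by
    rw [values_centerProblem]
    ext r
    have hcon : ∀ z : Fin (k + d + 1) → ℝ,
        (∀ g ∈ segConstraints (X (Sum.inl idxR) : SegPoly k d) ++
          (List.finRange d).flatMap fun l =>
            if l < c then [varX l - X (Sum.inl (idxG l)), X (Sum.inl (idxG l)) - varX l] else [],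
          0 ≤ aeval (Sum.elim a z) g) ↔
        SegFeas A B (a idxR) (fun i => z ⟨i, by omega⟩) (fun c => z ⟨k + c, by omega⟩) ∧
          ∀ l < c, z ⟨k + l, by omega⟩ = a (idxG l) := by
      intro z
      have hs := segConstraints_iff a z (X (Sum.inl idxR))
      simp only [aeval_X, Sum.elim_inl] at hs
      rw [List.forall_mem_append, hs]
      refine and_congr_right fun _ => ?_
      constructor
      · intro h l hl
        have h1 := h (varX l - X (Sum.inl (idxG l)))
          (List.mem_flatMap.2 ⟨l, List.mem_finRange l, by simp [hl]⟩)
        have h2 := h (X (Sum.inl (idxG l)) - varX l)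
          (List.mem_flatMap.2 ⟨l, List.mem_finRange l, by simp [hl]⟩)
        simp only [varX, map_sub, aeval_X, Sum.elim_inl, Sum.elim_inr, sub_nonneg] at h1 h2
        exact le_antisymm h2 h1
      · intro h g hg
        obtain ⟨l, -, hg⟩ := List.mem_flatMap.1 hg
        split_ifs at hg with hl
        · have := h l hl
          simp only [List.mem_cons, List.not_mem_nil, or_false] at hg
          rcases hg with rfl | rfl <;> simp [varX, this]
        · simp at hg
    constructor
    · rintro ⟨z, hz, rfl⟩
      have := (hcon z).1 hz
      refine ⟨(_, _), ⟨this.1, Set.mem_iInter.2 this.2⟩, ?_⟩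
      simp [varX]
    · rintro ⟨⟨t, x⟩, ⟨hf, hg⟩, rfl⟩
      refine ⟨assemble t x 0, (hcon _).2 ?_, ?_⟩
      · simp only [assemble_t, assemble_x]
        exact ⟨hf, Set.mem_iInter.1 hg⟩
      · simp [varX, assemble_x]
  obtain ⟨⟨t, x⟩, ⟨hf, hg⟩, hxy⟩ := hy.1
  exact ⟨y, by rwa [hv], t, x, hf, Set.mem_iInter.1 hg, hxy⟩

end Segments

end RealRAM

namespace RealRAM

/-! ### Mixed radix notation -/

section Radix

variable {k : ℕ}

theorem finRange_split {pre post : List (Fin k)} {a : Fin k}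
    (h : List.finRange k = pre ++ a :: post) : pre = (List.finRange k).take a ∧ a ∉ pre := by
  have hl : pre.length < (List.finRange k).length := by rw [h]; simp
  have ha : (List.finRange k)[pre.length] = a := by simp [h]
  rw [List.getElem_finRange] at ha
  have hla : pre.length = a := by rw [← ha]; simp
  refine ⟨by rw [h, ← hla]; simp, ?_⟩
  have hnd := List.nodup_finRange k
  rw [h] at hnd
  have := List.disjoint_of_nodup_append hnd
  exact fun hm => this hm (by simp)

/-- The place value of the digit `i` for the radices `R`. -/
def stride (R : Fin k → ℕ) (i : Fin k) : ℕ := (((List.finRange k).take i).map R).prod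

/-- The digit `i` of the number `v`. -/
def digit (R : Fin k → ℕ) (v : ℕ) (i : Fin k) : ℕ := v / stride R i % R i

/-- The number with given digits. -/
def ofDigits (R : Fin k → ℕ) (x : Fin k → ℕ) : ℕ := ∑ i, x i * stride R i

theorem stride_eq (R : Fin k → ℕ) (i : Fin k) :
    stride R i = ∏ j : Fin i, R (Fin.castLE i.is_lt.le j) := by
  rw [stride, ← List.prod_ofFn]
  congr 1
  apply List.ext_getElem
  · simp
  · intro n h1 h2
    simp only [List.getElem_map, List.getElem_take, List.getElem_finRange, List.getElem_ofFn]
    congr 1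

theorem ofDigits_eq (R : Fin k → ℕ) (x : ∀ i, Fin (R i)) :
    ofDigits R (fun i => x i) = (finPiFinEquiv x : ℕ) := by
  rw [finPiFinEquiv_apply, ofDigits]
  exact Finset.sum_congr rfl fun i _ => by rw [stride_eq]

theorem finPiFinEquiv_symm_val (R : Fin k → ℕ) (v : Fin (∏ i, R i)) (i : Fin k) :
    (finPiFinEquiv.symm v i : ℕ) = digit R v i := by
  rw [digit, stride_eq]; rfl

theorem ofDigits_lt {R : Fin k → ℕ} {x : Fin k → ℕ} (hx : ∀ i, x i < R i) :
    ofDigits R x < ∏ i, R i := by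
  rw [ofDigits_eq R fun i => ⟨x i, hx i⟩]
  exact Fin.isLt _

theorem digit_ofDigits {R : Fin k → ℕ} {x : Fin k → ℕ} (hx : ∀ i, x i < R i) (i : Fin k) :
    digit R (ofDigits R x) i = x i := by
  rw [ofDigits_eq R fun i => ⟨x i, hx i⟩, ← finPiFinEquiv_symm_val, Equiv.symm_apply_apply]

theorem ofDigits_digit {R : Fin k → ℕ} {v : ℕ} (hv : v < ∏ i, R i) :
    ofDigits R (digit R v) = v := by
  have h : digit R v = fun i => (finPiFinEquiv.symm (⟨v, hv⟩ : Fin (∏ i, R i)) i : ℕ) := by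
    funext i
    rw [finPiFinEquiv_symm_val]
  rw [h, ofDigits_eq, Equiv.apply_symm_apply]

theorem digit_lt {R : Fin k → ℕ} (hR : ∀ i, 0 < R i) (v : ℕ) (i : Fin k) : digit R v i < R i :=
  Nat.mod_lt _ (hR i)

theorem ofDigits_update {R : Fin k → ℕ} (x : Fin k → ℕ) (i : Fin k) (hx : 0 < x i) :
    ofDigits R (Function.update x i (x i - 1)) = ofDigits R x - stride R i := by
  have h1 := Finset.add_sum_erase Finset.univ (fun j => x j * stride R j) (Finset.mem_univ i)
  have h2 := Finset.add_sum_erase Finset.univ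
    (fun j => Function.update x i (x i - 1) j * stride R j) (Finset.mem_univ i)
  have h3 : ∑ j ∈ Finset.univ.erase i, Function.update x i (x i - 1) j * stride R j =
      ∑ j ∈ Finset.univ.erase i, x j * stride R j :=
    Finset.sum_congr rfl fun j hj => by rw [Function.update_of_ne (Finset.ne_of_mem_erase hj)]
  simp only [Function.update_self] at h2
  obtain ⟨y, hy⟩ : ∃ y, x i = y + 1 := ⟨x i - 1, by omega⟩
  rw [ofDigits, ofDigits, ← h1, ← h2, h3, hy]
  simp only [Nat.add_sub_cancel, add_mul, one_mul]
  omega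

theorem stride_pos {R : Fin k → ℕ} (hR : ∀ i, 0 < R i) (i : Fin k) : 0 < stride R i :=
  List.prod_pos fun _ h => by
    obtain ⟨j, -, rfl⟩ := List.mem_map.1 h
    exact hR j

theorem digit_sub_stride {R : Fin k → ℕ} (hR : ∀ i, 0 < R i) {v : ℕ} (hv : v < ∏ i, R i)
    {i : Fin k} (h : 0 < digit R v i) :
    digit R (v - stride R i) = Function.update (digit R v) i (digit R v i - 1) := by
  have h1 := ofDigits_update (R := R) (digit R v) i h
  rw [ofDigits_digit hv] at h1
  rw [← h1]
  funext j
  refine digit_ofDigits (fun j => ?_) j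
  by_cases hj : j = i
  · subst hj
    rw [Function.update_self]
    have := digit_lt hR v j
    omega
  · rw [Function.update_of_ne hj]
    exact digit_lt hR v j

theorem digit_succ_of_lt {S v : ℕ} (hS : 0 < S) (h : v % S + 1 ≠ S) :
    (v + 1) % S = v % S + 1 ∧ (v + 1) / S = v / S := by
  have h1 := Nat.mod_lt v hS
  have h2 := Nat.div_add_mod v S
  have h3 : v + 1 = (v % S + 1) + S * (v / S) := by omega
  constructor
  · rw [h3, Nat.add_mul_mod_self_left, Nat.mod_eq_of_lt (by omega)]
  · rw [h3, Nat.add_mul_div_left _ _ hS, Nat.div_eq_of_lt (by omega), zero_add]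

theorem digit_succ_of_eq {S v : ℕ} (hS : 0 < S) (h : v % S + 1 = S) :
    (v + 1) % S = 0 ∧ (v + 1) / S = v / S + 1 := by
  have h2 := Nat.div_add_mod v S
  have h3 : v + 1 = S * (v / S + 1) := by rw [mul_add]; omega
  constructor
  · rw [h3, Nat.mul_mod_right]
  · rw [h3, Nat.mul_div_cancel_left _ hS]

end Radix

/-! ### The free space graph -/

section Build

variable {k : ℕ} (d : ℕ) (N : Fin k → ℕ) (X : ℕ → ℝ)

/-- The number of vertices and edges of the curve `i`. -/
def radix (i : Fin k) : ℕ := N i + N i - 1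

/-- The position of the first coordinate of the curve `i` in the input. -/
def offset (i : Fin k) : ℕ := (((List.finRange k).take i).map fun j => d * N j).sum

/-- The first endpoints of the segments that belong to the node `v`. A digit `2 * j` stands for the
vertex `j` (a degenerate segment), and `2 * j + 1` for the edge from `j` to `j + 1`. -/
def segA (v : ℕ) (i : Fin k) (c : Fin d) : ℝ :=
  X (offset d N i + digit (radix N) v i / 2 * d + c)

/-- The second endpoints of the segments that belong to the node `v`. -/
def segB (v : ℕ) (i : Fin k) (c : Fin d) : ℝ :=
  X (offset d N i + (digit (radix N) v i + 1) / 2 * d + c)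

/-- The weight of a node. -/
def nodeWt (v : ℕ) : ℝ := segRad (segA d N X v) (segB d N X v)

variable {d N X}

/-- The variables of the curve `i` when the node `v` is processed. -/
structure FamSpec (d : ℕ) (N : Fin k → ℕ) (h : HS k (numPar k d)) (v : ℕ) (i : Fin k) : Prop where
  rad : h.n (.fam .rad i) 0 = radix N i
  str : h.n (.fam .str i) 0 = stride (radix N) i
  off : h.n (.fam .off i) 0 = offset d N i
  low : h.n (.fam .low i) 0 = v % stride (radix N) i
  dig : h.n (.fam .dig i) 0 = digit (radix N) v i
  pa : h.n (.fam .pa i) 0 = offset d N i + digit (radix N) v i / 2 * d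
  pb : h.n (.fam .pb i) 0 = offset d N i + (digit (radix N) v i + 1) / 2 * d

theorem FamSpec.congr {h h' : HS k (numPar k d)} {v : ℕ} {i : Fin k} (hS : FamSpec d N h v i)
    (hh : ∀ f, h'.n (.fam f i) 0 = h.n (.fam f i) 0) : FamSpec d N h' v i :=
  ⟨by rw [hh, hS.rad], by rw [hh, hS.str], by rw [hh, hS.off], by rw [hh, hS.low],
    by rw [hh, hS.dig], by rw [hh, hS.pa], by rw [hh, hS.pb]⟩

/-- Proceed to the next node, for one curve. -/
def advance (d : ℕ) (i : Fin k) : HP k (numPar k d) :=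
  putF .low i (.add (fv .low i) (.lit 1)) ;;
  .cond (.eq (fv .low i) (fv .str i))
    (putF .low i (.lit 0) ;; putF .dig i (.add (fv .dig i) (.lit 1)) ;;
      .cond (.eq (fv .pa i) (fv .pb i)) (putF .pb i (.add (fv .pb i) (.lit d)))
        (putF .pa i (fv .pb i)) ;;
      .cond (.eq (fv .dig i) (fv .rad i))
        (putF .dig i (.lit 0) ;; putF .pa i (fv .off i) ;; putF .pb i (fv .off i)) .skip)
    .skip

theorem runs_advance (h : HS k (numPar k d)) (hN : ∀ i, 0 < N i) {v : ℕ} {i : Fin k}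
    (hS : FamSpec d N h v i) : Runs (advance d i) h 11 fun h' => FamSpec d N h' (v + 1) i := by
  have hR : ∀ i, 0 < radix N i := fun i => by have := hN i; simp only [radix]; omega
  have hSp := stride_pos hR i
  obtain ⟨h1, h2, h3, h4, h5, h6, h7⟩ := hS
  refine (Runs.sl (by simp [advance]) ?_).mono (by simp [advance]) fun _ => id
  by_cases c1 : v % stride (radix N) i + 1 = stride (radix N) i
  · obtain ⟨a1, a2⟩ := digit_succ_of_eq hSp c1
    have hdig : digit (radix N) (v + 1) i = if digit (radix N) v i + 1 = radix N i then 0 else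
        digit (radix N) v i + 1 := by
      rw [digit, a2, digit]
      split_ifs with hc
      · exact (digit_succ_of_eq (hR i) hc).1
      · exact (digit_succ_of_lt (hR i) hc).1
    set D := digit (radix N) v i with hD
    obtain ⟨u, hu⟩ : ∃ u, D / 2 * d = u := ⟨_, rfl⟩
    obtain ⟨w, hw⟩ : ∃ w, (D + 1) / 2 * d = w := ⟨_, rfl⟩
    have hz : (D + 1 + 1) / 2 * d = u + d := by
      have : (D + 1 + 1) / 2 = D / 2 + 1 := by omega
      rw [this, Nat.succ_mul, hu]
    have hne : u ≠ w → w = u + d := by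
      intro hne
      have : (D + 1) / 2 = D / 2 + 1 := by
        have : D / 2 ≠ (D + 1) / 2 := fun he => hne (by rw [← hu, ← hw, he])
        omega
      rw [← hw, this, Nat.succ_mul, hu]
    rw [hu] at h6
    rw [hw] at h7
    by_cases c2 : u = w
    · by_cases c3 : D + 1 = radix N i <;> constructor <;>
        simp [advance, HP.sl, h1, h2, h3, h4, h5, h6, h7, c1, c2, c3, a1, hdig, hw, hz]
      rw [add_assoc]
    · have hwu := hne c2
      by_cases c3 : D + 1 = radix N i <;> constructor <;>
        simp [advance, HP.sl, h1, h2, h3, h4, h5, h6, h7, c1, c2, c3, a1, hdig, hw, hz, ← hwu]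
  · obtain ⟨a1, a2⟩ := digit_succ_of_lt hSp c1
    have hdig : digit (radix N) (v + 1) i = digit (radix N) v i := by rw [digit, a2, digit]
    constructor <;>
      simp [advance, HP.sl, h1, h2, h3, h4, h5, h6, h7, c1, a1, hdig]

/-- The whole family of curve variables at the node `v`. -/
theorem runs_advanceAll (h : HS k (numPar k d)) (hN : ∀ i, 0 < N i) {v : ℕ}
    (hS : ∀ i, FamSpec d N h v i) :
    Runs (seqL (List.finRange k) (advance d)) h (k * 11 + 1)
      fun h' => ∀ i, FamSpec d N h' (v + 1) i := by
  refine (Runs.seqL 11 (fun pre h' => (∀ i ∈ pre, FamSpec d N h' (v + 1) i) ∧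
    ∀ i, i ∉ pre → FamSpec d N h' v i) ⟨by simp, fun i _ => hS i⟩ ?_).mono (by simp)
    fun h' hh i => hh.1 i (List.mem_finRange i)
  rintro pre a post hl h' - ⟨hI, hI'⟩
  obtain ⟨-, ha⟩ := finRange_split hl
  refine (runs_advance h' hN (hI' a ha)).frame.mono le_rfl ?_
  rintro h'' ⟨h1, hF⟩
  have hother : ∀ i, i ≠ a → ∀ f, h''.n (.fam f i) 0 = h'.n (.fam f i) 0 := by
    intro i hi f
    rw [hF.n]
    simp [advance, hi]
  refine ⟨fun i hi => ?_, fun i hi => ?_⟩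
  · by_cases hia : i = a
    · exact hia ▸ h1
    · have : i ∈ pre := by simpa [hia] using hi
      exact (hI i this).congr (hother i hia)
  · simp only [List.mem_append, List.mem_cons, List.not_mem_nil, or_false, not_or] at hi
    exact (hI' i hi.1).congr (hother i hi.2)

/-- Copy one coordinate of an endpoint of a segment to the parameters of the current node. -/
def copyPar (d : ℕ) (j : Fin (numPar k d)) : HP k (numPar k d) :=
  if h : (j : ℕ) < k * d then
    .cpR (.par j) (vr .v) .inp
      (.add (fv .pa ⟨j / d, Nat.div_lt_of_lt_mul (by rw [mul_comm d k]; exact h)⟩) (.lit (j % d)))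
  else if h : (j : ℕ) - k * d < k * d then
    .cpR (.par j) (vr .v) .inp
      (.add (fv .pb ⟨(j - k * d) / d, Nat.div_lt_of_lt_mul (by rw [mul_comm d k]; exact h)⟩)
        (.lit ((j - k * d) % d)))
  else .skip

/-- The value of a parameter of the node `v`. -/
def parVal (d : ℕ) (N : Fin k → ℕ) (X : ℕ → ℝ) (v : ℕ) (j : Fin (numPar k d)) : ℝ :=
  if h : (j : ℕ) < k * d then
    X (offset d N ⟨j / d, Nat.div_lt_of_lt_mul (by rw [mul_comm d k]; exact h)⟩ +
      digit (radix N) v ⟨j / d, Nat.div_lt_of_lt_mul (by rw [mul_comm d k]; exact h)⟩ / 2 * d + j % d)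
  else if h : (j : ℕ) - k * d < k * d then
    X (offset d N ⟨(j - k * d) / d, Nat.div_lt_of_lt_mul (by rw [mul_comm d k]; exact h)⟩ +
      (digit (radix N) v ⟨(j - k * d) / d, Nat.div_lt_of_lt_mul (by rw [mul_comm d k]; exact h)⟩ + 1) / 2 * d +
        (j - k * d) % d)
  else 0

theorem idx_div_mod (i : Fin k) (c : Fin d) :
    ((i : ℕ) * d + c) / d = i ∧ ((i : ℕ) * d + c) % d = c := by
  have hd : 0 < d := by have := c.isLt; omega
  constructor
  · rw [mul_comm, Nat.mul_add_div hd, Nat.div_eq_of_lt c.isLt, add_zero]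
  · rw [mul_comm, Nat.mul_add_mod, Nat.mod_eq_of_lt c.isLt]

theorem parVal_idxA (v : ℕ) (i : Fin k) (c : Fin d) :
    parVal d N X v (idxA i c) = segA d N X v i c := by
  obtain ⟨h1, h2⟩ := idx_div_mod i c
  have h3 := idx_lt i c
  simp only [parVal, idxA, h3, dif_pos, h1, h2, segA, Fin.eta]

theorem parVal_idxB (v : ℕ) (i : Fin k) (c : Fin d) :
    parVal d N X v (idxB i c) = segB d N X v i c := by
  obtain ⟨h1, h2⟩ := idx_div_mod i c
  have h3 := idx_lt i c
  have h4 : ¬ k * d + ((i : ℕ) * d + c) < k * d := by omega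
  simp only [parVal, idxB, h4, dif_neg, not_false_eq_true, Nat.add_sub_cancel_left, h3, dif_pos,
    h1, h2, segB, Fin.eta]

@[simp] theorem wN_copyPar (j : Fin (numPar k d)) (c : NC k) : ¬ (copyPar d j).wN c := by
  unfold copyPar
  split_ifs <;> simp

theorem wX_copyPar (j : Fin (numPar k d)) (c : RC (numPar k d)) :
    (copyPar d j).wX c → c = .par j := by
  unfold copyPar
  split_ifs <;> simp

theorem runs_copyPars (h : HS k (numPar k d)) {v : ℕ} (hv : h.n (.sc .v) 0 = v)
    (hX : h.x .inp = X) (hS : ∀ i, FamSpec d N h v i) :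
    Runs (seqL (List.finRange (numPar k d)) (copyPar d)) h (numPar k d + 1) fun h' =>
      (∀ j : Fin (numPar k d), (j : ℕ) < 2 * (k * d) → h'.x (.par j) v = parVal d N X v j) ∧
      ∀ j u, u ≠ v → h'.x (.par j) u = h.x (.par j) u := by
  have key := Runs.seqL (l := List.finRange (numPar k d)) (f := copyPar d) (h := h) 1
    (fun pre h' => (∀ j : Fin (numPar k d), j ∈ pre → (j : ℕ) < 2 * (k * d) →
      h'.x (.par j) v = parVal d N X v j) ∧ ∀ j u, u ≠ v → h'.x (.par j) u = h.x (.par j) u)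
    ⟨by simp, fun _ _ _ => rfl⟩ ?_
  · exact key.mono (by simp) fun h' hh => ⟨fun j hj => hh.1 j (List.mem_finRange j) hj, hh.2⟩
  · rintro pre a post hl h' hF ⟨hI, hI'⟩
    have hn : ∀ c, h'.n c = h.n c := fun c => hF.n c (by simp)
    have hx : h'.x .inp = X := by
      rw [hF.x, hX]
      rw [wX_seqL]
      rintro ⟨j, -, hj⟩
      exact absurd (wX_copyPar j _ hj) (by simp)
    have done : ∀ (y : ℝ), ((a : ℕ) < 2 * (k * d) → y = parVal d N X v a) →
        (∀ j : Fin (numPar k d), j ∈ pre ++ [a] → (j : ℕ) < 2 * (k * d) →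
          (h'.setX (.par a) v y).x (.par j) v = parVal d N X v j) ∧
        ∀ j u, u ≠ v → (h'.setX (.par a) v y).x (.par j) u = h.x (.par j) u := by
      intro y hy
      refine ⟨fun j hj hlt => ?_, fun j u hu => ?_⟩
      · by_cases hja : j = a
        · subst hja
          simp [hy hlt]
        · have : j ∈ pre := by simpa [hja] using hj
          simp [hja, hI j this hlt]
      · simp [hu, hI' j u hu]
    by_cases c1 : (a : ℕ) < k * d
    · simp only [copyPar, c1, dif_pos]
      refine Runs.cpR ?_
      simp only [NE.eval, hn, hx, hv, (hS _).pa]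
      refine done _ fun _ => ?_
      simp only [parVal, c1, dif_pos]
    · by_cases c2 : (a : ℕ) - k * d < k * d
      · simp only [copyPar, c1, c2, dif_pos, dif_neg, not_false_eq_true]
        refine Runs.cpR ?_
        simp only [NE.eval, hn, hx, hv, (hS _).pb]
        refine done _ fun _ => ?_
        simp only [parVal, c1, c2, dif_pos, dif_neg, not_false_eq_true]
      · simp only [copyPar, c1, c2, dif_neg, not_false_eq_true]
        refine Runs.skip ⟨fun j hj hlt => ?_, hI'⟩
        refine hI j ?_ hlt
        simp only [List.mem_append, List.mem_cons, List.not_mem_nil, or_false] at hj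
        rcases hj with hj | rfl
        · exact hj
        · omega

/-- Add the edge from the current node to the one with the digit `i` decreased. -/
def pushEdge (d : ℕ) (i : Fin k) : HP k (numPar k d) :=
  .cond (.lt (.lit 0) (fv .dig i))
    (putA .eu (vr .nM) (vr .v) ;; putA .ev (vr .nM) (.sub (vr .v) (fv .str i)) ;;
      .cond (.rlt (.par idxR) (vr .v) (.par idxR) (.sub (vr .v) (fv .str i)))
        (.cpR .ew (vr .nM) (.par idxR) (.sub (vr .v) (fv .str i)))
        (.cpR .ew (vr .nM) (.par idxR) (vr .v)) ;;
      put .nM (.add (vr .nM) (.lit 1))) .skip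

/-- The edges in memory are those described by `E`, where `E u i` stands for the edge from the
node `u` to the node with the digit `i` decreased. -/
structure EdgeSpec (d : ℕ) (N : Fin k → ℕ) (X : ℕ → ℝ) (E : ℕ → Fin k → Prop) (M : ℕ)
    (a b : ℕ → ℕ) (w : ℕ → ℝ) : Prop where
  toEdge : ∀ e < M, ∃ u i, E u i ∧ a e = u ∧ b e = u - stride (radix N) i ∧
    w e = max (nodeWt d N X u) (nodeWt d N X (u - stride (radix N) i))
  ofEdge : ∀ u i, E u i → ∃ e < M, a e = u ∧ b e = u - stride (radix N) i ∧
    w e = max (nodeWt d N X u) (nodeWt d N X (u - stride (radix N) i))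

theorem EdgeSpec.congr {E E' : ℕ → Fin k → Prop} {M : ℕ} {a b : ℕ → ℕ} {w : ℕ → ℝ}
    (h : EdgeSpec d N X E M a b w) (hE : ∀ u i, E u i ↔ E' u i) : EdgeSpec d N X E' M a b w := by
  have : E = E' := funext fun u => funext fun i => propext (hE u i)
  exact this ▸ h

theorem EdgeSpec.push {E E' : ℕ → Fin k → Prop} {M : ℕ} {a b : ℕ → ℕ} {w : ℕ → ℝ}
    (h : EdgeSpec d N X E M a b w) {v : ℕ} {j : Fin k} (hE : ∀ u i, E' u i ↔ E u i ∨ u = v ∧ i = j)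
    {y : ℝ} (hy : y = max (nodeWt d N X v) (nodeWt d N X (v - stride (radix N) j))) :
    EdgeSpec d N X E' (M + 1) (Function.update a M v)
      (Function.update b M (v - stride (radix N) j)) (Function.update w M y) := by
  constructor
  · intro e he
    rcases Nat.lt_succ_iff_lt_or_eq.1 he with hlt | rfl
    · obtain ⟨u, i, h1, h2⟩ := h.toEdge e hlt
      refine ⟨u, i, (hE _ _).2 (Or.inl h1), ?_⟩
      rwa [Function.update_of_ne hlt.ne, Function.update_of_ne hlt.ne, Function.update_of_ne hlt.ne]
    · refine ⟨v, j, (hE _ _).2 (Or.inr ⟨rfl, rfl⟩), ?_⟩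
      simp only [Function.update_self, hy, and_self]
  · intro u i hui
    rcases (hE u i).1 hui with h1 | ⟨rfl, rfl⟩
    · obtain ⟨e, he, h2⟩ := h.ofEdge u i h1
      refine ⟨e, by omega, ?_⟩
      rwa [Function.update_of_ne he.ne, Function.update_of_ne he.ne, Function.update_of_ne he.ne]
    · refine ⟨M, by omega, ?_⟩
      simp only [Function.update_self, hy, and_self]

theorem runs_pushEdges (h : HS k (numPar k d)) {v : ℕ} (hv : h.n (.sc .v) 0 = v)
    (hS : ∀ i, FamSpec d N h v i) (hW : ∀ u ≤ v, h.x (.par idxR) u = nodeWt d N X u)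
    (hM : h.n (.sc .nM) 0 ≤ k * v)
    (hE : EdgeSpec d N X (fun u i => u < v ∧ 0 < digit (radix N) u i) (h.n (.sc .nM) 0)
      (h.n (.sc .eu)) (h.n (.sc .ev)) (h.x .ew)) :
    Runs (seqL (List.finRange k) (pushEdge d)) h (k * 6 + 1) fun h' =>
      h'.n (.sc .nM) 0 ≤ k * (v + 1) ∧
      EdgeSpec d N X (fun u i => u < v + 1 ∧ 0 < digit (radix N) u i) (h'.n (.sc .nM) 0)
        (h'.n (.sc .eu)) (h'.n (.sc .ev)) (h'.x .ew) := by
  have key := Runs.seqL (l := List.finRange k) (f := pushEdge d) (h := h) 6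
    (fun pre h' => h'.n (.sc .nM) 0 ≤ k * v + pre.length ∧
      EdgeSpec d N X (fun u i => (u < v ∨ u = v ∧ i ∈ pre) ∧ 0 < digit (radix N) u i)
        (h'.n (.sc .nM) 0) (h'.n (.sc .eu)) (h'.n (.sc .ev)) (h'.x .ew))
    ⟨by simpa using hM, hE.congr (by simp)⟩ ?_
  · refine key.mono (by simp) fun h' hh => ⟨?_, hh.2.congr fun u i => ?_⟩
    · have := hh.1
      rw [List.length_finRange] at this
      rw [mul_add]
      omega
    · simp only [List.mem_finRange, and_true]
      rw [Nat.lt_succ_iff_lt_or_eq]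
  · rintro pre a post hl h' hF ⟨hI, hI'⟩
    have hfam : ∀ f i, h'.n (.fam f i) = h.n (.fam f i) := fun f i => hF.n _ (by simp [pushEdge])
    have hv' : h'.n (.sc .v) 0 = v := by rw [hF.n _ (by simp [pushEdge]), hv]
    have hW' : ∀ u ≤ v, h'.x (.par idxR) u = nodeWt d N X u := fun u hu => by
      rw [hF.x _ (by simp [pushEdge]), hW u hu]
    have hstr : h'.n (.fam .str a) 0 = stride (radix N) a := by rw [hfam, (hS a).str]
    have hdig : h'.n (.fam .dig a) 0 = digit (radix N) v a := by rw [hfam, (hS a).dig]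
    refine (Runs.cond (T := 5) (fun hc => ?_) fun hc => ?_).mono le_rfl fun _ => id
    · simp only [BE.holds, NE.eval, hdig] at hc
      have hb : (BE.rlt (.par idxR) (vr .v) (.par idxR) (.sub (vr .v) (fv .str a))).holds
          ((h'.setN (.sc .eu) (h'.n (.sc .nM) 0) v).setN (.sc .ev) (h'.n (.sc .nM) 0)
            (v - stride (radix N) a)) ↔
          nodeWt d N X v < nodeWt d N X (v - stride (radix N) a) := by
        simp [hv', hstr, hW' v le_rfl, hW' (v - stride (radix N) a) (Nat.sub_le _ _)]
      have hEp : ∀ u i, ((u < v ∨ u = v ∧ i ∈ pre ++ [a]) ∧ 0 < digit (radix N) u i) ↔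
          ((u < v ∨ u = v ∧ i ∈ pre) ∧ 0 < digit (radix N) u i) ∨ u = v ∧ i = a := by
        intro u i
        simp only [List.mem_append, List.mem_cons, List.not_mem_nil, or_false]
        constructor
        · rintro ⟨h1 | ⟨h1, h2 | h2⟩, h3⟩
          · exact Or.inl ⟨Or.inl h1, h3⟩
          · exact Or.inl ⟨Or.inr ⟨h1, h2⟩, h3⟩
          · exact Or.inr ⟨h1, h2⟩
        · rintro (⟨h1 | ⟨h1, h2⟩, h3⟩ | ⟨rfl, rfl⟩)
          · exact ⟨Or.inl h1, h3⟩
          · exact ⟨Or.inr ⟨h1, Or.inl h2⟩, h3⟩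
          · exact ⟨Or.inr ⟨rfl, Or.inr rfl⟩, hc⟩
      refine (Runs.sl (by simp) ?_).mono (by simp) fun _ => id
      have hlen : h'.n (.sc .nM) 0 + 1 ≤ k * v + (pre ++ [a]).length := by
        rw [List.length_append, List.length_singleton]
        omega
      by_cases hlt : nodeWt d N X v < nodeWt d N X (v - stride (radix N) a)
      · have := hI'.push hEp (y := nodeWt d N X (v - stride (radix N) a))
          (max_eq_right hlt.le).symm
        simp only [HP.sl, NE.eval, hv', hstr, HS.setN_col, HS.setX_col, HS.setX_n, HS.setN_x,
          NC.sc.injEq, reduceCtorEq, if_false, if_true, Function.update_self, hb, hlt,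
          hW' (v - stride (radix N) a) (Nat.sub_le _ _)]
        exact ⟨hlen, this⟩
      · have := hI'.push hEp (y := nodeWt d N X v) (max_eq_left (not_lt.1 hlt)).symm
        simp only [HP.sl, NE.eval, hv', hstr, HS.setN_col, HS.setX_col, HS.setX_n, HS.setN_x,
          NC.sc.injEq, reduceCtorEq, if_false, if_true, Function.update_self, hb, hlt,
          hW' v le_rfl]
        exact ⟨hlen, this⟩
    · simp only [BE.holds, NE.eval, hdig] at hc
      refine (Runs.skip ⟨?_, hI'.congr fun u i => ?_⟩).mono (by omega) fun _ => id
      · rw [List.length_append]; omega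
      · simp only [List.mem_append, List.mem_cons, List.not_mem_nil, or_false]
        constructor
        · rintro ⟨h1 | ⟨h1, h2⟩, h3⟩
          · exact ⟨Or.inl h1, h3⟩
          · exact ⟨Or.inr ⟨h1, Or.inl h2⟩, h3⟩
        · rintro ⟨h1 | ⟨h1, h2 | h2⟩, h3⟩
          · exact ⟨Or.inl h1, h3⟩
          · exact ⟨Or.inr ⟨h1, h2⟩, h3⟩
          · rw [h1, h2] at h3
            exact (hc h3).elim

end Build

end RealRAM

namespace RealRAM

section Build

variable {k d : ℕ} {N : Fin k → ℕ} {X : ℕ → ℝ}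

/-- Set up the variables of one curve. -/
def initFam (d : ℕ) (i : Fin k) : HP k (numPar k d) :=
  putF .rad i (.sub (.add (fv .cnt i) (fv .cnt i)) (.lit 1)) ;;
  putF .off i (vr .pos) ;; putF .pa i (vr .pos) ;; putF .pb i (vr .pos) ;;
  putF .low i (.lit 0) ;; putF .dig i (.lit 0) ;; putF .str i (vr .nV) ;;
  put .pos (.add (vr .pos) (.smul d (fv .cnt i))) ;; put .ia (fv .rad i) ;; put .acc (.lit 0)

/-- Multiply the number of nodes by the radix of one curve, by repeated addition. -/
def growNodes (k d : ℕ) : HP k (numPar k d) :=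
  forLoop .z .ia (put .acc (.add (vr .acc) (vr .nV))) ;; put .nV (vr .acc)

theorem runs_initFam (h : HS k (numPar k d)) {i : Fin k} (hc : h.n (.fam .cnt i) 0 = N i)
    (hV : h.n (.sc .nV) 0 = stride (radix N) i) (hp : h.n (.sc .pos) 0 = offset d N i) :
    Runs (initFam d i) h 10 fun h' => FamSpec d N h' 0 i ∧
      h'.n (.sc .nV) 0 = stride (radix N) i ∧ h'.n (.sc .ia) 0 = radix N i ∧
      h'.n (.sc .acc) 0 = 0 ∧ h'.n (.sc .pos) 0 = offset d N i + d * N i := by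
  have hdig : digit (radix N) 0 i = 0 := by simp [digit]
  refine (Runs.sl (by simp [initFam]) ?_).mono (by simp [initFam]) fun _ => id
  refine ⟨⟨?_, ?_, ?_, ?_, ?_, ?_, ?_⟩, ?_, ?_, ?_, ?_⟩ <;>
    simp [initFam, HP.sl, hc, hV, hp, hdig, radix]

theorem runs_growNodes (h : HS k (numPar k d)) {a b : ℕ} (hV : h.n (.sc .nV) 0 = a)
    (hia : h.n (.sc .ia) 0 = b) (hacc : h.n (.sc .acc) 0 = 0) :
    Runs (growNodes k d) h (3 * b + 3) fun h' => h'.n (.sc .nV) 0 = a * b := by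
  refine Runs.seq' (b * 3 + 2) 1 ((Runs.forLoop (by simp) (by simp) (by simp)
    (fun j h' => h'.n (.sc .acc) 0 = a * j) b 1 hia (by simp [hacc]) ?_).mono le_rfl ?_) (by omega)
  · intro j hj h' hF _ _ hI
    have : h'.n (.sc .nV) 0 = a := by rw [hF.n _ (by simp [forLoop]), hV]
    refine Runs.setN ?_
    simp [hI, this, mul_add]
  · rintro h' ⟨hI, -⟩
    refine Runs.setN ?_
    simp [hI]

theorem runs_initFams (h : HS k (numPar k d)) (hc : ∀ i, h.n (.fam .cnt i) 0 = N i)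
    (hV : h.n (.sc .nV) 0 = 1) (hp : h.n (.sc .pos) 0 = 0) {Rm : ℕ} (hRm : ∀ i, radix N i ≤ Rm) :
    Runs (seqL (List.finRange k) fun i => initFam d i ;; growNodes k d) h (k * (3 * Rm + 13) + 1)
      fun h' => (∀ i, FamSpec d N h' 0 i) ∧ h'.n (.sc .nV) 0 = ∏ i, radix N i := by
  refine (Runs.seqL (3 * Rm + 13) (fun pre h' => (∀ i ∈ pre, FamSpec d N h' 0 i) ∧
    h'.n (.sc .nV) 0 = (pre.map (radix N)).prod ∧
    h'.n (.sc .pos) 0 = (pre.map fun j => d * N j).sum) ⟨by simp, by simp [hV], by simp [hp]⟩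
    ?_).mono (by simp) fun h' hh => ⟨fun i => hh.1 i (List.mem_finRange i), ?_⟩
  · rintro pre a post hl h' hF ⟨hI, hI1, hI2⟩
    obtain ⟨hpre, ha⟩ := finRange_split hl
    have e1 : h'.n (.fam .cnt a) 0 = N a := by
      rw [hF.n _ (by simp [initFam, growNodes, forLoop]), hc]
    have hst : (pre.map (radix N)).prod = stride (radix N) a := by rw [hpre]; rfl
    have hof : (pre.map fun j => d * N j).sum = offset d N a := by rw [hpre]; rfl
    refine Runs.seq' 10 (3 * Rm + 3) ((runs_initFam h' e1 (hI1.trans hst)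
      (hI2.trans hof)).frame.mono le_rfl ?_) (by omega)
    rintro h1 ⟨⟨f1, f2, f3, f4, f5⟩, hF1⟩
    refine (runs_growNodes h1 f2 f3 f4).frame.mono (by have := hRm a; omega) ?_
    rintro h2 ⟨g1, hF2⟩
    refine ⟨fun i hi => ?_, ?_, ?_⟩
    · have h21 : ∀ f, h2.n (.fam f i) 0 = h1.n (.fam f i) 0 := fun f => by
        rw [hF2.n _ (by simp [growNodes, forLoop])]
      refine FamSpec.congr ?_ h21
      by_cases hia : i = a
      · exact hia ▸ f1
      · have : i ∈ pre := by simpa [hia] using hi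
        refine (hI i this).congr fun f => ?_
        rw [hF1.n _ (by simp [initFam, hia])]
    · rw [g1, List.map_append, List.prod_append, hst]
      simp
    · rw [hF2.n _ (by simp [growNodes, forLoop]), f5, List.map_append, List.sum_append, hof]
      simp
  · rw [hh.2.1, Fin.prod_univ_def]

/-- Compute the weight of the current node and add the edges to the nodes with one digit
decreased. -/
def buildNode (k d : ℕ) : HP k (numPar k d) :=
  seqL (List.finRange (numPar k d)) (copyPar d) ;;
  .minim (radProblem k d) (vr .v) (.par idxR) ;;
  seqL (List.finRange k) (pushEdge d) ;; seqL (List.finRange k) (advance d)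

/-- The row of the node `v` holds its segments and its weight. -/
structure NodeSpec (d : ℕ) (N : Fin k → ℕ) (X : ℕ → ℝ) (h : HS k (numPar k d)) (v : ℕ) : Prop where
  par : ∀ j : Fin (numPar k d), (j : ℕ) < 2 * (k * d) → h.x (.par j) v = parVal d N X v j
  wt : h.x (.par idxR) v = nodeWt d N X v

/-- The number of steps that `buildNode` takes. -/
def nodeTicks (k d : ℕ) : ℕ := numPar k d + 17 * k + 4

theorem runs_buildNode (hk : 0 < k) (h : HS k (numPar k d)) (hN : ∀ i, 0 < N i) {v : ℕ}
    (hv : h.n (.sc .v) 0 = v) (hX : h.x .inp = X) (hS : ∀ i, FamSpec d N h v i)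
    (hW : ∀ u < v, NodeSpec d N X h u) (hM : h.n (.sc .nM) 0 ≤ k * v)
    (hE : EdgeSpec d N X (fun u i => u < v ∧ 0 < digit (radix N) u i) (h.n (.sc .nM) 0)
      (h.n (.sc .eu)) (h.n (.sc .ev)) (h.x .ew)) :
    Runs (buildNode k d) h (nodeTicks k d) fun h' => (∀ i, FamSpec d N h' (v + 1) i) ∧
      (∀ u < v + 1, NodeSpec d N X h' u) ∧ h'.n (.sc .nM) 0 ≤ k * (v + 1) ∧
      EdgeSpec d N X (fun u i => u < v + 1 ∧ 0 < digit (radix N) u i) (h'.n (.sc .nM) 0)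
        (h'.n (.sc .eu)) (h'.n (.sc .ev)) (h'.x .ew) := by
  refine Runs.seq' (numPar k d + 1) (17 * k + 3)
    ((runs_copyPars h hv hX hS).frame.mono le_rfl ?_) (by simp only [nodeTicks]; omega)
  rintro h1 ⟨⟨hp1, hp1'⟩, hF1⟩
  have n1 : ∀ c, h1.n c = h.n c := fun c => hF1.n c (by simp)
  have x1 : h1.x .ew = h.x .ew := by
    rw [hF1.x]
    rw [wX_seqL]
    rintro ⟨j, -, hj⟩
    exact absurd (wX_copyPar j _ hj) (by simp)
  have hA : (fun i c => h1.x (.par (idxA i c)) v) = segA d N X v := by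
    funext i c
    rw [hp1 _ (by have := idx_lt i c; simp only [idxA]; omega), parVal_idxA]
  have hB : (fun i c => h1.x (.par (idxB i c)) v) = segB d N X v := by
    funext i c
    rw [hp1 _ (by have := idx_lt i c; simp only [idxB]; omega), parVal_idxB]
  have hmin := isLeast_radProblem hk fun j => h1.x (.par j) v
  simp only [hA, hB] at hmin
  refine Runs.seq' 1 (17 * k + 2) (Runs.minim (P := radProblem k d) le_rfl
    (y := nodeWt d N X v) ?_ ?_) (by omega)
  · rw [NE.eval, NE.eval, n1, hv]
    exact hmin
  rw [NE.eval, NE.eval, n1, hv]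
  set h2 := h1.setX (.par idxR) v (nodeWt d N X v) with h2d
  have n2 : ∀ c, h2.n c = h.n c := fun c => by rw [h2d, HS.setX_n, n1]
  have w2 : h2.x .ew = h.x .ew := by rw [h2d, HS.setX_col, if_neg (by simp), x1]
  have hW2 : ∀ u ≤ v, NodeSpec d N X h2 u := by
    intro u hu
    rcases hu.lt_or_eq with hlt | rfl
    · constructor
      · intro j hj
        simp [h2d, hlt.ne, hp1' j u hlt.ne, (hW u hlt).par j hj]
      · simp [h2d, hlt.ne, hp1' idxR u hlt.ne, (hW u hlt).wt]
    · constructor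
      · intro j hj
        have : j ≠ idxR := by
          rintro rfl
          simp [idxR] at hj
        simp [h2d, this, hp1 j hj]
      · simp [h2d]
  have hS2 : ∀ i, FamSpec d N h2 v i := fun i => (hS i).congr fun f => by rw [n2]
  refine Runs.seq' (k * 6 + 1) (11 * k + 1) ((runs_pushEdges h2 (by rw [n2, hv]) hS2
    (fun u hu => (hW2 u hu).wt) (by rw [n2]; exact hM)
    (by rw [n2, n2, n2, w2]; exact hE)).frame.mono le_rfl ?_) (by omega)
  rintro h3 ⟨⟨hM3, hE3⟩, hF3⟩
  have hS3 : ∀ i, FamSpec d N h3 v i := fun i => (hS2 i).congr fun f => by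
    rw [hF3.n _ (by simp [pushEdge])]
  have hW3 : ∀ u < v + 1, NodeSpec d N X h3 u := fun u hu => by
    have hx : ∀ j, h3.x (.par j) = h2.x (.par j) := fun j => hF3.x _ (by simp [pushEdge])
    exact ⟨fun j hj => by rw [hx, (hW2 u (by omega)).par j hj], by rw [hx, (hW2 u (by omega)).wt]⟩
  refine (runs_advanceAll h3 hN hS3).frame.mono (by omega) ?_
  rintro h4 ⟨hS4, hF4⟩
  have hx4 : ∀ c, h4.x c = h3.x c := fun c => hF4.x c (by simp [advance])
  have hn4 : ∀ a, h4.n (.sc a) = h3.n (.sc a) := fun a => hF4.n _ (by simp [advance])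
  refine ⟨hS4, fun u hu => ⟨fun j hj => ?_, ?_⟩, ?_, ?_⟩
  · rw [hx4, (hW3 u hu).par j hj]
  · rw [hx4, (hW3 u hu).wt]
  · rw [hn4]; exact hM3
  · rw [hn4, hn4, hn4, hx4]; exact hE3

/-- Compute the graph whose nodes are the cells of the free space, with digits as in `segA`. -/
def build (k d : ℕ) : HP k (numPar k d) :=
  put .pos (.lit 0) ;; put .nV (.lit 1) ;;
  seqL (List.finRange k) (fun i => initFam d i ;; growNodes k d) ;; put .nM (.lit 0) ;;
  forLoop .v .nV (buildNode k d)

/-- The memory holds the free space graph. -/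
structure Built (d : ℕ) (N : Fin k → ℕ) (X : ℕ → ℝ) (h : HS k (numPar k d)) (M : ℕ) : Prop where
  nV : h.n (.sc .nV) 0 = ∏ i, radix N i
  nM : h.n (.sc .nM) 0 = M
  nM_le : M ≤ k * ∏ i, radix N i
  node : ∀ u < ∏ i, radix N i, NodeSpec d N X h u
  edge : EdgeSpec d N X (fun u i => u < ∏ i, radix N i ∧ 0 < digit (radix N) u i) M
    (h.n (.sc .eu)) (h.n (.sc .ev)) (h.x .ew)

/-- The free space graph is built in time linear in the number of its nodes. -/
theorem runs_build (hk : 0 < k) (h : HS k (numPar k d)) (hN : ∀ i, 0 < N i)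
    (hc : ∀ i, h.n (.fam .cnt i) 0 = N i) (hX : h.x .inp = X) {Rm : ℕ}
    (hRm : ∀ i, radix N i ≤ Rm) :
    Runs (build k d) h (k * (3 * Rm + 13) + 6 + (∏ i, radix N i) * (nodeTicks k d + 2))
      fun h' => ∃ M, Built d N X h' M := by
  set V := ∏ i, radix N i with hVd
  refine Runs.seq' 1 (k * (3 * Rm + 13) + 5 + V * (nodeTicks k d + 2)) (Runs.setN ?_) (by omega)
  refine Runs.seq' 1 (k * (3 * Rm + 13) + 4 + V * (nodeTicks k d + 2)) (Runs.setN ?_) (by omega)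
  refine Runs.seq' (k * (3 * Rm + 13) + 1) (3 + V * (nodeTicks k d + 2))
    ((runs_initFams _ (N := N) (by simp [hc]) (by simp) (by simp) hRm).frame.mono le_rfl ?_)
    (by omega)
  rintro h1 ⟨⟨hS1, hV1⟩, hF1⟩
  have x1 : h1.x .inp = X := by rw [hF1.x _ (by simp [initFam, growNodes, forLoop])]; simp [hX]
  refine Runs.seq' 1 (V * (nodeTicks k d + 2) + 2) (Runs.setN ?_) (by omega)
  refine (Runs.forLoop (by simp [buildNode, pushEdge, advance])
    (by simp [buildNode, pushEdge, advance]) (by simp)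
    (fun i h' => (∀ j, FamSpec d N h' i j) ∧ (∀ u < i, NodeSpec d N X h' u) ∧
      h'.n (.sc .nM) 0 ≤ k * i ∧ EdgeSpec d N X (fun u j => u < i ∧ 0 < digit (radix N) u j)
        (h'.n (.sc .nM) 0) (h'.n (.sc .eu)) (h'.n (.sc .ev)) (h'.x .ew)) V (nodeTicks k d)
    (by simp [hV1, hVd]) ?_ ?_).frame.mono le_rfl ?_
  · refine ⟨fun j => (hS1 j).congr (by simp), by simp, by simp, ⟨by simp, by simp⟩⟩
  · rintro i hi h' hF hv - ⟨a1, a2, a3, a4⟩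
    have hx : h'.x .inp = X := by
      rw [hF.x, HS.setN_x, x1]
      simp only [forLoop, buildNode, HP.wX, wX_seqL, pushEdge, advance, reduceCtorEq, or_false,
        false_or, and_false, exists_false, not_exists, not_and]
      intro j _ hj
      exact absurd (wX_copyPar j _ hj) (by simp)
    refine (runs_buildNode hk h' hN hv hx a1 a2 a3 a4).mono le_rfl ?_
    rintro h'' ⟨b1, b2, b3, b4⟩
    refine ⟨fun j => (b1 j).congr (by simp), fun u hu => ⟨(b2 u hu).par, (b2 u hu).wt⟩, ?_, ?_⟩
    · simpa using b3
    · simpa [HS.setN_col] using b4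
  · rintro h' ⟨⟨⟨-, a2, a3, a4⟩, -⟩, hF⟩
    refine ⟨_, ⟨?_, rfl, a3, a2, a4⟩⟩
    rw [hF.n _ (by simp [forLoop, buildNode, pushEdge, advance])]
    simp [hV1]

end Build

end RealRAM

namespace RealRAM

section Solve

variable {k d : ℕ} {N : Fin k → ℕ} {X : ℕ → ℝ}

/-- The adjacency relation of the free space graph, restricted to edges with weight in `q`. -/
def GraphRel (d : ℕ) (N : Fin k → ℕ) (X : ℕ → ℝ) (q : ℝ → Prop) (u w : ℕ) : Prop :=
  ∃ i, u < ∏ i, radix N i ∧ 0 < digit (radix N) u i ∧ w = u - stride (radix N) i ∧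
    q (max (nodeWt d N X u) (nodeWt d N X w))

/-- The squared radius `r` suffices for a path from the first to the last node of the graph. -/
def Feasible (d : ℕ) (N : Fin k → ℕ) (X : ℕ → ℝ) (r : ℝ) : Prop :=
  (∏ i, radix N i = 1 ∧ nodeWt d N X 0 ≤ r) ∨
    (∏ i, radix N i ≠ 1 ∧ Relation.EqvGen (GraphRel d N X (· ≤ r)) 0 (∏ i, radix N i - 1))

/-- The stored edges are those of the free space graph. -/
theorem Built.edgeRel {h : HS k (numPar k d)} {M : ℕ} (hB : Built d N X h M) (q : ℝ → Prop) :
    EdgeRel M (fun e => q (h.x .ew e)) (h.n (.sc .eu)) (h.n (.sc .ev)) = GraphRel d N X q := by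
  funext u w
  apply propext
  constructor
  · rintro ⟨e, he, hq, h1, h2⟩
    obtain ⟨u', i, hu, h3, h4, h5⟩ := hB.edge.toEdge e he
    rw [h1] at h3
    subst h3
    rw [h2] at h4
    exact ⟨i, hu.1, hu.2, h4, by rw [h4, ← h5]; exact hq⟩
  · rintro ⟨i, hu, hi, rfl, hq⟩
    obtain ⟨e, he, h1, h2, h3⟩ := hB.edge.ofEdge u i ⟨hu, hi⟩
    exact ⟨e, he, by simp only [h3]; exact hq, h1, h2⟩

theorem radix_pos (hN : ∀ i, 0 < N i) (i : Fin k) : 0 < radix N i := by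
  have := hN i
  simp only [radix]
  omega

theorem radix_prod_pos (hN : ∀ i, 0 < N i) : 0 < ∏ i, radix N i :=
  Finset.prod_pos fun i _ => radix_pos hN i

theorem Built.isGraph {h : HS k (numPar k d)} {M : ℕ} (hB : Built d N X h M)
    (hs : h.n (.sc .src) 0 < ∏ i, radix N i) (ht : h.n (.sc .tgtv) 0 < ∏ i, radix N i) :
    IsGraph h (∏ i, radix N i) M := by
  refine ⟨hB.nV, hB.nM, fun e he => ?_, fun e he => ?_, hs, ht⟩
  · obtain ⟨u, i, hu, h1, h2, h3⟩ := hB.edge.toEdge e he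
    rw [h1]; exact hu.1
  · obtain ⟨u, i, hu, h1, h2, h3⟩ := hB.edge.toEdge e he
    rw [h2]; exact (Nat.sub_le _ _).trans_lt hu.1

/-- Decreasing digits leads from every node to the first one. -/
theorem graphRel_connected (hN : ∀ i, 0 < N i) : ∀ v < ∏ i, radix N i,
    Relation.EqvGen (GraphRel d N X fun _ => True) 0 v := by
  intro v
  induction v using Nat.strong_induction_on with
  | _ v ih =>
    intro hv
    rcases Nat.eq_zero_or_pos v with rfl | hpos
    · exact Relation.EqvGen.refl _
    · obtain ⟨i, hi⟩ : ∃ i, 0 < digit (radix N) v i := by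
        by_contra! hall
        have h0 := ofDigits_digit hv
        have : ofDigits (radix N) (digit (radix N) v) = 0 :=
          Finset.sum_eq_zero fun i _ => by rw [Nat.le_zero.1 (hall i), zero_mul]
        omega
      have hlt : v - stride (radix N) i < v :=
        Nat.sub_lt hpos (stride_pos (radix_pos hN) i)
      exact (ih _ hlt (hlt.trans hv)).trans _ _ _
        (Relation.EqvGen.symm _ _ (Relation.EqvGen.rel _ _ ⟨i, hv, hi, rfl, trivial⟩))

/-- Store the bottleneck value of the free space graph. -/
def findRadius (k d : ℕ) : HP k (numPar k d) :=
  build k d ;; (put .src (.lit 0) ;; put .tgtv (.sub (vr .nV) (.lit 1)) ;;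
    .cpR .ans (.lit 0) (.par idxR) (.lit 0) ;;
    .cond (.eq (vr .nV) (.lit 1)) (put .done (.lit 1)) (put .done (.lit 0))) ;; bottleneck

/-- A bound for the number of steps of `build`. -/
def buildTicks (k d V Rm : ℕ) : ℕ := k * (3 * Rm + 13) + 6 + V * (nodeTicks k d + 2)

/-- The bottleneck weight is the least feasible squared radius. A graph with a single node has no edges;
then the answer is the weight of the node. -/
theorem runs_findRadius (hk : 0 < k) (h : HS k (numPar k d)) (hN : ∀ i, 0 < N i)
    (hc : ∀ i, h.n (.fam .cnt i) 0 = N i) (hX : h.x .inp = X) {Rm : ℕ}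
    (hRm : ∀ i, radix N i ≤ Rm) :
    Runs (findRadius k d) h (buildTicks k d (∏ i, radix N i) Rm + 6 +
      (60 + 40000 * k) * ∏ i, radix N i) fun h' => ∀ r, Feasible d N X r ↔ h'.x .ans 0 ≤ r := by
  set V := ∏ i, radix N i with hVd
  have hVp : 0 < V := radix_prod_pos hN
  refine Runs.seq' (buildTicks k d V Rm) (6 + (60 + 40000 * k) * V)
    ((runs_build hk h hN hc hX hRm).mono le_rfl ?_) (by omega)
  rintro h1 ⟨M, hB⟩
  refine Runs.seq' 5 (1 + (60 + 40000 * k) * V) (((Runs.sl (Q := fun h' =>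
    h'.n (.sc .src) 0 = 0 ∧ h'.n (.sc .tgtv) 0 = V - 1 ∧ h'.x .ans 0 = nodeWt d N X 0 ∧
      (h'.n (.sc .done) 0 = 0 ↔ V ≠ 1)) (by simp) ?_).mono (by simp) fun _ => id).frame.mono
    le_rfl ?_) (by omega)
  · have hw := (hB.node 0 hVp).wt
    have hV1 : h1.n (.sc .nV) 0 = V := hB.nV
    by_cases hV : V = 1 <;> simp [HP.sl, hV1, hw, hV]
  rintro h2 ⟨⟨hs, ht, hans, hdone⟩, hF⟩
  have hB2 : Built d N X h2 M := by
    have hn : ∀ a : NA, a ≠ .src → a ≠ .tgtv → a ≠ .done → h2.n (.sc a) = h1.n (.sc a) :=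
      fun a a1 a2 a3 => hF.n _ (by simp [a1, a2, a3])
    refine ⟨?_, ?_, hB.nM_le, fun u hu => ⟨fun j hj => ?_, ?_⟩, ?_⟩
    · rw [hn _ (by simp) (by simp) (by simp), hB.nV]
    · rw [hn _ (by simp) (by simp) (by simp), hB.nM]
    · rw [hF.x _ (by simp), (hB.node u hu).par j hj]
    · rw [hF.x _ (by simp), (hB.node u hu).wt]
    · rw [hn _ (by simp) (by simp) (by simp), hn _ (by simp) (by simp) (by simp), hF.x _ (by simp)]
      exact hB.edge
  have hM := hB.nM_le
  refine (runs_bottleneck (Feasible d N X) h2 hB2.nV hB2.nM (fun hd => ?_) (fun hd => ?_)).mono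
    (by rw [← hVd] at hM ⊢; nlinarith) fun _ => id
  · have hV := hdone.1 hd
    refine ⟨hB2.isGraph (by rw [hs]; exact hVp) (by rw [ht]; omega), ?_, ?_, fun r => ?_⟩
    · rw [hs, ht]; omega
    · rw [ConnIn, Conn, hs, ht, hB2.edgeRel fun _ => True]
      exact graphRel_connected hN _ (by omega)
    · rw [ConnIn, Conn, hs, ht, hB2.edgeRel (· ≤ r), Feasible, ← hVd]
      simp [hV]
  · intro r
    have hV : V = 1 := by
      by_contra hV
      exact hd (hdone.2 hV)
    rw [Feasible, ← hVd, hans]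
    simp [hV]

/-- Compute the center with lexicographically least coordinates for the node `cur`. -/
def findCenter (k d : ℕ) : HP k (numPar k d) :=
  seqL (List.finRange d) fun c => .minim (centerProblem k d c) (vr .cur) (.par (idxG c))

/-- A single minimization problem returns one number, so a center is found coordinate by coordinate:
each is minimized subject to the values of the previous ones. -/
theorem runs_findCenter (hk : 0 < k) (h : HS k (numPar k d)) {v : ℕ} (hv : h.n (.sc .cur) 0 = v)
    {A B : Fin k → Fin d → ℝ} {r : ℝ} (hA : ∀ i c, h.x (.par (idxA i c)) v = A i c)
    (hB : ∀ i c, h.x (.par (idxB i c)) v = B i c) (hr : h.x (.par idxR) v = r)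
    (hle : segRad A B ≤ r) :
    Runs (findCenter k d) h (d + 1) fun h' =>
      (∃ t, SegFeas A B r t fun c => h'.x (.par (idxG c)) v) ∧
      ∀ c, ∀ u ≠ v, h'.x (.par c) u = h.x (.par c) u := by
  have hidxA : ∀ (i : Fin k) (c c' : Fin d), idxA i c ≠ idxG c' := by
    intro i c c' he
    have := idx_lt i c
    simp only [idxA, idxG, Fin.mk.injEq] at he
    omega
  have hidxB : ∀ (i : Fin k) (c c' : Fin d), idxB i c ≠ idxG c' := by
    intro i c c' he
    have := idx_lt i c
    simp only [idxB, idxG, Fin.mk.injEq] at he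
    omega
  have hidxR : ∀ (c' : Fin d), (idxR : Fin (numPar k d)) ≠ idxG c' := by
    intro c' he
    simp only [idxR, idxG, Fin.mk.injEq] at he
    omega
  have key := Runs.seqL (l := List.finRange d)
    (f := fun c => HP.minim (centerProblem k d c) (vr .cur) (.par (idxG c))) (h := h) 1
    (fun pre h' => (∃ t x, SegFeas A B r t x ∧ ∀ l ∈ pre, x l = h'.x (.par (idxG l)) v) ∧
      ∀ c, ∀ u ≠ v, h'.x (.par c) u = h.x (.par c) u) ⟨?_, fun _ _ _ => rfl⟩ ?_
  · refine key.mono (by simp) ?_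
    rintro h' ⟨⟨t, x, hf, hx⟩, hh⟩
    refine ⟨⟨t, ?_⟩, hh⟩
    have : x = fun c => h'.x (.par (idxG c)) v := funext fun c => hx c (List.mem_finRange c)
    rwa [← this]
  · obtain ⟨t, x, hf⟩ := (segRad_le_iff hk A B r).1 hle
    exact ⟨t, x, hf, by simp⟩
  · rintro pre a post hl h' hF ⟨⟨t, x, hf, hx⟩, hh⟩
    have hpre : ∀ l, l ∈ pre ↔ l < a := by
      intro l
      obtain ⟨hpre, -⟩ := finRange_split hl
      rw [hpre, List.mem_take_iff_getElem]
      constructor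
      · rintro ⟨i, hi, rfl⟩
        simp only [List.getElem_finRange]
        rw [Fin.lt_def]
        simp
        omega
      · intro hla
        exact ⟨l, by have := l.isLt; have := Fin.lt_def.1 hla; simp; omega, by simp⟩
    have e1 : h'.n (.sc .cur) 0 = v := by rw [hF.n _ (by simp), hv]
    have e2 : (fun (i : Fin k) (c : Fin d) => h'.x (.par (idxA i c)) v) = A := by
      funext i c
      rw [hF.x _ (by simp [hidxA]), hA]
    have e3 : (fun (i : Fin k) (c : Fin d) => h'.x (.par (idxB i c)) v) = B := by
      funext i c
      rw [hF.x _ (by simp [hidxB]), hB]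
    have e4 : h'.x (.par idxR) v = r := by rw [hF.x _ (by simp [hidxR]), hr]
    obtain ⟨y, hy, t', x', hf', hx', hxy⟩ := exists_isLeast_centerProblem hk a
      (fun j => h'.x (.par j) v) (by
        simp only [e2, e3, e4]
        exact ⟨t, x, hf, fun l hl => hx l ((hpre l).2 hl)⟩)
    simp only [e2, e3, e4] at hf'
    refine Runs.minim (P := centerProblem k d a) le_rfl (y := y) ?_ ?_
    · rw [NE.eval, NE.eval, e1]
      exact hy
    · rw [NE.eval, NE.eval, e1]
      refine ⟨⟨t', x', hf', fun l hl => ?_⟩, fun c u hu => ?_⟩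
      · by_cases hla : l = a
        · subst hla
          simp [hxy]
        · have hl' : l ∈ pre := by simpa [hla] using hl
          have : idxG (k := k) l ≠ idxG a := by
            intro he
            simp only [idxG, Fin.mk.injEq] at he
            exact hla (Fin.ext (by omega))
          simp [this, hx' l ((hpre l).1 hl')]
      · simp [hu, hh c u hu]

/-- Two nodes are joined by an edge of weight at most `r`. -/
def Adj (d : ℕ) (N : Fin k → ℕ) (X : ℕ → ℝ) (r : ℝ) (u w : ℕ) : Prop :=
  GraphRel d N X (· ≤ r) u w ∨ GraphRel d N X (· ≤ r) w u

theorem Adj.wt {r : ℝ} {u w : ℕ} (h : Adj d N X r u w) :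
    nodeWt d N X u ≤ r ∧ nodeWt d N X w ≤ r := by
  rcases h with ⟨i, _, _, _, h⟩ | ⟨i, _, _, _, h⟩
  · exact max_le_iff.1 h
  · exact (max_le_iff.1 h).symm

/-- The center that is stored in the row of the node `v` is good. -/
def HasCenter (d : ℕ) (N : Fin k → ℕ) (X : ℕ → ℝ) (r : ℝ) (h : HS k (numPar k d)) (v : ℕ) : Prop :=
  ∃ t, SegFeas (segA d N X v) (segB d N X v) r t fun c => h.x (.par (idxG c)) v

/-- Process the current node of the path and proceed to its parent. -/
def traceStep (k d : ℕ) : HP k (numPar k d) :=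
  .cpR (.par idxR) (vr .cur) .ans (.lit 0) ;; findCenter k d ;;
  .cond (.eq (vr .cur) (.lit 0)) (put .fin (.lit 1))
    (put .cur (ar .par (vr .cur)) ;; put .len (.add (vr .len) (.lit 1)) ;;
      putA .pth (vr .len) (vr .cur))

/-- The state while the path is followed. -/
structure TraceInv (d : ℕ) (N : Fin k → ℕ) (X : ℕ → ℝ) (r : ℝ) (h : HS k (numPar k d)) : Prop where
  first : h.n (.sc .pth) 0 = ∏ i, radix N i - 1
  last : h.n (.sc .pth) (h.n (.sc .len) 0) = h.n (.sc .cur) 0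
  lt : ∀ j ≤ h.n (.sc .len) 0, h.n (.sc .pth) j < ∏ i, radix N i
  adj : ∀ j < h.n (.sc .len) 0, Adj d N X r (h.n (.sc .pth) j) (h.n (.sc .pth) (j + 1))
  wt : nodeWt d N X (h.n (.sc .cur) 0) ≤ r
  center : ∀ j < h.n (.sc .len) 0, HasCenter d N X r h (h.n (.sc .pth) j)
  fin : h.n (.sc .fin) 0 ≠ 0 → h.n (.sc .cur) 0 = 0 ∧ HasCenter d N X r h 0

theorem runs_traceStep (hk : 0 < k) (h : HS k (numPar k d)) {r : ℝ} (hans : h.x .ans 0 = r)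
    (hnode : ∀ u < ∏ i, radix N i, ∀ j : Fin (numPar k d), (j : ℕ) < 2 * (k * d) →
      h.x (.par j) u = parVal d N X u j)
    (hI : TraceInv d N X r h)
    (hpar : h.n (.sc .cur) 0 ≠ 0 → h.n (.sc .par) (h.n (.sc .cur) 0) < ∏ i, radix N i ∧
      Adj d N X r (h.n (.sc .cur) 0) (h.n (.sc .par) (h.n (.sc .cur) 0)))
    (hfin : h.n (.sc .fin) 0 = 0) :
    Runs (traceStep k d) h (d + 6) fun h' => TraceInv d N X r h' ∧
      if h.n (.sc .cur) 0 = 0 then h'.n (.sc .fin) 0 = 1 ∧ h'.n (.sc .len) 0 = h.n (.sc .len) 0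
      else h'.n (.sc .fin) 0 = 0 ∧ h'.n (.sc .cur) 0 = h.n (.sc .par) (h.n (.sc .cur) 0) ∧
        h'.n (.sc .len) 0 = h.n (.sc .len) 0 + 1 := by
  obtain ⟨i1, i2, i3, i4, i5, i6, -⟩ := hI
  set v := h.n (.sc .cur) 0 with hv
  have hvV : v < ∏ i, radix N i := by rw [← i2]; exact i3 _ le_rfl
  refine Runs.seq' 1 (d + 5) (Runs.cpR ?_) (by omega)
  simp only [NE.eval, ← hv, hans]
  set h1 := h.setX (.par idxR) v r with h1d
  have hcol : ∀ (j : Fin (numPar k d)), (j : ℕ) < 2 * (k * d) → ∀ u < ∏ i, radix N i,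
      h1.x (.par j) u = parVal d N X u j := by
    intro j hj u hu
    have : j ≠ idxR := by
      rintro rfl
      simp [idxR] at hj
    simp [h1d, this, hnode u hu j hj]
  refine Runs.seq' (d + 1) 4 ((runs_findCenter hk h1 (v := v) (A := segA d N X v)
    (B := segB d N X v) (r := r) (by simp [h1d, hv]) (fun i c => ?_) (fun i c => ?_) (by simp [h1d])
    i5).frame.mono le_rfl ?_) (by omega)
  · rw [hcol _ (by have := idx_lt i c; simp only [idxA]; omega) v hvV, parVal_idxA]
  · rw [hcol _ (by have := idx_lt i c; simp only [idxB]; omega) v hvV, parVal_idxB]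
  rintro h2 ⟨⟨hc2, hx2⟩, hF2⟩
  have n2 : ∀ c, h2.n c = h.n c := fun c => by rw [hF2.n c (by simp [findCenter])]; rfl
  have hcen : ∀ u, (u = v ∨ HasCenter d N X r h u) → HasCenter d N X r h2 u := by
    intro u hu
    by_cases huv : u = v
    · subst huv; exact hc2
    · obtain ⟨t, ht⟩ := hu.resolve_left huv
      refine ⟨t, ?_⟩
      have : (fun c : Fin d => h2.x (.par (idxG c)) u) = fun c => h.x (.par (idxG c)) u := by
        funext c
        rw [hx2 _ u huv]
        simp [h1d, huv]
      rwa [this]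
  refine (Runs.cond (T := 3) (fun hb => ?_) fun hb => ?_).mono le_rfl fun _ => id
  · simp only [BE.holds, NE.eval, n2, ← hv] at hb
    refine (Runs.setN ?_).mono (by omega) fun _ => id
    simp only [NE.eval, hb, if_true]
    refine ⟨?_, by simp, by simp [n2]⟩
    constructor <;> simp only [HS.setN_n, NC.sc.injEq, reduceCtorEq, false_and, if_false, n2,
      ← hv]
    · exact i1
    · exact i2
    · exact i3
    · exact i4
    · exact i5
    · exact fun j hj => hcen _ (Or.inr (i6 j hj))
    · exact fun _ => ⟨hb, hcen _ (Or.inl hb.symm)⟩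
  · simp only [BE.holds, NE.eval, n2, ← hv] at hb
    obtain ⟨p1, p2⟩ := hpar hb
    refine (Runs.sl (by simp) ?_).mono (by simp) fun _ => id
    have e1 : ∀ j ≤ h.n (.sc .len) 0, Function.update (h.n (.sc .pth)) (h.n (.sc .len) 0 + 1)
        (h.n (.sc .par) v) j = h.n (.sc .pth) j := fun j hj => Function.update_of_ne (by omega) _ _
    simp only [hb, if_false, HP.sl, NE.eval]
    refine ⟨?_, ?_, ?_, ?_⟩
    · constructor <;> simp only [HS.setN_col, NC.sc.injEq, reduceCtorEq, if_false, if_true, n2,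
        ← hv, Function.update_self]
      · rw [e1 _ (Nat.zero_le _), i1]
      · intro j hj
        rcases hj.lt_or_eq with hlt | rfl
        · rw [e1 _ (by omega)]; exact i3 j (by omega)
        · rw [Function.update_self]; exact p1
      · intro j hj
        rw [e1 _ (by omega)]
        rcases (Nat.lt_succ_iff_lt_or_eq.1 hj) with hlt | rfl
        · rw [e1 _ (by omega)]; exact i4 j hlt
        · rw [Function.update_self, i2]; exact p2
      · exact p2.wt.2
      · intro j hj
        rw [e1 _ (by omega)]
        rcases (Nat.lt_succ_iff_lt_or_eq.1 hj) with hlt | rfl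
        · exact hcen _ (Or.inr (i6 j hlt))
        · exact hcen _ (Or.inl i2)
      · exact fun hf => (hf hfin).elim
    all_goals simp [n2, hfin, ← hv]

/-- Store a path from the last to the first node along edges of weight at most `ans`, and the
centers of its nodes. -/
def writePath (k d : ℕ) : HP k (numPar k d) :=
  build k d ;; .cpR .piv (.lit 0) .ans (.lit 0) ;; markComponents lePivot ;;
  (put .cur (.sub (vr .nV) (.lit 1)) ;; put .len (.lit 0) ;; put .fin (.lit 0) ;;
    putA .pth (.lit 0) (vr .cur)) ;;
  .loop (.eq (vr .fin) (.lit 0)) (traceStep k d) ;; put .len (.add (vr .len) (.lit 1))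

/-- A path of `L` nodes with their centers. -/
structure PathSpec (d : ℕ) (N : Fin k → ℕ) (X : ℕ → ℝ) (r : ℝ) (h : HS k (numPar k d)) (L : ℕ) :
    Prop where
  nV : h.n (.sc .nV) 0 = ∏ i, radix N i
  len : h.n (.sc .len) 0 = L + 1
  le : L ≤ ∏ i, radix N i
  first : h.n (.sc .pth) 0 = ∏ i, radix N i - 1
  last : h.n (.sc .pth) L = 0
  lt : ∀ j ≤ L, h.n (.sc .pth) j < ∏ i, radix N i
  adj : ∀ j < L, Adj d N X r (h.n (.sc .pth) j) (h.n (.sc .pth) (j + 1))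
  center : ∀ j ≤ L, HasCenter d N X r h (h.n (.sc .pth) j)

/-- The parents in the spanning forest lead from the last node to the first one, which is a root. The
number of steps is bounded since the parents are ordered. -/
theorem runs_writePath (hk : 0 < k) (h : HS k (numPar k d)) (hN : ∀ i, 0 < N i)
    (hc : ∀ i, h.n (.fam .cnt i) 0 = N i) (hX : h.x .inp = X) {Rm : ℕ}
    (hRm : ∀ i, radix N i ≤ Rm) {r : ℝ} (hr : h.x .ans 0 = r) (hfeas : Feasible d N X r) :
    Runs (writePath k d) h (buildTicks k d (∏ i, radix N i) Rm + (31 * k + 27 + (d + 7)) *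
      (∏ i, radix N i) + d + 30) fun h' => ∃ L, PathSpec d N X r h' L := by
  set V := ∏ i, radix N i with hVd
  have hVp : 0 < V := radix_prod_pos hN
  refine Runs.seq' (buildTicks k d V Rm) ((31 * k + 27 + (d + 7)) * V + d + 30)
    ((runs_build hk h hN hc hX hRm).frame.mono le_rfl ?_) (by omega)
  rintro h1 ⟨⟨M, hB⟩, hF1⟩
  have hans1 : h1.x .ans 0 = r := by
    rw [hF1.x, hr]
    simp only [build, forLoop, buildNode, HP.wX, wX_seqL, pushEdge, advance, initFam, growNodes,
      reduceCtorEq, or_false, false_or, and_false, exists_false, not_exists, not_and]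
    intro j _ hj
    exact absurd (wX_copyPar j _ hj) (by simp)
  refine Runs.seq' 1 ((31 * k + 27 + (d + 7)) * V + d + 29) (Runs.cpR ?_) (by omega)
  simp only [NE.eval, hans1]
  have hB2 : Built d N X (h1.setX .piv 0 r) M := by
    refine ⟨hB.nV, hB.nM, hB.nM_le, fun u hu => ⟨fun j hj => ?_, ?_⟩, ?_⟩
    · simpa using (hB.node u hu).par j hj
    · simpa using (hB.node u hu).wt
    · simpa [HS.setX_col] using hB.edge
  set h2 := h1.setX .piv 0 r with h2d
  have hans2 : h2.x .ans 0 = r := by simp [h2d, hans1]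
  have hpiv2 : h2.x .piv 0 = r := by simp [h2d]
  have hE := hB2.edge
  have hM := hB.nM_le
  have hmark := runs_markComponents h2 hB2.nV hB2.nM
    (fun e he => by obtain ⟨u, i, hu, e1, -⟩ := hE.toEdge e he; rw [e1]; exact hu.1)
    (fun e he => by
      obtain ⟨u, i, hu, -, e1, -⟩ := hE.toEdge e he
      rw [e1]; exact (Nat.sub_le _ _).trans_lt hu.1)
    lePivot (fun e => h2.x .ew e ≤ r) (fun e he h' hF he' => by
      rw [lePivot, BE.holds, BE.holds, NE.eval, NE.eval, NE.eval, he',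
        hF.x _ (by simp [mark, forLoop]), hF.x _ (by simp [mark, forLoop]), hpiv2, not_lt])
  refine Runs.seq' (31 * M + 27 * V + 13) ((d + 7) * V + d + 16) (hmark.frame.mono le_rfl ?_)
    (by rw [← hVd] at hM; nlinarith)
  rintro h3 ⟨⟨-, hsf⟩, hF3⟩
  rw [hB2.edgeRel (· ≤ r)] at hsf
  have hpar3 : ∀ c, h3.x c = h2.x c := fun c => hF3.x c (by simp)
  obtain ⟨ord, hord⟩ := hsf.par
  set lab := h3.n (.sc .lab) with hlab
  set par := h3.n (.sc .par) with hpard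
  have hlab0 : lab 0 = 1 := hsf.lab_zero hVp
  have hlabt : lab (V - 1) = 1 := by
    by_cases hV : V = 1
    · rw [hV]; exact hlab0
    · have hconn : Relation.EqvGen (GraphRel d N X (· ≤ r)) 0 (V - 1) := by
        rcases hfeas with ⟨h, -⟩ | ⟨-, h⟩
        · exact (hV h).elim
        · exact h
      rw [← (hsf.lab_iff 0 hVp (V - 1) (by omega)).2 hconn, hlab0]
  have hstep : ∀ v < V, v ≠ 0 → lab v = 1 → par v < V ∧ ord (par v) < ord v ∧ ord v < V ∧
      lab (par v) = 1 ∧ Adj d N X r v (par v) := by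
    intro v hv hv0 hl
    rcases hord v hv with h | ⟨a1, a2, a3, a4, a5⟩
    · omega
    · exact ⟨a1, a2, a3, a4.trans hl, a5.symm⟩
  have hwt : nodeWt d N X (V - 1) ≤ r := by
    by_cases hV : V = 1
    · rcases hfeas with ⟨-, h⟩ | ⟨h, -⟩
      · rw [hV]; exact h
      · exact (h hV).elim
    · exact (hstep (V - 1) (by omega) (by omega) hlabt).2.2.2.2.wt.1
  -- The number of further steps from the node `v`.
  let rest : ℕ → ℕ := fun v => if v = 0 then 0 else ord v + 1
  have hV3 : h3.n (.sc .nV) 0 = V := by rw [hF3.n _ (by simp)]; exact hB2.nV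
  refine Runs.seq' 4 ((d + 7) * V + d + 12) (((Runs.sl (Q := fun h' => TraceInv d N X r h' ∧
    h'.n (.sc .fin) 0 = 0 ∧ h'.n (.sc .cur) 0 = V - 1 ∧ h'.n (.sc .len) 0 = 0) (by simp)
    ?_).mono (by simp) fun _ => id).frame.mono le_rfl ?_) (by omega)
  · refine ⟨⟨?_, ?_, ?_, ?_, ?_, ?_, ?_⟩, ?_, ?_, ?_⟩ <;> simp [HP.sl, hV3, ← hVd, hwt, hVp]
  rintro h4 ⟨⟨hI4, hf4, hc4, hl4⟩, hF4⟩
  have hlab4 : h4.n (.sc .lab) = lab := by rw [hF4.n _ (by simp)]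
  have hpar4 : h4.n (.sc .par) = par := by rw [hF4.n _ (by simp)]
  have hx4 : ∀ c, h4.x c = h2.x c := fun c => by rw [hF4.x _ (by simp), hpar3]
  have key := Runs.loop (b := .eq (vr .fin) (.lit 0)) (p := traceStep k d) (h₀ := h4)
    (fun h' => TraceInv d N X r h' ∧ lab (h'.n (.sc .cur) 0) = 1 ∧
      h'.n (.sc .len) 0 + rest (h'.n (.sc .cur) 0) ≤ V)
    (fun h' => if h'.n (.sc .fin) 0 = 0 then (rest (h'.n (.sc .cur) 0) + 1) * (d + 7) else 0)
    ⟨hI4, by rw [hc4]; exact hlabt, ?_⟩ ?_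
  · refine Runs.seq' _ 1 (key.frame.mono le_rfl ?_) ?_
    · rintro h5 ⟨⟨⟨hI, -, hle⟩, hb⟩, hF5⟩
      have hV5 : h5.n (.sc .nV) 0 = V := by
        rw [hF5.n _ (by simp [traceStep, findCenter]), hF4.n _ (by simp), hV3]
      obtain ⟨i1, i2, i3, i4, i5, i6, i7⟩ := hI
      have hf := i7 hb
      refine Runs.setN ?_
      refine ⟨h5.n (.sc .len) 0, ⟨by simp [hV5, hVd], by simp, by rw [← hVd]; omega, by simpa using i1, ?_,
        by simpa using i3, by simpa using i4, ?_⟩⟩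
      · simpa [i2] using hf.1
      · intro j hj
        simp only [HS.setN_n, NC.sc.injEq, reduceCtorEq, false_and, if_false]
        rcases hj.lt_or_eq with hlt | rfl
        · exact i6 j hlt
        · rw [i2, hf.1]; exact hf.2
    · simp only [hf4, if_true, hc4]
      have : rest (V - 1) ≤ V := by
        by_cases hV : V - 1 = 0
        · simp [rest, hV]
        · simp only [rest, hV, if_false]
          have := (hstep (V - 1) (by omega) hV hlabt).2.2.1
          omega
      nlinarith
  · rw [hl4, hc4, zero_add]
    by_cases hV : V - 1 = 0
    · simp [rest, hV]
    · simp only [rest, hV, if_false]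
      have := (hstep (V - 1) (by omega) hV hlabt).2.2.1
      omega
  · rintro h5 hF5 ⟨hI, hl, hle⟩ hb
    simp only [BE.holds, NE.eval] at hb
    have hp5 : h5.n (.sc .par) = par := by
      rw [hF5.n _ (by simp [traceStep, findCenter]), hpar4]
    have hx5 : ∀ c, (∀ c', c ≠ .par (idxG c')) → c ≠ .par idxR → h5.x c = h2.x c := by
      intro c h1 h2
      rw [hF5.x, hx4]
      simp only [HP.wX, traceStep, findCenter, wX_seqL]
      rintro (h | ⟨c', -, h⟩ | h | h | h | h)
      · exact h2 h
      · exact h1 c' h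
      all_goals exact h
    have hcur : h5.n (.sc .cur) 0 < V := by rw [← hI.last]; exact hI.lt _ le_rfl
    refine ⟨d + 6, (runs_traceStep hk h5 (r := r) ?_ ?_ hI ?_ hb).mono le_rfl ?_⟩
    · rw [hx5 _ (by simp) (by simp), hans2]
    · intro u hu j hj
      rw [hx5 _ ?_ ?_]
      · exact (hB2.node u hu).par j hj
      · intro c' he
        simp only [RC.par.injEq] at he
        rw [he] at hj
        simp only [idxG] at hj
        omega
      · intro he
        simp only [RC.par.injEq] at he
        rw [he] at hj
        simp only [idxR] at hj
        omega
    · intro h0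
      rw [hp5]
      have := hstep _ hcur h0 hl
      exact ⟨this.1, this.2.2.2.2⟩
    · rintro h6 ⟨hI6, hh⟩
      rw [if_pos hb]
      by_cases h0 : h5.n (.sc .cur) 0 = 0
      · rw [if_pos h0] at hh
        have hc6 := (hI6.fin (by rw [hh.1]; exact one_ne_zero)).1
        refine ⟨⟨hI6, by rw [hc6]; exact hlab0, ?_⟩, ?_⟩
        · rw [hc6, hh.2]; rwa [h0] at hle
        · rw [if_neg (by rw [hh.1]; exact one_ne_zero)]
          simp only [rest, h0, if_true]
          omega
      · rw [if_neg h0, hp5] at hh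
        have hs := hstep _ hcur h0 hl
        have hrest : rest (par (h5.n (.sc .cur) 0)) + 1 ≤ rest (h5.n (.sc .cur) 0) := by
          simp only [rest, h0, if_false]
          split_ifs <;> omega
        refine ⟨⟨hI6, by rw [hh.2.1]; exact hs.2.2.2.1, ?_⟩, ?_⟩
        · rw [hh.2.1, hh.2.2]; omega
        · rw [if_pos hh.1, hh.2.1]
          nlinarith

end Solve

end RealRAM

namespace RealRAM

/-! ### Input and output of the program -/

theorem getD_flatMap {α : Type*} (f : α → List ℝ) {pre post : List α} {a : α} {m : ℕ}
    (hm : m < (f a).length) :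
    ((pre ++ a :: post).flatMap f).getD ((pre.map fun b => (f b).length).sum + m) 0 =
      (f a).getD m 0 := by
  have hl : (pre.flatMap f).length = (pre.map fun b => (f b).length).sum := by
    rw [List.length_flatMap]
  rw [List.flatMap_append, List.flatMap_cons, List.getD_append_right _ _ _ _ (by omega), hl,
    Nat.add_sub_cancel_left, List.getD_append _ _ _ _ hm]

theorem finRange_eq_take_append {k : ℕ} (i : Fin k) : List.finRange k =
    (List.finRange k).take i ++ i :: (List.finRange k).drop (i + 1) := by
  have h : (i : ℕ) < (List.finRange k).length := by simp
  conv_lhs => rw [← List.take_append_drop i (List.finRange k), List.drop_eq_getElem_cons h]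
  simp

/-- The position of a coordinate in the input. -/
theorem getD_inputCoords {k d : ℕ} (π : Fin k → PolygonalCurve d) (i : Fin k)
    (j : Fin ((π i).numEdges + 1)) (c : Fin d) :
    (inputCoords π).getD (offset d (fun i => (π i).complexity) i + j * d + c) 0 =
      (π i).vertex j c := by
  have hlen : ∀ i : Fin k, ((List.finRange ((π i).numEdges + 1)).flatMap fun j =>
      List.ofFn fun c : Fin d => (π i).vertex j c).length = d * (π i).complexity := by
    intro i
    rw [List.length_flatMap]
    simp [PolygonalCurve.complexity, mul_comm]
  have hjc : (j : ℕ) * d + c < d * (π i).complexity := by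
    have := idx_lt j c
    rwa [mul_comm d]
  have hoff : offset d (fun i => (π i).complexity) i = (((List.finRange k).take i).map fun i =>
      ((List.finRange ((π i).numEdges + 1)).flatMap fun j =>
        List.ofFn fun c : Fin d => (π i).vertex j c).length).sum := by
    simp only [hlen, offset]
  have hj : ((j : ℕ) * d) = (((List.finRange ((π i).numEdges + 1)).take j).map fun j =>
      (List.ofFn fun c : Fin d => (π i).vertex j c).length).sum := by
    simp
  rw [inputCoords, hoff, add_assoc]
  conv_lhs => rw [finRange_eq_take_append i]
  rw [List.take_append_of_le_length (by simp [i.isLt.le]), List.take_take, min_self]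
  rw [getD_flatMap (fun i => (List.finRange ((π i).numEdges + 1)).flatMap fun j =>
        List.ofFn fun c : Fin d => (π i).vertex j c) (by rw [hlen]; exact hjc), hj]
  conv_lhs => rw [finRange_eq_take_append j]
  rw [List.take_append_of_le_length (by simp [j.isLt.le]), List.take_take, min_self]
  rw [getD_flatMap (fun j => List.ofFn fun c : Fin d => (π i).vertex j c) (by simp)]
  simp

theorem offset_lt {k d : ℕ} (N : Fin k → ℕ) (i : Fin k) {m : ℕ} (hm : m < d * N i) :
    offset d N i + m < ((List.finRange k).map fun i => d * N i).sum := by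
  conv_rhs => rw [finRange_eq_take_append i]
  rw [List.map_append, List.sum_append, List.map_cons, List.sum_cons, offset]
  omega

section Transfer

variable (k np : ℕ)

/-- The address of a scalar variable. -/
def addr (a : NA) : ℕ := width k np * 0 + (NC.sc a : NC k).code

/-- The content of a scalar variable, as an expression of the machine. -/
def scalar (a : NA) : NatExpr := (vr a : NE k).compile (width k np)

@[simp] theorem eval_scalar (s : State) (a : NA) : (scalar k np a).eval s = s.nat (addr k np a) := by
  simp [scalar, NE.compile, NatExpr.eval, addr]

/-- Assignment to a scalar variable. -/
def setScalar (a : NA) (e : NatExpr) : Program := .storeNat (.lit (addr k np a)) e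

theorem exec_setScalar (s : State) (a : NA) (e : NatExpr) : Exec (setScalar k np a e) s
    ⟨Function.update s.nat (addr k np a) (e.eval s), s.real⟩ (e.cost + 2) := by
  have := Exec.storeNat s (.lit (addr k np a)) e
  simp only [NatExpr.eval, NatExpr.cost] at this
  rw [show e.cost + 2 = 1 + e.cost + 1 by omega]
  exact this

/-- Move the input coordinates to the column `inp`, starting with the last one. -/
def spread : Program :=
  .loop (.natLt (.lit 0) (scalar k np .pos))
    (.seq (setScalar k np .pos (.sub (scalar k np .pos) (.lit 1)))
      (.storeReal (cell (width k np) (scalar k np .pos) 0) (.load (scalar k np .pos))))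

/-- A bound for the number of steps in one round of `spread`. -/
def spreadTicks : ℕ :=
  (BoolExpr.natLt (.lit 0) (scalar k np .pos)).cost + (NatExpr.sub (scalar k np .pos) (.lit 1)).cost +
    (cell (width k np) (scalar k np .pos) 0).cost + (RealExpr.load (scalar k np .pos)).cost + 4

/-- Moving coordinates from the last one down is safe: the cell `width * j` is at or after the cell
`j`, so it does not hold a coordinate that is still to be moved. -/
theorem exec_spread : ∀ (T : ℕ) (s : State), s.nat (addr k np .pos) = T →
    ∃ s' t, Exec (spread k np) s s' t ∧ t ≤ spreadTicks k np * (T + 1) ∧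
      s'.nat = Function.update s.nat (addr k np .pos) 0 ∧
      (∀ j < T, s'.real (width k np * j) = s.real j) ∧
      ∀ a, (∀ j < T, a ≠ width k np * j) → s'.real a = s.real a := by
  intro T
  induction T with
  | zero =>
    intro s hs
    refine ⟨s, _, Exec.loop_false (by simp [BoolExpr.Holds, NatExpr.eval, hs]), ?_, ?_, by simp,
      by simp⟩
    · simp only [spreadTicks]; omega
    · rw [← hs, Function.update_eq_self]
  | succ T ih =>
    intro s hs
    have hW : 0 < width k np := by simp [width]
    have e1 := exec_setScalar k np s .pos (.sub (scalar k np .pos) (.lit 1))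
    simp only [NatExpr.eval, eval_scalar, hs, Nat.add_sub_cancel] at e1
    set s1 : State := ⟨Function.update s.nat (addr k np .pos) T, s.real⟩ with hs1
    have e2 := Exec.storeReal s1 (cell (width k np) (scalar k np .pos) 0)
      (.load (scalar k np .pos))
    simp only [eval_cell, eval_scalar, RealExpr.eval, hs1, Function.update_self, add_zero] at e2
    rw [← hs1] at e2
    set s2 : State := ⟨Function.update s.nat (addr k np .pos) T,
      Function.update s.real (width k np * T) (s.real T)⟩ with hs2
    obtain ⟨s', t, e3, ht, hn, hr, hr'⟩ := ih s2 (by simp [hs2])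
    refine ⟨s', _, Exec.loop_true (by simp [BoolExpr.Holds, NatExpr.eval, hs]) (Exec.seq e1 e2) e3,
      ?_, ?_, ?_, ?_⟩
    · have : spreadTicks k np * (T + 1 + 1) = spreadTicks k np * (T + 1) + spreadTicks k np := by
        ring
      rw [this]
      simp only [NatExpr.cost, spreadTicks] at *
      omega
    · rw [hn, hs2]; simp
    · intro j hj
      rcases Nat.lt_succ_iff_lt_or_eq.1 hj with hlt | rfl
      · rw [hr j hlt, hs2]
        refine Function.update_of_ne ?_ _ _
        have := Nat.le_mul_of_pos_left T hW
        omega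
      · rw [hr' _ fun i hi he => ?_, hs2]
        · exact Function.update_self _ _ _
        · have := Nat.eq_of_mul_eq_mul_left hW he
          omega
    · intro a ha
      rw [hr' a fun j hj => ha j (by omega), hs2]
      exact Function.update_of_ne (ha T (by omega)) _ _

variable (d : ℕ)

/-- Write the given coordinates of the center of the `ib`-th node of the path from `out` on. -/
def emitCoords (o : ℕ) : List (Fin d) → Program
  | [] => .skip
  | c :: l => .seq (.storeReal (.add (scalar k np .out) (.lit c))
      (.load (cell (width k np) ((ar .pth (vr .ib) : NE k).compile (width k np)) (o + c))))
      (emitCoords o l)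

/-- The number of steps for one coordinate. -/
def emitTicks : ℕ :=
  (scalar k np .out).cost + 5 +
    (mulConst (width k np) ((ar .pth (vr .ib) : NE k).compile (width k np))).cost + 3

theorem exec_emitCoords (o : ℕ) (l : List (Fin d)) : ∀ (s : State) (q p : ℕ),
    s.nat (addr k np .out) = q →
    s.nat (width k np * s.nat (addr k np .ib) + (NC.sc .pth : NC k).code) = p →
    (∀ c : Fin d, width k np * p + (o + c) < q) →
    ∃ s' t, Exec (emitCoords k np d o l) s s' t ∧ t ≤ emitTicks k np * l.length + 1 ∧
      s'.nat = s.nat ∧ (∀ c ∈ l, s'.real (q + c) = s.real (width k np * p + (o + c))) ∧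
      ∀ a, (∀ c ∈ l, a ≠ q + c) → s'.real a = s.real a := by
  induction l with
  | nil => exact fun s q p _ _ _ => ⟨s, 1, Exec.skip s, by simp, rfl, by simp, fun _ _ => rfl⟩
  | cons c l ih =>
    intro s q p hq hp hlt
    have e1 := Exec.storeReal s (.add (scalar k np .out) (.lit c))
      (.load (cell (width k np) ((ar .pth (vr .ib) : NE k).compile (width k np)) (o + c)))
    have hsrc : ((ar .pth (vr .ib) : NE k).compile (width k np)).eval s = p := by
      rw [NE.eval_compile]
      exact hp
    simp only [NatExpr.eval, eval_scalar, hq, RealExpr.eval, eval_cell, hsrc] at e1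
    obtain ⟨s', t, e2, ht, hn, hr, hr'⟩ := ih ⟨s.nat, Function.update s.real (q + c)
      (s.real (width k np * p + (o + c)))⟩ q p hq hp hlt
    refine ⟨s', _, Exec.seq e1 e2, ?_, hn, fun c' hc' => ?_, fun a ha => ?_⟩
    · simp only [NatExpr.cost, RealExpr.cost, cell, List.length_cons, emitTicks] at *
      rw [mul_add]
      omega
    · by_cases hm : c' ∈ l
      · rw [hr c' hm]
        exact Function.update_of_ne (by have := hlt c'; omega) _ _
      · have hcc : c' = c := by simpa [hm] using hc'
        subst hcc
        rw [hr' _ fun c'' hc'' he => ?_]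
        · exact Function.update_self _ _ _
        · have : c' = c'' := Fin.ext (by omega)
          exact hm (this ▸ hc'')
    · rw [hr' a fun c' hc' => ha c' (List.mem_cons_of_mem _ hc')]
      exact Function.update_of_ne (ha c List.mem_cons_self) _ _

/-- Write the centers of the first `ib` nodes of the path from `out` on, the last one first. -/
def emit (o : ℕ) : Program :=
  .loop (.natLt (.lit 0) (scalar k np .ib))
    (.seq (setScalar k np .ib (.sub (scalar k np .ib) (.lit 1)))
      (.seq (emitCoords k np d o (List.finRange d))
        (setScalar k np .out (.add (scalar k np .out) (.lit d)))))

/-- A bound for the number of steps in one round of `emit`. -/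
def emitLoopTicks : ℕ :=
  (BoolExpr.natLt (.lit 0) (scalar k np .ib)).cost + (NatExpr.sub (scalar k np .ib) (.lit 1)).cost +
    emitTicks k np * d + (NatExpr.add (scalar k np .out) (.lit d)).cost + 6

theorem addr_injective : Function.Injective (addr k np) := by
  intro a b h
  have : (NC.sc a : NC k) = .sc b := NC.code_injective (by simpa [addr] using h)
  simpa using this

/-- A scalar variable is not an entry of the path. -/
theorem addr_ne_pth (a : NA) (ha : a ≠ .pth) (j : ℕ) :
    width k np * j + (NC.sc .pth : NC k).code ≠ addr k np a := by
  intro h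
  have := row_col_inj (NC.code_lt np (NC.sc .pth : NC k)) (NC.code_lt np (NC.sc a : NC k)) h
  exact ha (by simpa using (NC.code_injective this.2).symm)

/-- The output is written beyond the cells that hold the centers, so these are not overwritten. -/
theorem exec_emit (o : ℕ) : ∀ (n : ℕ) (s : State) (q : ℕ) (p : ℕ → ℕ),
    s.nat (addr k np .ib) = n → s.nat (addr k np .out) = q →
    (∀ j < n, s.nat (width k np * j + (NC.sc .pth : NC k).code) = p j) →
    (∀ j < n, ∀ c : Fin d, width k np * p j + (o + c) < q) →
    ∃ s' t, Exec (emit k np d o) s s' t ∧ t ≤ emitLoopTicks k np d * (n + 1) ∧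
      (∀ a, a ≠ addr k np .ib → a ≠ addr k np .out → s'.nat a = s.nat a) ∧
      (∀ a < q, s'.real a = s.real a) ∧
      ∀ j < n, ∀ c : Fin d,
        s'.real (q + j * d + c) = s.real (width k np * p (n - 1 - j) + (o + c)) := by
  intro n
  induction n with
  | zero =>
    intro s q p hs _ _ _
    refine ⟨s, _, Exec.loop_false (by simp [BoolExpr.Holds, NatExpr.eval, hs]), ?_,
      fun _ _ _ => rfl, fun _ _ => rfl, by simp⟩
    simp only [emitLoopTicks]; omega
  | succ n ih =>
    intro s q p hs hq hp hlt
    have hio : addr k np .out ≠ addr k np .ib := fun h => by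
      simpa using addr_injective k np h
    have e1 := exec_setScalar k np s .ib (.sub (scalar k np .ib) (.lit 1))
    simp only [NatExpr.eval, eval_scalar, hs, Nat.add_sub_cancel] at e1
    set s1 : State := ⟨Function.update s.nat (addr k np .ib) n, s.real⟩ with hs1
    have hq1 : s1.nat (addr k np .out) = q := by
      rw [hs1]; exact (Function.update_of_ne hio _ _).trans hq
    have hp1 : s1.nat (width k np * s1.nat (addr k np .ib) + (NC.sc .pth : NC k).code) = p n := by
      have : s1.nat (addr k np .ib) = n := Function.update_self _ _ _
      rw [this, ← hp n (by omega)]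
      exact Function.update_of_ne (addr_ne_pth k np .ib (by simp) n) _ _
    obtain ⟨s2, t2, e2, ht2, hn2, hr2, hr2'⟩ := exec_emitCoords k np d o (List.finRange d) s1 q
      (p n) hq1 hp1 (hlt n (by omega))
    have e3 := exec_setScalar k np s2 .out (.add (scalar k np .out) (.lit d))
    simp only [NatExpr.eval, eval_scalar, hn2, hq1] at e3
    set s3 : State := ⟨Function.update s1.nat (addr k np .out) (q + d), s2.real⟩ with hs3
    have hb3 : s3.nat (addr k np .ib) = n := by
      rw [hs3]
      refine (Function.update_of_ne hio.symm _ _).trans ?_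
      exact Function.update_self _ _ _
    obtain ⟨s', t, e4, ht, hn, hr, hr'⟩ := ih s3 (q + d) p hb3
      (by rw [hs3]; exact Function.update_self _ _ _) (fun j hj => by
        rw [hs3]
        refine (Function.update_of_ne (addr_ne_pth k np .out (by simp) j) _ _).trans ?_
        refine (Function.update_of_ne (addr_ne_pth k np .ib (by simp) j) _ _).trans ?_
        exact hp j (by omega)) (fun j hj c => by have := hlt j (by omega) c; omega)
    refine ⟨s', _, Exec.loop_true (by simp [BoolExpr.Holds, NatExpr.eval, hs])
      (Exec.seq e1 (Exec.seq e2 e3)) e4, ?_, ?_, ?_, ?_⟩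
    · have : emitLoopTicks k np d * (n + 1 + 1) =
          emitLoopTicks k np d * (n + 1) + emitLoopTicks k np d := by ring
      rw [this]
      rw [List.length_finRange] at ht2
      simp only [NatExpr.cost, emitLoopTicks] at *
      omega
    · intro a ha1 ha2
      rw [hn a ha1 ha2, hs3]
      exact (Function.update_of_ne ha2 _ _).trans (Function.update_of_ne ha1 _ _)
    · intro a ha
      rw [hr a (by omega)]
      exact hr2' a fun c _ => by omega
    · intro j hj c
      rcases j with _ | j
      · rw [zero_mul, add_zero, hr _ (by have := c.isLt; omega)]
        exact hr2 c (List.mem_finRange c)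
      · have h1 : q + (j + 1) * d + c = q + d + j * d + c := by ring
        have h2 : n + 1 - 1 - (j + 1) = n - 1 - j := by omega
        rw [h1, hr' j (by omega) c, h2]
        exact hr2' _ fun c' _ => by have := hlt (n - 1 - j) (by omega) c; omega

end Transfer

end RealRAM

namespace RealRAM

section Solver

variable {k d : ℕ}

/-- Programs that do not change the memory for real numbers. -/
def Program.NatOnly : Program → Prop
  | .skip => True
  | .storeNat _ _ => True
  | .storeReal _ _ => False
  | .minimize _ _ _ => False
  | .seq p q => p.NatOnly ∧ q.NatOnly
  | .cond _ p q => p.NatOnly ∧ q.NatOnly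
  | .loop _ p => p.NatOnly

theorem Program.NatOnly.real_eq {p : Program} {s s' : State} {t : ℕ} (he : Exec p s s' t) :
    p.NatOnly → s'.real = s.real := by
  induction he with
  | skip | storeNat | loop_false => exact fun _ => rfl
  | storeReal | minimize => exact fun h => h.elim
  | seq _ _ ih ih' => exact fun h => (ih' h.2).trans (ih h.1)
  | cond_true _ _ ih => exact fun h => ih h.1
  | cond_false _ _ ih => exact fun h => ih h.2
  | loop_true _ _ _ ih ih' => exact fun h => (ih' h).trans (ih h)

/-- Store the number of input coordinates in `pos`. -/
def countCoords (k d : ℕ) : HP k (numPar k d) :=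
  put .pos (.lit 0) ;;
    seqL (List.finRange k) fun i => put .pos (.add (vr .pos) (.smul d (fv .cnt i)))

theorem natOnly_countCoords (k d : ℕ) : (countCoords k d).compile.NatOnly := by
  have : ∀ l : List (Fin k), (seqL (np := numPar k d) l fun i =>
      put .pos (.add (vr .pos) (.smul d (fv .cnt i)))).compile.NatOnly := by
    intro l
    induction l with
    | nil => trivial
    | cons a l ih => exact ⟨trivial, ih⟩
  exact ⟨trivial, this _⟩

theorem runs_countCoords (h : HS k (numPar k d)) {N : Fin k → ℕ}
    (hc : ∀ i, h.n (.fam .cnt i) 0 = N i) :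
    Runs (countCoords k d) h (k + 2) fun h' =>
      h'.n (.sc .pos) 0 = ((List.finRange k).map fun i => d * N i).sum := by
  refine Runs.seq' 1 (k + 1) (Runs.setN ?_) (by omega)
  refine (Runs.seqL 1 (fun pre h' => h'.n (.sc .pos) 0 = (pre.map fun i => d * N i).sum)
    (by simp) ?_).mono (by simp) fun _ => id
  intro pre a post hl h' hF hI
  have : h'.n (.fam .cnt a) 0 = N a := by rw [hF.n _ (by simp)]; simp [hc]
  refine Runs.setN ?_
  simp [hI, this]

/-- The part of the program that works on columns. -/
def solveGraph (k d : ℕ) : HP k (numPar k d) :=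
  findRadius k d ;; writePath k d ;; put .ib (vr .len) ;;
    put .out (.smul (width k (numPar k d)) (vr .nV))

/-- A bound for the number of steps of `solveGraph`. -/
def solveTicks (k d V Rm : ℕ) : ℕ :=
  (buildTicks k d V Rm + 6 + (60 + 40000 * k) * V) +
    (buildTicks k d V Rm + (31 * k + 27 + (d + 7)) * V + d + 30) + 2

/-- The coordinates of the output start at the first row that belongs to no node. -/
theorem runs_solveGraph (hk : 0 < k) (h : HS k (numPar k d)) {N : Fin k → ℕ} (hN : ∀ i, 0 < N i)
    (hc : ∀ i, h.n (.fam .cnt i) 0 = N i) {Rm : ℕ} (hRm : ∀ i, radix N i ≤ Rm) :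
    Runs (solveGraph k d) h (solveTicks k d (∏ i, radix N i) Rm) fun h' => ∃ L r,
      PathSpec d N (h.x .inp) r h' L ∧ (∀ r', Feasible d N (h.x .inp) r' ↔ r ≤ r') ∧
      h'.n (.sc .ib) 0 = L + 1 ∧
      h'.n (.sc .out) 0 = width k (numPar k d) * ∏ i, radix N i := by
  set V := ∏ i, radix N i with hVd
  refine Runs.seq' (buildTicks k d V Rm + 6 + (60 + 40000 * k) * V)
    ((buildTicks k d V Rm + (31 * k + 27 + (d + 7)) * V + d + 30) + 2)
    ((runs_findRadius hk h hN hc rfl hRm).frame.mono le_rfl ?_)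
    (by simp only [solveTicks]; omega)
  rintro h1 ⟨hfeas, hF1⟩
  have hx1 : h1.x .inp = h.x .inp := by
    rw [hF1.x]
    simp only [findRadius, bottleneck, round, findPivot, reduceLevel, reduceBlock, rankSort,
      rankBody, sampleBlock, contract, newId, wX_markComponents,
      build, forLoop, buildNode, HP.wX, wX_seqL, pushEdge, advance, initFam, growNodes,
      reduceCtorEq, or_false, false_or, and_false, exists_false, not_exists, not_and]
    intro j _ hj
    exact absurd (wX_copyPar j _ hj) (by simp)
  have hc1 : ∀ i, h1.n (.fam .cnt i) 0 = N i := by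
    intro i
    rw [hF1.n, hc]
    simp [findRadius, bottleneck, round, findPivot, reduceLevel, reduceBlock, rankSort,
      rankBody, sampleBlock, contract, newId,
      build, forLoop, buildNode, pushEdge, advance, initFam, growNodes]
  refine Runs.seq' (buildTicks k d V Rm + (31 * k + 27 + (d + 7)) * V + d + 30) 2
    ((runs_writePath hk h1 hN hc1 hx1 hRm rfl ((hfeas _).2 le_rfl)).mono le_rfl ?_) (by omega)
  rintro h2 ⟨L, hP⟩
  refine (Runs.sl (by simp) ?_).mono (by simp) fun _ => id
  refine ⟨L, h1.x .ans 0, ?_, hfeas, ?_, ?_⟩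
  · obtain ⟨q1, q2, q3, q4, q5, q6, q7, q8⟩ := hP
    constructor <;>
      try simp only [HP.sl, HS.setN_n, NC.sc.injEq, reduceCtorEq, false_and, if_false]
    · exact q1
    · exact q2
    · exact q3
    · exact q4
    · exact q5
    · exact q6
    · exact q7
    · exact q8
  · simp [HP.sl, hP.len]
  · simp [HP.sl, hP.nV, hVd]

/-- The column of the first coordinate of the center. -/
def centerCol (k d : ℕ) : ℕ := 6 + (2 * (k * d) + 1)

/-- The whole program. -/
def solver (k d : ℕ) : Program :=
  .seq (countCoords k d).compile (.seq (spread k (numPar k d)) (.seq (solveGraph k d).compile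
    (.seq (emit k (numPar k d) d (centerCol k d))
      (.seq (.storeNat (.lit 0) (scalar k (numPar k d) .len))
        (.storeNat (.lit 1) (cell (width k (numPar k d)) (scalar k (numPar k d) .nV) 0))))))

/-- A path of nodes with centers that shows that the squared radius `r` suffices. -/
structure GoodPath (d : ℕ) (N : Fin k → ℕ) (X : ℕ → ℝ) (r : ℝ) (L : ℕ) (p : ℕ → ℕ)
    (γ : ℕ → Fin d → ℝ) : Prop where
  first : p 0 = 0
  last : p L = ∏ i, radix N i - 1
  adj : ∀ j < L, Adj d N X r (p j) (p (j + 1))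
  center : ∀ j ≤ L, ∃ t, SegFeas (segA d N X (p j)) (segB d N X (p j)) r t (γ j)

/-- A bound for the number of steps of the whole program. -/
def solverTicks (k d n V : ℕ) : ℕ :=
  (countCoords k d).K * (k + 2) + spreadTicks k (numPar k d) * (d * n + 1) +
    (solveGraph k d).K * solveTicks k d V (2 * n) + emitLoopTicks k (numPar k d) d * (V + 2) +
    ((scalar k (numPar k d) .len).cost + 2 +
      ((cell (width k (numPar k d)) (scalar k (numPar k d) .nV) 0).cost + 2))

/-- The program halts, and its output is the sequence of the centers of a path in the free space graph,
whose nodes have weight at most the least feasible squared radius `r`. -/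
theorem exec_solver (hk : 0 < k) (π : Fin k → PolygonalCurve d) :
    ∃ s t X L p r γ, Exec (solver k d) (inputState π) s t ∧
      t ≤ solverTicks k d (∑ i, (π i).complexity) (∏ i, radix (fun i => (π i).complexity) i) ∧
      (∀ (i : Fin k) (j : Fin ((π i).numEdges + 1)) (c : Fin d),
        X (offset d (fun i => (π i).complexity) i + j * d + c) = (π i).vertex j c) ∧
      L ≤ ∏ i, radix (fun i => (π i).complexity) i ∧
      s.nat 0 = L + 1 ∧ (∀ j ≤ L, ∀ c : Fin d, s.real (s.nat 1 + j * d + c) = γ j c) ∧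
      GoodPath d (fun i => (π i).complexity) X r L p γ ∧
      ∀ r', Feasible d (fun i => (π i).complexity) X r' ↔ r ≤ r' := by
  set N : Fin k → ℕ := fun i => (π i).complexity with hNd
  set V := ∏ i, radix N i with hVd
  set n := ∑ i, (π i).complexity with hnd
  set np := numPar k d with hnp
  set W := width k np with hW
  have hN : ∀ i, 0 < N i := fun i => Nat.succ_pos _
  have hWp : 0 < W := by simp [hW, width]
  have hVp : 0 < V := radix_prod_pos hN
  have hRm : ∀ i, radix N i ≤ 2 * n := fun i => by
    have : N i ≤ n := Finset.single_le_sum (f := N) (fun _ _ => Nat.zero_le _) (Finset.mem_univ i)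
    simp only [radix]
    omega
  have hcnt0 : ∀ i, (view k np (inputState π)).n (.fam .cnt i) 0 = N i := by
    intro i
    have : (i : ℕ) < k := i.isLt
    simp [view, inputState, NC.code, NF.num, hNd]
  obtain ⟨s1, t1, e1, ht1, hpos, hF1⟩ := (runs_countCoords _ hcnt0).frame _ rfl
  have hT : ((List.finRange k).map fun i => d * N i).sum = d * n := by
    rw [List.sum_map_mul_left, hnd, Fin.sum_univ_def]
  have hreal1 : s1.real = (inputState π).real :=
    Program.NatOnly.real_eq e1 (natOnly_countCoords k d)
  obtain ⟨s2, t2, e2, ht2, hn2, hr2, -⟩ := exec_spread k np (d * n) s1 (by rw [← hT, ← hpos]; rfl)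
  have hcnt2 : ∀ i, (view k np s2).n (.fam .cnt i) 0 = N i := by
    intro i
    have h1 : (view k np s1).n (.fam .cnt i) 0 = N i := by
      rw [hF1.n _ (by simp [countCoords]), hcnt0]
    rw [← h1]
    simp only [view, hn2]
    refine Function.update_of_ne ?_ _ _
    simp only [addr]
    intro he
    have := NC.code_injective (add_left_cancel he)
    simp at this
  set X := (view k np s2).x .inp with hXd
  have hX : ∀ (i : Fin k) (j : Fin ((π i).numEdges + 1)) (c : Fin d),
      X (offset d N i + j * d + c) = (π i).vertex j c := by
    intro i j c
    have hlt : offset d N i + j * d + c < d * n := by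
      rw [← hT, add_assoc]
      refine offset_lt N i ?_
      have := idx_lt j c
      rwa [mul_comm d]
    have : X (offset d N i + j * d + c) = s2.real (W * (offset d N i + j * d + c)) := by
      simp [hXd, view, RC.code, hW]
    rw [this, hr2 _ hlt, hreal1]
    exact getD_inputCoords π i j c
  obtain ⟨s3, t3, e3, ht3, L, r, hP, hfeas, hib, hout⟩ :=
    (runs_solveGraph hk (view k np s2) hN hcnt2 hRm) s2 rfl
  set p := fun j => s3.nat (W * j + (NC.sc .pth : NC k).code) with hpd
  have hcol : ∀ c : Fin d, (RC.par (idxG c) : RC np).code = centerCol k d + c := by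
    intro c
    simp only [RC.code, idxG, centerCol]
    omega
  obtain ⟨s4, t4, e4, ht4, hn4, -, hr4⟩ := exec_emit k np d (centerCol k d) (L + 1) s3 (W * V) p
    hib hout (fun j _ => rfl) (fun j hj c => by
      change W * p j + (centerCol k d + c) < W * V
      have h1 : p j + 1 ≤ V := hP.lt j (by omega)
      have h2 := RC.code_lt k (RC.par (idxG c) : RC np)
      rw [hcol] at h2
      change _ < W at h2
      have h3 := Nat.mul_le_mul_left W h1
      rw [mul_add, mul_one] at h3
      omega)
  have hlen4 : s4.nat (addr k np .len) = L + 1 := by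
    rw [hn4 _ (fun h => by simpa using addr_injective k np h)
      (fun h => by simpa using addr_injective k np h)]
    exact hP.len
  have hV4 : s4.nat (addr k np .nV) = V := by
    rw [hn4 _ (fun h => by simpa using addr_injective k np h)
      (fun h => by simpa using addr_injective k np h)]
    exact hP.nV
  have e5 := Exec.storeNat s4 (.lit 0) (scalar k np .len)
  simp only [NatExpr.eval, eval_scalar, hlen4] at e5
  set s5 : State := ⟨Function.update s4.nat 0 (L + 1), s4.real⟩ with hs5
  have hV5 : s5.nat (addr k np .nV) = V := by
    rw [← hV4]
    change Function.update s4.nat 0 (L + 1) (addr k np .nV) = s4.nat (addr k np .nV)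
    refine Function.update_of_ne ?_ _ _
    simp only [addr, NC.code]
    omega
  have e6 := Exec.storeNat s5 (.lit 1) (cell W (scalar k np .nV) 0)
  simp only [NatExpr.eval, eval_cell, eval_scalar, hV5, add_zero] at e6
  set s6 : State := ⟨Function.update s5.nat 1 (W * V), s5.real⟩ with hs6
  have h60 : s6.nat 0 = L + 1 := by
    change Function.update (Function.update s4.nat 0 (L + 1)) 1 (W * V) 0 = L + 1
    rw [Function.update_of_ne zero_ne_one, Function.update_self]
  have h61 : s6.nat 1 = W * V := by
    change Function.update (Function.update s4.nat 0 (L + 1)) 1 (W * V) 1 = W * V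
    rw [Function.update_self]
  refine ⟨s6, _, X, L, fun j => p (L - j), r, fun j c => s3.real (W * p (L - j) + (centerCol k d + c)),
    Exec.seq e1 (Exec.seq e2 (Exec.seq e3 (Exec.seq e4 (Exec.seq e5 e6)))), ?_, hX, hP.le, h60, ?_,
    ⟨?_, ?_, ?_, ?_⟩, hfeas⟩
  · have h4 : emitLoopTicks k np d * (L + 1 + 1) ≤ emitLoopTicks k np d * (V + 2) :=
      Nat.mul_le_mul_left _ (by have := hP.le; omega)
    rw [← hVd] at ht3
    simp only [solverTicks, NatExpr.cost, ← hnp, ← hW]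
    omega
  · intro j hj c
    rw [h61]
    exact hr4 j (by omega) c
  · simp only [Nat.sub_zero]
    exact hP.last
  · simp only [Nat.sub_self]
    exact hP.first
  · intro j hj
    have := hP.adj (L - (j + 1)) (by omega)
    have h1 : L - (j + 1) + 1 = L - j := by omega
    rw [h1] at this
    exact this.symm
  · intro j hj
    obtain ⟨t, ht⟩ := hP.center (L - j) (by omega)
    refine ⟨t, ?_⟩
    have hcen : (fun c : Fin d => s3.real (W * p (L - j) + (centerCol k d + c))) =
        fun c => (view k np s3).x (.par (idxG c)) ((view k np s3).n (.sc .pth) (L - j)) := by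
      funext c
      simp only [view, hcol]
      rfl
    simp only [hcen]
    exact ht

/-- The running time is linear in the size of the input and the number of nodes. -/
theorem solverTicks_le (k d : ℕ) : ∃ C, ∀ n V, 0 < n → solverTicks k d n V ≤ C * (n + V) := by
  have hb : ∀ n V, 0 < n → buildTicks k d V (2 * n) ≤ (19 * k + 6 + (nodeTicks k d + 2)) * (n + V) := by
    intro n V hn
    simp only [buildTicks]
    nlinarith [Nat.zero_le (k * V), Nat.zero_le (nodeTicks k d * n), Nat.mul_le_mul_left k hn]
  have hs : ∀ n V, 0 < n → solveTicks k d V (2 * n) ≤ (2 * (19 * k + 6 + (nodeTicks k d + 2)) + 6 +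
      (60 + 40000 * k) + (31 * k + 27 + (d + 7)) + d + 30 + 2) * (n + V) := by
    intro n V hn
    have := hb n V hn
    simp only [solveTicks]
    set B := 19 * k + 6 + (nodeTicks k d + 2)
    set a := 60 + 40000 * k
    set b := 31 * k + 27 + (d + 7)
    nlinarith [Nat.zero_le (a * n), Nat.zero_le (b * n), Nat.mul_le_mul_left d hn]
  obtain ⟨c, hc⟩ : ∃ c, ∀ n V, 0 < n → solveTicks k d V (2 * n) ≤ c * (n + V) := ⟨_, hs⟩
  set E := (scalar k (numPar k d) .len).cost + 2 +
      ((cell (width k (numPar k d)) (scalar k (numPar k d) .nV) 0).cost + 2) with hE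
  refine ⟨(countCoords k d).K * (k + 2) + spreadTicks k (numPar k d) * (d + 1) +
    (solveGraph k d).K * c + emitLoopTicks k (numPar k d) d * 2 + E, fun n V hn => ?_⟩
  simp only [solverTicks, ← hE]
  have h0 : 1 ≤ n + V := by omega
  have h1 : (countCoords k d).K * (k + 2) ≤ (countCoords k d).K * (k + 2) * (n + V) :=
    Nat.le_mul_of_pos_right _ h0
  have h2 : spreadTicks k (numPar k d) * (d * n + 1) ≤
      spreadTicks k (numPar k d) * (d + 1) * (n + V) := by
    rw [mul_assoc]
    refine Nat.mul_le_mul_left _ ?_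
    nlinarith [Nat.zero_le (d * V)]
  have h3 : (solveGraph k d).K * solveTicks k d V (2 * n) ≤ (solveGraph k d).K * c * (n + V) := by
    rw [mul_assoc]
    exact Nat.mul_le_mul_left _ (hc n V hn)
  have h4 : emitLoopTicks k (numPar k d) d * (V + 2) ≤
      emitLoopTicks k (numPar k d) d * 2 * (n + V) := by
    rw [mul_assoc]
    exact Nat.mul_le_mul_left _ (by omega)
  have h5 : E ≤ E * (n + V) := Nat.le_mul_of_pos_right _ h0
  simp only [add_mul] at *
  omega

end Solver

end RealRAM

namespace RealRAM

/-! ### Piecewise linear maps -/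

section PiecewiseLinear

variable {E : Type*} [NormedAddCommGroup E] [NormedSpace ℝ E]

/-- The map on `[0, L]` with the values `y j` at the integers that is linear in between. -/
def pl (L : ℕ) (y : ℕ → E) (ρ : ℝ) : E :=
  y 0 + ∑ j ∈ Finset.range L, (max 0 (min 1 (ρ - j)) : ℝ) • (y (j + 1) - y j)

theorem continuous_pl (L : ℕ) (y : ℕ → E) : Continuous (pl L y) := by
  unfold pl
  fun_prop

theorem pl_add (L : ℕ) (y : ℕ → E) {j : ℕ} (hj : j < L) {t : ℝ} (h0 : 0 ≤ t) (h1 : t ≤ 1) :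
    pl L y (j + t) = y j + t • (y (j + 1) - y j) := by
  have hsub : ∑ i ∈ Finset.range (j + 1), (max 0 (min 1 ((j : ℝ) + t - i)) : ℝ) •
      (y (i + 1) - y i) = ∑ i ∈ Finset.range L, (max 0 (min 1 ((j : ℝ) + t - i)) : ℝ) •
      (y (i + 1) - y i) := by
    refine Finset.sum_subset (Finset.range_subset_range.2 hj) fun i _ hi => ?_
    have : (j : ℝ) + 1 ≤ i := by
      have : j + 1 ≤ i := by simpa using hi
      exact_mod_cast this
    rw [max_eq_left ((min_le_right _ _).trans (by linarith)), zero_smul]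
  have hlow : ∑ i ∈ Finset.range j, (max 0 (min 1 ((j : ℝ) + t - i)) : ℝ) • (y (i + 1) - y i) =
      ∑ i ∈ Finset.range j, (y (i + 1) - y i) := by
    refine Finset.sum_congr rfl fun i hi => ?_
    have : (i : ℝ) + 1 ≤ j := by exact_mod_cast Finset.mem_range.1 hi
    rw [min_eq_left (by linarith), max_eq_right zero_le_one, one_smul]
  rw [pl, ← hsub, Finset.sum_range_succ, hlow, Finset.sum_range_sub, add_sub_cancel_left,
    min_eq_right h1, max_eq_right h0]
  abel

theorem pl_natCast (L : ℕ) (y : ℕ → E) {j : ℕ} (hj : j ≤ L) : pl L y j = y j := by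
  rcases j with _ | j
  · simp only [pl, Nat.cast_zero, zero_sub]
    rw [Finset.sum_eq_zero, add_zero]
    intro i _
    rw [max_eq_left ((min_le_right _ _).trans (neg_nonpos.2 (Nat.cast_nonneg i))), zero_smul]
  · have := pl_add L y (j := j) hj zero_le_one le_rfl
    rw [Nat.cast_add, Nat.cast_one, this, one_smul, add_sub_cancel]

theorem exists_eq_add {L : ℕ} (hL : 0 < L) {ρ : ℝ} (h0 : 0 ≤ ρ) (h1 : ρ ≤ L) :
    ∃ j < L, ∃ t : ℝ, 0 ≤ t ∧ t ≤ 1 ∧ ρ = j + t := by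
  have hf := Nat.floor_le h0
  have hf' := Nat.lt_floor_add_one ρ
  by_cases hlt : ⌊ρ⌋₊ < L
  · exact ⟨⌊ρ⌋₊, hlt, ρ - ⌊ρ⌋₊, by linarith, by linarith, by ring⟩
  · have h2 : (L : ℝ) ≤ ⌊ρ⌋₊ := by exact_mod_cast not_lt.1 hlt
    have h3 : ρ = L := le_antisymm h1 (h2.trans hf)
    refine ⟨L - 1, by omega, 1, zero_le_one, le_rfl, ?_⟩
    rw [h3, Nat.cast_sub hL, Nat.cast_one]
    ring

/-- A convex condition that holds at the breakpoints holds everywhere. -/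
theorem pl_mem {L : ℕ} {y : ℕ → E} {s : Set E} (hs : Convex ℝ s) (hy : ∀ j ≤ L, y j ∈ s) {ρ : ℝ}
    (h0 : 0 ≤ ρ) (h1 : ρ ≤ L) : pl L y ρ ∈ s := by
  rcases Nat.eq_zero_or_pos L with rfl | hL
  · simpa [pl] using hy 0 le_rfl
  · obtain ⟨j, hj, t, ht0, ht1, rfl⟩ := exists_eq_add hL h0 h1
    rw [pl_add L y hj ht0 ht1]
    exact hs.add_smul_sub_mem (hy j hj.le) (hy (j + 1) hj) ⟨ht0, ht1⟩

end PiecewiseLinear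

/-! ### The weak Fréchet distance of polygonal curves -/

section Frechet

variable {d : ℕ}

/-- The vertices, as a sequence. -/
def vtx (π : PolygonalCurve d) (j : ℕ) : Pt d :=
  if h : j < π.numEdges + 1 then π.vertex ⟨j, h⟩ else 0

/-- A polygonal curve is piecewise linear with its vertices as values. -/
theorem toCurve_eq_pl (π : PolygonalCurve d) (t : unitInterval) :
    π.toCurve t = pl π.numEdges (vtx π) (π.numEdges * t) := by
  change π.vertex 0 + _ = _
  rw [pl, Finset.sum_range]
  congr 1
  refine Finset.sum_congr rfl fun j _ => ?_
  have h1 : vtx π (j + 1) = π.vertex j.succ := by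
    rw [vtx, dif_pos (by omega)]
    rfl
  have h2 : vtx π j = π.vertex j.castSucc := by
    rw [vtx, dif_pos (by omega)]
    rfl
  rw [h1, h2]

theorem bddAbove_dist (π σ : Curve d) (f g : C(unitInterval, unitInterval)) :
    BddAbove (Set.range fun s : unitInterval => dist (π (f s)) (σ (g s))) :=
  (isCompact_range (by fun_prop)).bddAbove

theorem dist_le_curveWidth (π σ : Curve d) (f g : C(unitInterval, unitInterval))
    (s : unitInterval) : dist (π (f s)) (σ (g s)) ≤ curveWidth π σ f g :=
  le_ciSup (bddAbove_dist π σ f g) s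

theorem curveWidth_nonneg (π σ : Curve d) (f g : C(unitInterval, unitInterval)) :
    0 ≤ curveWidth π σ f g := dist_nonneg.trans (dist_le_curveWidth π σ f g 0)

theorem weakFrechet_nonneg (π σ : Curve d) : 0 ≤ weakFrechet π σ := by
  refine Real.sInf_nonneg ?_
  rintro w ⟨f, g, -, -, rfl⟩
  exact curveWidth_nonneg π σ f g

theorem weakFrechet_le (π σ : Curve d) {f g : C(unitInterval, unitInterval)}
    (hf : IsWeakReparam f) (hg : IsWeakReparam g) {ρ : ℝ}
    (h : ∀ s, dist (π (f s)) (σ (g s)) ≤ ρ) : weakFrechet π σ ≤ ρ := by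
  have hmem : curveWidth π σ f g ∈ {w : ℝ | ∃ f g : C(unitInterval, unitInterval),
      IsWeakReparam f ∧ IsWeakReparam g ∧ w = curveWidth π σ f g} := ⟨f, g, hf, hg, rfl⟩
  refine (csInf_le ⟨0, ?_⟩ hmem).trans (ciSup_le h)
  rintro w ⟨f, g, -, -, rfl⟩
  exact curveWidth_nonneg π σ f g

/-- A radius above the weak Fréchet distance is attained by some pair of reparameterizations. -/
theorem exists_reparam_of_weakFrechet_lt (π σ : Curve d) {ρ : ℝ} (h : weakFrechet π σ < ρ) :
    ∃ f g : C(unitInterval, unitInterval), IsWeakReparam f ∧ IsWeakReparam g ∧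
      ∀ s, dist (π (f s)) (σ (g s)) ≤ ρ := by
  have hne : {w : ℝ | ∃ f g : C(unitInterval, unitInterval),
      IsWeakReparam f ∧ IsWeakReparam g ∧ w = curveWidth π σ f g}.Nonempty :=
    ⟨_, ContinuousMap.id _, ContinuousMap.id _, ⟨rfl, rfl⟩, ⟨rfl, rfl⟩, rfl⟩
  obtain ⟨w, ⟨f, g, hf, hg, rfl⟩, hw⟩ := exists_lt_of_csInf_lt hne h
  exact ⟨f, g, hf, hg, fun s => (dist_le_curveWidth π σ f g s).trans hw.le⟩

/-- A walk on a polygonal curve, given by a map to `[0, numEdges]`, bounds the distance. -/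
theorem weakFrechet_le_of_walk (π : PolygonalCurve d) (σ : Curve d) (F : unitInterval → ℝ)
    (hF : Continuous F) (h0 : F 0 = 0) (h1 : F 1 = π.numEdges)
    (hmem : ∀ s, F s ∈ Set.Icc (0 : ℝ) π.numEdges) {ρ : ℝ}
    (h : ∀ s, dist (pl π.numEdges (vtx π) (F s)) (σ s) ≤ ρ) : weakFrechet π.toCurve σ ≤ ρ := by
  rcases Nat.eq_zero_or_pos π.numEdges with hm | hm
  · refine weakFrechet_le π.toCurve σ (f := ContinuousMap.id _) (g := ContinuousMap.id _)
      ⟨rfl, rfl⟩ ⟨rfl, rfl⟩ fun s => ?_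
    have hs := h s
    have hz : F s = 0 := by
      have := hmem s
      rw [hm, Nat.cast_zero] at this
      exact le_antisymm this.2 this.1
    rw [hz] at hs
    simpa [toCurve_eq_pl, hm] using hs
  · have hm' : (0 : ℝ) < π.numEdges := by exact_mod_cast hm
    let f : C(unitInterval, unitInterval) :=
      ⟨fun s => ⟨F s / π.numEdges, div_nonneg (hmem s).1 hm'.le, (div_le_one hm').2 (hmem s).2⟩,
        by fun_prop⟩
    refine weakFrechet_le π.toCurve σ (f := f) (g := ContinuousMap.id _)
      ⟨Subtype.ext (by simp [f, h0]), Subtype.ext (by simp [f, h1, hm'.ne'])⟩ ⟨rfl, rfl⟩ fun s => ?_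
    have : (π.numEdges : ℝ) * (f s : ℝ) = F s := mul_div_cancel₀ _ hm'.ne'
    rw [toCurve_eq_pl, this]
    exact h s

end Frechet

end RealRAM

namespace RealRAM

/-! ### Paths in the free space graph give curves -/

section Upper

variable {k d : ℕ}

/-- The parameter, along a polygonal curve, of a point of the cell with digit `D`: the vertex `D / 2`
if `D` is even, and the point at `t` on an edge if `D` is odd. -/
def locate (D : ℕ) (t : ℝ) : ℝ :=
  ((D / 2 : ℕ) : ℝ) + t * ((((D + 1) / 2 : ℕ) : ℝ) - ((D / 2 : ℕ) : ℝ))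

theorem locate_mem {D e e' : ℕ} (h1 : e ≤ D / 2) (h2 : (D + 1) / 2 ≤ e') {t : ℝ} (h0 : 0 ≤ t)
    (h1' : t ≤ 1) : (e : ℝ) ≤ locate D t ∧ locate D t ≤ e' := by
  have a1 : (e : ℝ) ≤ (D / 2 : ℕ) := by exact_mod_cast h1
  have a2 : (((D + 1) / 2 : ℕ) : ℝ) ≤ e' := by exact_mod_cast h2
  have a3 : ((D / 2 : ℕ) : ℝ) ≤ ((D + 1) / 2 : ℕ) := by exact_mod_cast (by omega)
  unfold locate
  constructor <;> nlinarith

theorem locate_even (a : ℕ) (t : ℝ) : locate (2 * a) t = a := by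
  have h1 : 2 * a / 2 = a := by omega
  have h2 : (2 * a + 1) / 2 = a := by omega
  rw [locate, h1, h2, sub_self, mul_zero, add_zero]

theorem locate_odd (a : ℕ) (t : ℝ) : locate (2 * a + 1) t = a + t := by
  have h1 : (2 * a + 1) / 2 = a := by omega
  have h2 : (2 * a + 1 + 1) / 2 = a + 1 := by omega
  rw [locate, h1, h2]
  push_cast
  ring

theorem pl_locate {E : Type*} [NormedAddCommGroup E] [NormedSpace ℝ E] {m D : ℕ} (y : ℕ → E)
    (hD : D ≤ 2 * m) {t : ℝ} (h0 : 0 ≤ t) (h1 : t ≤ 1) :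
    pl m y (locate D t) = y (D / 2) + t • (y ((D + 1) / 2) - y (D / 2)) := by
  rcases Nat.even_or_odd' D with ⟨a, rfl | rfl⟩
  · have h1 : 2 * a / 2 = a := by omega
    have h2 : (2 * a + 1) / 2 = a := by omega
    rw [locate_even, h1, h2, sub_self, smul_zero, add_zero, pl_natCast m y (by omega)]
  · have h1' : (2 * a + 1) / 2 = a := by omega
    have h2 : (2 * a + 1 + 1) / 2 = a + 1 := by omega
    rw [locate_odd, h1', h2, pl_add m y (by omega) h0 h1]

/-- Points of neighboring cells lie on a common edge. -/
theorem locate_pair {m D D' : ℕ} (hD : D ≤ 2 * m) (hD' : D' ≤ 2 * m)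
    (h : D' = D ∨ D' = D + 1 ∨ D = D' + 1) {t t' : ℝ} (ht0 : 0 ≤ t) (ht1 : t ≤ 1) (ht0' : 0 ≤ t')
    (ht1' : t' ≤ 1) : locate D t = locate D' t' ∨ ∃ e < m, ∃ a a' : ℝ, (0 ≤ a ∧ a ≤ 1) ∧
      (0 ≤ a' ∧ a' ≤ 1) ∧ locate D t = e + a ∧ locate D' t' = e + a' := by
  have key : ∀ e < m, e ≤ D / 2 → (D + 1) / 2 ≤ e + 1 → e ≤ D' / 2 → (D' + 1) / 2 ≤ e + 1 →
      ∃ e < m, ∃ a a' : ℝ, (0 ≤ a ∧ a ≤ 1) ∧ (0 ≤ a' ∧ a' ≤ 1) ∧ locate D t = e + a ∧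
        locate D' t' = e + a' := by
    intro e he b1 b2 b3 b4
    obtain ⟨c1, c2⟩ := locate_mem b1 b2 ht0 ht1
    obtain ⟨c3, c4⟩ := locate_mem b3 b4 ht0' ht1'
    push_cast at c2 c4
    exact ⟨e, he, locate D t - e, locate D' t' - e, ⟨by linarith, by linarith⟩,
      ⟨by linarith, by linarith⟩, by ring, by ring⟩
  rcases h with rfl | rfl | rfl
  · rcases Nat.even_or_odd' D' with ⟨a, rfl | rfl⟩
    · exact Or.inl (by rw [locate_even, locate_even])
    · exact Or.inr (key a (by omega) (by omega) (by omega) (by omega) (by omega))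
  · exact Or.inr (key (D / 2) (by omega) (by omega) (by omega) (by omega) (by omega))
  · exact Or.inr (key (D' / 2) (by omega) (by omega) (by omega) (by omega) (by omega))

/-- Between points of neighboring cells, a piecewise linear map is linear. -/
theorem pl_between {E : Type*} [NormedAddCommGroup E] [NormedSpace ℝ E] {m : ℕ} (y : ℕ → E)
    {s s' : ℝ} (h : s = s' ∨ ∃ e < m, ∃ a a' : ℝ, (0 ≤ a ∧ a ≤ 1) ∧ (0 ≤ a' ∧ a' ≤ 1) ∧
      s = e + a ∧ s' = e + a') {t : ℝ} (h0 : 0 ≤ t) (h1 : t ≤ 1) :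
    pl m y (s + t * (s' - s)) = pl m y s + t • (pl m y s' - pl m y s) := by
  rcases h with rfl | ⟨e, he, a, a', ⟨a0, a1⟩, ⟨b0, b1⟩, rfl, rfl⟩
  · simp
  · have h2 : (e : ℝ) + a + t * (e + a' - (e + a)) = e + (a + t * (a' - a)) := by ring
    rw [h2, pl_add m y he (by nlinarith) (by nlinarith), pl_add m y he a0 a1, pl_add m y he b0 b1]
    module

variable {π : Fin k → PolygonalCurve d} {X : ℕ → ℝ}

theorem radix_complexity (π : Fin k → PolygonalCurve d) (i : Fin k) :
    radix (fun i => (π i).complexity) i = 2 * (π i).numEdges + 1 := by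
  simp only [radix, PolygonalCurve.complexity]
  omega

theorem digit_le (π : Fin k → PolygonalCurve d) (v : ℕ) (i : Fin k) :
    digit (radix fun i => (π i).complexity) v i ≤ 2 * (π i).numEdges := by
  have h := digit_lt (fun i => radix_pos (N := fun i => (π i).complexity)
    (fun _ => Nat.succ_pos _) i) v i
  rw [radix_complexity] at h
  omega

/-- The input column `X` holds the coordinates of the curves. -/
def HoldsInput (π : Fin k → PolygonalCurve d) (X : ℕ → ℝ) : Prop :=
  ∀ (i : Fin k) (j : Fin ((π i).numEdges + 1)) (c : Fin d),
    X (offset d (fun i => (π i).complexity) i + j * d + c) = (π i).vertex j c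

theorem HoldsInput.vtx (hX : HoldsInput π X) (i : Fin k) {j : ℕ} (hj : j ≤ (π i).numEdges)
    (c : Fin d) : X (offset d (fun i => (π i).complexity) i + j * d + c) = vtx (π i) j c := by
  rw [RealRAM.vtx, dif_pos (by omega)]
  exact hX i ⟨j, by omega⟩ c

theorem HoldsInput.segA_eq (hX : HoldsInput π X) (v : ℕ) (i : Fin k) (c : Fin d) :
    segA d (fun i => (π i).complexity) X v i c =
      RealRAM.vtx (π i) (digit (radix fun i => (π i).complexity) v i / 2) c :=
  hX.vtx i (by have := digit_le π v i; omega) c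

theorem HoldsInput.segB_eq (hX : HoldsInput π X) (v : ℕ) (i : Fin k) (c : Fin d) :
    segB d (fun i => (π i).complexity) X v i c =
      RealRAM.vtx (π i) ((digit (radix fun i => (π i).complexity) v i + 1) / 2) c :=
  hX.vtx i (by have := digit_le π v i; omega) c

/-- In terms of distances, feasibility for a node says that the ball contains points of the curves
in the cells given by the digits. -/
theorem segSq_eq_dist (hX : HoldsInput π X) (v : ℕ) {t : Fin k → ℝ} (i : Fin k) (h0 : 0 ≤ t i)
    (h1 : t i ≤ 1) (x : Pt d) :
    segSq (segA d (fun i => (π i).complexity) X v) (segB d (fun i => (π i).complexity) X v) t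
      (fun c => x c) i = dist (pl (π i).numEdges (RealRAM.vtx (π i))
        (locate (digit (radix fun i => (π i).complexity) v i) (t i))) x ^ 2 := by
  rw [pl_locate _ (digit_le π v i) h0 h1, EuclideanSpace.dist_eq, Real.sq_sqrt
    (Finset.sum_nonneg fun _ _ => sq_nonneg _), segSq]
  refine Finset.sum_congr rfl fun c _ => ?_
  rw [hX.segA_eq, hX.segB_eq, Real.dist_eq, sq_abs]
  simp

/-- Neighbors in the free space graph have digits that differ by at most one. -/
theorem Adj.digit {N : Fin k → ℕ} (hN : ∀ i, 0 < N i) {r : ℝ} {u w : ℕ} (h : Adj d N X r u w)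
    (i : Fin k) : RealRAM.digit (radix N) w i = RealRAM.digit (radix N) u i ∨
      RealRAM.digit (radix N) w i = RealRAM.digit (radix N) u i + 1 ∨
      RealRAM.digit (radix N) u i = RealRAM.digit (radix N) w i + 1 := by
  have key : ∀ u w, GraphRel d N X (· ≤ r) u w →
      RealRAM.digit (radix N) w i = RealRAM.digit (radix N) u i ∨
      RealRAM.digit (radix N) u i = RealRAM.digit (radix N) w i + 1 := by
    rintro u w ⟨j, hu, hj, rfl, -⟩
    rw [digit_sub_stride (radix_pos hN) hu hj]
    by_cases hij : i = j
    · subst hij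
      rw [Function.update_self]
      right
      omega
    · rw [Function.update_of_ne hij]
      exact Or.inl rfl
  rcases h with h | h
  · rcases key _ _ h with h | h
    · exact Or.inl h
    · exact Or.inr (Or.inr h)
  · rcases key _ _ h with h | h
    · exact Or.inl h.symm
    · exact Or.inr (Or.inl h)

/-- The largest digits give the last node. -/
theorem ofDigits_pred (R : Fin k → ℕ) (hR : ∀ i, 0 < R i) :
    ofDigits R (fun i => R i - 1) = ∏ i, R i - 1 := by
  have hP : 0 < ∏ i, R i := Finset.prod_pos fun i _ => hR i
  refine le_antisymm ?_ ?_
  · have := ofDigits_lt (R := R) (x := fun i => R i - 1) fun i => by have := hR i; omega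
    omega
  · conv_lhs => rw [← ofDigits_digit (R := R) (v := ∏ i, R i - 1) (by omega)]
    exact Finset.sum_le_sum fun i _ => Nat.mul_le_mul_right _
      (Nat.le_sub_one_of_lt (digit_lt hR (∏ i, R i - 1) i))

theorem digit_last (R : Fin k → ℕ) (hR : ∀ i, 0 < R i) (i : Fin k) :
    digit R (∏ i, R i - 1) i = R i - 1 := by
  rw [← ofDigits_pred R hR, digit_ofDigits fun i => by have := hR i; omega]

/-- The curve through the centers of a path has weak Fréchet distance at most `√r` to all curves:
while it moves from one center to the next, every input curve moves inside one of its edges. -/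
theorem GoodPath.weakFrechet_le (hX : HoldsInput π X) {r : ℝ} {L : ℕ} {p : ℕ → ℕ}
    {γ : ℕ → Fin d → ℝ} (hG : GoodPath d (fun i => (π i).complexity) X r L p γ) (i : Fin k) :
    weakFrechet (π i).toCurve
      (PolygonalCurve.mk L fun j => WithLp.toLp 2 (γ j)).toCurve ≤ √r := by
  set N : Fin k → ℕ := fun i => (π i).complexity with hN
  have hNp : ∀ i, 0 < N i := fun _ => Nat.succ_pos _
  set σ := PolygonalCurve.mk L fun j => WithLp.toLp 2 (γ j) with hσ
  have hσv : ∀ j ≤ L, RealRAM.vtx σ j = WithLp.toLp 2 (γ j) := fun j hj => by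
    rw [RealRAM.vtx, dif_pos (show j < σ.numEdges + 1 by simp only [hσ]; omega)]
  have hcen : ∀ j, ∃ t, j ≤ L → SegFeas (segA d N X (p j)) (segB d N X (p j)) r t (γ j) := by
    intro j
    by_cases hj : j ≤ L
    · obtain ⟨t, ht⟩ := hG.center j hj
      exact ⟨t, fun _ => ht⟩
    · exact ⟨0, fun h => (hj h).elim⟩
  choose t ht using hcen
  let m := (π i).numEdges
  let D : ℕ → ℕ := fun j => RealRAM.digit (radix N) (p j) i
  have hD : ∀ j, D j ≤ 2 * m := fun j => digit_le π (p j) i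
  let s : ℕ → ℝ := fun j => locate (D j) (t j i)
  have hs : ∀ j ≤ L, dist (pl m (RealRAM.vtx (π i)) (s j)) (RealRAM.vtx σ j) ≤ √r := by
    intro j hj
    have h1 := (ht j hj).le i
    have h2 := segSq_eq_dist hX (p j) (t := t j) i ((ht j hj).t_mem i).1 ((ht j hj).t_mem i).2
      (WithLp.toLp 2 (γ j))
    rw [hσv j hj]
    refine Real.le_sqrt_of_sq_le ?_
    rw [← h2]
    exact h1
  have hLcast : ∀ x : unitInterval, 0 ≤ (L : ℝ) * x ∧ (L : ℝ) * x ≤ L := fun x =>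
    ⟨mul_nonneg (Nat.cast_nonneg _) x.2.1, mul_le_of_le_one_right (Nat.cast_nonneg _) x.2.2⟩
  refine weakFrechet_le_of_walk (π i) σ.toCurve (fun x => pl L s (L * x)) ?_ ?_ ?_ ?_ ?_
  · exact (continuous_pl L s).comp (by fun_prop)
  · have := pl_natCast L s (Nat.zero_le L)
    rw [Nat.cast_zero] at this
    simp only [Set.Icc.coe_zero, mul_zero, this]
    have h0 : D 0 = 2 * 0 := by simp [D, hG.first, RealRAM.digit]
    simp only [s, h0, locate_even, Nat.cast_zero]
  · simp only [Set.Icc.coe_one, mul_one, pl_natCast L s le_rfl]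
    have h0 : D L = 2 * m := by
      simp only [D, hG.last, digit_last (radix N) (radix_pos hNp)]
      rw [hN, radix_complexity]
      rfl
    simp only [s, h0, locate_even]
    rfl
  · intro x
    refine pl_mem (convex_Icc _ _) (fun j hj => ?_) (hLcast x).1 (hLcast x).2
    have := locate_mem (D := D j) (e := 0) (e' := m) (Nat.zero_le _) (by have := hD j; omega)
      ((ht j hj).t_mem i).1 ((ht j hj).t_mem i).2
    rw [Nat.cast_zero] at this
    exact this
  · intro x
    rw [toCurve_eq_pl]
    change dist (pl m (RealRAM.vtx (π i)) (pl L s (L * x))) (pl L (RealRAM.vtx σ) (L * x)) ≤ √r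
    rcases Nat.eq_zero_or_pos L with hL | hL
    · have h0 : (L : ℝ) * x = (0 : ℕ) := by simp [hL]
      rw [h0, pl_natCast L _ (Nat.zero_le _), pl_natCast L _ (Nat.zero_le _)]
      exact hs 0 (Nat.zero_le _)
    · obtain ⟨j, hj, u, hu0, hu1, hju⟩ := exists_eq_add hL (hLcast x).1 (hLcast x).2
      rw [hju, pl_add L _ hj hu0 hu1, pl_add L _ hj hu0 hu1, smul_eq_mul,
        pl_between _ (locate_pair (hD j) (hD (j + 1)) ((hG.adj j hj).digit hNp i)
          ((ht j hj.le).t_mem i).1 ((ht j hj.le).t_mem i).2 ((ht (j + 1) hj).t_mem i).1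
          ((ht (j + 1) hj).t_mem i).2) hu0 hu1]
      have h1 := hs j hj.le
      have h2 := hs (j + 1) hj
      rw [dist_eq_norm, ← mem_closedBall_zero_iff] at h1 h2 ⊢
      have h3 := (convex_closedBall (0 : Pt d) (√r)).add_smul_sub_mem h1 h2 ⟨hu0, hu1⟩
      convert h3 using 1
      module

end Upper

end RealRAM

namespace RealRAM

/-! ### Climbing several mountains at once -/

section Climb

variable {k n : ℕ}

/-- `x` and `y` are positions on `k` height profiles, each at one common height, and every
coordinate of `y` is a neighbor of the coordinate of `x`. -/
def Climb (G : Fin k → ℕ → ℤ) (x y : Fin k → Fin (n + 1)) : Prop :=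
  (∃ h, ∀ i, G i (x i) = h) ∧ (∃ h, ∀ i, G i (y i) = h) ∧
    ∀ i, (x i : ℕ) + 1 = y i ∨ (y i : ℕ) + 1 = x i

/-- The graph of simultaneous climbs. -/
def climbGraph (hk : 0 < k) (G : Fin k → ℕ → ℤ) : SimpleGraph (Fin k → Fin (n + 1)) where
  Adj := Climb G
  symm := ⟨fun _ _ h => ⟨h.2.1, h.1, fun i => (h.2.2 i).symm⟩⟩
  loopless := ⟨fun x h => by have := h.2.2 ⟨0, hk⟩; omega⟩

/-- A height profile of `n` unit steps from height `0` to height `L` that stays between these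
heights. -/
structure IsProfile (n : ℕ) (L : ℤ) (g : ℕ → ℤ) : Prop where
  zero : g 0 = 0
  last : g n = L
  step : ∀ j < n, g (j + 1) = g j + 1 ∨ g (j + 1) = g j - 1
  nonneg : ∀ j ≤ n, 0 ≤ g j
  le : ∀ j ≤ n, g j ≤ L

/-- The neighbors of `x` at height `h`. -/
def nbrs (g : ℕ → ℤ) (x : Fin (n + 1)) (h : ℤ) : Finset (Fin (n + 1)) :=
  {y | ((x : ℕ) + 1 = y ∨ (y : ℕ) + 1 = x) ∧ g y = h}

theorem mem_nbrs {g : ℕ → ℤ} {x y : Fin (n + 1)} {h : ℤ} :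
    y ∈ nbrs g x h ↔ ((x : ℕ) + 1 = y ∨ (y : ℕ) + 1 = x) ∧ g y = h := by
  simp [nbrs]

theorem IsProfile.adj {L : ℤ} {g : ℕ → ℤ} (hg : IsProfile n L g) {x y : Fin (n + 1)}
    (h : (x : ℕ) + 1 = y ∨ (y : ℕ) + 1 = x) : g y = g x + 1 ∨ g y = g x - 1 := by
  rcases h with h | h
  · rw [← h]
    exact hg.step x (by omega)
  · rcases hg.step y (by omega) with h1 | h1 <;> rw [h] at h1 <;> omega

/-- All neighbors are one unit up or down. -/
theorem IsProfile.card_nbrs {L : ℤ} {g : ℕ → ℤ} (hg : IsProfile n L g) (x : Fin (n + 1)) :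
    (nbrs g x (g x + 1)).card + (nbrs g x (g x - 1)).card =
      ({y : Fin (n + 1) | (x : ℕ) + 1 = y ∨ (y : ℕ) + 1 = x} : Finset _).card := by
  classical
  rw [← Finset.card_union_of_disjoint]
  · congr 1
    ext y
    simp only [Finset.mem_union, mem_nbrs, Finset.mem_filter_univ]
    refine ⟨fun h => by tauto, fun h => ?_⟩
    have := hg.adj h
    tauto
  · rw [Finset.disjoint_left]
    intro y h1 h2
    have h1' := (mem_nbrs.1 h1).2
    have h2' := (mem_nbrs.1 h2).2
    omega

theorem IsProfile.card_nbrs_interior {L : ℤ} {g : ℕ → ℤ} (hg : IsProfile n L g) {x : Fin (n + 1)}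
    (h0 : 0 < (x : ℕ)) (h1 : (x : ℕ) < n) :
    (nbrs g x (g x + 1)).card + (nbrs g x (g x - 1)).card = 2 := by
  rw [hg.card_nbrs, Finset.card_eq_two]
  refine ⟨⟨x - 1, by omega⟩, ⟨x + 1, by omega⟩, by simp [Fin.ext_iff], ?_⟩
  ext y
  simp only [Finset.mem_filter_univ, Finset.mem_insert, Finset.mem_singleton, Fin.ext_iff]
  omega

theorem IsProfile.card_nbrs_zero {L : ℤ} {g : ℕ → ℤ} (hg : IsProfile n L g) (hn : 0 < n) :
    (nbrs g (0 : Fin (n + 1)) (g 0 + 1)).card + (nbrs g (0 : Fin (n + 1)) (g 0 - 1)).card = 1 := by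
  have := hg.card_nbrs 0
  rw [Fin.val_zero] at this
  rw [this, Finset.card_eq_one]
  refine ⟨⟨1, by omega⟩, ?_⟩
  ext y
  simp only [Finset.mem_filter_univ, Finset.mem_singleton, Fin.ext_iff]
  omega

theorem climb_iff (hk : 0 < k) {L : ℤ} {G : Fin k → ℕ → ℤ} (hG : ∀ i, IsProfile n L (G i))
    {x : Fin k → Fin (n + 1)} {h : ℤ} (hx : ∀ i, G i (x i) = h) (y : Fin k → Fin (n + 1)) :
    Climb G x y ↔ (∀ i, y i ∈ nbrs (G i) (x i) (h + 1)) ∨ ∀ i, y i ∈ nbrs (G i) (x i) (h - 1) := by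
  constructor
  · rintro ⟨-, ⟨h', hy⟩, ha⟩
    have h1 := (hG ⟨0, hk⟩).adj (ha ⟨0, hk⟩)
    rw [hx, hy] at h1
    rcases h1 with h1 | h1
    · exact Or.inl fun i => mem_nbrs.2 ⟨ha i, by rw [hy, h1]⟩
    · exact Or.inr fun i => mem_nbrs.2 ⟨ha i, by rw [hy, h1]⟩
  · rintro (h1 | h1)
    · exact ⟨⟨h, hx⟩, ⟨h + 1, fun i => (mem_nbrs.1 (h1 i)).2⟩, fun i => (mem_nbrs.1 (h1 i)).1⟩
    · exact ⟨⟨h, hx⟩, ⟨h - 1, fun i => (mem_nbrs.1 (h1 i)).2⟩, fun i => (mem_nbrs.1 (h1 i)).1⟩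

open Classical in
/-- A climber at a common height has as many moves as there are joint moves up and down. -/
theorem card_climb (hk : 0 < k) {L : ℤ} {G : Fin k → ℕ → ℤ} (hG : ∀ i, IsProfile n L (G i))
    {x : Fin k → Fin (n + 1)} {h : ℤ} (hx : ∀ i, G i (x i) = h) :
    ({y | Climb G x y} : Finset (Fin k → Fin (n + 1))).card =
      ∏ i, (nbrs (G i) (x i) (h + 1)).card + ∏ i, (nbrs (G i) (x i) (h - 1)).card := by
  rw [← Fintype.card_piFinset, ← Fintype.card_piFinset, ← Finset.card_union_of_disjoint]
  · congr 1
    ext y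
    simp only [Finset.mem_filter_univ, Finset.mem_union, Fintype.mem_piFinset]
    exact climb_iff hk hG hx y
  · rw [Finset.disjoint_left]
    intro y h1 h2
    have h1' := (mem_nbrs.1 (Fintype.mem_piFinset.1 h1 ⟨0, hk⟩)).2
    have h2' := (mem_nbrs.1 (Fintype.mem_piFinset.1 h2 ⟨0, hk⟩)).2
    omega

/-- Only the common start and the common end have an odd number of moves. -/
theorem endpoint_of_odd (hk : 0 < k) {L : ℤ} (hL : 0 < L) {G : Fin k → ℕ → ℤ}
    (hG : ∀ i, IsProfile n L (G i)) {x : Fin k → Fin (n + 1)} {h : ℤ} (hx : ∀ i, G i (x i) = h)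
    (hodd : Odd (∏ i, (nbrs (G i) (x i) (h + 1)).card + ∏ i, (nbrs (G i) (x i) (h - 1)).card)) :
    (∀ i, (x i : ℕ) = 0) ∨ ∀ i, (x i : ℕ) = n := by
  have hint : ∀ i, 0 < (x i : ℕ) → (x i : ℕ) < n →
      (nbrs (G i) (x i) (h + 1)).card + (nbrs (G i) (x i) (h - 1)).card = 2 := fun i h0 h1 => by
    have := (hG i).card_nbrs_interior h0 h1
    rwa [hx i] at this
  have hmem : ∀ i, (∃ y, y ∈ nbrs (G i) (x i) (h + 1)) → h + 1 ≤ L := by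
    rintro i ⟨y, hy⟩
    rw [← (mem_nbrs.1 hy).2]
    exact (hG i).le y (by omega)
  have hmem' : ∀ i, (∃ y, y ∈ nbrs (G i) (x i) (h - 1)) → 0 ≤ h - 1 := by
    rintro i ⟨y, hy⟩
    rw [← (mem_nbrs.1 hy).2]
    exact (hG i).nonneg y (by omega)
  have hup : h = L → ∀ i, (nbrs (G i) (x i) (h + 1)).card = 0 := fun hh i => by
    rw [Finset.card_eq_zero, Finset.eq_empty_iff_forall_notMem]
    intro y hy
    have := hmem i ⟨y, hy⟩
    omega
  have hdn : h = 0 → ∀ i, (nbrs (G i) (x i) (h - 1)).card = 0 := fun hh i => by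
    rw [Finset.card_eq_zero, Finset.eq_empty_iff_forall_notMem]
    intro y hy
    have := hmem' i ⟨y, hy⟩
    omega
  have hx0 : ∀ i, (x i : ℕ) = 0 → h = 0 := fun i hi => by rw [← hx i, hi, (hG i).zero]
  have hxn : ∀ i, (x i : ℕ) = n → h = L := fun i hi => by rw [← hx i, hi, (hG i).last]
  have i₀ : Fin k := ⟨0, hk⟩
  by_cases h0 : h = 0
  · left
    intro i
    by_contra hi
    have h1 := hint i (by omega) (lt_of_le_of_ne (by omega) fun hn => by
      have := hxn i hn; omega)
    rw [hdn h0 i, add_zero] at h1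
    have h2 : ∏ i, (nbrs (G i) (x i) (h - 1)).card = 0 :=
      Finset.prod_eq_zero (Finset.mem_univ i) (hdn h0 i)
    rw [h2, add_zero] at hodd
    have h3 := Finset.dvd_prod_of_mem (fun i => (nbrs (G i) (x i) (h + 1)).card)
      (Finset.mem_univ i)
    rw [h1] at h3
    exact (Nat.not_even_iff_odd.2 hodd) (even_iff_two_dvd.2 h3)
  by_cases hhL : h = L
  · right
    intro i
    by_contra hi
    have h1 := hint i (Nat.pos_of_ne_zero fun h' => h0 (hx0 i h')) (by omega)
    rw [hup hhL i, zero_add] at h1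
    have h2 : ∏ i, (nbrs (G i) (x i) (h + 1)).card = 0 :=
      Finset.prod_eq_zero (Finset.mem_univ i) (hup hhL i)
    rw [h2, zero_add] at hodd
    have h3 := Finset.dvd_prod_of_mem (fun i => (nbrs (G i) (x i) (h - 1)).card)
      (Finset.mem_univ i)
    rw [h1] at h3
    exact ((Nat.not_even_iff_odd.2 hodd) (even_iff_two_dvd.2 h3)).elim
  -- At an intermediate height every climber has two moves, so the two products have equal parity.
  exfalso
  have hsum : ∀ i, (nbrs (G i) (x i) (h + 1)).card + (nbrs (G i) (x i) (h - 1)).card = 2 :=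
    fun i => hint i (Nat.pos_of_ne_zero fun h' => h0 (hx0 i h'))
      (lt_of_le_of_ne (by omega) fun hn => hhL (hxn i hn))
  refine (Nat.not_even_iff_odd.2 hodd) ?_
  by_cases hall : ∀ i, (nbrs (G i) (x i) (h + 1)).card = 1
  · have h1 : ∀ i, (nbrs (G i) (x i) (h - 1)).card = 1 := fun i => by
      have := hsum i; have := hall i; omega
    rw [Finset.prod_eq_one fun i _ => hall i, Finset.prod_eq_one fun i _ => h1 i]
    exact even_two
  · push Not at hall
    obtain ⟨i, hi⟩ := hall
    have h1 := hsum i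
    refine Even.add (even_iff_two_dvd.2 ?_) (even_iff_two_dvd.2 ?_)
    · exact Dvd.dvd.trans (by omega)
        (Finset.dvd_prod_of_mem (fun i => (nbrs (G i) (x i) (h + 1)).card) (Finset.mem_univ i))
    · exact Dvd.dvd.trans (by omega)
        (Finset.dvd_prod_of_mem (fun i => (nbrs (G i) (x i) (h - 1)).card) (Finset.mem_univ i))

/-- Climbers on several profiles can move simultaneously, always at a common height, from the start
to the end of their profiles: in the component of the common start, the number of vertices of odd
degree is even, and only the common end can be the second one. -/
theorem exists_climb (hk : 0 < k) {L : ℤ} (hL : 0 < L) {G : Fin k → ℕ → ℤ}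
    (hG : ∀ i, IsProfile n L (G i)) :
    Relation.ReflTransGen (Climb G) (fun _ => (0 : Fin (n + 1))) (fun _ => Fin.last n) := by
  classical
  set A := climbGraph (n := n) hk G with hA
  set o : Fin k → Fin (n + 1) := fun _ => 0 with ho
  have hn : 0 < n := by
    rcases Nat.eq_zero_or_pos n with rfl | h
    · have h1 := (hG ⟨0, hk⟩).last
      rw [(hG ⟨0, hk⟩).zero] at h1
      omega
    · exact h
  let H : SimpleGraph (Fin k → Fin (n + 1)) :=
    { Adj := fun x y => A.Adj x y ∧ A.Reachable o x
      symm := ⟨fun x y h => ⟨h.1.symm, h.2.trans h.1.reachable⟩⟩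
      loopless := ⟨fun x h => A.loopless.irrefl x h.1⟩ }
  have hdeg : ∀ x h, A.Reachable o x → (∀ i, G i (x i) = h) → H.degree x =
      ∏ i, (nbrs (G i) (x i) (h + 1)).card + ∏ i, (nbrs (G i) (x i) (h - 1)).card := by
    intro x h hr hx
    rw [← card_climb hk hG hx, ← SimpleGraph.card_neighborFinset_eq_degree]
    congr 1
    ext y
    rw [SimpleGraph.mem_neighborFinset, Finset.mem_filter_univ]
    exact ⟨fun h => h.1, fun h => ⟨h, hr⟩⟩
  have ho0 : ∀ i, G i (o i) = 0 := fun i => (hG i).zero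
  have hodd : Odd (H.degree o) := by
    rw [hdeg o 0 (SimpleGraph.Reachable.refl _) ho0]
    have hdn : ∀ i, (nbrs (G i) (o i) (0 - 1)).card = 0 := fun i => by
      rw [Finset.card_eq_zero, Finset.eq_empty_iff_forall_notMem]
      intro y hy
      have h1 := (mem_nbrs.1 hy).2
      have h2 := (hG i).nonneg y (by omega)
      omega
    have hup : ∀ i, (nbrs (G i) (o i) (0 + 1)).card = 1 := fun i => by
      have := (hG i).card_nbrs_zero hn
      rw [(hG i).zero] at this
      have h2 := hdn i
      simp only [ho] at h2 ⊢
      omega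
    rw [Finset.prod_eq_one fun i _ => hup i,
      Finset.prod_eq_zero (Finset.mem_univ ⟨0, hk⟩) (hdn _)]
    exact odd_one
  obtain ⟨x, hxo, hx⟩ := H.exists_ne_odd_degree_of_exists_odd_degree o hodd
  obtain ⟨y, hy⟩ : ∃ y, H.Adj x y := by
    by_contra! hno
    have : H.degree x = 0 := by
      rw [← SimpleGraph.card_neighborFinset_eq_degree, Finset.card_eq_zero,
        Finset.eq_empty_iff_forall_notMem]
      intro y hy
      exact hno y ((SimpleGraph.mem_neighborFinset _ _ _).1 hy)
    rw [this] at hx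
    exact absurd hx (by decide)
  obtain ⟨⟨⟨h, hh⟩, -, -⟩, hr⟩ := hy
  rw [hdeg x h hr hh] at hx
  have hlast : x = fun _ => Fin.last n := by
    rcases endpoint_of_odd hk hL hG hh hx with h1 | h1
    · exact (hxo (funext fun i => Fin.ext (h1 i))).elim
    · exact funext fun i => Fin.ext (h1 i)
  rw [← hlast]
  exact (SimpleGraph.reachable_iff_reflTransGen o x).1 hr

end Climb

end RealRAM

namespace RealRAM

/-! ### Every curve gives a path in the free space graph -/

section Lower

variable {k d : ℕ} {N : Fin k → ℕ} {X : ℕ → ℝ} {π : Fin k → PolygonalCurve d}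

/-- Two nodes of the grid are joined inside every box that contains only nodes of small weight. -/
theorem eqvGen_of_box {r : ℝ} : ∀ (n : ℕ) (D D' : Fin k → ℕ),
    ∑ i, (D i + D' i) = n → (∀ i, D i < radix N i) → (∀ i, D' i < radix N i) →
    (∀ z : Fin k → ℕ, (∀ i, min (D i) (D' i) ≤ z i ∧ z i ≤ max (D i) (D' i)) →
      nodeWt d N X (ofDigits (radix N) z) ≤ r) →
    Relation.EqvGen (GraphRel d N X (· ≤ r)) (ofDigits (radix N) D) (ofDigits (radix N) D') := by
  intro n
  induction n using Nat.strong_induction_on with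
  | _ n ih =>
    -- Decreasing the larger one of two different digits is a step in the graph.
    have step : ∀ (D D' : Fin k → ℕ) (i : Fin k), D' i < D i → ∑ i, (D i + D' i) = n →
        (∀ i, D i < radix N i) → (∀ i, D' i < radix N i) →
        (∀ z : Fin k → ℕ, (∀ i, min (D i) (D' i) ≤ z i ∧ z i ≤ max (D i) (D' i)) →
          nodeWt d N X (ofDigits (radix N) z) ≤ r) →
        Relation.EqvGen (GraphRel d N X (· ≤ r)) (ofDigits (radix N) D)
          (ofDigits (radix N) D') := by
      intro D D' i hi hn hD hD' hz
      set E := Function.update D i (D i - 1) with hE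
      have hEi : E i = D i - 1 := Function.update_self ..
      have hEj : ∀ j, j ≠ i → E j = D j := fun j hj => Function.update_of_ne hj ..
      have hle : ∀ j, E j ≤ D j := fun j => by
        by_cases hj : j = i
        · subst hj; omega
        · rw [hEj j hj]
      have hbox : ∀ z : Fin k → ℕ, (∀ j, min (E j) (D' j) ≤ z j ∧ z j ≤ max (E j) (D' j)) →
          nodeWt d N X (ofDigits (radix N) z) ≤ r := by
        intro z h
        refine hz z fun j => ?_
        have h1 := h j
        by_cases hj : j = i
        · subst hj; omega
        · rwa [hEj j hj] at h1
      have hlt : ∑ j, (E j + D' j) < n := by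
        rw [← hn]
        exact Finset.sum_lt_sum (fun j _ => by have := hle j; omega)
          ⟨i, Finset.mem_univ _, by omega⟩
      refine Relation.EqvGen.trans _ _ _ (Relation.EqvGen.rel _ _ ?_)
        (ih _ hlt E D' rfl (fun j => (hle j).trans_lt (hD j)) hD' hbox)
      refine ⟨i, ofDigits_lt hD, ?_, ofDigits_update D i (by omega), max_le ?_ ?_⟩
      · rw [digit_ofDigits hD]
        omega
      · exact hz D fun j => ⟨min_le_left _ _, le_max_left _ _⟩
      · refine hz E fun j => ?_
        by_cases hj : j = i
        · subst hj; omega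
        · rw [hEj j hj]
          exact ⟨min_le_left _ _, le_max_left _ _⟩
    intro D D' hn hD hD' hz
    by_cases heq : D = D'
    · subst heq
      exact Relation.EqvGen.refl _
    · obtain ⟨i, hi⟩ := Function.ne_iff.1 heq
      rcases lt_or_gt_of_ne hi with hi | hi
      · refine Relation.EqvGen.symm _ _ (step D' D i hi ?_ hD' hD fun z h => hz z fun j => ?_)
        · rw [← hn]
          exact Finset.sum_congr rfl fun _ _ => add_comm _ _
        · rw [min_comm, max_comm]
          exact h j
      · exact step D D' i hi hn hD hD' hz

/-- The digit of the cell that contains the parameter `u`. -/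
def cellOf (u : ℝ) : ℕ := ⌊u⌋₊ + ⌈u⌉₊

theorem cellOf_natCast (m : ℕ) : cellOf m = 2 * m := by
  rw [cellOf, Nat.floor_natCast, Nat.ceil_natCast, two_mul]

theorem cellOf_le {u : ℝ} {m : ℕ} (h : u ≤ m) : cellOf u ≤ 2 * m := by
  have h1 : ⌊u⌋₊ ≤ m := Nat.floor_le_of_le h
  have h2 : ⌈u⌉₊ ≤ m := Nat.ceil_le.2 h
  rw [cellOf]
  omega

theorem exists_locate_cellOf {u : ℝ} (h0 : 0 ≤ u) :
    ∃ t, (0 ≤ t ∧ t ≤ 1) ∧ locate (cellOf u) t = u := by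
  refine ⟨u - ⌊u⌋₊, ⟨sub_nonneg.2 (Nat.floor_le h0), by have := Nat.lt_floor_add_one u; linarith⟩, ?_⟩
  rcases Nat.lt_or_ge ⌊u⌋₊ ⌈u⌉₊ with h | h
  · have h1 := Nat.ceil_le_floor_add_one u
    rw [cellOf, show ⌊u⌋₊ + ⌈u⌉₊ = 2 * ⌊u⌋₊ + 1 by omega, locate_odd]
    ring
  · have h1 := Nat.floor_le_ceil u
    rw [cellOf, show ⌊u⌋₊ + ⌈u⌉₊ = 2 * ⌊u⌋₊ by omega, locate_even]
    exact le_antisymm (Nat.floor_le h0) ((Nat.le_ceil u).trans (by exact_mod_cast h))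

theorem locate_half (E : ℕ) : locate E (1 / 2) = E / 2 := by
  rcases Nat.even_or_odd' E with ⟨a, rfl | rfl⟩
  · rw [locate_even]; push_cast; ring
  · rw [locate_odd]; push_cast; ring

/-- A motion from `u` to `u'` meets all the cells between those of `u` and `u'`. -/
theorem exists_locate_between {u u' : ℝ} (h0 : 0 ≤ u) (h0' : 0 ≤ u') {E : ℕ}
    (h : min (cellOf u) (cellOf u') ≤ E ∧ E ≤ max (cellOf u) (cellOf u')) :
    ∃ w ∈ Set.uIcc u u', ∃ t, (0 ≤ t ∧ t ≤ 1) ∧ locate E t = w := by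
  have key : ∀ u u' : ℝ, 0 ≤ u → 0 ≤ u' → cellOf u ≤ E → E ≤ cellOf u' →
      ∃ w ∈ Set.uIcc u u', ∃ t, (0 ≤ t ∧ t ≤ 1) ∧ locate E t = w := by
    intro u u' h0 h0' h1 h2
    rcases h1.eq_or_lt with h1 | h1
    · exact ⟨u, Set.left_mem_uIcc, h1 ▸ exists_locate_cellOf h0⟩
    rcases h2.eq_or_lt with h2 | h2
    · exact ⟨u', Set.right_mem_uIcc, h2 ▸ exists_locate_cellOf h0'⟩
    refine ⟨E / 2, Set.mem_uIcc.2 (Or.inl ⟨?_, ?_⟩), 1 / 2, by norm_num, locate_half E⟩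
    · have a1 := Nat.lt_floor_add_one u
      have a2 := Nat.le_ceil u
      have a3 : ((⌊u⌋₊ + ⌈u⌉₊ + 1 : ℕ) : ℝ) ≤ E := by exact_mod_cast h1
      push_cast at a3
      linarith
    · have a1 := Nat.floor_le h0'
      have a2 := Nat.ceil_lt_add_one h0'
      have a3 : ((E + 1 : ℕ) : ℝ) ≤ (⌊u'⌋₊ + ⌈u'⌉₊ : ℕ) := by exact_mod_cast h2
      push_cast at a3
      linarith
  rcases le_total (cellOf u) (cellOf u') with hc | hc
  · rw [min_eq_left hc, max_eq_right hc] at h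
    exact key u u' h0 h0' h.1 h.2
  · rw [min_eq_right hc, max_eq_left hc] at h
    rw [Set.uIcc_comm]
    exact key u' u h0' h0 h.1 h.2

/-- A ball that contains points of the curves in the cells of a node bounds its weight. -/
theorem nodeWt_le (hk : 0 < k) (hX : HoldsInput π X) {v : ℕ} {w : Fin k → ℝ} {c : Pt d} {ρ : ℝ}
    (hw : ∀ i, ∃ t, (0 ≤ t ∧ t ≤ 1) ∧
      locate (digit (radix fun i => (π i).complexity) v i) t = w i)
    (h : ∀ i, dist (pl (π i).numEdges (vtx (π i)) (w i)) c ≤ ρ) :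
    nodeWt d (fun i => (π i).complexity) X v ≤ ρ ^ 2 := by
  choose t ht htw using hw
  refine (segRad_le_iff hk _ _ _).2 ⟨t, fun j => c j, ht, fun i => ?_⟩
  rw [segSq_eq_dist hX v i (ht i).1 (ht i).2 c, htw]
  exact pow_le_pow_left₀ dist_nonneg (h i) 2

/-- A slowly moving real sequence is followed by a profile with unit steps: take the largest integer
of the right parity below it, reflected at zero. -/
theorem exists_profile {n L : ℕ} (hn : Even n) (hL : Even L) (hL0 : 0 < L) {a : ℕ → ℝ}
    (a0 : a 0 = 0) (an : a n = L) (hnn : ∀ j, 0 ≤ a j) (hle : ∀ j, a j ≤ L)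
    (hs : ∀ j < n, |a (j + 1) - a j| ≤ 1) :
    ∃ g, IsProfile n L g ∧ ∀ j, |(g j : ℝ) - a j| ≤ 2 := by
  let P : ℕ → ℤ := fun j => j + 2 * ⌊(a j - j) / 2⌋
  have h1 : ∀ j, (P j : ℝ) ≤ a j := fun j => by
    have := Int.floor_le ((a j - j) / 2)
    simp only [P]
    push_cast
    linarith
  have h2 : ∀ j, a j < P j + 2 := fun j => by
    have := Int.lt_floor_add_one ((a j - j) / 2)
    simp only [P]
    push_cast
    linarith
  have h3 : ∀ j, -1 ≤ P j := fun j => by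
    have h : (-2 : ℝ) < P j := by linarith [h2 j, hnn j]
    have h' : (-2 : ℤ) < P j := by exact_mod_cast h
    omega
  have h4 : ∀ j, P j ≤ L := fun j => by exact_mod_cast (h1 j).trans (hle j)
  refine ⟨fun j => |P j|, ⟨?_, ?_, fun j hj => ?_, fun j _ => abs_nonneg _, fun j _ => ?_⟩,
    fun j => ?_⟩
  · simp [P, a0]
  · obtain ⟨b, rfl⟩ := hn
    obtain ⟨c, rfl⟩ := hL
    have hfl : (a (b + b) - (b + b : ℕ)) / 2 = ((c - b : ℤ) : ℝ) := by
      rw [an]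
      push_cast
      ring
    have hP : P (b + b) = (c + c : ℕ) := by
      simp only [P]
      rw [hfl, Int.floor_intCast]
      push_cast
      ring
    rw [hP]
    exact abs_of_nonneg (Int.natCast_nonneg _)
  · have b1 := abs_le.1 (hs j hj)
    have b2 : (P (j + 1) : ℝ) < P j + 3 := by linarith [h1 (j + 1), h2 j]
    have b3 : (P j : ℝ) < P (j + 1) + 3 := by linarith [h1 j, h2 (j + 1)]
    have b4 : P (j + 1) < P j + 3 := by exact_mod_cast b2
    have b5 : P j < P (j + 1) + 3 := by exact_mod_cast b3
    have b6 : P (j + 1) = (j + 1 : ℕ) + 2 * ⌊(a (j + 1) - (j + 1 : ℕ)) / 2⌋ := rfl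
    have b7 : P j = j + 2 * ⌊(a j - j) / 2⌋ := rfl
    have b8 := h3 j
    have b9 := h3 (j + 1)
    change |P (j + 1)| = |P j| + 1 ∨ |P (j + 1)| = |P j| - 1
    rcases abs_cases (P j) with c1 | c1 <;> rcases abs_cases (P (j + 1)) with c2 | c2 <;> omega
  · have := h3 j
    have := h4 j
    exact abs_le.2 ⟨by omega, by omega⟩
  · change |((|P j| : ℤ) : ℝ) - a j| ≤ 2
    rcases (h3 j).eq_or_lt with h | h
    · have c1 := h2 j
      rw [← h] at c1 ⊢
      norm_num at c1 ⊢
      exact abs_le.2 ⟨by linarith, by linarith [hnn j]⟩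
    · rw [abs_of_nonneg (by omega : (0 : ℤ) ≤ P j)]
      exact abs_le.2 ⟨by linarith [h2 j], by linarith [h1 j]⟩

/-- Reparameterizations of all curves against a curve `τ` are followed by a simultaneous climb of
profiles that approximate the reparameterizations of `τ`. Each of its states gives a ball centered
on `τ` and a point of the curves near it, and between consecutive states the cells of these points
only pass through nodes of small weight. -/
theorem feasible_of_weakFrechet_lt (hk : 0 < k) (hX : HoldsInput π X) (τ : Curve d) {ρ δ : ℝ}
    (hτ : ∀ i, weakFrechet (π i).toCurve τ < ρ) (hδ : 0 < δ) :
    Feasible d (fun i => (π i).complexity) X ((ρ + δ) ^ 2) := by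
  set N : Fin k → ℕ := fun i => (π i).complexity with hN
  have hNp : ∀ i, 0 < N i := fun _ => Nat.succ_pos _
  have hrad : ∀ i, radix N i = 2 * (π i).numEdges + 1 := radix_complexity π
  choose f g hf hg hfg using fun i => exists_reparam_of_weakFrechet_lt _ τ (hτ i)
  by_cases hprod : ∏ i, radix N i = 1
  · refine Or.inl ⟨hprod, nodeWt_le hk hX (w := fun _ => 0) (c := τ 0) (fun i => ?_) fun i => ?_⟩
    · have hz : digit (radix N) 0 i = 2 * 0 := by simp [digit]
      exact ⟨0, ⟨le_rfl, zero_le_one⟩, by rw [hz, locate_even, Nat.cast_zero]⟩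
    · have h := hfg i 0
      rw [(hf i).1, (hg i).1, toCurve_eq_pl, Set.Icc.coe_zero, mul_zero] at h
      linarith
  refine Or.inr ⟨hprod, ?_⟩
  obtain ⟨η, hη, hητ⟩ := Metric.uniformContinuous_iff.1
    (CompactSpace.uniformContinuous_of_continuous τ.continuous) (δ / 2) (by linarith)
  -- the number of height levels
  obtain ⟨l, hl⟩ := exists_nat_one_div_lt hη
  set L : ℕ := 2 * (l + 1) with hL
  have hLpos : (0 : ℝ) < L := by rw [hL]; positivity
  have hLη : 2 / (L : ℝ) < η := by
    refine lt_of_eq_of_lt ?_ hl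
    rw [hL]
    push_cast
    field_simp
  let U : Fin k → unitInterval → ℝ := fun i s => (π i).numEdges * f i s
  have hUmem : ∀ i s, U i s ∈ Set.Icc (0 : ℝ) (π i).numEdges := fun i s =>
    ⟨mul_nonneg (Nat.cast_nonneg _) (f i s).2.1,
      mul_le_of_le_one_right (Nat.cast_nonneg _) (f i s).2.2⟩
  have huc : ∀ i, ∃ ζ > 0, ∀ a ∈ Set.Icc (0 : ℝ) (π i).numEdges,
      ∀ b ∈ Set.Icc (0 : ℝ) (π i).numEdges, dist a b < ζ →
      dist (pl (π i).numEdges (vtx (π i)) a) (pl (π i).numEdges (vtx (π i)) b) < δ / 2 := fun i =>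
    Metric.uniformContinuousOn_iff.1 (isCompact_Icc.uniformContinuousOn_of_continuous
      (continuous_pl _ _).continuousOn) (δ / 2) (by linarith)
  choose ζ hζ hpl using huc
  have huf : ∀ i, ∃ θ > 0, ∀ a b : unitInterval, dist a b < θ →
      dist ((L : ℝ) * g i a) (L * g i b) < 1 ∧ dist (U i a) (U i b) < ζ i := by
    intro i
    obtain ⟨θ₁, h1, h1'⟩ := Metric.uniformContinuous_iff.1
      (CompactSpace.uniformContinuous_of_continuous
        (f := fun s => (L : ℝ) * (g i s : ℝ)) (by fun_prop)) 1 one_pos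
    obtain ⟨θ₂, h2, h2'⟩ := Metric.uniformContinuous_iff.1
      (CompactSpace.uniformContinuous_of_continuous (f := U i) (by fun_prop)) (ζ i) (hζ i)
    exact ⟨min θ₁ θ₂, lt_min h1 h2, fun a b h => ⟨h1' (h.trans_le (min_le_left _ _)),
      h2' (h.trans_le (min_le_right _ _))⟩⟩
  choose θ hθ hgU using huf
  -- the number of sample points
  obtain ⟨n, hn⟩ := (Filter.eventually_all.2 fun i =>
    tendsto_one_div_add_atTop_nhds_zero_nat.eventually_lt_const (hθ i)).exists
  set M : ℕ := 2 * (n + 1) with hM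
  have hMpos : (0 : ℝ) < M := by rw [hM]; positivity
  have hMθ : ∀ i, 1 / (M : ℝ) < θ i := fun i => by
    refine lt_of_le_of_lt ?_ (hn i)
    rw [hM]
    push_cast
    exact one_div_le_one_div_of_le (by positivity) (by linarith [Nat.cast_nonneg (α := ℝ) n])
  let pt : ℕ → unitInterval := fun j =>
    ⟨min 1 (j / M), le_min zero_le_one (by positivity), min_le_left _ _⟩
  have hpt : ∀ j ≤ M, (pt j : ℝ) = j / M := fun j hj =>
    min_eq_right ((div_le_one hMpos).2 (by exact_mod_cast hj))
  have hpt0 : pt 0 = 0 := Subtype.ext (by rw [hpt 0 (Nat.zero_le _)]; simp)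
  have hptM : pt M = 1 := Subtype.ext (by rw [hpt M le_rfl, div_self hMpos.ne']; rfl)
  have hdist : ∀ i, ∀ j < M, dist (pt (j + 1)) (pt j) < θ i := fun i j hj => by
    rw [Subtype.dist_eq, hpt j hj.le, hpt (j + 1) hj, Real.dist_eq]
    refine lt_of_eq_of_lt ?_ (hMθ i)
    rw [← sub_div]
    push_cast
    rw [add_sub_cancel_left, abs_of_nonneg (by positivity)]
  have hprof : ∀ i, ∃ G, IsProfile M L G ∧ ∀ j, |(G j : ℝ) - L * g i (pt j)| ≤ 2 := fun i =>
    exists_profile (a := fun j => L * g i (pt j)) (even_two_mul _) (even_two_mul _) (by omega)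
      (by rw [hpt0, (hg i).1, Set.Icc.coe_zero, mul_zero])
      (by rw [hptM, (hg i).2, Set.Icc.coe_one, mul_one])
      (fun j => mul_nonneg hLpos.le (g i _).2.1)
      (fun j => mul_le_of_le_one_right hLpos.le (g i _).2.2)
      (fun j hj => (hgU i _ _ (hdist i j hj)).1.le)
  choose G hG hGa using hprof
  let D : (Fin k → Fin (M + 1)) → Fin k → ℕ := fun x i => cellOf (U i (pt (x i)))
  have hD : ∀ x i, D x i < radix N i := fun x i => by
    have := cellOf_le (hUmem i (pt (x i))).2
    rw [hrad]
    exact Nat.lt_succ_of_le this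
  have hstep : ∀ x y, Climb G x y → Relation.EqvGen (GraphRel d N X (· ≤ (ρ + δ) ^ 2))
      (ofDigits (radix N) (D x)) (ofDigits (radix N) (D y)) := by
    rintro x y ⟨⟨h, hx⟩, -, hxy⟩
    refine eqvGen_of_box _ _ _ rfl (hD x) (hD y) fun z hz => ?_
    have hzlt : ∀ i, z i < radix N i := fun i =>
      (hz i).2.trans_lt (max_lt (hD x i) (hD y i))
    choose w hw hw' using fun i => exists_locate_between (hUmem i (pt (x i))).1
      (hUmem i (pt (y i))).1 (hz i)
    have hh0 : 0 ≤ h := hx ⟨0, hk⟩ ▸ (hG ⟨0, hk⟩).nonneg _ (by omega)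
    have hhL : h ≤ L := hx ⟨0, hk⟩ ▸ (hG ⟨0, hk⟩).le _ (by omega)
    let c : unitInterval := ⟨h / L, div_nonneg (by exact_mod_cast hh0) hLpos.le,
      (div_le_one hLpos).2 (by exact_mod_cast hhL)⟩
    refine nodeWt_le hk hX (w := w) (c := τ c) (fun i => ?_) fun i => ?_
    · rw [← hN, digit_ofDigits hzlt]
      exact hw' i
    · have hwmem : w i ∈ Set.Icc (0 : ℝ) (π i).numEdges :=
        Set.uIcc_subset_Icc (hUmem i _) (hUmem i _) (hw i)
      have h1 : dist (w i) (U i (pt (x i))) < ζ i := by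
        have hUd : dist (U i (pt (y i))) (U i (pt (x i))) < ζ i := by
          rcases hxy i with he | he
          · rw [← he]
            exact (hgU i _ _ (hdist i _ (by omega))).2
          · rw [← he, dist_comm]
            exact (hgU i _ _ (hdist i _ (by omega))).2
        rw [Real.dist_eq] at hUd ⊢
        exact (Set.abs_sub_left_of_mem_uIcc (hw i)).trans_lt hUd
      have h2 := hpl i _ hwmem _ (hUmem i _) h1
      have h3 := hfg i (pt (x i))
      rw [toCurve_eq_pl] at h3
      have h4 : dist (g i (pt (x i))) c < η := by
        refine lt_of_le_of_lt ?_ hLη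
        have h5 := hGa i (x i)
        rw [hx i] at h5
        have h6 : (c : ℝ) - g i (pt (x i)) = (h - L * g i (pt (x i))) / L := by
          change (h : ℝ) / L - _ = _
          field_simp
        rw [Subtype.dist_eq, Real.dist_eq, abs_sub_comm, h6, abs_div, abs_of_pos hLpos]
        exact div_le_div_of_nonneg_right h5 hLpos.le
      have h5 := hητ h4
      have h6 := dist_triangle4 (pl (π i).numEdges (vtx (π i)) (w i))
        (pl (π i).numEdges (vtx (π i)) (U i (pt (x i)))) (τ (g i (pt (x i)))) (τ c)
      linarith
  have hL0 : (0 : ℤ) < L := by exact_mod_cast (by omega : 0 < L)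
  have hchain : ∀ y, Relation.ReflTransGen (Climb G) (fun _ => (0 : Fin (M + 1))) y →
      Relation.EqvGen (GraphRel d N X (· ≤ (ρ + δ) ^ 2))
        (ofDigits (radix N) (D fun _ => 0)) (ofDigits (radix N) (D y)) := by
    intro y hy
    induction hy with
    | refl => exact Relation.EqvGen.refl _
    | tail _ h ih => exact ih.trans _ _ _ (hstep _ _ h)
  have hmain := hchain _ (exists_climb hk hL0 hG)
  have hfirst : ofDigits (radix N) (D fun _ => 0) = 0 := by
    refine Finset.sum_eq_zero fun i _ => ?_
    have hz : D (fun _ => 0) i = 0 := by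
      have h1 : U i (pt ((0 : Fin (M + 1)) : ℕ)) = ((0 : ℕ) : ℝ) := by
        simp only [U, Fin.val_zero, hpt0, (hf i).1, Set.Icc.coe_zero, mul_zero, Nat.cast_zero]
      simp only [D]
      rw [h1, cellOf_natCast]
    rw [hz, zero_mul]
  have hlast : ofDigits (radix N) (D fun _ => Fin.last M) = ∏ i, radix N i - 1 := by
    rw [← ofDigits_pred _ (radix_pos hNp)]
    congr 1
    funext i
    have h1 : U i (pt (Fin.last M : ℕ)) = (π i).numEdges := by
      simp only [U, Fin.val_last, hptM, (hf i).2, Set.Icc.coe_one, mul_one]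
    simp only [D]
    rw [h1, cellOf_natCast, hrad]
    rfl
  rwa [hfirst, hlast] at hmain

/-- The bottleneck radius bounds the distance to every curve from below. -/
theorem sqrt_le_of_weakFrechet_le (hk : 0 < k) (hX : HoldsInput π X) {r : ℝ}
    (hr : ∀ r', Feasible d (fun i => (π i).complexity) X r' → r ≤ r') (τ : Curve d) {ρ : ℝ}
    (hτ : ∀ i, weakFrechet (π i).toCurve τ ≤ ρ) : √r ≤ ρ := by
  have hρ : 0 ≤ ρ := (weakFrechet_nonneg _ _).trans (hτ ⟨0, hk⟩)
  refine le_of_forall_pos_le_add fun δ hδ => ?_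
  have h := hr _ (feasible_of_weakFrechet_lt hk hX τ (ρ := ρ + δ / 2) (δ := δ / 2)
    (fun i => by linarith [hτ i]) (by linarith))
  rw [show ρ + δ / 2 + δ / 2 = ρ + δ by ring] at h
  exact (Real.sqrt_le_sqrt h).trans (Real.sqrt_sq (by linarith)).le

end Lower

end RealRAM

namespace RealRAM

/-! ### Enclosing balls of moving points -/

section Enclosing

variable {ι : Type*} {d : ℕ}

theorem minRad_le {p : ι → Pt d} {r : ℝ} (h0 : 0 ≤ r) {c : Pt d} (h : ∀ i, dist (p i) c ≤ r) :
    minRad p ≤ r :=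
  csInf_le ⟨0, fun _ h => h.1⟩ ⟨h0, c, h⟩

theorem exists_ball_of_minRad_lt [Fintype ι] {p : ι → Pt d} {r : ℝ} (h : minRad p < r) :
    0 ≤ r ∧ ∃ c : Pt d, ∀ i, dist (p i) c ≤ r := by
  have hne : {r : ℝ | 0 ≤ r ∧ ∃ c : Pt d, ∀ i, dist (p i) c ≤ r}.Nonempty :=
    ⟨∑ i, dist (p i) 0, Finset.sum_nonneg fun _ _ => dist_nonneg, 0, fun i =>
      Finset.single_le_sum (f := fun i => dist (p i) 0) (fun _ _ => dist_nonneg)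
        (Finset.mem_univ i)⟩
  obtain ⟨w, ⟨hw0, c, hc⟩, hw⟩ := exists_lt_of_csInf_lt hne h
  exact ⟨hw0.trans hw.le, c, fun i => (hc i).trans hw.le⟩

/-- A convex combination of enclosing balls at two times encloses the points at the time between. -/
theorem convexOn_minRad [Fintype ι] (a b : ι → Pt d) :
    ConvexOn ℝ Set.univ fun t : ℝ => minRad fun i => a i + t • b i := by
  refine ⟨convex_univ, fun x _ y _ u v hu hv huv => ?_⟩
  refine le_of_forall_pos_le_add fun ε hε => ?_
  obtain ⟨h1, c₁, hc₁⟩ := exists_ball_of_minRad_lt (lt_add_of_pos_right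
    (minRad fun i => a i + x • b i) hε)
  obtain ⟨h2, c₂, hc₂⟩ := exists_ball_of_minRad_lt (lt_add_of_pos_right
    (minRad fun i => a i + y • b i) hε)
  set r₁ := minRad fun i => a i + x • b i
  set r₂ := minRad fun i => a i + y • b i
  have hr : u • r₁ + v • r₂ + ε = u * (r₁ + ε) + v * (r₂ + ε) := by
    simp only [smul_eq_mul]
    linear_combination (-ε) * huv
  rw [hr]
  refine minRad_le (by positivity) (c := u • c₁ + v • c₂) fun i => ?_
  have hv' : v = 1 - u := by linarith
  have he : a i + (u • x + v • y) • b i - (u • c₁ + v • c₂) =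
      u • (a i + x • b i - c₁) + v • (a i + y • b i - c₂) := by
    rw [hv']
    module
  have n1 := hc₁ i
  have n2 := hc₂ i
  rw [dist_eq_norm] at n1 n2 ⊢
  rw [he]
  refine (norm_add_le _ _).trans (add_le_add ?_ ?_)
  · rw [norm_smul, Real.norm_of_nonneg hu]
    exact mul_le_mul_of_nonneg_left n1 hu
  · rw [norm_smul, Real.norm_of_nonneg hv]
    exact mul_le_mul_of_nonneg_left n2 hv

end Enclosing

end RealRAM

theorem mainTheorem5 (k d : ℕ) (hk : 0 < k) :
    (∃ (P : RealRAM.Program) (C : ℕ), ∀ π : Fin k → PolygonalCurve d,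
      ∃ (s : RealRAM.State) (t : ℕ) (σ : PolygonalCurve d),
        RealRAM.Exec P (RealRAM.inputState π) s t ∧
        t ≤ C * (∑ i, (π i).complexity) ^ k ∧
        s.Outputs σ ∧
        σ.complexity ≤ C * (∑ i, (π i).complexity) ^ k ∧
        ∀ τ : Curve d,
          (⨆ i, weakFrechet (π i).toCurve σ.toCurve) ≤ ⨆ i, weakFrechet (π i).toCurve τ) ∧
    (∀ a b : Fin k → Pt d,
      ConvexOn ℝ Set.univ fun t : ℝ => minRad fun i => a i + t • b i) := by
  refine ⟨?_, RealRAM.convexOn_minRad⟩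
  obtain ⟨C, hC⟩ := RealRAM.solverTicks_le k d
  refine ⟨RealRAM.solver k d, (C + 1) * (1 + 2 ^ k), fun π => ?_⟩
  obtain ⟨s, t, X, L, p, r, γ, hexec, ht, hX, hL, hlen, hcoord, hpath, hr⟩ :=
    RealRAM.exec_solver hk π
  set n := ∑ i, (π i).complexity
  set V := ∏ i, RealRAM.radix (fun i => (π i).complexity) i with hVd
  have hle : ∀ i, (π i).complexity ≤ n := fun i =>
    Finset.single_le_sum (f := fun i => (π i).complexity) (fun _ _ => Nat.zero_le _)
      (Finset.mem_univ i)
  have hn : 0 < n := (Nat.succ_pos _).trans_le (hle ⟨0, hk⟩)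
  have hV : V ≤ 2 ^ k * n ^ k := by
    rw [← mul_pow]
    refine (Finset.prod_le_prod (fun _ _ => Nat.zero_le _) fun i _ => ?_).trans
      (by rw [Finset.prod_const, Finset.card_univ, Fintype.card_fin])
    have := hle i
    simp only [RealRAM.radix]
    omega
  have hnk : n ≤ n ^ k := Nat.le_self_pow hk.ne' n
  have hsum : n + V ≤ (1 + 2 ^ k) * n ^ k := by
    rw [add_mul, one_mul]
    exact add_le_add hnk hV
  have hup := fun i => hpath.weakFrechet_le hX i
  refine ⟨s, t, PolygonalCurve.mk L fun j => WithLp.toLp 2 (γ j), hexec, ?_, ⟨hlen, fun j c =>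
    hcoord j (Nat.lt_succ_iff.1 j.isLt) c⟩, ?_, fun τ => ?_⟩
  · calc t ≤ C * (n + V) := ht.trans (hC n V hn)
      _ ≤ (C + 1) * ((1 + 2 ^ k) * n ^ k) := Nat.mul_le_mul (Nat.le_succ _) hsum
      _ = (C + 1) * (1 + 2 ^ k) * n ^ k := (mul_assoc _ _ _).symm
  · calc L + 1 ≤ 1 * (n + V) := by omega
      _ ≤ (C + 1) * ((1 + 2 ^ k) * n ^ k) := Nat.mul_le_mul (by omega) hsum
      _ = (C + 1) * (1 + 2 ^ k) * n ^ k := (mul_assoc _ _ _).symm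
  · have : Nonempty (Fin k) := ⟨⟨0, hk⟩⟩
    exact ciSup_le fun i => (hup i).trans (RealRAM.sqrt_le_of_weakFrechet_le hk hX
      (fun r' h => (hr r').1 h) τ fun j =>
        le_ciSup (f := fun i => weakFrechet (π i).toCurve τ) (Set.finite_range _).bddAbove j)

end
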